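/- Let $(X^4,\partial X)$ be a complete Riemannian manifold with (possibly empty) boundary with $\mathrm{Ric}^X_2\ge 0$, i.e. for every $x\in X$ and all orthonormal $u,v,w\in T_xX$, $R_X(v,u,u,v)+R_X(w,u,u,w)\ge 0$ (with the sign convention that $R_X(v,u,u,v)$ is the sectional curvature of the plane spanned by $u,v$). Let $(M^3,\partial M)\hookrightarrow (X^4,\partial X)$ be a stable two-sided free boundary minimal immersion with unit normal $\nu$. That is: $M$ carries the induced metric, $\partial M$ is mapped into $\partial X$, the mean curvature of $M$ vanishes, along $\partial M$ the outward unit normal of $\partial M\subset M$ agrees with the outward unit normal $\eta$ of $\partial X\subset X$, and for all compactly supported smooth $\varphi$ on $M$ $$\int_M |\nabla\varphi|^2-(\mathrm{Ric}_X(\nu,\nu)+|\mathrm{II}|^2)\varphi^2-\int_{\partial M}\mathrm{II}_{\partial X}(\nu,\nu)\varphi^2\ \ge\ 0 .$$ Here $\mathrm{II}$ is the second fundamental form of $M$, $\mathrm{II}_{\partial X}(Y,Z)=-\langle\overline\nabla_ZY,\eta\rangle$ with $\overline\nabla$ the Levi-Civita connection of $X$, and $H_{\partial X}=\operatorname{tr}\mathrm{II}_{\partial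 X}$. Let $u$ be a harmonic function on $M$ that is smooth up to the boundary, and assume that either * $u$ satisfies the Neumann condition (its normal derivative vanishes on $\partial M$) and $\mathrm{II}_{\partial X}(e_1,e_1)+\mathrm{II}_{\partial X}(e_2,e_2)\ge0$ for all $x\in\partial X$ and all orthonormal $e_1,e_2\in T_x\partial X$; or * $u$ satisfies the Dirichlet condition ($u$ is locally constant on $\partial M$, for instance $u=0$ on $\partial M$) and $H_{\partial X}\ge 0$. Then for every compactly supported locally Lipschitz function $\phi$ on $M$, both of the following integrals are finite and $$\int_M\phi^2\Big(\tfrac13|\mathrm{II}|^2|\nabla u|^2+\tfrac12\big|\nabla|\nabla u|\big|^2\Big)\ \le\ \int_M|\nabla\phi|^2|\nabla u|^2 .$$ -/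

import Mathlib

open Set MeasureTheory Manifold Bundle Topology
open scoped ContDiff

noncomputable section

/-! ### Riemannian geometry of manifolds with (possibly empty) boundary

Manifolds with boundary are modelled on the half-space `{x ∈ ℝⁿ | 0 ≤ x 0}` by the model `𝓡∂ n`; the
metric is Mathlib's `RiemannianBundle` structure on the tangent bundle.  A tangent vector at `x` is
its coordinate vector in the preferred chart `extChartAt (𝓡∂ n) x`; every tensor at `x` is computed
in that chart, where derivatives are derivatives within the half-space. -/

namespace RiemBdry

section Metric

variable (n : ℕ) [NeZero n] {X : Type*} [TopologicalSpace X]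
  [ChartedSpace (EuclideanHalfSpace n) X]
  [RiemannianBundle (fun x : X => TangentSpace (𝓡∂ n) x)]

/-- The metric `g_z(v, w)` in the coordinates of the preferred chart at `x`, at the coordinate
point `z`. -/
def metricCoord (x : X) (z v w : EuclideanSpace ℝ (Fin n)) : ℝ :=
  inner ℝ
    (mfderivWithin 𝓘(ℝ, EuclideanSpace ℝ (Fin n)) (𝓡∂ n) (extChartAt (𝓡∂ n) x).symm
      (range (𝓡∂ n)) z v)
    (mfderivWithin 𝓘(ℝ, EuclideanSpace ℝ (Fin n)) (𝓡∂ n) (extChartAt (𝓡∂ n) x).symm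
      (range (𝓡∂ n)) z w)

/-- The matrix `(g_ij)` of the metric in the coordinates of the chart at `x`. -/
def gram (x : X) (z : EuclideanSpace ℝ (Fin n)) : Matrix (Fin n) (Fin n) ℝ :=
  Matrix.of fun i j =>
    metricCoord n x z (EuclideanSpace.single i (1 : ℝ)) (EuclideanSpace.single j (1 : ℝ))

/-- The Christoffel symbols of the first kind of the Levi-Civita connection, contracted with `v`,
`w`, `ξ`: `½ (∂_v g(w, ξ) + ∂_w g(v, ξ) - ∂_ξ g(v, w))`. -/
def christoffelFirst (x : X) (z v w ξ : EuclideanSpace ℝ (Fin n)) : ℝ :=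
  (1 / 2 : ℝ) *
    (fderivWithin ℝ (fun y => metricCoord n x y w ξ) (range (𝓡∂ n)) z v
      + fderivWithin ℝ (fun y => metricCoord n x y v ξ) (range (𝓡∂ n)) z w
      - fderivWithin ℝ (fun y => metricCoord n x y v w) (range (𝓡∂ n)) z ξ)

/-- The Christoffel symbols of the Levi-Civita connection: the vector `Γ_z(v, w)` with components
`g^{kl} Γ_{vw,l}`.  For vector fields that are constant in the chart, `∇_v w = Γ(v, w)`. -/
def christoffel (x : X) (z v w : EuclideanSpace ℝ (Fin n)) : EuclideanSpace ℝ (Fin n) :=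
  WithLp.toLp 2 fun k =>
    ∑ l, (gram n x z)⁻¹ k l * christoffelFirst n x z v w (EuclideanSpace.single l (1 : ℝ))

/-- The curvature endomorphism
`R(u, v) w = ∇_u ∇_v w - ∇_v ∇_u w - ∇_[u,v] w` at the point `x`. -/
def curvature (x : X) (u v w : TangentSpace (𝓡∂ n) x) : TangentSpace (𝓡∂ n) x :=
  let z : EuclideanSpace ℝ (Fin n) := extChartAt (𝓡∂ n) x x
  let u' : EuclideanSpace ℝ (Fin n) := u
  let v' : EuclideanSpace ℝ (Fin n) := v
  let w' : EuclideanSpace ℝ (Fin n) := w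
  (fderivWithin ℝ (fun y => christoffel n x y v' w') (range (𝓡∂ n)) z u'
    - fderivWithin ℝ (fun y => christoffel n x y u' w') (range (𝓡∂ n)) z v'
    + christoffel n x z u' (christoffel n x z v' w')
    - christoffel n x z v' (christoffel n x z u' w') : EuclideanSpace ℝ (Fin n))

/-- The Riemann curvature tensor `R(a, b, c, d) = ⟨R(a, b) c, d⟩`; thus `R(v, u, u, v)` is the
sectional curvature of the plane spanned by orthonormal `u`, `v`. -/
def riem (x : X) (a b c d : TangentSpace (𝓡∂ n) x) : ℝ :=
  inner ℝ (curvature n x a b c) d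

instance instFiniteDimensionalTangentSpace (x : X) :
    FiniteDimensional ℝ (TangentSpace (𝓡∂ n) x) :=
  inferInstanceAs (FiniteDimensional ℝ (EuclideanSpace ℝ (Fin n)))

/-- An orthonormal basis of the tangent space at `x`, used to take traces. -/
def onb (x : X) :
    OrthonormalBasis (Fin (Module.finrank ℝ (TangentSpace (𝓡∂ n) x))) ℝ
      (TangentSpace (𝓡∂ n) x) :=
  stdOrthonormalBasis ℝ (TangentSpace (𝓡∂ n) x)

/-- The Ricci curvature `Ric(v, w) = ∑ᵢ R(eᵢ, v, w, eᵢ)`. -/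
def ricci (x : X) (v w : TangentSpace (𝓡∂ n) x) : ℝ :=
  ∑ i, riem n x (onb n x i) v w (onb n x i)

/-- The gradient `∇f` of a function. -/
def grad (f : X → ℝ) (x : X) : TangentSpace (𝓡∂ n) x :=
  ∑ i, (show ℝ from mfderiv (𝓡∂ n) 𝓘(ℝ, ℝ) f x (onb n x i)) • onb n x i

/-- The function `|∇f|`. -/
def gradNorm (f : X → ℝ) (x : X) : ℝ := ‖grad n f x‖

/-- The Hessian `∇²f(v, w) = v(w f) - (∇_v w) f`. -/
def hessian (f : X → ℝ) (x : X) (v w : TangentSpace (𝓡∂ n) x) : ℝ :=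
  let fc : EuclideanSpace ℝ (Fin n) → ℝ := fun y => f ((extChartAt (𝓡∂ n) x).symm y)
  let z : EuclideanSpace ℝ (Fin n) := extChartAt (𝓡∂ n) x x
  fderivWithin ℝ (fun y => fderivWithin ℝ fc (range (𝓡∂ n)) y) (range (𝓡∂ n)) z v w
    - fderivWithin ℝ fc (range (𝓡∂ n)) z (christoffel n x z v w)

/-- The Laplace-Beltrami operator, the trace of the Hessian. -/
def laplacian (f : X → ℝ) (x : X) : ℝ := ∑ i, hessian n f x (onb n x i) (onb n x i)

/-! #### The boundary -/

/-- The tangent space `T_x ∂X` at a boundary point `x`. -/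
def boundaryTangent (x : X) : Submodule ℝ (TangentSpace (𝓡∂ n) x) :=
  LinearMap.ker (EuclideanSpace.projₗ (𝕜 := ℝ) (0 : Fin n) : EuclideanSpace ℝ (Fin n) →ₗ[ℝ] ℝ)

/-- The gradient at `x` of the `0`-th coordinate function of the chart at `x`. At a boundary point it
is normal to the boundary and points inwards. -/
def coordGrad (x : X) : TangentSpace (𝓡∂ n) x :=
  ∑ i, ((show EuclideanSpace ℝ (Fin n) from onb n x i) 0) • onb n x i

/-- The outward pointing unit normal of `∂X ⊂ X` at a boundary point `x`. -/
def outwardNormal (x : X) : TangentSpace (𝓡∂ n) x :=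
  -(‖coordGrad n x‖⁻¹ • coordGrad n x)

/-- The second fundamental form `II_{∂X}(v, w) = -⟨∇_v w, η⟩` of the boundary with respect to the
outward pointing unit normal `η`, for `v`, `w` tangent to the boundary. -/
def boundaryII (x : X) (v w : TangentSpace (𝓡∂ n) x) : ℝ :=
  - inner ℝ (show TangentSpace (𝓡∂ n) x from christoffel n x (extChartAt (𝓡∂ n) x x) v w)
      (outwardNormal n x)

/-- The orthogonal projection of `T_x X` onto `T_x ∂X` at a boundary point `x`. -/
def boundaryProj (x : X) (v : TangentSpace (𝓡∂ n) x) : TangentSpace (𝓡∂ n) x :=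
  v - (inner ℝ v (outwardNormal n x) : ℝ) • outwardNormal n x

/-- The mean curvature `H_{∂X} = tr II_{∂X}` of the boundary. The trace over `T_x ∂X` is computed as
the trace over `T_x X` of the form precomposed with the orthogonal projection onto `T_x ∂X`. -/
def boundaryMeanCurvature (x : X) : ℝ :=
  ∑ i, boundaryII n x (boundaryProj n x (onb n x i)) (boundaryProj n x (onb n x i))

/-! #### Volume and boundary area -/

/-- The Riemannian volume of the domain of the chart at `x`: the measure `√(det g) dz`. -/
def chartVolume [MeasurableSpace X] (x : X) : Measure X :=
  Measure.map (extChartAt (𝓡∂ n) x).symm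
    ((volume.restrict (extChartAt (𝓡∂ n) x).target).withDensity
      fun z => ENNReal.ofReal (Real.sqrt (gram n x z).det))

variable (X) in
/-- The Riemannian volume measure: the measure which on every chart domain is `√(det g) dz`,
obtained as the supremum of these measures, which agree on the overlaps. -/
def vol [MeasurableSpace X] : Measure X := ⨆ x : X, chartVolume n x

/-- The inclusion of `ℝ^{n-1}` into `ℝⁿ` as the hyperplane `{z 0 = 0}`. -/
def bdryIncl (y : EuclideanSpace ℝ {i : Fin n // i ≠ 0}) : EuclideanSpace ℝ (Fin n) :=
  WithLp.toLp 2 fun i => if h : i = 0 then 0 else y ⟨i, h⟩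

/-- The area measure of the part of `∂X` in the domain of the chart at `x`. -/
def chartBdryArea [MeasurableSpace X] (x : X) : Measure X :=
  Measure.map (fun y => (extChartAt (𝓡∂ n) x).symm (bdryIncl n y))
    ((volume.restrict (bdryIncl n ⁻¹' (extChartAt (𝓡∂ n) x).target)).withDensity
      fun y => ENNReal.ofReal (Real.sqrt
        ((gram n x (bdryIncl n y)).submatrix (Subtype.val : {i : Fin n // i ≠ 0} → Fin n)
          Subtype.val).det))

variable (X) in
/-- The area measure of `∂X` with respect to the induced metric, as a measure on `X` that is
concentrated on `∂X`. -/
def bdryArea [MeasurableSpace X] : Measure X := ⨆ x : X, chartBdryArea n x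

/-! #### Curvature and boundary conditions -/

variable (X) in
/-- `Ric_2 ≥ 0`: nonnegative 2-intermediate Ricci curvature. -/
def Ric2Nonneg : Prop :=
  ∀ (x : X) (u v w : TangentSpace (𝓡∂ n) x), Orthonormal ℝ ![u, v, w] →
    0 ≤ riem n x v u u v + riem n x w u u w

variable (X) in
/-- `II_2 ≥ 0`: the boundary is 2-convex. -/
def Bdry2Convex : Prop :=
  ∀ x ∈ (𝓡∂ n).boundary X, ∀ e₁ ∈ boundaryTangent n x,
    ∀ e₂ ∈ boundaryTangent n x, Orthonormal ℝ ![e₁, e₂] →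
      0 ≤ boundaryII n x e₁ e₁ + boundaryII n x e₂ e₂

variable (X) in
/-- `H_{∂X} ≥ 0`: the boundary is mean convex. -/
def BdryMeanConvex : Prop :=
  ∀ x ∈ (𝓡∂ n).boundary X, 0 ≤ boundaryMeanCurvature n x

/-- A smooth (up to the boundary) harmonic function. -/
def IsHarmonic (u : X → ℝ) : Prop :=
  ContMDiff (𝓡∂ n) 𝓘(ℝ, ℝ) ∞ u ∧ ∀ x, laplacian n u x = 0

/-- The Neumann boundary condition: the normal derivative vanishes along the boundary. -/
def IsNeumann (u : X → ℝ) : Prop :=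
  ∀ x ∈ (𝓡∂ n).boundary X, (mfderiv (𝓡∂ n) 𝓘(ℝ, ℝ) u x (outwardNormal n x) : ℝ) = 0

end Metric

section Boundary

variable (n : ℕ) [NeZero n] {X : Type*} [TopologicalSpace X]
  [ChartedSpace (EuclideanHalfSpace n) X]

/-- The Dirichlet boundary condition: `u` is locally constant on the boundary, that is, constant
on every component of the boundary. -/
def IsDirichlet (u : X → ℝ) : Prop :=
  IsLocallyConstant (((𝓡∂ n).boundary X).domRestrict u)

/-- Local Lipschitz continuity of a function on a manifold, tested in the charts. -/
def IsLocallyLipschitz (φ : X → ℝ) : Prop :=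
  ∀ x : X, ∃ (K : NNReal), ∃ s ∈ 𝓝[range (𝓡∂ n)] (extChartAt (𝓡∂ n) x x),
    LipschitzOnWith K (fun z => φ ((extChartAt (𝓡∂ n) x).symm z)) s

end Boundary

section Immersion

variable (m n : ℕ) [NeZero m] [NeZero n]
  {M : Type*} [TopologicalSpace M] [ChartedSpace (EuclideanHalfSpace m) M]
  [RiemannianBundle (fun p : M => TangentSpace (𝓡∂ m) p)]
  {X : Type*} [TopologicalSpace X] [ChartedSpace (EuclideanHalfSpace n) X]
  [RiemannianBundle (fun x : X => TangentSpace (𝓡∂ n) x)]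

/-- The ambient derivative `∇̄_v (dF w)` of an immersion `F`, for `w` extended constantly in the
chart at `p`. -/
def ambientSecondDeriv (F : M → X) (p : M) (v w : TangentSpace (𝓡∂ m) p) :
    TangentSpace (𝓡∂ n) (F p) :=
  let Fc : EuclideanSpace ℝ (Fin m) → EuclideanSpace ℝ (Fin n) :=
    writtenInExtChartAt (𝓡∂ m) (𝓡∂ n) p F
  let z : EuclideanSpace ℝ (Fin m) := extChartAt (𝓡∂ m) p p
  (fderivWithin ℝ (fun y => fderivWithin ℝ Fc (range (𝓡∂ m)) y) (range (𝓡∂ m)) z v w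
    + christoffel n (F p) (extChartAt (𝓡∂ n) (F p) (F p))
        (mfderiv (𝓡∂ m) (𝓡∂ n) F p v) (mfderiv (𝓡∂ m) (𝓡∂ n) F p w) :
    EuclideanSpace ℝ (Fin n))

/-- The second fundamental form `II(v, w) = -⟨∇̄_v w, ν⟩` of an immersed hypersurface with unit
normal `ν`. -/
def secondFF (F : M → X) (ν : ∀ p, TangentSpace (𝓡∂ n) (F p)) (p : M)
    (v w : TangentSpace (𝓡∂ m) p) : ℝ :=
  - inner ℝ (ambientSecondDeriv m n F p v w) (ν p)

/-- The mean curvature `H = tr II`. -/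
def meanCurvature (F : M → X) (ν : ∀ p, TangentSpace (𝓡∂ n) (F p)) (p : M) : ℝ :=
  ∑ i, secondFF m n F ν p (onb m p i) (onb m p i)

/-- `|II|²`. -/
def normSqII (F : M → X) (ν : ∀ p, TangentSpace (𝓡∂ n) (F p)) (p : M) : ℝ :=
  ∑ i, ∑ j, secondFF m n F ν p (onb m p i) (onb m p j) ^ 2

/-- Stability: the second variation of area is nonnegative,
`∫_M |∇φ|² - (Ric_X(ν, ν) + |II|²) φ² - ∫_∂M II_{∂X}(ν, ν) φ² ≥ 0` for all compactly supported
smooth `φ` (which need not vanish on `∂M`). -/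
def IsStable [MeasurableSpace M] (F : M → X) (ν : ∀ p, TangentSpace (𝓡∂ n) (F p)) : Prop :=
  ∀ φ : M → ℝ, ContMDiff (𝓡∂ m) 𝓘(ℝ, ℝ) ∞ φ → HasCompactSupport φ →
    0 ≤ (∫ p, (gradNorm m φ p ^ 2
              - (ricci n (F p) (ν p) (ν p) + normSqII m n F ν p) * φ p ^ 2) ∂(vol m M))
        - ∫ p, boundaryII n (F p) (ν p) (ν p) * φ p ^ 2 ∂(bdryArea m M)

variable [IsManifold (𝓡∂ n) ∞ X]

/-- `F : (M, ∂M) → (X, ∂X)` is a two-sided free boundary minimal immersion of a hypersurface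
(`M` carrying the induced metric) with unit normal field `ν`. -/
structure IsFBMH (F : M → X) (ν : ∀ p, TangentSpace (𝓡∂ n) (F p)) : Prop where
  codim_one : n = m + 1
  smooth : ContMDiff (𝓡∂ m) (𝓡∂ n) ∞ F
  /-- `F` is an immersion and `M` carries the induced metric. -/
  isometric : ∀ (p : M) (v w : TangentSpace (𝓡∂ m) p),
    inner ℝ (mfderiv (𝓡∂ m) (𝓡∂ n) F p v) (mfderiv (𝓡∂ m) (𝓡∂ n) F p w) = inner ℝ v w
  /-- `ν` is smooth. -/
  smooth_normal : ContMDiff (𝓡∂ m) (𝓡∂ n).tangent ∞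
    (fun p => (⟨F p, ν p⟩ : TangentBundle (𝓡∂ n) X))
  /-- `ν` has unit length. -/
  unit_normal : ∀ p, ‖ν p‖ = 1
  /-- `ν` is normal to `M`. -/
  normal : ∀ (p : M) (v : TangentSpace (𝓡∂ m) p),
    inner ℝ (mfderiv (𝓡∂ m) (𝓡∂ n) F p v) (ν p) = 0
  /-- The mean curvature vanishes. -/
  minimal : ∀ p, meanCurvature m n F ν p = 0
  /-- `∂M` is mapped into `∂X`. -/
  boundary : ∀ p ∈ (𝓡∂ m).boundary M, F p ∈ (𝓡∂ n).boundary X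
  /-- The outward unit normals of `∂M ⊂ M` and `∂X ⊂ X` agree along `∂M`. -/
  free_boundary : ∀ p ∈ (𝓡∂ m).boundary M,
    mfderiv (𝓡∂ m) (𝓡∂ n) F p (outwardNormal m p) = outwardNormal n (F p)

end Immersion

end RiemBdry

end

noncomputable section

namespace RiemBdry

set_option synthInstance.maxHeartbeats 200000
set_option maxSynthPendingDepth 6
set_option linter.unusedSectionVars false

section LocalGeometry

variable {E E' : Type*} [NormedAddCommGroup E] [NormedSpace ℝ E]
  [NormedAddCommGroup E'] [NormedSpace ℝ E']

/-- A smooth metric `g` on a subset `s` of a normed space, together with the Christoffel symbols `Γ`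
of its Levi-Civita connection. -/
structure IsLeviCivitaOn (s : Set E) (g : E → E →L[ℝ] E →L[ℝ] ℝ) (Γ : E → E →L[ℝ] E →L[ℝ] E) :
    Prop where
  uniq : UniqueDiffOn ℝ s
  dense : s ⊆ closure (interior s)
  smooth_g : ContDiffOn ℝ ∞ g s
  smooth_christoffel : ContDiffOn ℝ ∞ Γ s
  symm : ∀ z ∈ s, ∀ v w, g z v w = g z w v
  pos : ∀ z ∈ s, ∀ v, v ≠ 0 → 0 < g z v v
  koszul : ∀ z ∈ s, ∀ v w ξ, 2 * g z (Γ z v w) ξ =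
    fderivWithin ℝ g s z v w ξ + fderivWithin ℝ g s z w v ξ - fderivWithin ℝ g s z ξ v w

/-- Product rule for the evaluation of a field of bilinear maps on two fields of vectors. -/
lemma fderivWithin_bilin {E₁ E₂ E₃ : Type*} [NormedAddCommGroup E₁] [NormedSpace ℝ E₁]
    [NormedAddCommGroup E₂] [NormedSpace ℝ E₂] [NormedAddCommGroup E₃] [NormedSpace ℝ E₃]
    {s : Set E} {z : E} (hs : UniqueDiffWithinAt ℝ s z)
    {B : E → E₁ →L[ℝ] E₂ →L[ℝ] E₃} {Y : E → E₁} {Z : E → E₂}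
    (hB : DifferentiableWithinAt ℝ B s z) (hY : DifferentiableWithinAt ℝ Y s z)
    (hZ : DifferentiableWithinAt ℝ Z s z) (a : E) :
    fderivWithin ℝ (fun y => B y (Y y) (Z y)) s z a =
      fderivWithin ℝ B s z a (Y z) (Z z) + B z (fderivWithin ℝ Y s z a) (Z z)
        + B z (Y z) (fderivWithin ℝ Z s z a) := by
  rw [fderivWithin_clm_apply hs (hB.clm_apply hY) hZ, fderivWithin_clm_apply hs hB hY]
  simp [add_comm]

/-- Product rule for the evaluation of a field of linear maps on a field of vectors. -/
lemma fderivWithin_lin {E₁ E₂ : Type*} [NormedAddCommGroup E₁] [NormedSpace ℝ E₁]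
    [NormedAddCommGroup E₂] [NormedSpace ℝ E₂]
    {s : Set E} {z : E} (hs : UniqueDiffWithinAt ℝ s z)
    {B : E → E₁ →L[ℝ] E₂} {Y : E → E₁}
    (hB : DifferentiableWithinAt ℝ B s z) (hY : DifferentiableWithinAt ℝ Y s z) (a : E) :
    fderivWithin ℝ (fun y => B y (Y y)) s z a =
      fderivWithin ℝ B s z a (Y z) + B z (fderivWithin ℝ Y s z a) := by
  rw [fderivWithin_clm_apply hs hB hY]
  simp [add_comm]

lemma fderivWithin_eval {E₁ E₂ : Type*} [NormedAddCommGroup E₁] [NormedSpace ℝ E₁]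
    [NormedAddCommGroup E₂] [NormedSpace ℝ E₂]
    {s : Set E} {z : E} (hs : UniqueDiffWithinAt ℝ s z) {B : E → E₁ →L[ℝ] E₂}
    (hB : DifferentiableWithinAt ℝ B s z) (v : E₁) (a : E) :
    fderivWithin ℝ (fun y => B y v) s z a = fderivWithin ℝ B s z a v := by
  rw [fderivWithin_lin hs hB (differentiableWithinAt_const v)]
  simp

lemma fderivWithin_eval₂ {E₁ E₂ E₃ : Type*} [NormedAddCommGroup E₁] [NormedSpace ℝ E₁]
    [NormedAddCommGroup E₂] [NormedSpace ℝ E₂] [NormedAddCommGroup E₃] [NormedSpace ℝ E₃]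
    {s : Set E} {z : E} (hs : UniqueDiffWithinAt ℝ s z) {B : E → E₁ →L[ℝ] E₂ →L[ℝ] E₃}
    (hB : DifferentiableWithinAt ℝ B s z) (v : E₁) (w : E₂) (a : E) :
    fderivWithin ℝ (fun y => B y v w) s z a = fderivWithin ℝ B s z a v w := by
  rw [fderivWithin_eval hs (hB.clm_apply (differentiableWithinAt_const v)),
    fderivWithin_eval hs hB]

lemma diffWithinAt_of_smooth {s : Set E} {f : E → E'} (h : ContDiffOn ℝ ∞ f s) {z : E}
    (hz : z ∈ s) : DifferentiableWithinAt ℝ f s z :=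
  (h z hz).differentiableWithinAt (by simp)

lemma smooth_fderivWithin {s : Set E} {f : E → E'} (h : ContDiffOn ℝ ∞ f s)
    (hs : UniqueDiffOn ℝ s) : ContDiffOn ℝ ∞ (fderivWithin ℝ f s) s :=
  h.fderivWithin hs (by simp)

lemma fderivWithin_fderivWithin_symm {s : Set E} {f : E → E'} (h : ContDiffOn ℝ ∞ f s)
    (hs : UniqueDiffOn ℝ s) (hd : s ⊆ closure (interior s)) {z : E} (hz : z ∈ s) (v w : E) :
    fderivWithin ℝ (fderivWithin ℝ f s) s z v w = fderivWithin ℝ (fderivWithin ℝ f s) s z w v :=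
  ((h z hz).isSymmSndFDerivWithinAt
    (by
      rw [minSmoothness_of_isRCLikeNormedField]
      exact WithTop.coe_le_coe.2 (le_top : (2 : ℕ∞) ≤ ⊤)) hs (hd hz) hz) v w

/-- The curvature endomorphism of the connection with Christoffel symbols `Γ`. -/
def localCurv (s : Set E) (Γ : E → E →L[ℝ] E →L[ℝ] E) (z a b c : E) : E :=
  fderivWithin ℝ Γ s z a b c - fderivWithin ℝ Γ s z b a c + Γ z a (Γ z b c) - Γ z b (Γ z a c)

/-- The ambient second derivative of a map in coordinates. -/
def localSndDeriv (s : Set E) (F : E → E') (Γ' : E' → E' →L[ℝ] E' →L[ℝ] E') (z v w : E) : E' :=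
  fderivWithin ℝ (fderivWithin ℝ F s) s z v w
    + Γ' (F z) (fderivWithin ℝ F s z v) (fderivWithin ℝ F s z w)

/-- The Hessian of a function in coordinates. -/
def localHess (s : Set E) (Γ : E → E →L[ℝ] E →L[ℝ] E) (f : E → ℝ) (z v w : E) : ℝ :=
  fderivWithin ℝ (fderivWithin ℝ f s) s z v w - fderivWithin ℝ f s z (Γ z v w)

namespace IsLeviCivitaOn

variable {s : Set E} {g : E → E →L[ℝ] E →L[ℝ] ℝ} {Γ : E → E →L[ℝ] E →L[ℝ] E}
  {s' : Set E'} {g' : E' → E' →L[ℝ] E' →L[ℝ] ℝ} {Γ' : E' → E' →L[ℝ] E' →L[ℝ] E'}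

lemma ext_inner (h : IsLeviCivitaOn s g Γ) {z : E} (hz : z ∈ s) {v w : E}
    (H : ∀ ξ, g z v ξ = g z w ξ) : v = w := by
  by_contra hne
  have := h.pos z hz (v - w) (sub_ne_zero.2 hne)
  rw [(g z).map_sub, sub_apply, H (v - w), sub_self] at this
  exact lt_irrefl _ this

lemma fderivWithin_symm (h : IsLeviCivitaOn s g Γ) {z : E} (hz : z ∈ s) (a v w : E) :
    fderivWithin ℝ g s z a v w = fderivWithin ℝ g s z a w v := by
  have hg := diffWithinAt_of_smooth h.smooth_g hz
  have e1 := fderivWithin_bilin (h.uniq z hz) hg (differentiableWithinAt_const v)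
    (differentiableWithinAt_const w) a
  have e2 := fderivWithin_bilin (h.uniq z hz) hg (differentiableWithinAt_const w)
    (differentiableWithinAt_const v) a
  simp only [fderivWithin_fun_const, Pi.zero_apply, zero_apply, map_zero, add_zero,
    zero_apply] at e1 e2
  rw [← e1, ← e2]
  congr 1
  exact fderivWithin_congr (fun y hy => h.symm y hy v w) (h.symm z hz v w)

lemma christoffel_symm (h : IsLeviCivitaOn s g Γ) {z : E} (hz : z ∈ s) (v w : E) :
    Γ z v w = Γ z w v := by
  apply h.ext_inner hz
  intro ξ
  have h1 := h.koszul z hz v w ξ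
  have h2 := h.koszul z hz w v ξ
  have := h.fderivWithin_symm hz ξ v w
  linarith

/-- The Levi-Civita connection is compatible with the metric. -/
lemma compat (h : IsLeviCivitaOn s g Γ) {z : E} (hz : z ∈ s) (a v w : E) :
    fderivWithin ℝ g s z a v w = g z (Γ z a v) w + g z v (Γ z a w) := by
  have h1 := h.koszul z hz a v w
  have h2 := h.koszul z hz a w v
  have h3 := h.symm z hz v (Γ z a w)
  have h4 := h.fderivWithin_symm hz a v w
  have h5 := h.fderivWithin_symm hz v a w
  have h6 := h.fderivWithin_symm hz w a v
  linarith

/-- Derivative of the metric product of two fields along a map `F`. -/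
lemma fderivWithin_inner_along (h' : IsLeviCivitaOn s' g' Γ') (hs : UniqueDiffOn ℝ s)
    {F : E → E'} (hF : ContDiffOn ℝ ∞ F s) (hm : MapsTo F s s') {z : E} (hz : z ∈ s)
    {Y Z : E → E'} (hY : DifferentiableWithinAt ℝ Y s z) (hZ : DifferentiableWithinAt ℝ Z s z)
    (a : E) :
    fderivWithin ℝ (fun y => g' (F y) (Y y) (Z y)) s z a =
      g' (F z) (fderivWithin ℝ Y s z a + Γ' (F z) (fderivWithin ℝ F s z a) (Y z)) (Z z)
      + g' (F z) (Y z) (fderivWithin ℝ Z s z a + Γ' (F z) (fderivWithin ℝ F s z a) (Z z)) := by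
  have hFd := diffWithinAt_of_smooth hF hz
  have hg' := diffWithinAt_of_smooth h'.smooth_g (hm hz)
  have hcomp : DifferentiableWithinAt ℝ (fun y => g' (F y)) s z := hg'.comp z hFd hm
  rw [fderivWithin_bilin (hs z hz) hcomp hY hZ]
  have : fderivWithin ℝ (fun y => g' (F y)) s z a
      = fderivWithin ℝ g' s' (F z) (fderivWithin ℝ F s z a) := by
    have := fderivWithin_comp z hg' hFd hm (hs z hz)
    rw [Function.comp_def] at this
    rw [this]; rfl
  rw [this, h'.compat (hm hz)]
  simp only [map_add, add_apply]
  ring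

/-- Derivative of the metric product of two fields. -/
lemma fderivWithin_inner (h : IsLeviCivitaOn s g Γ) {z : E} (hz : z ∈ s)
    {Y Z : E → E} (hY : DifferentiableWithinAt ℝ Y s z) (hZ : DifferentiableWithinAt ℝ Z s z)
    (a : E) :
    fderivWithin ℝ (fun y => g y (Y y) (Z y)) s z a =
      g z (fderivWithin ℝ Y s z a + Γ z a (Y z)) (Z z)
      + g z (Y z) (fderivWithin ℝ Z s z a + Γ z a (Z z)) := by
  have := fderivWithin_inner_along h h.uniq (F := id) contDiffOn_id (mapsTo_id s) hz hY hZ a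
  simpa [fderivWithin_id (h.uniq z hz)] using this

lemma localSndDeriv_symm (h : IsLeviCivitaOn s g Γ) (h' : IsLeviCivitaOn s' g' Γ')
    {F : E → E'} (hF : ContDiffOn ℝ ∞ F s) (hm : MapsTo F s s') {z : E} (hz : z ∈ s) (v w : E) :
    localSndDeriv s F Γ' z v w = localSndDeriv s F Γ' z w v := by
  rw [localSndDeriv, localSndDeriv, fderivWithin_fderivWithin_symm hF h.uniq h.dense hz,
    h'.christoffel_symm (hm hz)]

/-- The tangential part of the ambient second derivative of an isometric map is the Levi-Civita
connection of the induced metric. -/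
lemma inner_localSndDeriv (h : IsLeviCivitaOn s g Γ) (h' : IsLeviCivitaOn s' g' Γ')
    {F : E → E'} (hF : ContDiffOn ℝ ∞ F s) (hm : MapsTo F s s')
    (hiso : ∀ z ∈ s, ∀ v w, g' (F z) (fderivWithin ℝ F s z v) (fderivWithin ℝ F s z w) = g z v w)
    {z : E} (hz : z ∈ s) (v w ξ : E) :
    g' (F z) (localSndDeriv s F Γ' z v w) (fderivWithin ℝ F s z ξ) = g z (Γ z v w) ξ := by
  have hdF := diffWithinAt_of_smooth (smooth_fderivWithin hF h.uniq) hz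
  have key : ∀ a b c, fderivWithin ℝ g s z a b c =
      g' (F z) (localSndDeriv s F Γ' z a b) (fderivWithin ℝ F s z c)
      + g' (F z) (localSndDeriv s F Γ' z a c) (fderivWithin ℝ F s z b) := by
    intro a b c
    have e1 := fderivWithin_bilin (h.uniq z hz) (diffWithinAt_of_smooth h.smooth_g hz)
      (differentiableWithinAt_const b) (differentiableWithinAt_const c) a
    simp only [fderivWithin_fun_const, Pi.zero_apply, map_zero, add_zero,
      zero_apply] at e1
    rw [← e1]
    have hb : DifferentiableWithinAt ℝ (fun y => fderivWithin ℝ F s y b) s z :=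
      hdF.clm_apply (differentiableWithinAt_const b)
    have hc : DifferentiableWithinAt ℝ (fun y => fderivWithin ℝ F s y c) s z :=
      hdF.clm_apply (differentiableWithinAt_const c)
    have e2 := fderivWithin_inner_along h' h.uniq hF hm hz hb hc a
    rw [← fderivWithin_congr (fun y hy => (hiso y hy b c)) (hiso z hz b c), e2,
      fderivWithin_lin (h.uniq z hz) hdF (differentiableWithinAt_const b),
      fderivWithin_lin (h.uniq z hz) hdF (differentiableWithinAt_const c)]
    simp only [fderivWithin_fun_const, Pi.zero_apply, map_zero, add_zero,
      zero_apply]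
    rw [h'.symm _ (hm hz) (fderivWithin ℝ F s z b)]
    rfl
  have hk := h.koszul z hz v w ξ
  rw [key, key, key, localSndDeriv_symm h h' hF hm hz w v, localSndDeriv_symm h h' hF hm hz ξ v,
    localSndDeriv_symm h h' hF hm hz ξ w] at hk
  linarith

lemma differentiable_localSndDeriv (h : IsLeviCivitaOn s g Γ) (h' : IsLeviCivitaOn s' g' Γ')
    {F : E → E'} (hF : ContDiffOn ℝ ∞ F s) (hm : MapsTo F s s') (v w : E) :
    ContDiffOn ℝ ∞ (fun z => localSndDeriv s F Γ' z v w) s := by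
  have h1 := smooth_fderivWithin hF h.uniq
  have h2 := smooth_fderivWithin h1 h.uniq
  have h3 : ContDiffOn ℝ ∞ (fun z => Γ' (F z)) s := h'.smooth_christoffel.comp hF hm
  exact ((h2.clm_apply contDiffOn_const).clm_apply contDiffOn_const).add
    ((h3.clm_apply (h1.clm_apply contDiffOn_const)).clm_apply (h1.clm_apply contDiffOn_const))

/-- Commuting covariant derivatives along a map produces the ambient curvature. -/
lemma commute_localSndDeriv (h : IsLeviCivitaOn s g Γ) (h' : IsLeviCivitaOn s' g' Γ')
    {F : E → E'} (hF : ContDiffOn ℝ ∞ F s) (hm : MapsTo F s s') {z : E} (hz : z ∈ s) (a b c : E) :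
    (fderivWithin ℝ (fun y => localSndDeriv s F Γ' y b c) s z a
        + Γ' (F z) (fderivWithin ℝ F s z a) (localSndDeriv s F Γ' z b c))
      - (fderivWithin ℝ (fun y => localSndDeriv s F Γ' y a c) s z b
        + Γ' (F z) (fderivWithin ℝ F s z b) (localSndDeriv s F Γ' z a c))
      = localCurv s' Γ' (F z) (fderivWithin ℝ F s z a) (fderivWithin ℝ F s z b)
          (fderivWithin ℝ F s z c) := by
  have h1 := smooth_fderivWithin hF h.uniq
  have h2 := smooth_fderivWithin h1 h.uniq
  have h3 : ContDiffOn ℝ ∞ (fun z => Γ' (F z)) s := h'.smooth_christoffel.comp hF hm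
  have u := h.uniq z hz
  have d1 := diffWithinAt_of_smooth h1 hz
  have d2 := diffWithinAt_of_smooth h2 hz
  have d3 := diffWithinAt_of_smooth h3 hz
  have dc : ∀ w : E, DifferentiableWithinAt ℝ (fun y => fderivWithin ℝ F s y w) s z :=
    fun w => d1.clm_apply (differentiableWithinAt_const w)
  have eF : ∀ a, fderivWithin ℝ (fun y => Γ' (F y)) s z a
      = fderivWithin ℝ Γ' s' (F z) (fderivWithin ℝ F s z a) := by
    intro a
    have := fderivWithin_comp z (diffWithinAt_of_smooth h'.smooth_christoffel (hm hz))
      (diffWithinAt_of_smooth hF hz) hm u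
    rw [Function.comp_def] at this
    rw [this]; rfl
  have e : ∀ a b c, fderivWithin ℝ (fun y => localSndDeriv s F Γ' y b c) s z a =
      fderivWithin ℝ (fderivWithin ℝ (fderivWithin ℝ F s) s) s z a b c
      + (fderivWithin ℝ Γ' s' (F z) (fderivWithin ℝ F s z a) (fderivWithin ℝ F s z b)
          (fderivWithin ℝ F s z c)
        + Γ' (F z) (fderivWithin ℝ (fderivWithin ℝ F s) s z a b) (fderivWithin ℝ F s z c)
        + Γ' (F z) (fderivWithin ℝ F s z b) (fderivWithin ℝ (fderivWithin ℝ F s) s z a c)) := by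
    intro a b c
    unfold localSndDeriv
    rw [fderivWithin_fun_add u
      ((d2.clm_apply (differentiableWithinAt_const b)).clm_apply (differentiableWithinAt_const c))
      ((d3.clm_apply (dc b)).clm_apply (dc c))]
    rw [add_apply, fderivWithin_bilin u d2 (differentiableWithinAt_const b)
      (differentiableWithinAt_const c), fderivWithin_bilin u d3 (dc b) (dc c),
      fderivWithin_lin u d1 (differentiableWithinAt_const b),
      fderivWithin_lin u d1 (differentiableWithinAt_const c), eF]
    simp only [fderivWithin_fun_const, Pi.zero_apply, map_zero, add_zero,
      zero_apply]
  have s3 := fderivWithin_fderivWithin_symm h1 h.uniq h.dense hz a b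
  have s2 := fderivWithin_fderivWithin_symm hF h.uniq h.dense hz a b
  rw [e, e, s3, s2]
  simp only [localSndDeriv, localCurv, map_add]
  abel

/-- The tangential curvature of a map in terms of the Koszul expressions. -/
lemma inner_localCurv_along (h : IsLeviCivitaOn s g Γ) (h' : IsLeviCivitaOn s' g' Γ')
    {F : E → E'} (hF : ContDiffOn ℝ ∞ F s) (hm : MapsTo F s s')
    (hiso : ∀ z ∈ s, ∀ v w, g' (F z) (fderivWithin ℝ F s z v) (fderivWithin ℝ F s z w) = g z v w)
    {z : E} (hz : z ∈ s) (a b c d : E) :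
    g' (F z) (localCurv s' Γ' (F z) (fderivWithin ℝ F s z a) (fderivWithin ℝ F s z b)
          (fderivWithin ℝ F s z c)) (fderivWithin ℝ F s z d)
      = fderivWithin ℝ (fun y => g y (Γ y b c) d) s z a
        - fderivWithin ℝ (fun y => g y (Γ y a c) d) s z b
        - g' (F z) (localSndDeriv s F Γ' z b c) (localSndDeriv s F Γ' z a d)
        + g' (F z) (localSndDeriv s F Γ' z a c) (localSndDeriv s F Γ' z b d) := by
  have d1 := diffWithinAt_of_smooth (smooth_fderivWithin hF h.uniq) hz
  have u := h.uniq z hz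
  have e : ∀ a b, fderivWithin ℝ (fun y => g y (Γ y b c) d) s z a =
      g' (F z) (fderivWithin ℝ (fun y => localSndDeriv s F Γ' y b c) s z a
        + Γ' (F z) (fderivWithin ℝ F s z a) (localSndDeriv s F Γ' z b c)) (fderivWithin ℝ F s z d)
      + g' (F z) (localSndDeriv s F Γ' z b c) (localSndDeriv s F Γ' z a d) := by
    intro a b
    rw [← fderivWithin_congr (fun y hy => inner_localSndDeriv h h' hF hm hiso hy b c d)
      (inner_localSndDeriv h h' hF hm hiso hz b c d),
      fderivWithin_inner_along h' h.uniq hF hm hz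
        (diffWithinAt_of_smooth (differentiable_localSndDeriv h h' hF hm b c) hz)
        (d1.clm_apply (differentiableWithinAt_const d)) a,
      fderivWithin_lin u d1 (differentiableWithinAt_const d)]
    simp only [fderivWithin_fun_const, Pi.zero_apply, map_zero, add_zero,
      zero_apply]
    rfl
  rw [← commute_localSndDeriv h h' hF hm hz, e, e, map_sub, sub_apply]
  ring

lemma localSndDeriv_id (h : IsLeviCivitaOn s g Γ) {z : E} (hz : z ∈ s) (v w : E) :
    localSndDeriv s id Γ z v w = Γ z v w := by
  have : fderivWithin ℝ (fderivWithin ℝ (id : E → E) s) s z = 0 := by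
    rw [fderivWithin_congr (f := fun _ => ContinuousLinearMap.id ℝ E)
      (fun y hy => fderivWithin_id (h.uniq y hy)) (fderivWithin_id (h.uniq z hz))]
    simp
  simp [localSndDeriv, this, fderivWithin_id (h.uniq z hz)]

/-- The Riemann tensor in terms of the Koszul expressions. -/
lemma inner_localCurv (h : IsLeviCivitaOn s g Γ) {z : E} (hz : z ∈ s) (a b c d : E) :
    g z (localCurv s Γ z a b c) d
      = fderivWithin ℝ (fun y => g y (Γ y b c) d) s z a
        - fderivWithin ℝ (fun y => g y (Γ y a c) d) s z b
        - g z (Γ z b c) (Γ z a d) + g z (Γ z a c) (Γ z b d) := by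
  have := inner_localCurv_along h h (F := id) contDiffOn_id (mapsTo_id s) (fun z hz v w => by
    simp [fderivWithin_id (h.uniq z hz)]) hz a b c d
  simpa [fderivWithin_id (h.uniq z hz), localSndDeriv_id h hz] using this

/-- The Gauss equation, for an isometric map whose ambient second derivative has normal part `B`. -/
lemma gauss (h : IsLeviCivitaOn s g Γ) (h' : IsLeviCivitaOn s' g' Γ')
    {F : E → E'} (hF : ContDiffOn ℝ ∞ F s) (hm : MapsTo F s s')
    (hiso : ∀ z ∈ s, ∀ v w, g' (F z) (fderivWithin ℝ F s z v) (fderivWithin ℝ F s z w) = g z v w)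
    {z : E} (hz : z ∈ s) {B : E → E → E'}
    (hB : ∀ v w, B v w = localSndDeriv s F Γ' z v w - fderivWithin ℝ F s z (Γ z v w))
    (a b c d : E) :
    g' (F z) (localCurv s' Γ' (F z) (fderivWithin ℝ F s z a) (fderivWithin ℝ F s z b)
          (fderivWithin ℝ F s z c)) (fderivWithin ℝ F s z d)
      = g z (localCurv s Γ z a b c) d - g' (F z) (B b c) (B a d) + g' (F z) (B a c) (B b d) := by
  rw [inner_localCurv_along h h' hF hm hiso hz, inner_localCurv h hz]
  have key : ∀ a b c d, g' (F z) (B a b) (B c d)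
      = g' (F z) (localSndDeriv s F Γ' z a b) (localSndDeriv s F Γ' z c d)
        - g z (Γ z a b) (Γ z c d) := by
    intro a b c d
    rw [hB, hB]
    simp only [map_sub, sub_apply]
    rw [hiso z hz, inner_localSndDeriv h h' hF hm hiso hz,
      h'.symm _ (hm hz) (fderivWithin ℝ F s z (Γ z a b)),
      inner_localSndDeriv h h' hF hm hiso hz, h.symm z hz (Γ z c d)]
    ring
  rw [key, key]
  ring

/-- The Riemann tensor is antisymmetric in its last two arguments. -/
lemma inner_localCurv_antisymm (h : IsLeviCivitaOn s g Γ) {z : E} (hz : z ∈ s) (a b c d : E) :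
    g z (localCurv s Γ z a b c) d = - g z (localCurv s Γ z a b d) c := by
  have u := h.uniq z hz
  have hg1 := smooth_fderivWithin h.smooth_g h.uniq
  have d1 := diffWithinAt_of_smooth hg1 hz
  have dg : ∀ b c d, DifferentiableWithinAt ℝ (fun y => g y (Γ y b c) d) s z := fun b c d =>
    ((diffWithinAt_of_smooth h.smooth_g hz).clm_apply
      (((diffWithinAt_of_smooth h.smooth_christoffel hz).clm_apply
        (differentiableWithinAt_const b)).clm_apply (differentiableWithinAt_const c))).clm_apply
      (differentiableWithinAt_const d)
  have key : ∀ a b, fderivWithin ℝ (fun y => g y (Γ y b c) d) s z a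
      + fderivWithin ℝ (fun y => g y (Γ y b d) c) s z a
      = fderivWithin ℝ (fderivWithin ℝ g s) s z a b c d := by
    intro a b
    have e0 : fderivWithin ℝ (fun y => g y (Γ y b c) d + g y (Γ y b d) c) s z a
        = fderivWithin ℝ (fun y => g y (Γ y b c) d) s z a
          + fderivWithin ℝ (fun y => g y (Γ y b d) c) s z a := by
      rw [fderivWithin_fun_add u (dg b c d) (dg b d c)]; rfl
    rw [← e0]
    have : ∀ y ∈ s, g y (Γ y b c) d + g y (Γ y b d) c = fderivWithin ℝ g s y b c d := by
      intro y hy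
      rw [h.compat hy, h.symm y hy c]
    rw [fderivWithin_congr this (this z hz)]
    have d2 : DifferentiableWithinAt ℝ (fun y => fderivWithin ℝ g s y b) s z :=
      d1.clm_apply (differentiableWithinAt_const b)
    have e2 := fderivWithin_eval₂ u d2 c d a
    have e3 : fderivWithin ℝ (fun y => fderivWithin ℝ g s y b) s z a
      = fderivWithin ℝ (fderivWithin ℝ g s) s z a b := fderivWithin_eval u d1 b a
    rw [e2, e3]
  rw [inner_localCurv h hz, inner_localCurv h hz]
  have k1 := key a b
  have k2 := key b a
  rw [fderivWithin_fderivWithin_symm h.smooth_g h.uniq h.dense hz] at k2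
  have s1 := h.symm z hz (Γ z b c) (Γ z a d)
  have s2 := h.symm z hz (Γ z a c) (Γ z b d)
  linarith

lemma localCurv_antisymm (z a b c : E) : localCurv s Γ z a b c = - localCurv s Γ z b a c := by
  simp only [localCurv]; abel

end IsLeviCivitaOn

end LocalGeometry

section Bochner

variable {E E' : Type*} [NormedAddCommGroup E] [NormedSpace ℝ E]
  [NormedAddCommGroup E'] [NormedSpace ℝ E']

/-- The covariant derivative `v ↦ ∇_v N` of a vector field in coordinates. -/
def localNabla (s : Set E) (Γ : E → E →L[ℝ] E →L[ℝ] E) (N : E → E) (z : E) : E →L[ℝ] E :=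
  fderivWithin ℝ N s z + (Γ z).flip (N z)

/-- An orthonormal basis for the form `B`. -/
structure IsOrthoBasis {ι : Type*} [Fintype ι] [DecidableEq ι] (B : E →L[ℝ] E →L[ℝ] ℝ)
    (e : ι → E) : Prop where
  orth : ∀ i j, B (e i) (e j) = if i = j then 1 else 0
  span : ∀ v, v = ∑ i, B v (e i) • e i

lemma IsOrthoBasis.inner_eq {ι : Type*} [Fintype ι] [DecidableEq ι] {B : E →L[ℝ] E →L[ℝ] ℝ}
    {e : ι → E} (he : IsOrthoBasis B e) (v w : E) : B v w = ∑ i, B v (e i) * B (e i) w := by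
  conv_lhs => rw [he.span v]
  simp [map_sum]

lemma IsOrthoBasis.trace_eq {ι : Type*} [Fintype ι] [DecidableEq ι] {B : E →L[ℝ] E →L[ℝ] ℝ}
    {e : ι → E} (he : IsOrthoBasis B e) (L : E →ₗ[ℝ] E) :
    LinearMap.trace ℝ E L = ∑ i, B (L (e i)) (e i) := by
  have hli : LinearIndependent ℝ e := by
    rw [Fintype.linearIndependent_iff]
    intro c hc i
    have := congrArg (fun v => B v (e i)) hc
    simpa [map_sum, he.orth] using this
  have hsp : ⊤ ≤ Submodule.span ℝ (range e) := by
    intro v _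
    rw [he.span v]
    exact Submodule.sum_mem _ fun i _ => Submodule.smul_mem _ _ (Submodule.subset_span ⟨i, rfl⟩)
  let b := Module.Basis.mk hli hsp
  have hb : ∀ v i, b.repr v i = B v (e i) := by
    intro v i
    have : b.repr v = b.repr (∑ j, B v (e j) • b j) := by
      congr 1
      simpa [b] using he.span v
    rw [this]
    simp [Finsupp.single_apply]
  rw [LinearMap.trace_eq_matrix_trace ℝ b, Matrix.trace]
  refine Finset.sum_congr rfl fun i _ => ?_
  rw [Matrix.diag_apply, LinearMap.toMatrix_apply, hb]
  simp [b]

namespace IsLeviCivitaOn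

variable {s : Set E} {g : E → E →L[ℝ] E →L[ℝ] ℝ} {Γ : E → E →L[ℝ] E →L[ℝ] E}
  {s' : Set E'} {g' : E' → E' →L[ℝ] E' →L[ℝ] ℝ} {Γ' : E' → E' →L[ℝ] E' →L[ℝ] E'}

/-- The Hessian is the derivative of the gradient. -/
lemma inner_localNabla (h : IsLeviCivitaOn s g Γ) {u : E → ℝ} (hu : ContDiffOn ℝ ∞ u s)
    {N : E → E} (hN : ContDiffOn ℝ ∞ N s)
    (hNu : ∀ z ∈ s, ∀ v, g z (N z) v = fderivWithin ℝ u s z v) {z : E} (hz : z ∈ s) (v w : E) :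
    g z (localNabla s Γ N z v) w = localHess s Γ u z v w := by
  have u1 := h.uniq z hz
  have d := diffWithinAt_of_smooth hN hz
  have e1 := h.fderivWithin_inner hz d (differentiableWithinAt_const w) v
  simp only [fderivWithin_fun_const, Pi.zero_apply, zero_apply, zero_add] at e1
  rw [fderivWithin_congr (fun y hy => hNu y hy w) (hNu z hz w),
    fderivWithin_eval u1 (diffWithinAt_of_smooth (smooth_fderivWithin hu h.uniq) hz),
    hNu z hz] at e1
  simp only [localNabla, localHess, add_apply, ContinuousLinearMap.flip_apply]
  linarith

lemma localHess_symm (h : IsLeviCivitaOn s g Γ) {u : E → ℝ} (hu : ContDiffOn ℝ ∞ u s)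
    {z : E} (hz : z ∈ s) (v w : E) : localHess s Γ u z v w = localHess s Γ u z w v := by
  rw [localHess, localHess, fderivWithin_fderivWithin_symm hu h.uniq h.dense hz,
    h.christoffel_symm hz]

lemma smooth_localNabla (h : IsLeviCivitaOn s g Γ) {N : E → E} (hN : ContDiffOn ℝ ∞ N s) :
    ContDiffOn ℝ ∞ (localNabla s Γ N) s := by
  have h1 : ContDiffOn ℝ ∞ (fun z => (Γ z).flip) s :=
    (ContinuousLinearMap.flipₗᵢ ℝ E E E).contDiff.comp_contDiffOn h.smooth_christoffel
  exact (smooth_fderivWithin hN h.uniq).add (h1.clm_apply hN)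

/-- The gradient of `|∇u|²` is `2 ∇_{∇u} ∇u`. -/
lemma fderivWithin_normSq_grad (h : IsLeviCivitaOn s g Γ) {u : E → ℝ} (hu : ContDiffOn ℝ ∞ u s)
    {N : E → E} (hN : ContDiffOn ℝ ∞ N s)
    (hNu : ∀ z ∈ s, ∀ v, g z (N z) v = fderivWithin ℝ u s z v) {z : E} (hz : z ∈ s) (v : E) :
    fderivWithin ℝ (fun y => g y (N y) (N y)) s z v = 2 * localHess s Γ u z v (N z) := by
  have d := diffWithinAt_of_smooth hN hz
  have e1 := h.fderivWithin_inner hz d d v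
  rw [e1, h.symm z hz (N z), ← inner_localNabla h hu hN hNu hz]
  simp only [localNabla, add_apply, ContinuousLinearMap.flip_apply]
  ring

/-- The covariant derivative of the endomorphism field `v ↦ ∇_v N`. -/
def nablaSq (s : Set E) (Γ : E → E →L[ℝ] E →L[ℝ] E) (N : E → E) (z v w : E) : E :=
  fderivWithin ℝ (localNabla s Γ N) s z v w + Γ z v (localNabla s Γ N z w)
    - localNabla s Γ N z (Γ z v w)

lemma nablaSq_sub (h : IsLeviCivitaOn s g Γ) {N : E → E} (hN : ContDiffOn ℝ ∞ N s)
    {z : E} (hz : z ∈ s) (v w : E) :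
    nablaSq s Γ N z v w - nablaSq s Γ N z w v = localCurv s Γ z v w (N z) := by
  have u1 := h.uniq z hz
  have dN := diffWithinAt_of_smooth hN hz
  have dN1 := diffWithinAt_of_smooth (smooth_fderivWithin hN h.uniq) hz
  have dΓ := diffWithinAt_of_smooth h.smooth_christoffel hz
  have dA := diffWithinAt_of_smooth (smooth_localNabla h hN) hz
  have e : ∀ v w, fderivWithin ℝ (localNabla s Γ N) s z v w =
      fderivWithin ℝ (fderivWithin ℝ N s) s z v w
      + (fderivWithin ℝ Γ s z v w (N z) + Γ z w (fderivWithin ℝ N s z v)) := by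
    intro v w
    rw [← fderivWithin_eval u1 dA w v]
    have : (fun y => localNabla s Γ N y w) = fun y => fderivWithin ℝ N s y w + Γ y w (N y) := by
      ext y; simp [localNabla]
    have d2 : DifferentiableWithinAt ℝ (fun y => Γ y w) s z :=
      dΓ.clm_apply (differentiableWithinAt_const w)
    rw [this, fderivWithin_fun_add u1 (dN1.clm_apply (differentiableWithinAt_const w))
      (d2.clm_apply dN), add_apply, fderivWithin_eval u1 dN1, fderivWithin_lin u1 d2 dN,
      fderivWithin_eval u1 dΓ]
  rw [nablaSq, nablaSq, e, e, fderivWithin_fderivWithin_symm hN h.uniq h.dense hz v w,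
    h.christoffel_symm hz v w]
  simp only [localNabla, add_apply, ContinuousLinearMap.flip_apply, localCurv, map_add]
  abel

lemma inner_nablaSq_symm (h : IsLeviCivitaOn s g Γ) {u : E → ℝ} (hu : ContDiffOn ℝ ∞ u s)
    {N : E → E} (hN : ContDiffOn ℝ ∞ N s)
    (hNu : ∀ z ∈ s, ∀ v, g z (N z) v = fderivWithin ℝ u s z v) {z : E} (hz : z ∈ s) (v w x : E) :
    g z (nablaSq s Γ N z v w) x = g z (nablaSq s Γ N z v x) w := by
  have u1 := h.uniq z hz
  have dA := diffWithinAt_of_smooth (smooth_localNabla h hN) hz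
  have hs : ∀ y ∈ s, ∀ a b, g y (localNabla s Γ N y a) b = g y (localNabla s Γ N y b) a := by
    intro y hy a b
    rw [inner_localNabla h hu hN hNu hy, inner_localNabla h hu hN hNu hy, localHess_symm h hu hy]
  have e : ∀ a b, fderivWithin ℝ (fun y => g y (localNabla s Γ N y a) b) s z v =
      g z (fderivWithin ℝ (localNabla s Γ N) s z v a + Γ z v (localNabla s Γ N z a)) b
      + g z (localNabla s Γ N z a) (Γ z v b) := by
    intro a b
    rw [h.fderivWithin_inner hz (dA.clm_apply (differentiableWithinAt_const a))
      (differentiableWithinAt_const b), fderivWithin_eval u1 dA]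
    simp
  have e1 := e w x
  have e2 := e x w
  rw [fderivWithin_congr (fun y hy => hs y hy w x) (hs z hz w x)] at e1
  have h1 := hs z hz (Γ z v w) x
  have h2 := hs z hz (Γ z v x) w
  simp only [nablaSq, map_sub, sub_apply]
  linarith

/-- The Hessian of `|∇u|²`. -/
lemma localHess_normSq_grad (h : IsLeviCivitaOn s g Γ) {u : E → ℝ} (hu : ContDiffOn ℝ ∞ u s)
    {N : E → E} (hN : ContDiffOn ℝ ∞ N s)
    (hNu : ∀ z ∈ s, ∀ v, g z (N z) v = fderivWithin ℝ u s z v) {z : E} (hz : z ∈ s) (v w : E) :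
    localHess s Γ (fun y => g y (N y) (N y)) z v w
      = 2 * (g z (nablaSq s Γ N z v w) (N z)
        + g z (localNabla s Γ N z v) (localNabla s Γ N z w)) := by
  have u1 := h.uniq z hz
  have dN := diffWithinAt_of_smooth hN hz
  have hA := smooth_localNabla h hN
  have dA := diffWithinAt_of_smooth hA hz
  have hf : ContDiffOn ℝ ∞ (fun y => g y (N y) (N y)) s :=
    (h.smooth_g.clm_apply hN).clm_apply hN
  have hd : ∀ y ∈ s, fderivWithin ℝ (fun y => g y (N y) (N y)) s y w
      = (2 : ℝ) • g y (localNabla s Γ N y w) (N y) := by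
    intro y hy
    rw [fderivWithin_normSq_grad h hu hN hNu hy, inner_localNabla h hu hN hNu hy, smul_eq_mul]
  rw [localHess, ← fderivWithin_eval u1 (diffWithinAt_of_smooth (smooth_fderivWithin hf h.uniq) hz),
    fderivWithin_congr hd (hd z hz), fderivWithin_normSq_grad h hu hN hNu hz,
    ← inner_localNabla h hu hN hNu hz]
  have hdd : DifferentiableWithinAt ℝ (fun y => g y (localNabla s Γ N y w) (N y)) s z :=
    ((diffWithinAt_of_smooth h.smooth_g hz).clm_apply
      (dA.clm_apply (differentiableWithinAt_const w))).clm_apply dN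
  rw [fderivWithin_fun_const_smul u1 hdd, smul_apply,
    h.fderivWithin_inner hz (dA.clm_apply (differentiableWithinAt_const w)) dN,
    fderivWithin_eval u1 dA]
  simp only [nablaSq, map_sub, sub_apply, smul_eq_mul]
  rw [h.symm z hz (localNabla s Γ N z w)]
  simp only [localNabla, add_apply, ContinuousLinearMap.flip_apply]
  ring

/-- **Bochner formula** for a harmonic function. -/
lemma bochner [FiniteDimensional ℝ E] (h : IsLeviCivitaOn s g Γ) {u : E → ℝ}
    (hu : ContDiffOn ℝ ∞ u s) {N : E → E} (hN : ContDiffOn ℝ ∞ N s)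
    (hNu : ∀ z ∈ s, ∀ v, g z (N z) v = fderivWithin ℝ u s z v)
    (hharm : ∀ z ∈ s, LinearMap.trace ℝ E (localNabla s Γ N z) = 0)
    {ι : Type*} [Fintype ι] [DecidableEq ι] {z : E} (hz : z ∈ s) {e : ι → E}
    (he : IsOrthoBasis (g z) e) :
    ∑ i, localHess s Γ (fun y => g y (N y) (N y)) z (e i) (e i)
      = 2 * (∑ i, ∑ j, localHess s Γ u z (e i) (e j) ^ 2
        + ∑ i, g z (localCurv s Γ z (e i) (N z) (N z)) (e i)) := by
  have u1 := h.uniq z hz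
  have dA := diffWithinAt_of_smooth (smooth_localNabla h hN) hz
  have htr : LinearMap.trace ℝ E (fderivWithin ℝ (localNabla s Γ N) s z (N z)) = 0 := by
    let T : (E →L[ℝ] E) →L[ℝ] ℝ := LinearMap.toContinuousLinearMap
      ((LinearMap.trace ℝ E).comp (ContinuousLinearMap.coeLM ℝ))
    have hT : ∀ L : E →L[ℝ] E, T L = LinearMap.trace ℝ E L := fun L => rfl
    have h0 : ∀ y ∈ s, T (localNabla s Γ N y) = 0 := fun y hy => by rw [hT, hharm y hy]
    have e1 := fderivWithin_lin u1 (differentiableWithinAt_const T) dA (N z)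
    rw [fderivWithin_congr h0 (h0 z hz)] at e1
    simpa [hT] using e1.symm
  have htr2 : ∑ i, g z (nablaSq s Γ N z (N z) (e i)) (e i) = 0 := by
    have e1 := he.trace_eq (fderivWithin ℝ (localNabla s Γ N) s z (N z) : E →ₗ[ℝ] E)
    have e2 := he.trace_eq ((Γ z (N z) : E →ₗ[ℝ] E) * (localNabla s Γ N z : E →ₗ[ℝ] E))
    have e3 := he.trace_eq ((localNabla s Γ N z : E →ₗ[ℝ] E) * (Γ z (N z) : E →ₗ[ℝ] E))
    rw [LinearMap.trace_mul_comm, e3] at e2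
    rw [htr] at e1
    simp only [nablaSq, map_sub, map_add, sub_apply, add_apply, Finset.sum_sub_distrib,
      Finset.sum_add_distrib]
    simp only [Module.End.mul_apply, ContinuousLinearMap.coe_coe] at e1 e2
    linarith
  have key : ∀ i, g z (nablaSq s Γ N z (e i) (e i)) (N z)
      = g z (nablaSq s Γ N z (N z) (e i)) (e i)
        + g z (localCurv s Γ z (e i) (N z) (N z)) (e i) := by
    intro i
    rw [inner_nablaSq_symm h hu hN hNu hz, ← nablaSq_sub h hN hz]
    simp
  have key2 : ∀ i, g z (localNabla s Γ N z (e i)) (localNabla s Γ N z (e i))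
      = ∑ j, localHess s Γ u z (e i) (e j) ^ 2 := by
    intro i
    rw [he.inner_eq]
    refine Finset.sum_congr rfl fun j _ => ?_
    rw [h.symm z hz (e j), inner_localNabla h hu hN hNu hz, sq]
  simp only [localHess_normSq_grad h hu hN hNu hz, ← Finset.mul_sum, Finset.sum_add_distrib, key,
    key2, htr2]
  ring

/-- The Hessian transforms as a tensor under a map preserving the connections. -/
lemma localHess_comp (h : IsLeviCivitaOn s g Γ) (h' : IsLeviCivitaOn s' g' Γ')
    {F : E → E'} (hF : ContDiffOn ℝ ∞ F s) (hm : MapsTo F s s') {f : E' → ℝ}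
    (hf : ContDiffOn ℝ ∞ f s') {z : E} (hz : z ∈ s) (v w : E)
    (hΓ : localSndDeriv s F Γ' z v w = fderivWithin ℝ F s z (Γ z v w)) :
    localHess s Γ (fun y => f (F y)) z v w
      = localHess s' Γ' f (F z) (fderivWithin ℝ F s z v) (fderivWithin ℝ F s z w) := by
  have u1 := h.uniq z hz
  have hF1 := smooth_fderivWithin hF h.uniq
  have hf1 := smooth_fderivWithin hf h'.uniq
  have hcomp : ∀ y ∈ s, ∀ w, fderivWithin ℝ (fun y => f (F y)) s y w
      = fderivWithin ℝ f s' (F y) (fderivWithin ℝ F s y w) := by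
    intro y hy w
    have := fderivWithin_comp y (diffWithinAt_of_smooth hf (hm hy))
      (diffWithinAt_of_smooth hF hy) hm (h.uniq y hy)
    rw [Function.comp_def] at this
    rw [this]; rfl
  have hfF : ContDiffOn ℝ ∞ (fun y => f (F y)) s := hf.comp hF hm
  have d1 : DifferentiableWithinAt ℝ (fun y => fderivWithin ℝ f s' (F y)) s z :=
    diffWithinAt_of_smooth (hf1.comp hF hm) hz
  have dF1 := diffWithinAt_of_smooth hF1 hz
  have e1 : fderivWithin ℝ (fun y => fderivWithin ℝ f s' (F y)) s z v
      = fderivWithin ℝ (fderivWithin ℝ f s') s' (F z) (fderivWithin ℝ F s z v) := by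
    have := fderivWithin_comp z (diffWithinAt_of_smooth hf1 (hm hz))
      (diffWithinAt_of_smooth hF hz) hm u1
    rw [Function.comp_def] at this
    rw [this]; rfl
  rw [localHess, ← fderivWithin_eval u1
      (diffWithinAt_of_smooth (smooth_fderivWithin hfF h.uniq) hz),
    fderivWithin_congr (fun y hy => hcomp y hy w) (hcomp z hz w),
    fderivWithin_lin u1 d1 (dF1.clm_apply (differentiableWithinAt_const w)), e1,
    fderivWithin_eval u1 dF1, hcomp z hz, ← hΓ, localSndDeriv, localHess]
  simp only [map_add]
  ring

end IsLeviCivitaOn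

end Bochner

/-- The coordinate space. -/
abbrev Euc (n : ℕ) := EuclideanSpace ℝ (Fin n)

section ChartMetric

variable (n : ℕ) [NeZero n] {X : Type*} [TopologicalSpace X]
  [ChartedSpace (EuclideanHalfSpace n) X]

/-- The derivative of the inverse of the chart at `x`. -/
def chartFrame (x : X) (z : Euc n) :
    Euc n →L[ℝ] TangentSpace (𝓡∂ n) ((extChartAt (𝓡∂ n) x).symm z) :=
  mfderivWithin 𝓘(ℝ, Euc n) (𝓡∂ n) (extChartAt (𝓡∂ n) x).symm
      (range (𝓡∂ n)) z

lemma fderivWithin_range_eq {F : Type*} [NormedAddCommGroup F] [NormedSpace ℝ F] (x : X)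
    (f : Euc n → F) {z : Euc n}
    (hz : z ∈ (extChartAt (𝓡∂ n) x).target) :
    fderivWithin ℝ f (range (𝓡∂ n)) z = fderivWithin ℝ f (extChartAt (𝓡∂ n) x).target z := by
  refine (fderivWithin_congr_set ?_)
  have := extChartAt_target_eventuallyEq_of_mem (I := 𝓡∂ n) hz
  exact this.symm

lemma fderivWithin_fderivWithin_range_eq {F : Type*} [NormedAddCommGroup F] [NormedSpace ℝ F]
    (x : X) (f : Euc n → F) {z : Euc n}
    (hz : z ∈ (extChartAt (𝓡∂ n) x).target) :
    fderivWithin ℝ (fun y => fderivWithin ℝ f (range (𝓡∂ n)) y) (range (𝓡∂ n)) z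
      = fderivWithin ℝ (fderivWithin ℝ f (extChartAt (𝓡∂ n) x).target)
          (extChartAt (𝓡∂ n) x).target z := by
  rw [fderivWithin_range_eq n x _ hz]
  exact fderivWithin_congr (fun y hy => fderivWithin_range_eq n x f hy)
    (fderivWithin_range_eq n x f hz)

variable [IsManifold (𝓡∂ n) ∞ X] [RiemannianBundle (fun x : X => TangentSpace (𝓡∂ n) x)]

lemma metricCoord_eq (x : X) (z v w : Euc n) :
    metricCoord n x z v w = inner ℝ (chartFrame n x z v) (chartFrame n x z w) := rfl

lemma metricCoord_add_left (x : X) (z v v' w : Euc n) :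
    metricCoord n x z (v + v') w = metricCoord n x z v w + metricCoord n x z v' w := by
  simp only [metricCoord_eq, map_add, inner_add_left]

lemma metricCoord_smul_left (x : X) (z : Euc n) (c : ℝ)
    (v w : Euc n) :
    metricCoord n x z (c • v) w = c * metricCoord n x z v w := by
  simp only [metricCoord_eq, map_smul, inner_smul_left]; simp

lemma metricCoord_comm (x : X) (z v w : Euc n) :
    metricCoord n x z v w = metricCoord n x z w v := by
  simp only [metricCoord_eq, real_inner_comm]

/-- The metric in the chart at `x` as a field of continuous bilinear forms. -/
def chartMetric (x : X) (z : Euc n) :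
    Euc n →L[ℝ] Euc n →L[ℝ] ℝ :=
  LinearMap.toContinuousLinearMap
    ((LinearMap.toContinuousLinearMap : _ ≃ₗ[ℝ] (Euc n →L[ℝ] ℝ)).toLinearMap.comp
      (LinearMap.mk₂ ℝ (metricCoord n x z) (metricCoord_add_left n x z)
        (metricCoord_smul_left n x z)
        (fun v w w' => by
          rw [metricCoord_comm, metricCoord_add_left, metricCoord_comm n x z w,
            metricCoord_comm n x z w'])
        (fun c v w => by
          rw [metricCoord_comm, metricCoord_smul_left, metricCoord_comm n x z w, smul_eq_mul])))

@[simp] lemma chartMetric_apply (x : X) (z v w : Euc n) :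
    chartMetric n x z v w = metricCoord n x z v w := rfl

lemma chartFrame_injective (x : X) {z : Euc n}
    (hz : z ∈ (extChartAt (𝓡∂ n) x).target) : Function.Injective (chartFrame n x z) := by
  have : IsManifold (𝓡∂ n) 1 X := IsManifold.of_le (n := ∞) (by simp)
  exact (isInvertible_mfderivWithin_extChartAt_symm hz).injective

lemma chartMetric_pos (x : X) {z : Euc n}
    (hz : z ∈ (extChartAt (𝓡∂ n) x).target) {v : Euc n} (hv : v ≠ 0) :
    0 < chartMetric n x z v v := by
  rw [chartMetric_apply, metricCoord_eq]
  exact real_inner_self_pos.2 fun h => hv (chartFrame_injective n x hz (by rw [h, map_zero]))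

variable [IsContMDiffRiemannianBundle (𝓡∂ n) ∞ (EuclideanSpace ℝ (Fin n))
      (fun x : X => TangentSpace (𝓡∂ n) x)]

lemma contMDiffOn_chartFrame (x : X) (v : Euc n) :
    ContMDiffOn 𝓘(ℝ, Euc n) (𝓡∂ n).tangent ∞
      (fun z => (⟨(extChartAt (𝓡∂ n) x).symm z, chartFrame n x z v⟩ : TangentBundle (𝓡∂ n) X))
      (extChartAt (𝓡∂ n) x).target := by
  have h1 : IsManifold (𝓡∂ n) 1 X := IsManifold.of_le (n := ∞) (by simp)
  have hs := (trivializationAt (EuclideanSpace ℝ (Fin n)) (TangentSpace (𝓡∂ n) (M := X))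
    x).contMDiffOn_symm (IB := 𝓡∂ n) (n := ∞)
  have h2 : ContMDiffOn 𝓘(ℝ, Euc n)
      ((𝓡∂ n).prod 𝓘(ℝ, Euc n)) ∞
      (fun z => ((extChartAt (𝓡∂ n) x).symm z, v)) (extChartAt (𝓡∂ n) x).target :=
    (contMDiffOn_extChartAt_symm x).prodMk contMDiffOn_const
  have hmem : ∀ z ∈ (extChartAt (𝓡∂ n) x).target,
      (extChartAt (𝓡∂ n) x).symm z ∈ (chartAt (EuclideanHalfSpace n) x).source := by
    intro z hz
    have := (extChartAt (𝓡∂ n) x).map_target hz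
    rwa [extChartAt_source] at this
  refine (hs.comp h2 ?_).congr ?_
  · intro z hz
    simp only [mem_preimage]
    rw [Trivialization.mem_target]
    exact hmem z hz
  · intro z hz
    have hb := hmem z hz
    have e1 := TangentBundle.symmL_trivializationAt (I := 𝓡∂ n) hb
    rw [(extChartAt (𝓡∂ n) x).right_inv hz] at e1
    simp only [Function.comp]
    rw [← Trivialization.mk_symm _ hb]
    congr 1
    exact (congrArg (fun L => L v) e1).symm.trans (Trivialization.symmL_apply _ hb v)

lemma contDiffOn_metricCoord (x : X) (v w : Euc n) :
    ContDiffOn ℝ ∞ (fun z => metricCoord n x z v w) (extChartAt (𝓡∂ n) x).target := by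
  rw [← contMDiffOn_iff_contDiffOn]
  exact ContMDiffOn.inner_bundle (contMDiffOn_chartFrame n x v) (contMDiffOn_chartFrame n x w)

lemma contDiffOn_chartMetric (x : X) :
    ContDiffOn ℝ ∞ (chartMetric n x) (extChartAt (𝓡∂ n) x).target := by
  rw [contDiffOn_clm_apply]
  intro v
  rw [contDiffOn_clm_apply]
  intro w
  exact contDiffOn_metricCoord n x v w


/-- The Koszul expression of the metric of the chart at `x`. -/
def chartKoszul (x : X) (z v w : Euc n) : Euc n →L[ℝ] ℝ :=
  (1 / 2 : ℝ) • (fderivWithin ℝ (chartMetric n x) (extChartAt (𝓡∂ n) x).target z v w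
    + fderivWithin ℝ (chartMetric n x) (extChartAt (𝓡∂ n) x).target z w v
    - ((fderivWithin ℝ (chartMetric n x) (extChartAt (𝓡∂ n) x).target z).flip v).flip w)

lemma christoffelFirst_eq (x : X) {z : Euc n} (hz : z ∈ (extChartAt (𝓡∂ n) x).target)
    (v w ξ : Euc n) : christoffelFirst n x z v w ξ = chartKoszul n x z v w ξ := by
  have hd := diffWithinAt_of_smooth (contDiffOn_chartMetric n x) hz
  have hu := uniqueDiffOn_extChartAt_target (I := 𝓡∂ n) x z hz
  have e : ∀ a b c : Euc n, fderivWithin ℝ (fun y => metricCoord n x y b c) (range (𝓡∂ n)) z a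
      = fderivWithin ℝ (chartMetric n x) (extChartAt (𝓡∂ n) x).target z a b c := by
    intro a b c
    rw [fderivWithin_range_eq n x _ hz, ← fderivWithin_eval₂ hu hd]
    rfl
  simp only [christoffelFirst, e, chartKoszul, smul_apply, add_apply, sub_apply,
    ContinuousLinearMap.flip_apply, smul_eq_mul]

lemma gram_apply (x : X) (z : Euc n) (i j : Fin n) :
    gram n x z i j = chartMetric n x z (EuclideanSpace.single i 1) (EuclideanSpace.single j 1) := rfl

lemma euc_eq_sum (v : Euc n) : v = ∑ i, v i • EuclideanSpace.single i (1 : ℝ) := by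
  conv_lhs => rw [← (EuclideanSpace.basisFun (Fin n) ℝ).sum_repr v]
  simp

lemma chartMetric_single_left (x : X) (z v : Euc n) (j : Fin n) :
    chartMetric n x z v (EuclideanSpace.single j 1) = ∑ i, v i * gram n x z i j := by
  conv_lhs => rw [euc_eq_sum n v]
  simp only [map_sum, map_smul, sum_apply, smul_apply, smul_eq_mul, gram_apply]

lemma gram_posDef (x : X) {z : Euc n} (hz : z ∈ (extChartAt (𝓡∂ n) x).target) :
    (gram n x z).PosDef := by
  apply Matrix.PosDef.of_dotProduct_mulVec_pos
  · ext i j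
    simp [gram, metricCoord_comm n x z (EuclideanSpace.single j 1)]
  · intro v hv
    have hv' : (WithLp.toLp 2 v : Euc n) ≠ 0 := by
      intro h
      exact hv (by simpa using congrArg WithLp.ofLp h)
    have := chartMetric_pos n x hz hv'
    rw [euc_eq_sum n (WithLp.toLp 2 v)] at this
    simp only [map_sum, map_smul, sum_apply, smul_apply, smul_eq_mul, ← gram_apply] at this
    simp only [dotProduct, Matrix.mulVec, star_trivial]
    refine this.trans_eq ?_
    refine Finset.sum_congr rfl fun i _ => ?_
    rw [Finset.mul_sum, Finset.mul_sum]
    refine Finset.sum_congr rfl fun j _ => ?_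
    have : gram n x z i j = gram n x z j i := metricCoord_comm n x z _ _
    rw [this]; ring

/-- The vector dual to a covector, in the coordinates of the chart at `x`. -/
def chartSharp (x : X) (z : Euc n) (ℓ : Euc n →L[ℝ] ℝ) : Euc n :=
  WithLp.toLp 2 fun k => ∑ l, (gram n x z)⁻¹ k l * ℓ (EuclideanSpace.single l 1)

lemma chartMetric_sharp (x : X) {z : Euc n} (hz : z ∈ (extChartAt (𝓡∂ n) x).target)
    (ℓ : Euc n →L[ℝ] ℝ) (ξ : Euc n) : chartMetric n x z (chartSharp n x z ℓ) ξ = ℓ ξ := by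
  suffices h : chartMetric n x z (chartSharp n x z ℓ) = ℓ by rw [h]
  apply ContinuousLinearMap.coe_injective
  apply (EuclideanSpace.basisFun (Fin n) ℝ).toBasis.ext
  intro j
  simp only [OrthonormalBasis.coe_toBasis, EuclideanSpace.basisFun_apply,
    ContinuousLinearMap.coe_coe]
  rw [chartMetric_single_left]
  have hinv : (gram n x z)⁻¹ * gram n x z = 1 :=
    Matrix.nonsing_inv_mul _ (gram_posDef n x hz).det_pos.ne'.isUnit
  have hsymm : ∀ i j, (gram n x z) i j = gram n x z j i := fun i j => metricCoord_comm n x z _ _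
  have hinv2 : gram n x z * (gram n x z)⁻¹ = 1 :=
    Matrix.mul_nonsing_inv _ (gram_posDef n x hz).det_pos.ne'.isUnit
  calc ∑ i, chartSharp n x z ℓ i * gram n x z i j
      = ∑ i, ∑ l, (gram n x z j i * (gram n x z)⁻¹ i l) * ℓ (EuclideanSpace.single l 1) := by
        refine Finset.sum_congr rfl fun i _ => ?_
        simp only [chartSharp, Finset.sum_mul]
        refine Finset.sum_congr rfl fun l _ => ?_
        rw [hsymm i j]; ring
    _ = ∑ l, (gram n x z * (gram n x z)⁻¹) j l * ℓ (EuclideanSpace.single l 1) := by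
        rw [Finset.sum_comm]
        simp only [Matrix.mul_apply, Finset.sum_mul]
    _ = ℓ (EuclideanSpace.single j 1) := by
        simp [hinv2, Matrix.one_apply]

lemma contDiffOn_gram (x : X) (i j : Fin n) :
    ContDiffOn ℝ ∞ (fun z => gram n x z i j) (extChartAt (𝓡∂ n) x).target :=
  contDiffOn_metricCoord n x _ _

lemma contDiffOn_det {ι F : Type*} [Fintype ι] [DecidableEq ι] [NormedAddCommGroup F]
    [NormedSpace ℝ F] {s : Set F} {A : F → Matrix ι ι ℝ}
    (hA : ∀ i j, ContDiffOn ℝ ∞ (fun z => A z i j) s) : ContDiffOn ℝ ∞ (fun z => (A z).det) s := by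
  simp only [Matrix.det_apply]
  refine ContDiffOn.sum fun σ _ => ?_
  refine ContDiffOn.const_smul _ ?_
  exact contDiffOn_prod fun i _ => hA _ _

lemma contDiffOn_gram_inv (x : X) (i j : Fin n) :
    ContDiffOn ℝ ∞ (fun z => (gram n x z)⁻¹ i j) (extChartAt (𝓡∂ n) x).target := by
  have h1 : ContDiffOn ℝ ∞ (fun z => ((gram n x z).det)⁻¹ * (gram n x z).adjugate i j)
      (extChartAt (𝓡∂ n) x).target := by
    refine ContDiffOn.mul (ContDiffOn.inv (contDiffOn_det fun i j => contDiffOn_gram n x i j)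
      fun z hz => (gram_posDef n x hz).det_pos.ne') ?_
    simp only [Matrix.adjugate_apply]
    refine contDiffOn_det fun k l => ?_
    by_cases h : k = j
    · subst h; simp only [Matrix.updateRow_self]; exact contDiffOn_const
    · simp only [Matrix.updateRow_ne h]; exact contDiffOn_gram n x k l
  refine h1.congr fun z hz => ?_
  rw [Matrix.inv_def, Matrix.smul_apply, smul_eq_mul, Ring.inverse_eq_inv]

lemma contDiffOn_chartSharp (x : X) {ℓ : Euc n → Euc n →L[ℝ] ℝ} {s : Set (Euc n)}
    (hs : s ⊆ (extChartAt (𝓡∂ n) x).target) (hℓ : ContDiffOn ℝ ∞ ℓ s) :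
    ContDiffOn ℝ ∞ (fun z => chartSharp n x z (ℓ z)) s := by
  rw [contDiffOn_euclidean]
  intro k
  simp only [chartSharp]
  refine ContDiffOn.sum fun l _ => ?_
  exact ((contDiffOn_gram_inv n x k l).mono hs).mul (hℓ.clm_apply contDiffOn_const)

lemma chartSharp_add (x : X) (z : Euc n) (ℓ ℓ' : Euc n →L[ℝ] ℝ) :
    chartSharp n x z (ℓ + ℓ') = chartSharp n x z ℓ + chartSharp n x z ℓ' := by
  ext k; simp [chartSharp, mul_add, Finset.sum_add_distrib]

lemma chartSharp_smul (x : X) (z : Euc n) (c : ℝ) (ℓ : Euc n →L[ℝ] ℝ) :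
    chartSharp n x z (c • ℓ) = c • chartSharp n x z ℓ := by
  ext k
  simp only [chartSharp, smul_apply, smul_eq_mul, PiLp.smul_apply, Finset.mul_sum]
  refine Finset.sum_congr rfl fun l _ => by ring

lemma chartKoszul_add_left (x : X) (z v v' w : Euc n) :
    chartKoszul n x z (v + v') w = chartKoszul n x z v w + chartKoszul n x z v' w := by
  ext ξ
  simp only [chartKoszul, map_add, smul_apply, add_apply, sub_apply,
    ContinuousLinearMap.flip_apply, smul_eq_mul]
  ring

lemma chartKoszul_smul_left (x : X) (z : Euc n) (c : ℝ) (v w : Euc n) :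
    chartKoszul n x z (c • v) w = c • chartKoszul n x z v w := by
  ext ξ
  simp only [chartKoszul, map_smul, smul_apply, add_apply, sub_apply,
    ContinuousLinearMap.flip_apply, smul_eq_mul]
  ring

lemma chartKoszul_add_right (x : X) (z v w w' : Euc n) :
    chartKoszul n x z v (w + w') = chartKoszul n x z v w + chartKoszul n x z v w' := by
  ext ξ
  simp only [chartKoszul, map_add, smul_apply, add_apply, sub_apply,
    ContinuousLinearMap.flip_apply, smul_eq_mul]
  ring

lemma chartKoszul_smul_right (x : X) (z : Euc n) (c : ℝ) (v w : Euc n) :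
    chartKoszul n x z v (c • w) = c • chartKoszul n x z v w := by
  ext ξ
  simp only [chartKoszul, map_smul, smul_apply, add_apply, sub_apply,
    ContinuousLinearMap.flip_apply, smul_eq_mul]
  ring

/-- The Christoffel symbols of the chart at `x` as a field of continuous bilinear maps. -/
def chartChristoffel (x : X) (z : Euc n) : Euc n →L[ℝ] Euc n →L[ℝ] Euc n :=
  LinearMap.toContinuousLinearMap
    ((LinearMap.toContinuousLinearMap : _ ≃ₗ[ℝ] (Euc n →L[ℝ] Euc n)).toLinearMap.comp
      (LinearMap.mk₂ ℝ (fun v w => chartSharp n x z (chartKoszul n x z v w))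
        (fun v v' w => by rw [chartKoszul_add_left, chartSharp_add])
        (fun c v w => by rw [chartKoszul_smul_left, chartSharp_smul])
        (fun v w w' => by rw [chartKoszul_add_right, chartSharp_add])
        (fun c v w => by rw [chartKoszul_smul_right, chartSharp_smul])))

lemma chartChristoffel_apply (x : X) (z v w : Euc n) :
    chartChristoffel n x z v w = chartSharp n x z (chartKoszul n x z v w) := rfl

lemma christoffel_eq (x : X) {z : Euc n} (hz : z ∈ (extChartAt (𝓡∂ n) x).target) (v w : Euc n) :
    christoffel n x z v w = chartChristoffel n x z v w := by
  ext k
  simp only [christoffel, chartChristoffel_apply, chartSharp, christoffelFirst_eq n x hz]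

/-- The metric in a chart with its Christoffel symbols. -/
lemma isLeviCivitaOn_chart (x : X) :
    IsLeviCivitaOn (extChartAt (𝓡∂ n) x).target (chartMetric n x) (chartChristoffel n x) where
  uniq := uniqueDiffOn_extChartAt_target x
  dense := extChartAt_target_subset_closure_interior
  smooth_g := contDiffOn_chartMetric n x
  smooth_christoffel := by
    rw [contDiffOn_clm_apply]
    intro v
    rw [contDiffOn_clm_apply]
    intro w
    have h1 := smooth_fderivWithin (contDiffOn_chartMetric n x)
      (uniqueDiffOn_extChartAt_target (I := 𝓡∂ n) x)
    refine contDiffOn_chartSharp n x subset_rfl ?_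
    rw [contDiffOn_clm_apply]
    intro ξ
    simp only [chartKoszul, smul_apply, add_apply, sub_apply, ContinuousLinearMap.flip_apply]
    have h2 : ∀ a b c : Euc n, ContDiffOn ℝ ∞ (fun z =>
        fderivWithin ℝ (chartMetric n x) (extChartAt (𝓡∂ n) x).target z a b c)
        (extChartAt (𝓡∂ n) x).target := fun a b c =>
      ((h1.clm_apply contDiffOn_const).clm_apply contDiffOn_const).clm_apply contDiffOn_const
    exact ContDiffOn.const_smul _ (((h2 _ _ _).add (h2 _ _ _)).sub (h2 _ _ _))
  symm := fun z _ v w => metricCoord_comm n x z v w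
  pos := fun z hz v hv => chartMetric_pos n x hz hv
  koszul := by
    intro z hz v w ξ
    rw [chartChristoffel_apply, chartMetric_sharp n x hz]
    simp only [chartKoszul, smul_apply, add_apply, sub_apply, ContinuousLinearMap.flip_apply,
      smul_eq_mul]
    ring

end ChartMetric

section Restrict

variable {E E' : Type*} [NormedAddCommGroup E] [NormedSpace ℝ E]
  [NormedAddCommGroup E'] [NormedSpace ℝ E']

lemma fderivWithin_inter_open {s u : Set E} (hu : IsOpen u) (f : E → E') {z : E} (hz : z ∈ u) :
    fderivWithin ℝ f (s ∩ u) z = fderivWithin ℝ f s z :=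
  fderivWithin_inter (hu.mem_nhds hz)

lemma IsLeviCivitaOn.inter {s u : Set E} {g : E → E →L[ℝ] E →L[ℝ] ℝ}
    {Γ : E → E →L[ℝ] E →L[ℝ] E} (h : IsLeviCivitaOn s g Γ) (hu : IsOpen u) :
    IsLeviCivitaOn (s ∩ u) g Γ where
  uniq := h.uniq.inter hu
  dense := by
    rintro z ⟨hz, hzu⟩
    rw [interior_inter, hu.interior_eq]
    have := hu.inter_closure (t := interior s) ⟨hzu, h.dense hz⟩
    rwa [inter_comm] at this
  smooth_g := h.smooth_g.mono inter_subset_left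
  smooth_christoffel := h.smooth_christoffel.mono inter_subset_left
  symm := fun z hz => h.symm z hz.1
  pos := fun z hz => h.pos z hz.1
  koszul := fun z hz v w ξ => by
    rw [fderivWithin_inter_open hu _ hz.2]; exact h.koszul z hz.1 v w ξ

lemma fderivWithin_fderivWithin_inter {s u : Set E} (hu : IsOpen u) (f : E → E') {z : E}
    (hz : z ∈ s ∩ u) : fderivWithin ℝ (fderivWithin ℝ f (s ∩ u)) (s ∩ u) z
      = fderivWithin ℝ (fderivWithin ℝ f s) s z := by
  rw [fderivWithin_inter_open hu _ hz.2]
  have h : fderivWithin ℝ (fderivWithin ℝ f (s ∩ u)) (s ∩ u) z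
      = fderivWithin ℝ (fderivWithin ℝ f s) (s ∩ u) z :=
    fderivWithin_congr (fun y hy => fderivWithin_inter_open hu _ hy.2)
      (fderivWithin_inter_open hu _ hz.2)
  rw [fderivWithin_inter_open hu _ hz.2, fderivWithin_inter_open hu _ hz.2] at h
  exact h

lemma localSndDeriv_inter {s u : Set E} (hu : IsOpen u) (F : E → E')
    (Γ' : E' → E' →L[ℝ] E' →L[ℝ] E') {z : E} (hz : z ∈ s ∩ u) :
    localSndDeriv (s ∩ u) F Γ' z = localSndDeriv s F Γ' z := by
  ext v w
  simp only [localSndDeriv, fderivWithin_fderivWithin_inter hu F hz,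
    fderivWithin_inter_open hu F hz.2]

lemma localHess_inter {s u : Set E} (hu : IsOpen u) (f : E → ℝ)
    (Γ : E → E →L[ℝ] E →L[ℝ] E) {z : E} (hz : z ∈ s ∩ u) :
    localHess (s ∩ u) Γ f z = localHess s Γ f z := by
  ext v w
  simp only [localHess, fderivWithin_fderivWithin_inter hu f hz,
    fderivWithin_inter_open hu f hz.2]

lemma localCurv_inter {s u : Set E} (hu : IsOpen u)
    (Γ : E → E →L[ℝ] E →L[ℝ] E) {z : E} (hz : z ∈ s ∩ u) :
    localCurv (s ∩ u) Γ z = localCurv s Γ z := by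
  ext a b c
  simp only [localCurv, fderivWithin_inter_open hu Γ hz.2]

end Restrict

section Frames

variable (n : ℕ) [NeZero n] {X : Type*} [TopologicalSpace X]
  [ChartedSpace (EuclideanHalfSpace n) X]

/-- The derivative at `p` of the inverse of the chart at `x`, in coordinates. -/
def frame (x p : X) : Euc n →L[ℝ] Euc n :=
  mfderivWithin 𝓘(ℝ, Euc n) (𝓡∂ n) (extChartAt (𝓡∂ n) x).symm (range (𝓡∂ n))
    (extChartAt (𝓡∂ n) x p)

/-- The derivative at `p` of the chart at `x`, in coordinates. -/
def coframe (x p : X) : Euc n →L[ℝ] Euc n :=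
  mfderiv (𝓡∂ n) 𝓘(ℝ, Euc n) (extChartAt (𝓡∂ n) x) p

section
variable [IsManifold (𝓡∂ n) ∞ X]

lemma isManifold_one : IsManifold (𝓡∂ n) 1 X := IsManifold.of_le (n := ∞) (by simp)

lemma coframe_comp_frame {x p : X} (hp : p ∈ (extChartAt (𝓡∂ n) x).source) :
    (coframe n x p).comp (frame n x p) = ContinuousLinearMap.id ℝ _ := by
  have := isManifold_one n (X := X)
  exact mfderiv_extChartAt_comp_mfderivWithin_extChartAt_symm' hp

lemma frame_comp_coframe {x p : X} (hp : p ∈ (extChartAt (𝓡∂ n) x).source) :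
    (frame n x p).comp (coframe n x p) = ContinuousLinearMap.id ℝ _ := by
  have := isManifold_one n (X := X)
  exact mfderivWithin_extChartAt_symm_comp_mfderiv_extChartAt' hp

lemma coframe_frame {x p : X} (hp : p ∈ (extChartAt (𝓡∂ n) x).source) (v : Euc n) :
    coframe n x p (frame n x p v) = v :=
  congrArg (fun L : Euc n →L[ℝ] Euc n => L v) (coframe_comp_frame n hp)

lemma frame_coframe {x p : X} (hp : p ∈ (extChartAt (𝓡∂ n) x).source) (v : Euc n) :
    frame n x p (coframe n x p v) = v :=
  congrArg (fun L : Euc n →L[ℝ] Euc n => L v) (frame_comp_coframe n hp)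

lemma frame_self (p : X) : frame n p p = ContinuousLinearMap.id ℝ _ := by
  have := isManifold_one n (X := X)
  exact mfderivWithin_range_extChartAt_symm

lemma coframe_self (p : X) : coframe n p p = ContinuousLinearMap.id ℝ _ := by
  have := isManifold_one n (X := X)
  exact mfderiv_extChartAt_self

end

variable [RiemannianBundle (fun x : X => TangentSpace (𝓡∂ n) x)]

/-- The metric at `p`, as a form on the coordinate space. -/
def metricAt (p : X) (v w : Euc n) : ℝ :=
  inner ℝ (show TangentSpace (𝓡∂ n) p from v) (show TangentSpace (𝓡∂ n) p from w)

lemma chartMetric_symm [IsManifold (𝓡∂ n) ∞ X] (x : X) (z v w : Euc n) :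
    chartMetric n x z v w
      = metricAt n ((extChartAt (𝓡∂ n) x).symm z) (chartFrame n x z v) (chartFrame n x z w) := rfl

variable [IsManifold (𝓡∂ n) ∞ X]

lemma chartMetric_eq {x p : X} (hp : p ∈ (extChartAt (𝓡∂ n) x).source) (v w : Euc n) :
    chartMetric n x (extChartAt (𝓡∂ n) x p) v w
      = metricAt n p (frame n x p v) (frame n x p w) := by
  rw [chartMetric_symm, (extChartAt (𝓡∂ n) x).left_inv hp]
  rfl

lemma chartMetric_self (p : X) (v w : Euc n) :
    chartMetric n p (extChartAt (𝓡∂ n) p p) v w = metricAt n p v w := by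
  rw [chartMetric_eq n (mem_extChartAt_source p), frame_self]
  rfl

end Frames

section Maps

variable (m n : ℕ) [NeZero m] [NeZero n]
  {M : Type*} [TopologicalSpace M] [ChartedSpace (EuclideanHalfSpace m) M]
  [RiemannianBundle (fun p : M => TangentSpace (𝓡∂ m) p)]
  {X : Type*} [TopologicalSpace X] [ChartedSpace (EuclideanHalfSpace n) X]
  [RiemannianBundle (fun x : X => TangentSpace (𝓡∂ n) x)]
  [IsManifold (𝓡∂ m) ∞ M] [IsManifold (𝓡∂ n) ∞ X]
  [IsContMDiffRiemannianBundle (𝓡∂ m) ∞ (EuclideanSpace ℝ (Fin m))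
      (fun p : M => TangentSpace (𝓡∂ m) p)]
  [IsContMDiffRiemannianBundle (𝓡∂ n) ∞ (EuclideanSpace ℝ (Fin n))
      (fun p : X => TangentSpace (𝓡∂ n) p)]

/-- The map `F` in the charts at `x` and `y`. -/
def inCharts (F : M → X) (x : M) (y : X) (z : Euc m) : Euc n :=
  extChartAt (𝓡∂ n) y (F ((extChartAt (𝓡∂ m) x).symm z))

/-- The derivative of `F` at `p`, in coordinates. -/
def dAt (F : M → X) (p : M) : Euc m →L[ℝ] Euc n := mfderiv (𝓡∂ m) (𝓡∂ n) F p

variable {m n}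

variable (m n) in
/-- The domain of a map in two charts. -/
def chartDomain (F : M → X) (x : M) (y : X) : Set (Euc m) :=
  {z ∈ (extChartAt (𝓡∂ m) x).target |
          F ((extChartAt (𝓡∂ m) x).symm z) ∈ (extChartAt (𝓡∂ n) y).source}

lemma exists_open_chartDomain {F : M → X} (hF : Continuous F) (x : M) (y : X) :
    ∃ u : Set (Euc m), IsOpen u ∧ chartDomain m n F x y = (extChartAt (𝓡∂ m) x).target ∩ u := by
  have h1 : ContinuousOn (fun z => F ((extChartAt (𝓡∂ m) x).symm z))
      (extChartAt (𝓡∂ m) x).target := hF.comp_continuousOn (continuousOn_extChartAt_symm x)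
  obtain ⟨u, hu, h⟩ := (continuousOn_iff'.1 h1) _ (isOpen_extChartAt_source (I := 𝓡∂ n) y)
  refine ⟨u, hu, ?_⟩
  rw [inter_comm, ← h, inter_comm]
  rfl

lemma contDiffOn_inCharts {F : M → X} (hF : ContMDiff (𝓡∂ m) (𝓡∂ n) ∞ F) (x : M) (y : X) :
    ContDiffOn ℝ ∞ (inCharts m n F x y) {z ∈ (extChartAt (𝓡∂ m) x).target |
          F ((extChartAt (𝓡∂ m) x).symm z) ∈ (extChartAt (𝓡∂ n) y).source} := by
  rw [← contMDiffOn_iff_contDiffOn]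
  have h1 := contMDiffOn_extChartAt (I := 𝓡∂ n) (n := ∞) (x := y)
  have h2 := contMDiffOn_extChartAt_symm (I := 𝓡∂ m) (n := ∞) x
  refine ContMDiffOn.comp h1 ((hF.comp_contMDiffOn h2).mono fun z hz => hz.1) ?_
  intro z hz
  have := hz.2
  rwa [extChartAt_source] at this

lemma fderivWithin_inCharts {F : M → X} (hF : ContMDiff (𝓡∂ m) (𝓡∂ n) ∞ F) {x p : M} {y : X}
    (hp : p ∈ (extChartAt (𝓡∂ m) x).source) (hy : F p ∈ (extChartAt (𝓡∂ n) y).source) :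
    fderivWithin ℝ (inCharts m n F x y) (extChartAt (𝓡∂ m) x).target (extChartAt (𝓡∂ m) x p)
      = (coframe n y (F p)).comp ((dAt m n F p).comp (frame m x p)) := by
  have i1 := isManifold_one m (X := M)
  have i2 := isManifold_one n (X := X)
  have hz := (extChartAt (𝓡∂ m) x).map_source hp
  rw [← fderivWithin_range_eq m x _ hz, ← mfderivWithin_eq_fderivWithin]
  have h1 : HasMFDerivWithinAt 𝓘(ℝ, Euc m) (𝓡∂ m) (extChartAt (𝓡∂ m) x).symm (range (𝓡∂ m))
    (extChartAt (𝓡∂ m) x p) (frame m x p) :=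
    (mdifferentiableWithinAt_extChartAt_symm hz).hasMFDerivWithinAt
  have hpp : (extChartAt (𝓡∂ m) x).symm (extChartAt (𝓡∂ m) x p) = p :=
    (extChartAt (𝓡∂ m) x).left_inv hp
  have h2 : HasMFDerivAt (𝓡∂ m) (𝓡∂ n) F
      ((extChartAt (𝓡∂ m) x).symm (extChartAt (𝓡∂ m) x p)) (dAt m n F p) := by
    rw [hpp]
    exact (hF.mdifferentiable (by simp) p).hasMFDerivAt
  have h3 : HasMFDerivAt (𝓡∂ n) 𝓘(ℝ, Euc n) (extChartAt (𝓡∂ n) y)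
      (F ((extChartAt (𝓡∂ m) x).symm (extChartAt (𝓡∂ m) x p))) (coframe n y (F p)) := by
    rw [hpp]
    exact (mdifferentiableAt_extChartAt (by rwa [extChartAt_source] at hy)).hasMFDerivAt
  have h4 := HasMFDerivAt.comp_hasMFDerivWithinAt (f := F ∘ (extChartAt (𝓡∂ m) x).symm) _ h3
    (h2.comp_hasMFDerivWithinAt _ h1)
  exact h4.mfderivWithin ((𝓡∂ m).uniqueMDiffOn _
    (extChartAt_target_subset_range x hz))

lemma mem_chartDomain {F : M → X} {x p : M} {y : X} (hp : p ∈ (extChartAt (𝓡∂ m) x).source)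
    (hy : F p ∈ (extChartAt (𝓡∂ n) y).source) : extChartAt (𝓡∂ m) x p ∈ chartDomain m n F x y := by
  refine ⟨(extChartAt (𝓡∂ m) x).map_source hp, ?_⟩
  rwa [(extChartAt (𝓡∂ m) x).left_inv hp]

lemma inCharts_apply {F : M → X} {x p : M} {y : X} (hp : p ∈ (extChartAt (𝓡∂ m) x).source) :
    inCharts m n F x y (extChartAt (𝓡∂ m) x p) = extChartAt (𝓡∂ n) y (F p) := by
  rw [inCharts, (extChartAt (𝓡∂ m) x).left_inv hp]

lemma mapsTo_inCharts (F : M → X) (x : M) (y : X) :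
    MapsTo (inCharts m n F x y) (chartDomain m n F x y) (extChartAt (𝓡∂ n) y).target :=
  fun _ hz => (extChartAt (𝓡∂ n) y).map_source hz.2

variable (m n) in
/-- Isometric maps. -/
def IsIsometric (F : M → X) : Prop := ∀ (p : M) (v w : Euc m),
  metricAt n (F p) (dAt m n F p v) (dAt m n F p w) = metricAt m p v w

lemma isometric_inCharts {F : M → X} (hF : ContMDiff (𝓡∂ m) (𝓡∂ n) ∞ F)
    (hiso : IsIsometric m n F) (x : M) (y : X) (z : Euc m) (hz : z ∈ chartDomain m n F x y)
    (v w : Euc m) :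
    chartMetric n y (inCharts m n F x y z)
      (fderivWithin ℝ (inCharts m n F x y) (chartDomain m n F x y) z v)
      (fderivWithin ℝ (inCharts m n F x y) (chartDomain m n F x y) z w) = chartMetric m x z v w := by
  obtain ⟨u, hu, he⟩ := exists_open_chartDomain (m := m) (n := n) hF.continuous x y
  have hz' := hz
  rw [he] at hz'
  rw [he, fderivWithin_inter_open hu _ hz'.2]
  set p := (extChartAt (𝓡∂ m) x).symm z with hp
  have hps : p ∈ (extChartAt (𝓡∂ m) x).source := (extChartAt (𝓡∂ m) x).map_target hz.1
  have hzp : z = extChartAt (𝓡∂ m) x p := ((extChartAt (𝓡∂ m) x).right_inv hz.1).symm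
  have hy : F p ∈ (extChartAt (𝓡∂ n) y).source := hz.2
  rw [hzp, fderivWithin_inCharts hF hps hy, inCharts_apply hps, chartMetric_eq n hy,
    chartMetric_eq m hps]
  simp only [ContinuousLinearMap.comp_apply, frame_coframe n hy]
  exact hiso p _ _

lemma isLeviCivitaOn_chartDomain {F : M → X} (hF : Continuous F) (x : M) (y : X) :
    IsLeviCivitaOn (chartDomain m n F x y) (chartMetric m x) (chartChristoffel m x) := by
  obtain ⟨u, hu, he⟩ := exists_open_chartDomain (m := m) (n := n) hF x y
  rw [he]
  exact (isLeviCivitaOn_chart m x).inter hu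

end Maps

section Transition

variable (n : ℕ) [NeZero n] {X : Type*} [TopologicalSpace X] [ChartedSpace (EuclideanHalfSpace n) X]
  [RiemannianBundle (fun x : X => TangentSpace (𝓡∂ n) x)]
  [IsManifold (𝓡∂ n) ∞ X]
  [IsContMDiffRiemannianBundle (𝓡∂ n) ∞ (EuclideanSpace ℝ (Fin n))
      (fun p : X => TangentSpace (𝓡∂ n) p)]

lemma dAt_id (p : X) : dAt n n (id : X → X) p = ContinuousLinearMap.id ℝ _ := mfderiv_id

lemma isIsometric_id : IsIsometric n n (id : X → X) := fun p v w => by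
  rw [dAt_id]; rfl

/-- The transition map preserves the Levi-Civita connection. -/
lemma localSndDeriv_transition (x y : X) {z : Euc n} (hz : z ∈ chartDomain n n (id : X → X) x y)
    (v w : Euc n) :
    localSndDeriv (extChartAt (𝓡∂ n) x).target (inCharts n n id x y) (chartChristoffel n y) z v w
      = fderivWithin ℝ (inCharts n n id x y) (extChartAt (𝓡∂ n) x).target z
          (chartChristoffel n x z v w) := by
  have hid : ContMDiff (𝓡∂ n) (𝓡∂ n) ∞ (id : X → X) := contMDiff_id
  obtain ⟨u, hu, he⟩ := exists_open_chartDomain (m := n) (n := n) hid.continuous x y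
  have hz' := hz
  rw [he] at hz'
  have hLC := isLeviCivitaOn_chartDomain (m := n) (n := n) hid.continuous x y
  have hLC' := isLeviCivitaOn_chart n y
  have hiso := isometric_inCharts hid (isIsometric_id n) x y
  have hm := mapsTo_inCharts (m := n) (n := n) id x y
  have hs : ContDiffOn ℝ ∞ (inCharts n n id x y) (chartDomain n n id x y) :=
    contDiffOn_inCharts hid x y
  rw [← localSndDeriv_inter hu _ _ hz', ← fderivWithin_inter_open hu _ hz'.2, ← he]
  apply hLC'.ext_inner (hm hz)
  intro ξ
  have hsurj : ∃ η, fderivWithin ℝ (inCharts n n id x y) (chartDomain n n id x y) z η = ξ := by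
    set p := (extChartAt (𝓡∂ n) x).symm z with hp
    have hps : p ∈ (extChartAt (𝓡∂ n) x).source := (extChartAt (𝓡∂ n) x).map_target hz.1
    have hzp : z = extChartAt (𝓡∂ n) x p := ((extChartAt (𝓡∂ n) x).right_inv hz.1).symm
    have hy : p ∈ (extChartAt (𝓡∂ n) y).source := hz.2
    refine ⟨coframe n x p (frame n y p ξ), ?_⟩
    rw [he, fderivWithin_inter_open hu _ hz'.2, hzp, fderivWithin_inCharts hid hps hy, dAt_id]
    simp only [ContinuousLinearMap.comp_apply, frame_coframe n hps, ContinuousLinearMap.id_apply,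
      id]
    exact coframe_frame n hy ξ
  obtain ⟨η, rfl⟩ := hsurj
  rw [IsLeviCivitaOn.inner_localSndDeriv hLC hLC' hs hm hiso hz, hiso z hz]

lemma fderivWithin_transition {x p : X} (hp : p ∈ (extChartAt (𝓡∂ n) x).source) :
    fderivWithin ℝ (inCharts n n id x p) (extChartAt (𝓡∂ n) x).target (extChartAt (𝓡∂ n) x p)
      = frame n x p := by
  have hid : ContMDiff (𝓡∂ n) (𝓡∂ n) ∞ (id : X → X) := contMDiff_id
  rw [fderivWithin_inCharts hid hp (mem_extChartAt_source p), dAt_id]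
  simp only [id, coframe_self, ContinuousLinearMap.id_comp]

variable {n}

lemma hessian_eq (f : X → ℝ) (p : X) (v w : Euc n) :
    hessian n f p v w = localHess (extChartAt (𝓡∂ n) p).target (chartChristoffel n p)
      (fun y => f ((extChartAt (𝓡∂ n) p).symm y)) (extChartAt (𝓡∂ n) p p) v w := by
  have hz := mem_extChartAt_target (I := 𝓡∂ n) p
  simp only [hessian, localHess]
  rw [fderivWithin_fderivWithin_range_eq n p _ hz, fderivWithin_range_eq n p _ hz]
  congr 2
  exact christoffel_eq n p hz v w

lemma contDiffOn_comp_symm {f : X → ℝ} (hf : ContMDiff (𝓡∂ n) 𝓘(ℝ, ℝ) ∞ f) (x : X) :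
    ContDiffOn ℝ ∞ (fun y => f ((extChartAt (𝓡∂ n) x).symm y)) (extChartAt (𝓡∂ n) x).target := by
  rw [← contMDiffOn_iff_contDiffOn]
  exact hf.comp_contMDiffOn (contMDiffOn_extChartAt_symm x)

/-- The Hessian in an arbitrary chart. -/
lemma hessian_frame {f : X → ℝ} (hf : ContMDiff (𝓡∂ n) 𝓘(ℝ, ℝ) ∞ f) {x p : X}
    (hp : p ∈ (extChartAt (𝓡∂ n) x).source) (v w : Euc n) :
    hessian n f p (frame n x p v) (frame n x p w)
      = localHess (extChartAt (𝓡∂ n) x).target (chartChristoffel n x)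
        (fun y => f ((extChartAt (𝓡∂ n) x).symm y)) (extChartAt (𝓡∂ n) x p) v w := by
  have hid : ContMDiff (𝓡∂ n) (𝓡∂ n) ∞ (id : X → X) := contMDiff_id
  obtain ⟨u, hu, he⟩ := exists_open_chartDomain (m := n) (n := n) hid.continuous x p
  have hz : extChartAt (𝓡∂ n) x p ∈ chartDomain n n id x p :=
    mem_chartDomain (F := (id : X → X)) hp (mem_extChartAt_source p)
  have hz' := hz
  rw [he] at hz'
  have hLC := isLeviCivitaOn_chartDomain (m := n) (n := n) hid.continuous x p
  have hLC' := isLeviCivitaOn_chart n p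
  have hm := mapsTo_inCharts (m := n) (n := n) id x p
  have hs : ContDiffOn ℝ ∞ (inCharts n n id x p) (chartDomain n n id x p) :=
    contDiffOn_inCharts hid x p
  have hd : fderivWithin ℝ (inCharts n n id x p) (chartDomain n n id x p) (extChartAt (𝓡∂ n) x p)
      = frame n x p := by
    rw [he, fderivWithin_inter_open hu _ hz'.2, fderivWithin_transition n hp]
  have key := IsLeviCivitaOn.localHess_comp hLC hLC' hs hm (contDiffOn_comp_symm hf p) hz v w (by
    rw [he, localSndDeriv_inter hu _ _ hz', fderivWithin_inter_open hu _ hz'.2,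
      localSndDeriv_transition n x p hz])
  rw [hessian_eq, ← localHess_inter hu _ _ hz', ← he]
  rw [hd, inCharts_apply hp] at key
  simp only [id] at key
  rw [← key]
  have hcongr : ∀ y ∈ chartDomain n n (id : X → X) x p, f ((extChartAt (𝓡∂ n) x).symm y)
      = f ((extChartAt (𝓡∂ n) p).symm (inCharts n n id x p y)) := by
    intro y hy
    rw [inCharts, (extChartAt (𝓡∂ n) p).left_inv hy.2]
    rfl
  have h1 : ∀ y ∈ chartDomain n n (id : X → X) x p,
      fderivWithin ℝ (fun y => f ((extChartAt (𝓡∂ n) x).symm y)) (chartDomain n n id x p) y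
      = fderivWithin ℝ (fun y => f ((extChartAt (𝓡∂ n) p).symm (inCharts n n id x p y)))
        (chartDomain n n id x p) y := fun y hy => fderivWithin_congr hcongr (hcongr y hy)
  simp only [localHess]
  rw [h1 _ hz, fderivWithin_congr h1 (h1 _ hz)]

lemma riem_eq (p : X) (a b c d : Euc n) :
    riem n p a b c d = metricAt n p (localCurv (extChartAt (𝓡∂ n) p).target (chartChristoffel n p)
      (extChartAt (𝓡∂ n) p p) a b c) d := by
  have hz := mem_extChartAt_target (I := 𝓡∂ n) p
  have hd := diffWithinAt_of_smooth (isLeviCivitaOn_chart n p).smooth_christoffel hz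
  have hu := uniqueDiffOn_extChartAt_target (I := 𝓡∂ n) p _ hz
  have e : ∀ a b c : Euc n, fderivWithin ℝ (fun y => christoffel n p y b c) (range (𝓡∂ n))
      (extChartAt (𝓡∂ n) p p) a = fderivWithin ℝ (chartChristoffel n p)
        (extChartAt (𝓡∂ n) p).target (extChartAt (𝓡∂ n) p p) a b c := by
    intro a b c
    rw [fderivWithin_range_eq n p _ hz, ← fderivWithin_eval₂ hu hd,
      fderivWithin_congr (fun y hy => christoffel_eq n p hy b c) (christoffel_eq n p hz b c)]
  have : (curvature n p a b c : Euc n) = localCurv (extChartAt (𝓡∂ n) p).target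
      (chartChristoffel n p) (extChartAt (𝓡∂ n) p p) a b c := by
    simp only [curvature, localCurv]
    rw [e, e, christoffel_eq n p hz, christoffel_eq n p hz, christoffel_eq n p hz,
      christoffel_eq n p hz]
  rw [← this]
  rfl

/-- The Riemann tensor in an arbitrary chart. -/
lemma riem_frame {x p : X} (hp : p ∈ (extChartAt (𝓡∂ n) x).source) (a b c d : Euc n) :
    riem n p (frame n x p a) (frame n x p b) (frame n x p c) (frame n x p d)
      = chartMetric n x (extChartAt (𝓡∂ n) x p) (localCurv (extChartAt (𝓡∂ n) x).target
        (chartChristoffel n x) (extChartAt (𝓡∂ n) x p) a b c) d := by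
  have hid : ContMDiff (𝓡∂ n) (𝓡∂ n) ∞ (id : X → X) := contMDiff_id
  obtain ⟨u, hu, he⟩ := exists_open_chartDomain (m := n) (n := n) hid.continuous x p
  have hz : extChartAt (𝓡∂ n) x p ∈ chartDomain n n id x p :=
    mem_chartDomain (F := (id : X → X)) hp (mem_extChartAt_source p)
  have hz' := hz
  rw [he] at hz'
  have hLC := isLeviCivitaOn_chartDomain (m := n) (n := n) hid.continuous x p
  have hLC' := isLeviCivitaOn_chart n p
  have hm := mapsTo_inCharts (m := n) (n := n) id x p
  have hiso := isometric_inCharts hid (isIsometric_id n) x p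
  have hs : ContDiffOn ℝ ∞ (inCharts n n id x p) (chartDomain n n id x p) :=
    contDiffOn_inCharts hid x p
  have hd : fderivWithin ℝ (inCharts n n id x p) (chartDomain n n id x p) (extChartAt (𝓡∂ n) x p)
      = frame n x p := by
    rw [he, fderivWithin_inter_open hu _ hz'.2, fderivWithin_transition n hp]
  have key := IsLeviCivitaOn.gauss hLC hLC' hs hm hiso hz (B := fun _ _ => 0) (by
    intro v w
    rw [he, localSndDeriv_inter hu _ _ hz', fderivWithin_inter_open hu _ hz'.2,
      localSndDeriv_transition n x p hz, sub_self]) a b c d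
  rw [hd, inCharts_apply hp] at key
  simp only [id, map_zero, sub_zero, add_zero] at key
  rw [riem_eq, ← chartMetric_self, key, he, localCurv_inter hu _ hz']

end Transition

section Traces

variable {E : Type*} [NormedAddCommGroup E] [NormedSpace ℝ E]

lemma isOrthoBasis_of_card {ι : Type*} [Fintype ι] [DecidableEq ι] [FiniteDimensional ℝ E]
    {B : E →L[ℝ] E →L[ℝ] ℝ} {e : ι → E} (h : ∀ i j, B (e i) (e j) = if i = j then 1 else 0)
    (hc : Fintype.card ι = Module.finrank ℝ E) : IsOrthoBasis B e where
  orth := h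
  span := by
    have hli : LinearIndependent ℝ e := by
      rw [Fintype.linearIndependent_iff]
      intro c hc i
      have := congrArg (fun v => B v (e i)) hc
      simpa [map_sum, h] using this
    have hsp : ⊤ ≤ Submodule.span ℝ (range e) :=
      (hli.span_eq_top_of_card_eq_finrank' hc).ge
    intro v
    obtain ⟨c, hc⟩ := (Submodule.mem_span_range_iff_exists_fun ℝ).1 (hsp (Submodule.mem_top (x := v)))
    rw [← hc]
    refine Finset.sum_congr rfl fun i _ => ?_
    simp [map_sum, h]

lemma IsOrthoBasis.sum_bilin_eq {ι κ : Type*} [Fintype ι] [DecidableEq ι] [Fintype κ]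
    [DecidableEq κ] {B : E →L[ℝ] E →L[ℝ] ℝ} {e : ι → E} {f : κ → E} (he : IsOrthoBasis B e)
    (hf : IsOrthoBasis B f) (b : E →ₗ[ℝ] E →ₗ[ℝ] ℝ) :
    ∑ i, b (e i) (e i) = ∑ k, b (f k) (f k) := by
  let L : E →ₗ[ℝ] E := ∑ j, (b.flip (e j)).smulRight (e j)
  have hL : ∀ v, L v = ∑ j, b v (e j) • e j := fun v => by simp [L]
  have h1 := he.trace_eq L
  have h2 := hf.trace_eq L
  have e1 : ∀ i, B (L (e i)) (e i) = b (e i) (e i) := by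
    intro i; simp [hL, he.orth]
  have e2 : ∀ k, B (L (f k)) (f k) = b (f k) (f k) := by
    intro k
    have hsym : ∀ v w, B v w = B w v := fun v w => by
      have h3 := he.inner_eq v w
      have h4 := he.inner_eq w v
      have h5 : ∀ v i, B (e i) v = B v (e i) := by
        intro v i
        conv_lhs => rw [he.span v]
        simp [he.orth]
      rw [h3, h4]
      refine Finset.sum_congr rfl fun i _ => ?_
      rw [h5, h5, mul_comm]
    conv_rhs => rw [he.span (f k)]
    rw [hL]
    conv_rhs => rw [← he.span (f k)]
    have h6 : b (f k) (f k) = ∑ j, B (f k) (e j) * b (f k) (e j) := by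
      conv_lhs => arg 2; rw [he.span (f k)]
      simp
    rw [h6]
    simp only [map_sum, map_smul, sum_apply, smul_apply, smul_eq_mul]
    refine Finset.sum_congr rfl fun i _ => ?_
    rw [hsym (e i), mul_comm]
  rw [h1] at h2
  simpa only [e1, e2] using h2

lemma IsOrthoBasis.sum_sq_eq {ι κ : Type*} [Fintype ι] [DecidableEq ι] [Fintype κ]
    [DecidableEq κ] {B : E →L[ℝ] E →L[ℝ] ℝ} {e : ι → E} {f : κ → E} (he : IsOrthoBasis B e)
    (hf : IsOrthoBasis B f) (b : E →ₗ[ℝ] E →ₗ[ℝ] ℝ) :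
    ∑ i, ∑ j, b (e i) (e j) ^ 2 = ∑ i, ∑ j, b (f i) (f j) ^ 2 := by
  have h1 : ∀ v, ∑ j, b v (e j) ^ 2 = ∑ j, b v (f j) ^ 2 := by
    intro v
    have := he.sum_bilin_eq hf ((LinearMap.lsmul ℝ ℝ).compl₁₂ (b v) (b v))
    simpa [sq] using this
  simp only [h1]
  have h2 : ∀ j, ∑ i, b (e i) (f j) ^ 2 = ∑ i, b (f i) (f j) ^ 2 := by
    intro j
    have := he.sum_bilin_eq hf ((LinearMap.lsmul ℝ ℝ).compl₁₂ (b.flip (f j)) (b.flip (f j)))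
    simpa [sq] using this
  rw [Finset.sum_comm, Finset.sum_congr rfl fun j _ => h2 j, Finset.sum_comm]

end Traces

section Compose

variable {E E' E'' : Type*} [NormedAddCommGroup E] [NormedSpace ℝ E]
  [NormedAddCommGroup E'] [NormedSpace ℝ E'] [NormedAddCommGroup E''] [NormedSpace ℝ E'']

lemma localSndDeriv_comp {s : Set E} {s' : Set E'} (hs : UniqueDiffOn ℝ s)
    (hs' : UniqueDiffOn ℝ s') {F : E → E'} {G : E' → E''} (hF : ContDiffOn ℝ ∞ F s)
    (hG : ContDiffOn ℝ ∞ G s') (hm : MapsTo F s s') (Γ' : E' → E' →L[ℝ] E' →L[ℝ] E')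
    (Γ'' : E'' → E'' →L[ℝ] E'' →L[ℝ] E'') {z : E} (hz : z ∈ s) (v w : E) :
    localSndDeriv s (fun y => G (F y)) Γ'' z v w
      = fderivWithin ℝ G s' (F z) (localSndDeriv s F Γ' z v w)
        + (localSndDeriv s' G Γ'' (F z) (fderivWithin ℝ F s z v) (fderivWithin ℝ F s z w)
          - fderivWithin ℝ G s' (F z) (Γ' (F z) (fderivWithin ℝ F s z v)
              (fderivWithin ℝ F s z w))) := by
  have hF1 := smooth_fderivWithin hF hs
  have hG1 := smooth_fderivWithin hG hs'
  have hcomp : ∀ y ∈ s, ∀ w, fderivWithin ℝ (fun y => G (F y)) s y w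
      = fderivWithin ℝ G s' (F y) (fderivWithin ℝ F s y w) := by
    intro y hy w
    have := fderivWithin_comp y (diffWithinAt_of_smooth hG (hm hy))
      (diffWithinAt_of_smooth hF hy) hm (hs y hy)
    rw [Function.comp_def] at this
    rw [this]; rfl
  have hGF : ContDiffOn ℝ ∞ (fun y => G (F y)) s := hG.comp hF hm
  have d1 : DifferentiableWithinAt ℝ (fun y => fderivWithin ℝ G s' (F y)) s z :=
    diffWithinAt_of_smooth (hG1.comp hF hm) hz
  have dF1 := diffWithinAt_of_smooth hF1 hz
  have e1 : fderivWithin ℝ (fun y => fderivWithin ℝ G s' (F y)) s z v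
      = fderivWithin ℝ (fderivWithin ℝ G s') s' (F z) (fderivWithin ℝ F s z v) := by
    have := fderivWithin_comp z (diffWithinAt_of_smooth hG1 (hm hz))
      (diffWithinAt_of_smooth hF hz) hm (hs z hz)
    rw [Function.comp_def] at this
    rw [this]; rfl
  rw [localSndDeriv, ← fderivWithin_eval (hs z hz)
      (diffWithinAt_of_smooth (smooth_fderivWithin hGF hs) hz),
    fderivWithin_congr (fun y hy => hcomp y hy w) (hcomp z hz w),
    fderivWithin_lin (hs z hz) d1 (dF1.clm_apply (differentiableWithinAt_const w)), e1,
    fderivWithin_eval (hs z hz) dF1, hcomp z hz, hcomp z hz, localSndDeriv, localSndDeriv]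
  simp only [map_add]
  abel

lemma localSndDeriv_congr {s : Set E} {F G : E → E'} (h : ∀ y ∈ s, F y = G y)
    (Γ' : E' → E' →L[ℝ] E' →L[ℝ] E') {z : E} (hz : z ∈ s) (v w : E) :
    localSndDeriv s F Γ' z v w = localSndDeriv s G Γ' z v w := by
  have h1 : ∀ y ∈ s, fderivWithin ℝ F s y = fderivWithin ℝ G s y :=
    fun y hy => fderivWithin_congr h (h y hy)
  simp only [localSndDeriv]
  rw [fderivWithin_congr h1 (h1 z hz), h1 z hz, h z hz]

end Compose

section Second

variable (m n : ℕ) [NeZero m] [NeZero n]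
  {M : Type*} [TopologicalSpace M] [ChartedSpace (EuclideanHalfSpace m) M]
  [RiemannianBundle (fun p : M => TangentSpace (𝓡∂ m) p)]
  {X : Type*} [TopologicalSpace X] [ChartedSpace (EuclideanHalfSpace n) X]
  [RiemannianBundle (fun x : X => TangentSpace (𝓡∂ n) x)]
  [IsManifold (𝓡∂ m) ∞ M] [IsManifold (𝓡∂ n) ∞ X]
  [IsContMDiffRiemannianBundle (𝓡∂ m) ∞ (EuclideanSpace ℝ (Fin m))
      (fun p : M => TangentSpace (𝓡∂ m) p)]
  [IsContMDiffRiemannianBundle (𝓡∂ n) ∞ (EuclideanSpace ℝ (Fin n))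
      (fun p : X => TangentSpace (𝓡∂ n) p)]

variable {m n}

lemma ambientSecondDeriv_eq {F : M → X} (hF : ContMDiff (𝓡∂ m) (𝓡∂ n) ∞ F) (p : M)
    (v w : Euc m) :
    ambientSecondDeriv m n F p v w = localSndDeriv (extChartAt (𝓡∂ m) p).target
      (inCharts m n F p (F p)) (chartChristoffel n (F p)) (extChartAt (𝓡∂ m) p p) v w := by
  have hz := mem_extChartAt_target (I := 𝓡∂ m) p
  have hz' := mem_extChartAt_target (I := 𝓡∂ n) (F p)
  have hd := fderivWithin_inCharts hF (mem_extChartAt_source (I := 𝓡∂ m) p)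
    (mem_extChartAt_source (I := 𝓡∂ n) (F p))
  rw [coframe_self, frame_self, ContinuousLinearMap.id_comp, ContinuousLinearMap.comp_id] at hd
  have ha : inCharts m n F p (F p) (extChartAt (𝓡∂ m) p p) = extChartAt (𝓡∂ n) (F p) (F p) :=
    inCharts_apply (mem_extChartAt_source p)
  rw [localSndDeriv, hd, ha, ← fderivWithin_fderivWithin_range_eq m p _ hz,
    ← christoffel_eq n (F p) hz']
  rfl

/-- The domain used to compare the second derivative of a map in two pairs of charts. -/
def compareDomain (m n : ℕ) [NeZero m] [NeZero n] [ChartedSpace (EuclideanHalfSpace m) M]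
    [ChartedSpace (EuclideanHalfSpace n) X] (F : M → X) (x p : M) (y : X) : Set (Euc m) :=
  {z ∈ (extChartAt (𝓡∂ m) x).target | (extChartAt (𝓡∂ m) x).symm z ∈
    (extChartAt (𝓡∂ m) p).source ∩ F ⁻¹' (extChartAt (𝓡∂ n) y).source
      ∩ F ⁻¹' (extChartAt (𝓡∂ n) (F p)).source}

lemma exists_open_compareDomain {F : M → X} (hF : Continuous F) (x p : M) (y : X) :
    ∃ u : Set (Euc m), IsOpen u ∧ compareDomain m n F x p y
      = (extChartAt (𝓡∂ m) x).target ∩ u := by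
  have ho : IsOpen ((extChartAt (𝓡∂ m) p).source ∩ F ⁻¹' (extChartAt (𝓡∂ n) y).source
      ∩ F ⁻¹' (extChartAt (𝓡∂ n) (F p)).source) :=
    ((isOpen_extChartAt_source p).inter ((isOpen_extChartAt_source y).preimage hF)).inter
      ((isOpen_extChartAt_source (F p)).preimage hF)
  obtain ⟨u, hu, h⟩ := (continuousOn_iff'.1 (continuousOn_extChartAt_symm (I := 𝓡∂ m) x)) _ ho
  refine ⟨u, hu, ?_⟩
  rw [inter_comm, ← h, inter_comm]
  rfl

/-- The second derivative of a map, corrected by the Christoffel symbols of the source, is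
tensorial. -/
lemma localSndDeriv_tensorial {F : M → X} (hF : ContMDiff (𝓡∂ m) (𝓡∂ n) ∞ F) {x p : M} {y : X}
    (hp : p ∈ (extChartAt (𝓡∂ m) x).source) (hy : F p ∈ (extChartAt (𝓡∂ n) y).source)
    (v w : Euc m) :
    frame n y (F p) (localSndDeriv (extChartAt (𝓡∂ m) x).target (inCharts m n F x y)
        (chartChristoffel n y) (extChartAt (𝓡∂ m) x p) v w
      - fderivWithin ℝ (inCharts m n F x y) (extChartAt (𝓡∂ m) x).target (extChartAt (𝓡∂ m) x p)
        (chartChristoffel m x (extChartAt (𝓡∂ m) x p) v w))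
    = localSndDeriv (extChartAt (𝓡∂ m) p).target (inCharts m n F p (F p))
        (chartChristoffel n (F p)) (extChartAt (𝓡∂ m) p p) (frame m x p v) (frame m x p w)
      - dAt m n F p (chartChristoffel m p (extChartAt (𝓡∂ m) p p) (frame m x p v)
          (frame m x p w)) := by
  have hidM : ContMDiff (𝓡∂ m) (𝓡∂ m) ∞ (id : M → M) := contMDiff_id
  have hidX : ContMDiff (𝓡∂ n) (𝓡∂ n) ∞ (id : X → X) := contMDiff_id
  have hps := mem_extChartAt_source (I := 𝓡∂ m) p
  have hqs := mem_extChartAt_source (I := 𝓡∂ n) (F p)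
  obtain ⟨u, hu, he⟩ := exists_open_compareDomain (m := m) (n := n) hF.continuous x p y
  set z := extChartAt (𝓡∂ m) x p with hzdef
  have hzt : z ∈ (extChartAt (𝓡∂ m) x).target := (extChartAt (𝓡∂ m) x).map_source hp
  have hz : z ∈ compareDomain m n F x p y := by
    refine ⟨hzt, ?_⟩
    rw [hzdef, (extChartAt (𝓡∂ m) x).left_inv hp]
    exact ⟨⟨hps, hy⟩, hqs⟩
  have hz' := hz
  rw [he] at hz'
  have hsu : UniqueDiffOn ℝ (compareDomain m n F x p y) := by
    rw [he]; exact (uniqueDiffOn_extChartAt_target x).inter hu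
  -- first factorization, through the chart at `p`
  obtain ⟨u₁, hu₁, he₁⟩ := exists_open_chartDomain (m := m) (n := n) hF.continuous p (F p)
  have hzp : extChartAt (𝓡∂ m) p p ∈ chartDomain m n F p (F p) := mem_chartDomain hps hqs
  have hzp' := hzp
  rw [he₁] at hzp'
  have hτ : ContDiffOn ℝ ∞ (inCharts m m id x p) (compareDomain m n F x p y) :=
    (contDiffOn_inCharts hidM x p).mono fun z hz => ⟨hz.1, hz.2.1.1⟩
  have hτm : MapsTo (inCharts m m id x p) (compareDomain m n F x p y)
      (chartDomain m n F p (F p)) := by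
    intro z hz
    refine ⟨(extChartAt (𝓡∂ m) p).map_source hz.2.1.1, ?_⟩
    rw [inCharts, id, (extChartAt (𝓡∂ m) p).left_inv hz.2.1.1]
    exact hz.2.2
  have hτz : inCharts m m id x p z = extChartAt (𝓡∂ m) p p := inCharts_apply (F := id) hp
  have hdτ : fderivWithin ℝ (inCharts m m id x p) (extChartAt (𝓡∂ m) x).target z = frame m x p :=
    fderivWithin_transition m hp
  have hdF : fderivWithin ℝ (inCharts m n F p (F p)) (extChartAt (𝓡∂ m) p).target
      (extChartAt (𝓡∂ m) p p) = dAt m n F p := by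
    rw [fderivWithin_inCharts hF hps hqs, coframe_self, frame_self, ContinuousLinearMap.id_comp,
      ContinuousLinearMap.comp_id]
  have key1 := localSndDeriv_comp hsu
    (isLeviCivitaOn_chartDomain (m := m) (n := n) hF.continuous p (F p)).uniq hτ
    (contDiffOn_inCharts hF p (F p)) hτm (chartChristoffel m p) (chartChristoffel n (F p)) hz v w
  have hzτ : z ∈ chartDomain m m (id : M → M) x p := ⟨hz.1, hz.2.1.1⟩
  rw [hτz, he₁, fderivWithin_inter_open hu₁ _ hzp'.2, localSndDeriv_inter hu₁ _ _ hzp', he,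
    fderivWithin_inter_open hu _ hz'.2, localSndDeriv_inter hu _ _ hz',
    localSndDeriv_inter hu _ _ hz', hdτ, hdF, localSndDeriv_transition m x p hzτ, hdτ] at key1
  -- second factorization, through the chart at `y`
  have hqy : extChartAt (𝓡∂ n) y (F p) ∈ chartDomain n n (id : X → X) y (F p) :=
    mem_chartDomain (F := (id : X → X)) hy hqs
  obtain ⟨u₂, hu₂, he₂⟩ :=
    exists_open_chartDomain (m := n) (n := n) (X := X) hidX.continuous y (F p)
  have hqy' := hqy
  rw [he₂] at hqy'
  have hFs : ContDiffOn ℝ ∞ (inCharts m n F x y) (compareDomain m n F x p y) :=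
    (contDiffOn_inCharts hF x y).mono fun z hz => ⟨hz.1, hz.2.1.2⟩
  have hFm : MapsTo (inCharts m n F x y) (compareDomain m n F x p y)
      (chartDomain n n (id : X → X) y (F p)) := by
    intro z hz
    refine ⟨(extChartAt (𝓡∂ n) y).map_source hz.2.1.2, ?_⟩
    rw [inCharts, id, (extChartAt (𝓡∂ n) y).left_inv hz.2.1.2]
    exact hz.2.2
  have hFz : inCharts m n F x y z = extChartAt (𝓡∂ n) y (F p) := inCharts_apply hp
  have hdσ : fderivWithin ℝ (inCharts n n id y (F p)) (extChartAt (𝓡∂ n) y).target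
      (extChartAt (𝓡∂ n) y (F p)) = frame n y (F p) := fderivWithin_transition n hy
  have key2 := localSndDeriv_comp hsu
    (isLeviCivitaOn_chartDomain (m := n) (n := n) (X := X) hidX.continuous y (F p)).uniq hFs
    (contDiffOn_inCharts hidX y (F p)) hFm (chartChristoffel n y) (chartChristoffel n (F p)) hz v w
  rw [hFz, he₂, fderivWithin_inter_open hu₂ _ hqy'.2, localSndDeriv_inter hu₂ _ _ hqy', he,
    fderivWithin_inter_open hu _ hz'.2, localSndDeriv_inter hu _ _ hz',
    localSndDeriv_inter hu _ _ hz', hdσ, localSndDeriv_transition n y (F p) hqy, hdσ, sub_self,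
    add_zero] at key2
  have hcongr : ∀ z ∈ compareDomain m n F x p y,
      inCharts m n F p (F p) (inCharts m m id x p z)
        = inCharts n n id y (F p) (inCharts m n F x y z) := by
    intro z hz
    simp only [inCharts, id]
    rw [(extChartAt (𝓡∂ m) p).left_inv hz.2.1.1, (extChartAt (𝓡∂ n) y).left_inv hz.2.1.2]
  have key3 := localSndDeriv_congr hcongr (chartChristoffel n (F p)) hz v w
  rw [he, localSndDeriv_inter hu _ _ hz', localSndDeriv_inter hu _ _ hz'] at key3
  rw [map_sub, ← key2, ← key3, key1, fderivWithin_inCharts hF hp hy]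
  simp only [ContinuousLinearMap.comp_apply, frame_coframe n hy]
  abel

end Second

section Boundary

variable {n : ℕ} [NeZero n] {X : Type*} [TopologicalSpace X]
  [ChartedSpace (EuclideanHalfSpace n) X]

lemma target_nonneg (x : X) {z : Euc n} (hz : z ∈ (extChartAt (𝓡∂ n) x).target) : 0 ≤ z 0 := by
  have := extChartAt_target_subset_range x hz
  rwa [range_modelWithCornersEuclideanHalfSpace] at this

variable (n) in
/-- Chart domains are relatively open in the half-space. -/
lemma exists_open_target (x : X) : ∃ O : Set (Euc n), IsOpen O ∧
    (extChartAt (𝓡∂ n) x).target = O ∩ {z | 0 ≤ z 0} := by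
  refine ⟨(𝓡∂ n).symm ⁻¹' (chartAt (EuclideanHalfSpace n) x).target,
    (chartAt (EuclideanHalfSpace n) x).open_target.preimage (𝓡∂ n).continuous_symm, ?_⟩
  rw [extChartAt_target, range_modelWithCornersEuclideanHalfSpace]

lemma eventually_mem_target (x : X) {z w : Euc n} (hz : z ∈ (extChartAt (𝓡∂ n) x).target)
    (hz0 : z 0 = 0) (hw : w 0 = 0) :
    ∀ᶠ t : ℝ in 𝓝 0, z + t • w ∈ (extChartAt (𝓡∂ n) x).target := by
  obtain ⟨O, hO, he⟩ := exists_open_target n x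
  have hc : Continuous fun t : ℝ => z + t • w := by fun_prop
  have hzO : z + (0 : ℝ) • w ∈ O := by rw [he] at hz; simpa using hz.1
  filter_upwards [hc.continuousAt.preimage_mem_nhds (hO.mem_nhds hzO)] with t ht
  rw [he]
  refine ⟨ht, ?_⟩
  simp [hz0, hw]

/-- A function which vanishes on the boundary of a chart domain has vanishing tangential
derivatives there. -/
lemma fderivWithin_eq_zero_of_boundary {F : Type*} [NormedAddCommGroup F] [NormedSpace ℝ F] (x : X)
    {u : Set (Euc n)} (hu : IsOpen u) {k : Euc n → F} {z w : Euc n}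
    (hz : z ∈ (extChartAt (𝓡∂ n) x).target ∩ u)
    (hz0 : z 0 = 0) (hw : w 0 = 0)
    (hk : DifferentiableWithinAt ℝ k ((extChartAt (𝓡∂ n) x).target ∩ u) z)
    (h0 : ∀ y ∈ (extChartAt (𝓡∂ n) x).target ∩ u, y 0 = 0 → k y = 0) :
    fderivWithin ℝ k ((extChartAt (𝓡∂ n) x).target ∩ u) z w = 0 := by
  set s := (extChartAt (𝓡∂ n) x).target ∩ u
  have hc : HasDerivAt (fun t : ℝ => z + t • w) w 0 := by
    simpa using ((hasDerivAt_id (0 : ℝ)).smul_const w).const_add z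
  have hcont : Continuous fun t : ℝ => z + t • w := by fun_prop
  have hmem : ∀ᶠ t : ℝ in 𝓝 0, z + t • w ∈ s := by
    filter_upwards [eventually_mem_target x hz.1 hz0 hw,
      hcont.continuousAt.preimage_mem_nhds (hu.mem_nhds (by simpa using hz.2))] with t h1 h2
    exact ⟨h1, h2⟩
  have hk' : HasFDerivWithinAt k (fderivWithin ℝ k s z) s (z + (0 : ℝ) • w) := by
    simpa using hk.hasFDerivWithinAt
  have h1 : HasDerivWithinAt (fun t : ℝ => k (z + t • w)) (fderivWithin ℝ k s z w)
      {t | z + t • w ∈ s} 0 :=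
    hk'.comp_hasDerivWithinAt (0 : ℝ) hc.hasDerivWithinAt (fun t ht => ht)
  have h2 := h1.hasDerivAt hmem
  have h3 : (fun t : ℝ => k (z + t • w)) =ᶠ[𝓝 0] fun _ => 0 := by
    filter_upwards [hmem] with t ht
    exact h0 _ ht (by simp [hz0, hw])
  exact h2.unique ((hasDerivAt_const (0 : ℝ) (0 : F)).congr_of_eventuallyEq h3)

variable [IsManifold (𝓡∂ n) ∞ X]

lemma mem_boundary_iff {x p : X} (hp : p ∈ (extChartAt (𝓡∂ n) x).source) :
    p ∈ (𝓡∂ n).boundary X ↔ extChartAt (𝓡∂ n) x p 0 = 0 := by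
  have hz := (extChartAt (𝓡∂ n) x).map_source hp
  have h1 : p ∈ (𝓡∂ n).boundary X ↔ ¬ (𝓡∂ n).IsInteriorPoint p := by
    rw [ModelWithCorners.isInteriorPoint_iff_not_isBoundaryPoint, not_not]; rfl
  have hs : p ∈ (chartAt (EuclideanHalfSpace n) x).source := by rwa [extChartAt_source] at hp
  have h2 := ModelWithCorners.isInteriorPoint_iff_of_mem_atlas (I := 𝓡∂ n) (n := ∞) (by simp)
    (chart_mem_atlas (EuclideanHalfSpace n) x) hs
  change _ ↔ extChartAt (𝓡∂ n) x p ∈ interior (extChartAt (𝓡∂ n) x).target at h2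
  have h3 : extChartAt (𝓡∂ n) x p ∈ interior (extChartAt (𝓡∂ n) x).target
      ↔ 0 < extChartAt (𝓡∂ n) x p 0 := by
    constructor
    · intro h
      have := interior_mono (extChartAt_target_subset_range x) h
      rwa [interior_range_modelWithCornersEuclideanHalfSpace] at this
    · intro h
      obtain ⟨O, hO, he⟩ := exists_open_target n x
      rw [he] at hz ⊢
      rw [interior_inter, hO.interior_eq]
      refine ⟨hz.1, ?_⟩
      rw [← range_modelWithCornersEuclideanHalfSpace,
        interior_range_modelWithCornersEuclideanHalfSpace]
      exact h
  rw [h1, h2, h3, not_lt]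
  exact ⟨fun h => le_antisymm h (target_nonneg x hz), fun h => h.le⟩

end Boundary

section Maps

variable {m n : ℕ} [NeZero m] [NeZero n]
  {M : Type*} [TopologicalSpace M] [ChartedSpace (EuclideanHalfSpace m) M]
  [RiemannianBundle (fun p : M => TangentSpace (𝓡∂ m) p)]
  {X : Type*} [TopologicalSpace X] [ChartedSpace (EuclideanHalfSpace n) X]
  [RiemannianBundle (fun x : X => TangentSpace (𝓡∂ n) x)]
  [IsManifold (𝓡∂ m) ∞ M] [IsManifold (𝓡∂ n) ∞ X]
  [IsContMDiffRiemannianBundle (𝓡∂ m) ∞ (EuclideanSpace ℝ (Fin m))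
      (fun p : M => TangentSpace (𝓡∂ m) p)]
  [IsContMDiffRiemannianBundle (𝓡∂ n) ∞ (EuclideanSpace ℝ (Fin n))
      (fun p : X => TangentSpace (𝓡∂ n) p)]

/-- Tangential first derivatives of the normal coordinate of a map of pairs vanish. -/
lemma fderivWithin_inCharts_zero {F : M → X} (hF : ContMDiff (𝓡∂ m) (𝓡∂ n) ∞ F)
    (hb : ∀ p ∈ (𝓡∂ m).boundary M, F p ∈ (𝓡∂ n).boundary X) {x : M} {y : X} {z w : Euc m}
    (hz : z ∈ chartDomain m n F x y) (hz0 : z 0 = 0) (hw : w 0 = 0) :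
    fderivWithin ℝ (inCharts m n F x y) (extChartAt (𝓡∂ m) x).target z w 0 = 0 := by
  obtain ⟨u, hu, he⟩ := exists_open_chartDomain (m := m) (n := n) hF.continuous x y
  have hs := contDiffOn_inCharts hF x y
  change ContDiffOn ℝ ∞ (inCharts m n F x y) (chartDomain m n F x y) at hs
  have hz' := hz
  rw [he] at hz'
  have hd := diffWithinAt_of_smooth hs hz
  rw [he] at hd
  rw [← fderivWithin_inter_open hu _ hz'.2]
  let P : Euc n →L[ℝ] ℝ := EuclideanSpace.proj 0
  have h1 : fderivWithin ℝ (fun y' => P (inCharts m n F x y y'))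
      ((extChartAt (𝓡∂ m) x).target ∩ u) z w = 0 := by
    refine fderivWithin_eq_zero_of_boundary x hu hz' hz0 hw (P.differentiableAt.comp_differentiableWithinAt z hd) ?_
    intro y' hy' h0
    rw [← he] at hy'
    have hps := (extChartAt (𝓡∂ m) x).map_target hy'.1
    have hpb : (extChartAt (𝓡∂ m) x).symm y' ∈ (𝓡∂ m).boundary M := by
      rw [mem_boundary_iff hps, (extChartAt (𝓡∂ m) x).right_inv hy'.1, h0]
    exact (mem_boundary_iff hy'.2).1 (hb _ hpb)
  have hu' : UniqueDiffWithinAt ℝ ((extChartAt (𝓡∂ m) x).target ∩ u) z :=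
    ((uniqueDiffOn_extChartAt_target x).inter hu) z hz'
  rw [fderivWithin_lin hu' (differentiableWithinAt_const P) hd] at h1
  simpa [P] using h1

/-- Tangential second derivatives of the normal coordinate of a map of pairs vanish. -/
lemma fderivWithin_fderivWithin_inCharts_zero {F : M → X} (hF : ContMDiff (𝓡∂ m) (𝓡∂ n) ∞ F)
    (hb : ∀ p ∈ (𝓡∂ m).boundary M, F p ∈ (𝓡∂ n).boundary X) {x : M} {y : X} {z v w : Euc m}
    (hz : z ∈ chartDomain m n F x y) (hz0 : z 0 = 0) (hv : v 0 = 0) (hw : w 0 = 0) :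
    fderivWithin ℝ (fderivWithin ℝ (inCharts m n F x y) (extChartAt (𝓡∂ m) x).target)
      (extChartAt (𝓡∂ m) x).target z v w 0 = 0 := by
  obtain ⟨u, hu, he⟩ := exists_open_chartDomain (m := m) (n := n) hF.continuous x y
  have hs := contDiffOn_inCharts hF x y
  change ContDiffOn ℝ ∞ (inCharts m n F x y) (chartDomain m n F x y) at hs
  have hz' := hz
  rw [he] at hz' hs
  have hu' := (uniqueDiffOn_extChartAt_target (I := 𝓡∂ m) x).inter hu
  have hd := diffWithinAt_of_smooth (smooth_fderivWithin hs hu') hz'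
  rw [← fderivWithin_fderivWithin_inter hu _ hz']
  let P : Euc n →L[ℝ] ℝ := EuclideanSpace.proj 0
  have hdw : DifferentiableWithinAt ℝ (fun y' => fderivWithin ℝ (inCharts m n F x y)
      ((extChartAt (𝓡∂ m) x).target ∩ u) y' w) ((extChartAt (𝓡∂ m) x).target ∩ u) z :=
    hd.clm_apply (differentiableWithinAt_const w)
  have h1 : fderivWithin ℝ (fun y' => P (fderivWithin ℝ (inCharts m n F x y)
      ((extChartAt (𝓡∂ m) x).target ∩ u) y' w))
      ((extChartAt (𝓡∂ m) x).target ∩ u) z v = 0 := by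
    refine fderivWithin_eq_zero_of_boundary x hu hz' hz0 hv
      (P.differentiableAt.comp_differentiableWithinAt z hdw) ?_
    intro y' hy' h0
    rw [fderivWithin_inter_open hu _ hy'.2]
    rw [← he] at hy'
    exact fderivWithin_inCharts_zero hF hb hy' h0 hw
  rw [fderivWithin_lin (hu' z hz') (differentiableWithinAt_const P) hdw,
    fderivWithin_eval (hu' z hz') hd] at h1
  simpa [P] using h1

end Maps

section Normal

variable {n : ℕ} [NeZero n] {X : Type*} [TopologicalSpace X]
  [ChartedSpace (EuclideanHalfSpace n) X]
  [RiemannianBundle (fun x : X => TangentSpace (𝓡∂ n) x)]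
  [IsManifold (𝓡∂ n) ∞ X]
  [IsContMDiffRiemannianBundle (𝓡∂ n) ∞ (EuclideanSpace ℝ (Fin n))
      (fun p : X => TangentSpace (𝓡∂ n) p)]

lemma frame_zero {x p : X} (hp : p ∈ (extChartAt (𝓡∂ n) x).source)
    (hb : p ∈ (𝓡∂ n).boundary X) {w : Euc n} (hw : w 0 = 0) : frame n x p w 0 = 0 := by
  have hid : ContMDiff (𝓡∂ n) (𝓡∂ n) ∞ (id : X → X) := contMDiff_id
  rw [← fderivWithin_transition n hp]
  exact fderivWithin_inCharts_zero hid (fun _ h => h)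
    (mem_chartDomain (F := (id : X → X)) hp (mem_extChartAt_source p))
    ((mem_boundary_iff hp).1 hb) hw

lemma frame_normal {x p : X} (hp : p ∈ (extChartAt (𝓡∂ n) x).source)
    (hb : p ∈ (𝓡∂ n).boundary X) : ∃ c : ℝ, 0 < c ∧ ∀ v, frame n x p v 0 = c * v 0 := by
  have key : ∀ v, frame n x p v 0 = frame n x p (EuclideanSpace.single 0 1) 0 * v 0 := by
    intro v
    have h1 : (v - v 0 • EuclideanSpace.single (0 : Fin n) (1 : ℝ) : Euc n) 0 = 0 := by simp
    have h2 := frame_zero hp hb h1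
    simp only [map_sub, map_smul, PiLp.sub_apply, PiLp.smul_apply, smul_eq_mul] at h2
    linarith
  refine ⟨_, lt_of_le_of_ne ?_ ?_, key⟩
  · have hid : ContMDiff (𝓡∂ n) (𝓡∂ n) ∞ (id : X → X) := contMDiff_id
    obtain ⟨u, hu, he⟩ := exists_open_chartDomain (m := n) (n := n) (X := X) hid.continuous x p
    have hz : extChartAt (𝓡∂ n) x p ∈ chartDomain n n (id : X → X) x p :=
      mem_chartDomain (F := (id : X → X)) hp (mem_extChartAt_source p)
    have hz' := hz
    rw [he] at hz'
    have hs := contDiffOn_inCharts hid x p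
    change ContDiffOn ℝ ∞ (inCharts n n id x p) (chartDomain n n (id : X → X) x p) at hs
    have hd := (diffWithinAt_of_smooth hs hz).hasFDerivWithinAt
    rw [he, fderivWithin_inter_open hu _ hz'.2, fderivWithin_transition n hp] at hd
    let P : Euc n →L[ℝ] ℝ := EuclideanSpace.proj 0
    have hd2 := P.hasFDerivAt.comp_hasFDerivWithinAt _ hd
    have hmin : IsLocalMinOn (P ∘ inCharts n n id x p) ((extChartAt (𝓡∂ n) x).target ∩ u)
        (extChartAt (𝓡∂ n) x p) := by
      filter_upwards [self_mem_nhdsWithin] with y hy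
      rw [← he] at hy
      have h1 : P (inCharts n n id x p (extChartAt (𝓡∂ n) x p)) = 0 := by
        rw [inCharts_apply (F := id) hp]
        exact (mem_boundary_iff (mem_extChartAt_source p)).1 hb
      simp only [Function.comp, h1]
      exact target_nonneg p (mapsTo_inCharts id x p hy)
    have hcone : EuclideanSpace.single 0 (1 : ℝ) ∈ posTangentConeAt
        ((extChartAt (𝓡∂ n) x).target ∩ u) (extChartAt (𝓡∂ n) x p) := by
      apply mem_posTangentConeAt_of_frequently_mem
      apply Filter.Eventually.frequently
      obtain ⟨O, hO, heO⟩ := exists_open_target n x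
      have hc : Continuous fun t : ℝ =>
          extChartAt (𝓡∂ n) x p + t • EuclideanSpace.single 0 (1 : ℝ) := by fun_prop
      have hzO : extChartAt (𝓡∂ n) x p + (0 : ℝ) • EuclideanSpace.single 0 (1 : ℝ) ∈ O ∩ u := by
        rw [heO] at hz'; simpa using ⟨hz'.1.1, hz'.2⟩
      filter_upwards [nhdsWithin_le_nhds
        (hc.continuousAt.preimage_mem_nhds ((hO.inter hu).mem_nhds hzO)), self_mem_nhdsWithin]
        with t ht ht0
      rw [heO] at hz' ⊢
      refine ⟨⟨ht.1, ?_⟩, ht.2⟩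
      have h0 := hz'.1.2
      have : (0 : ℝ) < t := ht0
      simp only [mem_ofPred_eq, PiLp.add_apply, PiLp.smul_apply, smul_eq_mul,
        PiLp.single_apply, if_true, mul_one] at h0 ⊢
      linarith
    exact hmin.hasFDerivWithinAt_nonneg hd2 hcone
  · intro h0
    have h1 := key (coframe n x p (EuclideanSpace.single 0 1))
    rw [frame_coframe n hp, ← h0] at h1
    simp at h1

lemma card_onb (p : X) :
    Fintype.card (Fin (Module.finrank ℝ (TangentSpace (𝓡∂ n) p))) = Module.finrank ℝ (Euc n) := by
  rw [Fintype.card_fin]; rfl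

lemma isOrthoBasis_of_metricAt {ι : Type*} [Fintype ι] [DecidableEq ι] {p : X} {e : ι → Euc n}
    (h : ∀ i j, metricAt n p (e i) (e j) = if i = j then 1 else 0)
    (hc : Fintype.card ι = n) : IsOrthoBasis (chartMetric n p (extChartAt (𝓡∂ n) p p)) e :=
  isOrthoBasis_of_card (fun i j => by rw [chartMetric_self, h]) (by simpa using hc)

variable (n) in
/-- The chosen orthonormal basis, in coordinates. -/
def onbVec (p : X) (i : Fin (Module.finrank ℝ (TangentSpace (𝓡∂ n) p))) : Euc n := onb n p i

lemma isOrthoBasis_onb (p : X) : IsOrthoBasis (chartMetric n p (extChartAt (𝓡∂ n) p p))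
    (onbVec n p) := by
  refine isOrthoBasis_of_card (fun i j => ?_) (card_onb p)
  rw [chartMetric_self]
  exact (orthonormal_iff_ite.1 (onb n p).orthonormal) i j

lemma isOrthoBasis_coframe {ι : Type*} [Fintype ι] [DecidableEq ι] {x p : X}
    (hp : p ∈ (extChartAt (𝓡∂ n) x).source) {e : ι → Euc n}
    (he : IsOrthoBasis (chartMetric n p (extChartAt (𝓡∂ n) p p)) e) :
    IsOrthoBasis (chartMetric n x (extChartAt (𝓡∂ n) x p)) (fun i => coframe n x p (e i)) where
  orth := fun i j => by
    rw [chartMetric_eq n hp, frame_coframe n hp, frame_coframe n hp, ← chartMetric_self, he.orth]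
  span := fun v => by
    have h1 := congrArg (coframe n x p) (he.span (frame n x p v))
    rw [coframe_frame n hp] at h1
    refine h1.trans ?_
    simp only [map_sum, map_smul]
    refine Finset.sum_congr rfl fun i _ => ?_
    rw [chartMetric_eq n hp, frame_coframe n hp, chartMetric_self]

lemma metricAt_comm (p : X) (v w : Euc n) : metricAt n p v w = metricAt n p w v :=
  real_inner_comm _ _

lemma metricAt_smul_left (p : X) (c : ℝ) (v w : Euc n) :
    metricAt n p (c • v) w = c * metricAt n p v w := by
  rw [← chartMetric_self, ← chartMetric_self]; simp only [map_smul, smul_apply, smul_eq_mul]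

lemma metricAt_sum_smul {ι : Type*} [Fintype ι] [DecidableEq ι] {p : X} {e : ι → Euc n}
    (he : IsOrthoBasis (chartMetric n p (extChartAt (𝓡∂ n) p p)) e) (L : Euc n →ₗ[ℝ] ℝ)
    (v : Euc n) : metricAt n p (∑ i, L (e i) • e i) v = L v := by
  rw [← chartMetric_self]
  conv_rhs => rw [he.span v]
  simp only [map_sum, map_smul, sum_apply, smul_apply, smul_eq_mul]
  refine Finset.sum_congr rfl fun i _ => ?_
  rw [chartMetric_self, chartMetric_self, metricAt_comm, mul_comm]

lemma metricAt_ext {p : X} {v w : Euc n} (h : ∀ ξ, metricAt n p v ξ = metricAt n p w ξ) :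
    v = w :=
  (isLeviCivitaOn_chart n p).ext_inner (mem_extChartAt_target p) fun ξ => by
    rw [chartMetric_self, chartMetric_self, h]

lemma metricAt_coordGrad (p : X) (v : Euc n) : metricAt n p (coordGrad n p) v = v 0 :=
  metricAt_sum_smul (isOrthoBasis_onb p) (EuclideanSpace.proj (𝕜 := ℝ) (0 : Fin n) : Euc n →L[ℝ] ℝ).toLinearMap v

lemma norm_sq_eq (p : X) (v : TangentSpace (𝓡∂ n) p) : ‖v‖ ^ 2 = metricAt n p v v :=
  (real_inner_self_eq_norm_sq v).symm

variable (n) in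
/-- The coordinate differential of the normal coordinate. -/
def proj0 : Euc n →L[ℝ] ℝ := EuclideanSpace.proj 0

variable (n) in
/-- The gradient of the normal coordinate of the chart at `x`. -/
def chartGrad0 (x : X) (z : Euc n) : Euc n := chartSharp n x z (proj0 n)

lemma chartGrad0_normSq_pos (x : X) {z : Euc n} (hz : z ∈ (extChartAt (𝓡∂ n) x).target) :
    0 < chartGrad0 n x z 0 := by
  have h1 := chartMetric_sharp n x hz (proj0 n) (chartGrad0 n x z)
  have h2 : chartGrad0 n x z ≠ 0 := by
    intro h
    have h3 := chartMetric_sharp n x hz (proj0 n) (EuclideanSpace.single 0 1)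
    change chartMetric n x z (chartGrad0 n x z) _ = _ at h3
    rw [h] at h3
    simp [proj0] at h3
  have h3 := chartMetric_pos n x hz h2
  change chartMetric n x z (chartGrad0 n x z) _ = _ at h1
  rw [h1] at h3
  simpa [proj0] using h3

variable (n) in
/-- The outward unit normal in the chart at `x`. -/
def chartNormal (x : X) (z : Euc n) : Euc n :=
  (-(Real.sqrt (chartGrad0 n x z 0))⁻¹) • chartGrad0 n x z

lemma chartMetric_normal (x : X) {z : Euc n} (hz : z ∈ (extChartAt (𝓡∂ n) x).target) (v : Euc n) :
    chartMetric n x z (chartNormal n x z) v = -(Real.sqrt (chartGrad0 n x z 0))⁻¹ * v 0 := by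
  rw [chartNormal, map_smul, smul_apply, chartGrad0, chartMetric_sharp n x hz]
  rfl

lemma coordGrad_eq (p : X) : (coordGrad n p : Euc n) = chartGrad0 n p (extChartAt (𝓡∂ n) p p) := by
  apply metricAt_ext (p := p)
  intro ξ
  rw [metricAt_coordGrad, ← chartMetric_self, chartGrad0,
    chartMetric_sharp n p (mem_extChartAt_target p)]
  rfl

lemma outwardNormal_eq (p : X) :
    (outwardNormal n p : Euc n) = chartNormal n p (extChartAt (𝓡∂ n) p p) := by
  have h1 : ‖coordGrad n p‖ = Real.sqrt (chartGrad0 n p (extChartAt (𝓡∂ n) p p) 0) := by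
    obtain ⟨c, hc⟩ : ∃ c : Euc n, c = coordGrad n p := ⟨_, rfl⟩
    have h3 : ‖coordGrad n p‖ ^ 2 = c 0 := by
      rw [hc]
      exact (norm_sq_eq p (coordGrad n p)).trans (metricAt_coordGrad p (coordGrad n p))
    have h4 : c = chartGrad0 n p (extChartAt (𝓡∂ n) p p) := hc.trans (coordGrad_eq p)
    rw [← h4, ← h3, Real.sqrt_sq (norm_nonneg _)]
  have h2 : (outwardNormal n p : Euc n) = -(‖coordGrad n p‖⁻¹ • (coordGrad n p : Euc n)) := rfl
  rw [h2, h1, chartNormal, neg_smul]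
  exact congrArg (fun v : Euc n => -((Real.sqrt (chartGrad0 n p (extChartAt (𝓡∂ n) p p) 0))⁻¹ • v))
    (coordGrad_eq p)

lemma outwardNormal_frame {x p : X} (hp : p ∈ (extChartAt (𝓡∂ n) x).source)
    (hb : p ∈ (𝓡∂ n).boundary X) :
    (outwardNormal n p : Euc n) = frame n x p (chartNormal n x (extChartAt (𝓡∂ n) x p)) := by
  obtain ⟨c, hc, hcv⟩ := frame_normal hp hb
  have hz := (extChartAt (𝓡∂ n) x).map_source hp
  have hpz := mem_extChartAt_target (I := 𝓡∂ n) p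
  have hg : chartGrad0 n p (extChartAt (𝓡∂ n) p p)
      = c • frame n x p (chartGrad0 n x (extChartAt (𝓡∂ n) x p)) := by
    apply metricAt_ext (p := p)
    intro ξ
    rw [← chartMetric_self, chartGrad0, chartMetric_sharp n p hpz, metricAt_smul_left]
    obtain ⟨v, rfl⟩ : ∃ v, frame n x p v = ξ := ⟨_, frame_coframe n hp ξ⟩
    rw [← chartMetric_eq n hp, chartGrad0, chartMetric_sharp n x hz]
    exact hcv v
  rw [outwardNormal_eq, chartNormal, chartNormal, hg, map_smul]
  have h0 := chartGrad0_normSq_pos x hz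
  have h1 : (c • frame n x p (chartGrad0 n x (extChartAt (𝓡∂ n) x p))) 0
      = c ^ 2 * chartGrad0 n x (extChartAt (𝓡∂ n) x p) 0 := by
    rw [PiLp.smul_apply, hcv, smul_eq_mul]; ring
  rw [h1, Real.sqrt_mul (by positivity), Real.sqrt_sq hc.le, smul_smul, mul_inv]
  congr 1
  field_simp

end Normal

section Functions

variable {n : ℕ} [NeZero n] {X : Type*} [TopologicalSpace X]
  [ChartedSpace (EuclideanHalfSpace n) X]

variable (n) in
/-- The differential of a function, in coordinates. -/
def dfun (f : X → ℝ) (p : X) : Euc n →L[ℝ] ℝ := mfderiv (𝓡∂ n) 𝓘(ℝ, ℝ) f p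

variable (n) in
/-- The coordinate expression of a function. -/
def inChart (f : X → ℝ) (x : X) (z : Euc n) : ℝ := f ((extChartAt (𝓡∂ n) x).symm z)

variable (n) in
/-- The differential of a function in the chart at `x`. -/
def chartD (f : X → ℝ) (x : X) (z : Euc n) : Euc n →L[ℝ] ℝ :=
  fderivWithin ℝ (inChart n f x) (extChartAt (𝓡∂ n) x).target z

variable [IsManifold (𝓡∂ n) ∞ X]

lemma dfun_comp_frame {f : X → ℝ} {x p : X} (hp : p ∈ (extChartAt (𝓡∂ n) x).source)
    (hf : MDifferentiableAt (𝓡∂ n) 𝓘(ℝ, ℝ) f p) :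
    (dfun n f p).comp (frame n x p) = chartD n f x (extChartAt (𝓡∂ n) x p) := by
  have := isManifold_one n (X := X)
  have hz := (extChartAt (𝓡∂ n) x).map_source hp
  rw [chartD, ← fderivWithin_range_eq n x _ hz, ← mfderivWithin_eq_fderivWithin]
  have hl := (extChartAt (𝓡∂ n) x).left_inv hp
  have h2 : MDifferentiableWithinAt 𝓘(ℝ, Euc n) (𝓡∂ n) (extChartAt (𝓡∂ n) x).symm
      (range (𝓡∂ n)) (extChartAt (𝓡∂ n) x p) :=
    mdifferentiableWithinAt_extChartAt_symm hz
  have hf' : MDifferentiableAt (𝓡∂ n) 𝓘(ℝ, ℝ) f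
      ((extChartAt (𝓡∂ n) x).symm (extChartAt (𝓡∂ n) x p)) := by rwa [hl]
  have key := mfderiv_comp_mfderivWithin (extChartAt (𝓡∂ n) x p) hf' h2
    ((𝓡∂ n).uniqueDiffOn.uniqueMDiffOn _
      (extChartAt_target_subset_range x hz))
  have e : inChart n f x = f ∘ (extChartAt (𝓡∂ n) x).symm := rfl
  rw [e, key, hl]
  rfl

lemma dfun_frame {f : X → ℝ} {x p : X} (hp : p ∈ (extChartAt (𝓡∂ n) x).source)
    (hf : MDifferentiableAt (𝓡∂ n) 𝓘(ℝ, ℝ) f p) (v : Euc n) :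
    dfun n f p (frame n x p v) = chartD n f x (extChartAt (𝓡∂ n) x p) v := by
  rw [← dfun_comp_frame hp hf]; rfl

lemma contMDiffOn_of_chart {F : Type*} [NormedAddCommGroup F] [NormedSpace ℝ F] {x : X}
    {k : Euc n → F} (hk : ContDiffOn ℝ ∞ k (extChartAt (𝓡∂ n) x).target) :
    ContMDiffOn (𝓡∂ n) 𝓘(ℝ, F) ∞ (fun p => k (extChartAt (𝓡∂ n) x p))
      (extChartAt (𝓡∂ n) x).source := by
  have h1 : ContMDiffOn (𝓡∂ n) 𝓘(ℝ, Euc n) ∞ (extChartAt (𝓡∂ n) x)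
      (extChartAt (𝓡∂ n) x).source := by
    rw [extChartAt_source]; exact contMDiffOn_extChartAt
  exact hk.contMDiffOn.comp h1 fun p hp => (extChartAt (𝓡∂ n) x).map_source hp

lemma contMDiff_of_charts {F : Type*} [NormedAddCommGroup F] [NormedSpace ℝ F] {f : X → F}
    {k : X → Euc n → F} (hk : ∀ x, ContDiffOn ℝ ∞ (k x) (extChartAt (𝓡∂ n) x).target)
    (hf : ∀ x, ∀ p ∈ (extChartAt (𝓡∂ n) x).source, f p = k x (extChartAt (𝓡∂ n) x p)) :
    ContMDiff (𝓡∂ n) 𝓘(ℝ, F) ∞ f := by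
  intro x
  have h1 := (contMDiffOn_of_chart (hk x)).congr (hf x)
  exact h1.contMDiffAt (extChartAt_source_mem_nhds x)

lemma continuousAt_of_chart {F : Type*} [TopologicalSpace F] {x p : X}
    (hp : p ∈ (extChartAt (𝓡∂ n) x).source) {k : Euc n → F} {u : Set (Euc n)} (hu : IsOpen u)
    (hpu : extChartAt (𝓡∂ n) x p ∈ u)
    (hk : ContinuousOn k ((extChartAt (𝓡∂ n) x).target ∩ u)) :
    ContinuousAt (fun p => k (extChartAt (𝓡∂ n) x p)) p := by
  have hc : ContinuousAt (extChartAt (𝓡∂ n) x) p := continuousAt_extChartAt' hp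
  have h1 := hk _ ⟨(extChartAt (𝓡∂ n) x).map_source hp, hpu⟩
  refine ContinuousWithinAt.tendsto h1 |>.comp ?_
  rw [tendsto_nhdsWithin_iff]
  refine ⟨hc, ?_⟩
  filter_upwards [(isOpen_extChartAt_source x).mem_nhds hp, hc.preimage_mem_nhds (hu.mem_nhds hpu)]
    with q hq hqu
  exact ⟨(extChartAt (𝓡∂ n) x).map_source hq, hqu⟩

variable [RiemannianBundle (fun x : X => TangentSpace (𝓡∂ n) x)]
  [IsContMDiffRiemannianBundle (𝓡∂ n) ∞ (EuclideanSpace ℝ (Fin n))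
      (fun p : X => TangentSpace (𝓡∂ n) p)]

lemma contDiffOn_chartD {f : X → ℝ} (hf : ContMDiff (𝓡∂ n) 𝓘(ℝ, ℝ) ∞ f) (x : X) :
    ContDiffOn ℝ ∞ (chartD n f x) (extChartAt (𝓡∂ n) x).target :=
  smooth_fderivWithin (contDiffOn_comp_symm hf x) (uniqueDiffOn_extChartAt_target x)

variable (n) in
/-- The gradient, in coordinates. -/
def gradVec (f : X → ℝ) (p : X) : Euc n := grad n f p

lemma metricAt_grad (f : X → ℝ) (p : X) (v : Euc n) :
    metricAt n p (gradVec n f p) v = dfun n f p v :=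
  metricAt_sum_smul (isOrthoBasis_onb p) (dfun n f p).toLinearMap v

lemma gradNorm_sq (f : X → ℝ) (p : X) :
    gradNorm n f p ^ 2 = metricAt n p (gradVec n f p) (gradVec n f p) := norm_sq_eq p _

variable (n) in
/-- The gradient in the chart at `x`. -/
def chartGrad (f : X → ℝ) (x : X) (z : Euc n) : Euc n := chartSharp n x z (chartD n f x z)

lemma chartMetric_grad (f : X → ℝ) (x : X) {z : Euc n} (hz : z ∈ (extChartAt (𝓡∂ n) x).target)
    (v : Euc n) : chartMetric n x z (chartGrad n f x z) v = chartD n f x z v :=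
  chartMetric_sharp n x hz _ v

lemma contDiffOn_chartGrad {f : X → ℝ} (hf : ContMDiff (𝓡∂ n) 𝓘(ℝ, ℝ) ∞ f) (x : X) :
    ContDiffOn ℝ ∞ (chartGrad n f x) (extChartAt (𝓡∂ n) x).target :=
  contDiffOn_chartSharp n x subset_rfl (contDiffOn_chartD hf x)

lemma gradVec_eq_frame {f : X → ℝ} {x p : X} (hp : p ∈ (extChartAt (𝓡∂ n) x).source)
    (hf : MDifferentiableAt (𝓡∂ n) 𝓘(ℝ, ℝ) f p) :
    gradVec n f p = frame n x p (chartGrad n f x (extChartAt (𝓡∂ n) x p)) := by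
  have hz := (extChartAt (𝓡∂ n) x).map_source hp
  apply metricAt_ext (p := p)
  intro ξ
  obtain ⟨v, rfl⟩ : ∃ v, frame n x p v = ξ := ⟨_, frame_coframe n hp ξ⟩
  rw [metricAt_grad, dfun_frame hp hf, ← chartMetric_eq n hp, chartMetric_grad f x hz]

lemma metricAt_gradVec {f h : X → ℝ} {x p : X} (hp : p ∈ (extChartAt (𝓡∂ n) x).source)
    (hf : MDifferentiableAt (𝓡∂ n) 𝓘(ℝ, ℝ) f p) (hh : MDifferentiableAt (𝓡∂ n) 𝓘(ℝ, ℝ) h p) :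
    metricAt n p (gradVec n f p) (gradVec n h p)
      = chartMetric n x (extChartAt (𝓡∂ n) x p) (chartGrad n f x (extChartAt (𝓡∂ n) x p))
          (chartGrad n h x (extChartAt (𝓡∂ n) x p)) := by
  rw [gradVec_eq_frame hp hf, gradVec_eq_frame hp hh, chartMetric_eq n hp]

lemma contMDiff_inner_grad {f h : X → ℝ} (hf : ContMDiff (𝓡∂ n) 𝓘(ℝ, ℝ) ∞ f)
    (hh : ContMDiff (𝓡∂ n) 𝓘(ℝ, ℝ) ∞ h) :
    ContMDiff (𝓡∂ n) 𝓘(ℝ, ℝ) ∞ fun p => metricAt n p (gradVec n f p) (gradVec n h p) := by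
  refine contMDiff_of_charts (k := fun x z => chartMetric n x z (chartGrad n f x z)
    (chartGrad n h x z)) (fun x => ?_) fun x p hp => ?_
  · exact ((contDiffOn_chartMetric n x).clm_apply (contDiffOn_chartGrad hf x)).clm_apply
      (contDiffOn_chartGrad hh x)
  · exact metricAt_gradVec hp (hf.mdifferentiableAt (by simp)) (hh.mdifferentiableAt (by simp))

lemma contMDiff_gradNorm_sq {f : X → ℝ} (hf : ContMDiff (𝓡∂ n) 𝓘(ℝ, ℝ) ∞ f) :
    ContMDiff (𝓡∂ n) 𝓘(ℝ, ℝ) ∞ fun p => gradNorm n f p ^ 2 := by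
  simp only [gradNorm_sq]
  exact contMDiff_inner_grad hf hf

/-- The bilinear form of the Hessian in a chart. -/
def localHessForm (s : Set (Euc n)) (Γ : Euc n → Euc n →L[ℝ] Euc n →L[ℝ] Euc n)
    (f : Euc n → ℝ) (z : Euc n) : Euc n →ₗ[ℝ] Euc n →ₗ[ℝ] ℝ :=
  LinearMap.mk₂ ℝ (fun v w => localHess s Γ f z v w)
    (fun v v' w => by simp [localHess]; ring)
    (fun c v w => by simp [localHess]; ring)
    (fun v w w' => by simp [localHess]; ring)
    (fun c v w => by simp [localHess]; ring)

lemma laplacian_eq_sum {f : X → ℝ} (hf : ContMDiff (𝓡∂ n) 𝓘(ℝ, ℝ) ∞ f) {x p : X}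
    (hp : p ∈ (extChartAt (𝓡∂ n) x).source) {ι : Type*} [Fintype ι] [DecidableEq ι]
    {e : ι → Euc n} (he : IsOrthoBasis (chartMetric n x (extChartAt (𝓡∂ n) x p)) e) :
    laplacian n f p = ∑ i, localHess (extChartAt (𝓡∂ n) x).target (chartChristoffel n x)
        (inChart n f x) (extChartAt (𝓡∂ n) x p) (e i) (e i) := by
  have h1 := (isOrthoBasis_coframe hp (isOrthoBasis_onb p)).sum_bilin_eq he
    (localHessForm (extChartAt (𝓡∂ n) x).target (chartChristoffel n x)
        (inChart n f x) (extChartAt (𝓡∂ n) x p))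
  refine Eq.trans (Finset.sum_congr rfl fun i _ => ?_) h1
  have h2 := hessian_frame hf hp (coframe n x p (onbVec n p i)) (coframe n x p (onbVec n p i))
  rw [frame_coframe n hp] at h2
  exact h2

/-- The Laplacian is the divergence of the gradient. -/
lemma laplacian_eq_trace {f : X → ℝ} (hf : ContMDiff (𝓡∂ n) 𝓘(ℝ, ℝ) ∞ f) {x p : X}
    (hp : p ∈ (extChartAt (𝓡∂ n) x).source) :
    laplacian n f p = LinearMap.trace ℝ (Euc n) (localNabla (extChartAt (𝓡∂ n) x).target
      (chartChristoffel n x) (chartGrad n f x) (extChartAt (𝓡∂ n) x p)) := by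
  have he := isOrthoBasis_coframe hp (isOrthoBasis_onb p)
  have hz := (extChartAt (𝓡∂ n) x).map_source hp
  rw [laplacian_eq_sum hf hp he, he.trace_eq]
  refine Finset.sum_congr rfl fun i _ => ?_
  exact ((isLeviCivitaOn_chart n x).inner_localNabla (contDiffOn_comp_symm hf x)
    (contDiffOn_chartGrad hf x) (fun z hz v => chartMetric_grad f x hz v) hz _ _).symm

lemma continuous_laplacian {f : X → ℝ} (hf : ContMDiff (𝓡∂ n) 𝓘(ℝ, ℝ) ∞ f) :
    Continuous (laplacian n f) := by
  refine (contMDiff_of_charts (n := n) (k := fun x z => LinearMap.trace ℝ (Euc n)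
    (localNabla (extChartAt (𝓡∂ n) x).target (chartChristoffel n x) (chartGrad n f x) z))
    (fun x => ?_) fun x p hp => laplacian_eq_trace hf hp).continuous
  have h1 := (isLeviCivitaOn_chart n x).smooth_localNabla (contDiffOn_chartGrad hf x)
  let T : (Euc n →L[ℝ] Euc n) →ₗ[ℝ] ℝ := (LinearMap.trace ℝ (Euc n)).comp
    (ContinuousLinearMap.coeLM ℝ)
  exact T.toContinuousLinearMap.contDiff.comp_contDiffOn h1

/-- The sum of a bilinear form over an orthonormal basis, in terms of the inverse Gram matrix. -/
lemma sum_onb_coord {ι : Type*} [Fintype ι] [DecidableEq ι] {x : X} {z : Euc n}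
    (hz : z ∈ (extChartAt (𝓡∂ n) x).target) {e : ι → Euc n}
    (he : IsOrthoBasis (chartMetric n x z) e) (a b : Fin n) :
    ∑ i, e i a * e i b = (gram n x z)⁻¹ a b := by
  have h1 : chartSharp n x z (EuclideanSpace.proj b) a = (gram n x z)⁻¹ a b := by
    simp [chartSharp, PiLp.single_apply]
  rw [← h1, he.span (chartSharp n x z (EuclideanSpace.proj b))]
  simp only [chartMetric_sharp n x hz]
  simp [mul_comm]

lemma sum_onb_bilin {ι : Type*} [Fintype ι] [DecidableEq ι] {x : X} {z : Euc n}
    (hz : z ∈ (extChartAt (𝓡∂ n) x).target) {e : ι → Euc n}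
    (he : IsOrthoBasis (chartMetric n x z) e) (b : Euc n →ₗ[ℝ] Euc n →ₗ[ℝ] ℝ) :
    ∑ i, b (e i) (e i) = ∑ k, ∑ l, (gram n x z)⁻¹ k l
      * b (EuclideanSpace.single k 1) (EuclideanSpace.single l 1) := by
  simp only [← sum_onb_coord hz he, Finset.sum_mul]
  have : ∀ i, b (e i) (e i) = ∑ k, ∑ l, e i k * e i l *
      b (EuclideanSpace.single k 1) (EuclideanSpace.single l 1) := by
    intro i
    conv_lhs => rw [euc_eq_sum n (e i)]
    simp only [map_sum, map_smul, LinearMap.sum_apply, LinearMap.smul_apply, smul_eq_mul,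
      Finset.mul_sum]
    rw [Finset.sum_comm]
    refine Finset.sum_congr rfl fun k _ => Finset.sum_congr rfl fun l _ => by ring
  simp only [this]
  rw [Finset.sum_comm]
  refine Finset.sum_congr rfl fun k _ => ?_
  rw [Finset.sum_comm]

lemma sum_onb_sq {ι : Type*} [Fintype ι] [DecidableEq ι] {x : X} {z : Euc n}
    (hz : z ∈ (extChartAt (𝓡∂ n) x).target) {e : ι → Euc n}
    (he : IsOrthoBasis (chartMetric n x z) e) (b : Euc n →ₗ[ℝ] Euc n →ₗ[ℝ] ℝ) :
    ∑ i, ∑ j, b (e i) (e j) ^ 2 = ∑ k, ∑ l, (gram n x z)⁻¹ k l * ∑ k', ∑ l', (gram n x z)⁻¹ k' l'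
      * (b (EuclideanSpace.single k 1) (EuclideanSpace.single k' 1)
        * b (EuclideanSpace.single l 1) (EuclideanSpace.single l' 1)) := by
  have h1 : ∀ v w : Euc n, ∑ j, b v (e j) * b w (e j) = ∑ k', ∑ l', (gram n x z)⁻¹ k' l'
      * (b v (EuclideanSpace.single k' 1) * b w (EuclideanSpace.single l' 1)) := by
    intro v w
    have := sum_onb_bilin hz he (LinearMap.mk₂ ℝ (fun s t => b v s * b w t)
      (fun s s' t => by simp [add_mul]) (fun c s t => by simp; ring)
      (fun s t t' => by simp [mul_add]) (fun c s t => by simp; ring))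
    exact this
  have h2 := sum_onb_bilin hz he (∑ j, LinearMap.mk₂ ℝ (fun s t => b s (e j) * b t (e j))
      (fun s s' t => by simp [add_mul]) (fun c s t => by simp; ring)
      (fun s t t' => by simp [mul_add]) (fun c s t => by simp; ring))
  simp only [LinearMap.sum_apply, LinearMap.mk₂_apply, h1] at h2
  rw [← h2]
  refine Finset.sum_congr rfl fun i _ => ?_
  rw [← h1]
  refine Finset.sum_congr rfl fun j _ => by ring

end Functions

section SecondForm

variable {m n : ℕ} [NeZero m] [NeZero n]
  {M : Type*} [TopologicalSpace M] [ChartedSpace (EuclideanHalfSpace m) M]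
  [RiemannianBundle (fun p : M => TangentSpace (𝓡∂ m) p)]
  {X : Type*} [TopologicalSpace X] [ChartedSpace (EuclideanHalfSpace n) X]
  [RiemannianBundle (fun x : X => TangentSpace (𝓡∂ n) x)]
  [IsManifold (𝓡∂ m) ∞ M] [IsManifold (𝓡∂ n) ∞ X]
  [IsContMDiffRiemannianBundle (𝓡∂ m) ∞ (EuclideanSpace ℝ (Fin m))
      (fun p : M => TangentSpace (𝓡∂ m) p)]
  [IsContMDiffRiemannianBundle (𝓡∂ n) ∞ (EuclideanSpace ℝ (Fin n))
      (fun p : X => TangentSpace (𝓡∂ n) p)]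
  {F : M → X} {ν : ∀ p, TangentSpace (𝓡∂ n) (F p)}

lemma fderivWithin_inCharts_self (hF : ContMDiff (𝓡∂ m) (𝓡∂ n) ∞ F) (p : M) :
    fderivWithin ℝ (inCharts m n F p (F p)) (extChartAt (𝓡∂ m) p).target (extChartAt (𝓡∂ m) p p)
      = dAt m n F p := by
  rw [fderivWithin_inCharts hF (mem_extChartAt_source p) (mem_extChartAt_source (F p)),
    coframe_self, frame_self]
  rfl

lemma metricAt_dAt (hF : IsFBMH m n F ν) (p : M) (v w : Euc m) :
    metricAt n (F p) (dAt m n F p v) (dAt m n F p w) = metricAt m p v w := hF.isometric p v w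

variable (n) in
/-- The normal, in coordinates. -/
def nrm (F : M → X) (ν : ∀ p, TangentSpace (𝓡∂ n) (F p)) (p : M) : Euc n := ν p

lemma metricAt_dAt_normal (hF : IsFBMH m n F ν) (p : M) (v : Euc m) :
    metricAt n (F p) (dAt m n F p v) (nrm n F ν p) = 0 := hF.normal p v

lemma metricAt_normal_self (hF : IsFBMH m n F ν) (p : M) :
    metricAt n (F p) (nrm n F ν p) (nrm n F ν p) = 1 := by
  have := norm_sq_eq (F p) (ν p)
  rw [hF.unit_normal, one_pow] at this
  exact this.symm

lemma secondFF_eq (hF : IsFBMH m n F ν) (p : M) (v w : Euc m) :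
    secondFF m n F ν p v w = - metricAt n (F p) (localSndDeriv (extChartAt (𝓡∂ m) p).target
      (inCharts m n F p (F p)) (chartChristoffel n (F p)) (extChartAt (𝓡∂ m) p p) v w) (nrm n F ν p) := by
  rw [← ambientSecondDeriv_eq hF.smooth]
  rfl

lemma metricAt_add_left (p : X) (a b w : Euc n) :
    metricAt n p (a + b) w = metricAt n p a w + metricAt n p b w := by
  simp only [← chartMetric_self, map_add, add_apply]

lemma metricAt_sub_left (p : X) (a b w : Euc n) :
    metricAt n p (a - b) w = metricAt n p a w - metricAt n p b w := by
  simp only [← chartMetric_self, map_sub, sub_apply]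

/-- The second fundamental form as a bilinear form in coordinates. -/
def secondForm (hF : IsFBMH m n F ν) (p : M) : Euc m →ₗ[ℝ] Euc m →ₗ[ℝ] ℝ :=
  LinearMap.mk₂ ℝ (fun v w => secondFF m n F ν p v w)
    (fun v v' w => by
      rw [secondFF_eq hF, secondFF_eq hF, secondFF_eq hF, ← neg_add, ← metricAt_add_left]
      congr 2; simp only [localSndDeriv, map_add, add_apply]; abel)
    (fun c v w => by
      rw [secondFF_eq hF, secondFF_eq hF, smul_eq_mul, mul_neg, ← metricAt_smul_left]
      congr 2; simp only [localSndDeriv, map_smul, smul_apply, smul_add])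
    (fun v w w' => by
      rw [secondFF_eq hF, secondFF_eq hF, secondFF_eq hF, ← neg_add, ← metricAt_add_left]
      congr 2; simp only [localSndDeriv, map_add]; abel)
    (fun c v w => by
      rw [secondFF_eq hF, secondFF_eq hF, smul_eq_mul, mul_neg, ← metricAt_smul_left]
      congr 2; simp only [localSndDeriv, map_smul, smul_add])

lemma secondForm_apply (hF : IsFBMH m n F ν) (p : M) (v w : Euc m) :
    secondForm hF p v w = secondFF m n F ν p v w := rfl

lemma secondForm_symm (hF : IsFBMH m n F ν) (p : M) (v w : Euc m) :
    secondForm hF p v w = secondForm hF p w v := by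
  rw [secondForm_apply, secondForm_apply, secondFF_eq hF, secondFF_eq hF]
  obtain ⟨u, hu, he⟩ := exists_open_chartDomain (m := m) (n := n) hF.smooth.continuous p (F p)
  have hz := mem_chartDomain (F := F) (mem_extChartAt_source (I := 𝓡∂ m) p)
    (mem_extChartAt_source (I := 𝓡∂ n) (F p))
  have h1 := IsLeviCivitaOn.localSndDeriv_symm
    (isLeviCivitaOn_chartDomain (m := m) (n := n) hF.smooth.continuous p (F p))
    (isLeviCivitaOn_chart n (F p)) (contDiffOn_inCharts hF.smooth p (F p))
    (mapsTo_inCharts F p (F p)) hz v w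
  rw [he] at h1 hz
  rw [localSndDeriv_inter hu _ _ hz] at h1
  rw [h1]

/-- An orthonormal basis of the hypersurface, completed by the normal. -/
def adapted {ι : Type*} (F : M → X) (ν : ∀ p, TangentSpace (𝓡∂ n) (F p)) (p : M)
    (e : ι → Euc m) : Option ι → Euc n
  | none => nrm n F ν p
  | some i => dAt m n F p (e i)

lemma isOrthoBasis_adapted (hF : IsFBMH m n F ν) {p : M} {ι : Type*} [Fintype ι] [DecidableEq ι]
    {e : ι → Euc m} (he : IsOrthoBasis (chartMetric m p (extChartAt (𝓡∂ m) p p)) e)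
    (hc : Fintype.card ι = m) :
    IsOrthoBasis (chartMetric n (F p) (extChartAt (𝓡∂ n) (F p) (F p))) (adapted F ν p e) := by
  refine isOrthoBasis_of_metricAt (fun i j => ?_) ?_
  · rcases i with _ | i <;> rcases j with _ | j
    · simpa using! metricAt_normal_self hF p
    · simp only [reduceCtorEq, if_false]
      rw [metricAt_comm]; exact metricAt_dAt_normal hF p _
    · simp only [reduceCtorEq, if_false]
      exact metricAt_dAt_normal hF p _
    · simp only [Option.some.injEq]
      rw [← he.orth i j, chartMetric_self]
      exact metricAt_dAt hF p _ _
  · rw [Fintype.card_option, hc, hF.codim_one]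

lemma finrank_tangent (p : M) : Module.finrank ℝ (TangentSpace (𝓡∂ m) p) = m := by
  have : Module.finrank ℝ (Euc m) = m := by simp
  exact this

/-- The normal part of the second derivative of the immersion. -/
lemma localSndDeriv_sub (hF : IsFBMH m n F ν) (p : M) (v w : Euc m) :
    localSndDeriv (extChartAt (𝓡∂ m) p).target (inCharts m n F p (F p))
        (chartChristoffel n (F p)) (extChartAt (𝓡∂ m) p p) v w
      - dAt m n F p (chartChristoffel m p (extChartAt (𝓡∂ m) p p) v w)
      = -(secondForm hF p v w) • nrm n F ν p := by
  obtain ⟨u, hu, he⟩ := exists_open_chartDomain (m := m) (n := n) hF.smooth.continuous p (F p)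
  have hz := mem_chartDomain (F := F) (mem_extChartAt_source (I := 𝓡∂ m) p)
    (mem_extChartAt_source (I := 𝓡∂ n) (F p))
  have h1 := IsLeviCivitaOn.inner_localSndDeriv
    (isLeviCivitaOn_chartDomain (m := m) (n := n) hF.smooth.continuous p (F p))
    (isLeviCivitaOn_chart n (F p)) (contDiffOn_inCharts hF.smooth p (F p))
    (mapsTo_inCharts F p (F p)) (isometric_inCharts hF.smooth hF.isometric p (F p)) hz v w
  have hz' := hz
  rw [he] at hz'
  have h2 : fderivWithin ℝ (inCharts m n F p (F p)) (chartDomain m n F p (F p))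
      (extChartAt (𝓡∂ m) p p) = dAt m n F p := by
    rw [he, fderivWithin_inter_open hu _ hz'.2, fderivWithin_inCharts_self hF.smooth]
  have h3 : localSndDeriv (chartDomain m n F p (F p)) (inCharts m n F p (F p))
        (chartChristoffel n (F p)) (extChartAt (𝓡∂ m) p p) v w
      = localSndDeriv (extChartAt (𝓡∂ m) p).target (inCharts m n F p (F p))
        (chartChristoffel n (F p)) (extChartAt (𝓡∂ m) p p) v w := by
    rw [he, localSndDeriv_inter hu _ _ hz']
  rw [h2, h3, inCharts_apply (mem_extChartAt_source p)] at h1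
  have hb := isOrthoBasis_adapted hF (isOrthoBasis_onb p) (by simpa using finrank_tangent p)
  conv_lhs => rw [hb.span (localSndDeriv (extChartAt (𝓡∂ m) p).target (inCharts m n F p (F p))
        (chartChristoffel n (F p)) (extChartAt (𝓡∂ m) p p) v w
      - dAt m n F p (chartChristoffel m p (extChartAt (𝓡∂ m) p p) v w))]
  rw [Fintype.sum_option]
  have h4 : ∀ i, chartMetric n (F p) (extChartAt (𝓡∂ n) (F p) (F p))
      (localSndDeriv (extChartAt (𝓡∂ m) p).target (inCharts m n F p (F p))
        (chartChristoffel n (F p)) (extChartAt (𝓡∂ m) p p) v w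
      - dAt m n F p (chartChristoffel m p (extChartAt (𝓡∂ m) p p) v w))
      (adapted F ν p (onbVec m p) (some i)) = 0 := by
    intro i
    rw [map_sub, sub_apply]
    simp only [adapted]
    rw [h1, chartMetric_self, chartMetric_self, metricAt_dAt hF, sub_self]
  simp only [h4, zero_smul, Finset.sum_const_zero, add_zero]
  rw [chartMetric_self, metricAt_sub_left]
  simp only [adapted]
  rw [metricAt_dAt_normal hF, sub_zero, secondForm_apply, secondFF_eq hF, neg_neg]

/-- The Gauss equation. -/
lemma gauss_eq (hF : IsFBMH m n F ν) (p : M) (a b c d : Euc m) :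
    riem n (F p) (dAt m n F p a) (dAt m n F p b) (dAt m n F p c) (dAt m n F p d)
      = riem m p a b c d - secondForm hF p b c * secondForm hF p a d
        + secondForm hF p a c * secondForm hF p b d := by
  obtain ⟨u, hu, he⟩ := exists_open_chartDomain (m := m) (n := n) hF.smooth.continuous p (F p)
  have hz := mem_chartDomain (F := F) (mem_extChartAt_source (I := 𝓡∂ m) p)
    (mem_extChartAt_source (I := 𝓡∂ n) (F p))
  have hz' := hz
  rw [he] at hz'
  have h2 : fderivWithin ℝ (inCharts m n F p (F p)) (chartDomain m n F p (F p))
      (extChartAt (𝓡∂ m) p p) = dAt m n F p := by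
    rw [he, fderivWithin_inter_open hu _ hz'.2, fderivWithin_inCharts_self hF.smooth]
  have h1 := IsLeviCivitaOn.gauss
    (isLeviCivitaOn_chartDomain (m := m) (n := n) hF.smooth.continuous p (F p))
    (isLeviCivitaOn_chart n (F p)) (contDiffOn_inCharts hF.smooth p (F p))
    (mapsTo_inCharts F p (F p)) (isometric_inCharts hF.smooth hF.isometric p (F p)) hz
    (B := fun v w => -(secondForm hF p v w) • nrm n F ν p) (fun v w => by
      rw [← localSndDeriv_sub, h2, he, localSndDeriv_inter hu _ _ hz']) a b c d
  rw [h2, inCharts_apply (mem_extChartAt_source p)] at h1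
  rw [riem_eq, ← chartMetric_self, h1, riem_eq, chartMetric_self, he,
    localCurv_inter hu _ hz']
  simp only [map_smul, smul_apply, chartMetric_self, metricAt_normal_self hF, smul_eq_mul]
  ring

/-- The normal part of the second derivative of the immersion in two charts. -/
def sndPart (m n : ℕ) [NeZero m] [NeZero n]
    [ChartedSpace (EuclideanHalfSpace m) M]
    [ChartedSpace (EuclideanHalfSpace n) X]
    [RiemannianBundle (fun p : M => TangentSpace (𝓡∂ m) p)]
    [RiemannianBundle (fun x : X => TangentSpace (𝓡∂ n) x)]
    [IsManifold (𝓡∂ m) ∞ M] [IsManifold (𝓡∂ n) ∞ X]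
  [IsContMDiffRiemannianBundle (𝓡∂ m) ∞ (EuclideanSpace ℝ (Fin m))
      (fun p : M => TangentSpace (𝓡∂ m) p)]
  [IsContMDiffRiemannianBundle (𝓡∂ n) ∞ (EuclideanSpace ℝ (Fin n))
      (fun p : X => TangentSpace (𝓡∂ n) p)]
    (F : M → X) (x : M) (y : X) (z v w : Euc m) : Euc n :=
  localSndDeriv (extChartAt (𝓡∂ m) x).target (inCharts m n F x y) (chartChristoffel n y) z v w
    - fderivWithin ℝ (inCharts m n F x y) (extChartAt (𝓡∂ m) x).target z
      (chartChristoffel m x z v w)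

variable (n) in
/-- The normal in the chart at `y`. -/
def normalVec (F : M → X) (ν : ∀ p, TangentSpace (𝓡∂ n) (F p)) (y : X) (p : M) : Euc n :=
  coframe n y (F p) (nrm n F ν p)

lemma secondForm_frame (hF : IsFBMH m n F ν) {x p : M} {y : X}
    (hp : p ∈ (extChartAt (𝓡∂ m) x).source) (hy : F p ∈ (extChartAt (𝓡∂ n) y).source)
    (v w : Euc m) : secondForm hF p (frame m x p v) (frame m x p w)
      = - chartMetric n y (extChartAt (𝓡∂ n) y (F p))
        (sndPart m n F x y (extChartAt (𝓡∂ m) x p) v w) (normalVec n F ν y p) := by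
  rw [chartMetric_eq n hy, normalVec, frame_coframe n hy, sndPart,
    localSndDeriv_tensorial hF.smooth hp hy, metricAt_sub_left, metricAt_dAt_normal hF, sub_zero,
    secondForm_apply, secondFF_eq hF]

lemma continuousAt_normalVec (hF : IsFBMH m n F ν) {p : M} {y : X}
    (hy : F p ∈ (extChartAt (𝓡∂ n) y).source) : ContinuousAt (normalVec n F ν y) p := by
  have hc : Continuous fun p => (⟨F p, ν p⟩ : TangentBundle (𝓡∂ n) X) := hF.smooth_normal.continuous
  have := isManifold_one n (X := X)
  rw [extChartAt_source] at hy
  have hmem : F p ∈ (trivializationAt (Euc n) (TangentSpace (𝓡∂ n) (M := X)) y).baseSet := by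
    rwa [TangentBundle.trivializationAt_baseSet]
  have h1 : ContinuousAt (fun q => (trivializationAt (Euc n) (TangentSpace (𝓡∂ n) (M := X)) y
      ⟨F q, ν q⟩).2) p := by
    have h2 := (trivializationAt (Euc n) (TangentSpace (𝓡∂ n) (M := X)) y).continuousAt
      (x := ⟨F p, ν p⟩) (by rwa [Bundle.Trivialization.mem_source])
    exact continuousAt_snd.comp (ContinuousAt.comp h2 hc.continuousAt)
  refine h1.congr ?_
  filter_upwards [hF.smooth.continuous.continuousAt.preimage_mem_nhds
    ((chartAt (EuclideanHalfSpace n) y).open_source.mem_nhds hy)] with q hq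
  have h3 := TangentBundle.continuousLinearMapAt_trivializationAt (I := 𝓡∂ n) hq
  have h4 : (trivializationAt (Euc n) (TangentSpace (𝓡∂ n) (M := X)) y).continuousLinearMapAt ℝ
      (F q) (ν q) = (trivializationAt (Euc n) (TangentSpace (𝓡∂ n) (M := X)) y ⟨F q, ν q⟩).2 := by
    rw [Bundle.Trivialization.continuousLinearMapAt_apply,
      Bundle.Trivialization.linearMapAt_apply, if_pos (by
        rwa [TangentBundle.trivializationAt_baseSet])]
  rw [← h4, h3]
  rfl

end SecondForm

section Continuity

variable {m n : ℕ} [NeZero m] [NeZero n]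
  {M : Type*} [TopologicalSpace M] [ChartedSpace (EuclideanHalfSpace m) M]
  [RiemannianBundle (fun p : M => TangentSpace (𝓡∂ m) p)]
  {X : Type*} [TopologicalSpace X] [ChartedSpace (EuclideanHalfSpace n) X]
  [RiemannianBundle (fun x : X => TangentSpace (𝓡∂ n) x)]
  [IsManifold (𝓡∂ m) ∞ M] [IsManifold (𝓡∂ n) ∞ X]
  [IsContMDiffRiemannianBundle (𝓡∂ m) ∞ (EuclideanSpace ℝ (Fin m))
      (fun p : M => TangentSpace (𝓡∂ m) p)]
  [IsContMDiffRiemannianBundle (𝓡∂ n) ∞ (EuclideanSpace ℝ (Fin n))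
      (fun p : X => TangentSpace (𝓡∂ n) p)]
  {F : M → X} {ν : ∀ p, TangentSpace (𝓡∂ n) (F p)}

lemma contDiffOn_fderivWithin_inCharts (hF : ContMDiff (𝓡∂ m) (𝓡∂ n) ∞ F) (x : M) (y : X) :
    ContDiffOn ℝ ∞ (fderivWithin ℝ (inCharts m n F x y) (extChartAt (𝓡∂ m) x).target)
      (chartDomain m n F x y) := by
  obtain ⟨u, hu, he⟩ := exists_open_chartDomain (m := m) (n := n) hF.continuous x y
  have h1 := smooth_fderivWithin (contDiffOn_inCharts hF x y)
    (isLeviCivitaOn_chartDomain (m := m) (n := n) hF.continuous x y).uniq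
  refine h1.congr fun z hz => ?_
  have hz' : z ∈ chartDomain m n F x y := hz
  rw [he] at hz'
  have := fderivWithin_inter_open hu (s := (extChartAt (𝓡∂ m) x).target)
    (inCharts m n F x y) hz'.2
  rw [← he] at this
  exact this.symm

lemma contDiffOn_fderivWithin_fderivWithin_inCharts (hF : ContMDiff (𝓡∂ m) (𝓡∂ n) ∞ F) (x : M)
    (y : X) : ContDiffOn ℝ ∞ (fderivWithin ℝ (fderivWithin ℝ (inCharts m n F x y)
      (extChartAt (𝓡∂ m) x).target) (extChartAt (𝓡∂ m) x).target) (chartDomain m n F x y) := by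
  obtain ⟨u, hu, he⟩ := exists_open_chartDomain (m := m) (n := n) hF.continuous x y
  have h1 := smooth_fderivWithin (contDiffOn_fderivWithin_inCharts hF x y)
    (isLeviCivitaOn_chartDomain (m := m) (n := n) hF.continuous x y).uniq
  refine h1.congr fun z hz => ?_
  have hz' : z ∈ chartDomain m n F x y := hz
  rw [he] at hz'
  have := fderivWithin_inter_open hu (s := (extChartAt (𝓡∂ m) x).target)
    (fderivWithin ℝ (inCharts m n F x y) (extChartAt (𝓡∂ m) x).target) hz'.2
  rw [← he] at this
  exact this.symm

lemma continuousAt_of_domain (hF : Continuous F) {p : M} {x : M} {y : X}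
    (hp : p ∈ (extChartAt (𝓡∂ m) x).source) (hy : F p ∈ (extChartAt (𝓡∂ n) y).source)
    {E : Type*} [TopologicalSpace E] {k : Euc m → E}
    (hk : ContinuousOn k (chartDomain m n F x y)) :
    ContinuousAt (fun p => k (extChartAt (𝓡∂ m) x p)) p := by
  obtain ⟨u, hu, he⟩ := exists_open_chartDomain (m := m) (n := n) hF x y
  have hz := mem_chartDomain (F := F) hp hy
  rw [he] at hz hk
  exact continuousAt_of_chart hp hu hz.2 hk

lemma continuousAt_of_target (hF : Continuous F) {p : M} {y : X}
    (hy : F p ∈ (extChartAt (𝓡∂ n) y).source) {E : Type*} [TopologicalSpace E] {k : Euc n → E}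
    (hk : ContinuousOn k (extChartAt (𝓡∂ n) y).target) :
    ContinuousAt (fun p => k (extChartAt (𝓡∂ n) y (F p))) p := by
  have h1 := continuousAt_of_chart hy isOpen_univ (mem_univ _) (k := k) (by rwa [inter_univ])
  exact ContinuousAt.comp (f := F) (x := p) h1 hF.continuousAt

/-- The Ricci form, in coordinates. -/
lemma ricci_eq_sum {x p : X} (hp : p ∈ (extChartAt (𝓡∂ n) x).source) (v : Euc n) :
    ricci n p (frame n x p v) (frame n x p v) = ∑ k, ∑ l,
      (gram n x (extChartAt (𝓡∂ n) x p))⁻¹ k l * chartMetric n x (extChartAt (𝓡∂ n) x p)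
        (localCurv (extChartAt (𝓡∂ n) x).target (chartChristoffel n x) (extChartAt (𝓡∂ n) x p)
          (EuclideanSpace.single k 1) v v) (EuclideanSpace.single l 1) := by
  have hz := (extChartAt (𝓡∂ n) x).map_source hp
  have he := isOrthoBasis_coframe hp (isOrthoBasis_onb p)
  let b : Euc n →ₗ[ℝ] Euc n →ₗ[ℝ] ℝ := LinearMap.mk₂ ℝ
    (fun s t => chartMetric n x (extChartAt (𝓡∂ n) x p)
        (localCurv (extChartAt (𝓡∂ n) x).target (chartChristoffel n x) (extChartAt (𝓡∂ n) x p)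
          s v v) t)
    (fun s s' t => by
      rw [← add_apply, ← map_add]; congr 2; simp only [localCurv, map_add, add_apply]; abel)
    (fun c s t => by
      rw [← smul_apply, ← map_smul]; congr 2
      simp only [localCurv, map_smul, smul_apply, smul_add, smul_sub])
    (fun s t t' => map_add _ _ _) (fun c s t => map_smul _ _ _)
  refine Eq.trans ?_ (sum_onb_bilin hz he b)
  refine Finset.sum_congr rfl fun i _ => ?_
  have := riem_frame hp (coframe n x p (onbVec n p i)) v v (coframe n x p (onbVec n p i))
  rw [frame_coframe n hp] at this
  exact this

lemma continuous_ricci_normal (hF : IsFBMH m n F ν) :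
    Continuous fun p => ricci n (F p) (ν p) (ν p) := by
  rw [continuous_iff_continuousAt]
  intro p
  have hc := hF.smooth.continuous
  have hy := mem_extChartAt_source (I := 𝓡∂ n) (F p)
  have hLC := isLeviCivitaOn_chart n (F p)
  have hN := continuousAt_normalVec hF hy
  have hΓ := continuousAt_of_target hc hy hLC.smooth_christoffel.continuousOn
  have hdΓ := continuousAt_of_target hc hy
    (smooth_fderivWithin hLC.smooth_christoffel hLC.uniq).continuousOn
  have hg := continuousAt_of_target hc hy (contDiffOn_chartMetric n (F p)).continuousOn
  have key : ContinuousAt (fun q => ∑ k, ∑ l,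
      (gram n (F p) (extChartAt (𝓡∂ n) (F p) (F q)))⁻¹ k l *
        chartMetric n (F p) (extChartAt (𝓡∂ n) (F p) (F q))
        (localCurv (extChartAt (𝓡∂ n) (F p)).target (chartChristoffel n (F p))
          (extChartAt (𝓡∂ n) (F p) (F q))
          (EuclideanSpace.single k 1) (normalVec n F ν (F p) q) (normalVec n F ν (F p) q))
          (EuclideanSpace.single l 1)) p := by
    refine tendsto_finsetSum _ fun k _ => tendsto_finsetSum _ fun l _ => ?_
    have hG := continuousAt_of_target hc hy (contDiffOn_gram_inv n (F p) k l).continuousOn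
    refine ContinuousAt.mul hG ?_
    refine (hg.clm_apply ?_).clm_apply continuousAt_const
    simp only [localCurv]
    refine ((ContinuousAt.sub ?_ ?_).add ?_).sub ?_
    · exact ((hdΓ.clm_apply continuousAt_const).clm_apply hN).clm_apply hN
    · exact ((hdΓ.clm_apply hN).clm_apply continuousAt_const).clm_apply hN
    · exact (hΓ.clm_apply continuousAt_const).clm_apply ((hΓ.clm_apply hN).clm_apply hN)
    · exact (hΓ.clm_apply hN).clm_apply ((hΓ.clm_apply continuousAt_const).clm_apply hN)
  refine key.congr ?_
  filter_upwards [hc.continuousAt.preimage_mem_nhds (extChartAt_source_mem_nhds (I := 𝓡∂ n) (F p))]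
    with q hq
  have h1 := ricci_eq_sum hq (normalVec n F ν (F p) q)
  rw [normalVec, frame_coframe n hq] at h1
  exact h1.symm

/-- The second fundamental form in charts. -/
def secondFormFrame (hF : IsFBMH m n F ν) (x p : M) : Euc m →ₗ[ℝ] Euc m →ₗ[ℝ] ℝ :=
  (secondForm hF p).compl₁₂ (frame m x p).toLinearMap (frame m x p).toLinearMap

lemma normSqII_eq_sum (hF : IsFBMH m n F ν) {p : M} {ι : Type*} [Fintype ι] [DecidableEq ι]
    {e : ι → Euc m} (he : IsOrthoBasis (chartMetric m p (extChartAt (𝓡∂ m) p p)) e) :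
    normSqII m n F ν p = ∑ i, ∑ j, secondForm hF p (e i) (e j) ^ 2 :=
  (isOrthoBasis_onb p).sum_sq_eq he (secondForm hF p)

lemma continuous_normSqII (hF : IsFBMH m n F ν) : Continuous (normSqII m n F ν) := by
  rw [continuous_iff_continuousAt]
  intro p
  have hc := hF.smooth.continuous
  have hp := mem_extChartAt_source (I := 𝓡∂ m) p
  have hy := mem_extChartAt_source (I := 𝓡∂ n) (F p)
  have hLC := isLeviCivitaOn_chart n (F p)
  have hN := continuousAt_normalVec hF hy
  have hΓ := continuousAt_of_target hc hy hLC.smooth_christoffel.continuousOn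
  have hg := continuousAt_of_target hc hy (contDiffOn_chartMetric n (F p)).continuousOn
  have hd := continuousAt_of_domain hc hp hy (contDiffOn_fderivWithin_inCharts hF.smooth p
    (F p)).continuousOn
  have hd2 := continuousAt_of_domain hc hp hy (contDiffOn_fderivWithin_fderivWithin_inCharts
    hF.smooth p (F p)).continuousOn
  have hΓM := continuousAt_of_chart hp isOpen_univ (mem_univ _)
    (k := chartChristoffel m p) (by
      rw [inter_univ]; exact (isLeviCivitaOn_chart m p).smooth_christoffel.continuousOn)
  have hsrc := extChartAt_source_mem_nhds (I := 𝓡∂ m) p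
  have hform : ∀ v w : Euc m, ContinuousAt (fun q => secondFormFrame hF p q v w) p := by
    intro v w
    have key : ContinuousAt (fun q => - chartMetric n (F p) (extChartAt (𝓡∂ n) (F p) (F q))
        (sndPart m n F p (F p) (extChartAt (𝓡∂ m) p q) v w) (normalVec n F ν (F p) q)) p := by
      refine ContinuousAt.neg ((hg.clm_apply ?_).clm_apply hN)
      simp only [sndPart, localSndDeriv]
      have h1 : ContinuousAt (fun q => chartChristoffel n (F p) (inCharts m n F p (F p)
          (extChartAt (𝓡∂ m) p q))) p := by
        refine hΓ.congr ?_
        filter_upwards [hsrc] with q hq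
        rw [inCharts_apply hq]
      refine ContinuousAt.sub (ContinuousAt.add ?_ ?_) ?_
      · exact (hd2.clm_apply continuousAt_const).clm_apply continuousAt_const
      · exact (h1.clm_apply (hd.clm_apply continuousAt_const)).clm_apply
          (hd.clm_apply continuousAt_const)
      · exact hd.clm_apply ((hΓM.clm_apply continuousAt_const).clm_apply continuousAt_const)
    refine key.congr ?_
    filter_upwards [hsrc, hc.continuousAt.preimage_mem_nhds
      (extChartAt_source_mem_nhds (I := 𝓡∂ n) (F p))] with q hq hq'
    exact (secondForm_frame hF hq hq' v w).symm
  have key : ContinuousAt (fun q => ∑ k, ∑ l, (gram m p (extChartAt (𝓡∂ m) p q))⁻¹ k l *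
      ∑ k', ∑ l', (gram m p (extChartAt (𝓡∂ m) p q))⁻¹ k' l'
      * (secondFormFrame hF p q (EuclideanSpace.single k 1) (EuclideanSpace.single k' 1)
        * secondFormFrame hF p q (EuclideanSpace.single l 1) (EuclideanSpace.single l' 1))) p := by
    have hG : ∀ k l, ContinuousAt (fun q => (gram m p (extChartAt (𝓡∂ m) p q))⁻¹ k l) p :=
      fun k l => continuousAt_of_chart hp isOpen_univ (mem_univ _)
        (k := fun z => (gram m p z)⁻¹ k l) (by
        rw [inter_univ]; exact (contDiffOn_gram_inv m p k l).continuousOn)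
    refine tendsto_finsetSum _ fun k _ => tendsto_finsetSum _ fun l _ => ?_
    refine ContinuousAt.mul (hG k l) ?_
    refine tendsto_finsetSum _ fun k' _ => tendsto_finsetSum _ fun l' _ => ?_
    exact ContinuousAt.mul (hG k' l') ((hform _ _).mul (hform _ _))
  refine key.congr ?_
  filter_upwards [hsrc] with q hq
  have hz := (extChartAt (𝓡∂ m) p).map_source hq
  rw [← sum_onb_sq hz (isOrthoBasis_coframe hq (isOrthoBasis_onb q))]
  refine Finset.sum_congr rfl fun i _ => Finset.sum_congr rfl fun j _ => ?_
  have h1 : secondFormFrame hF p q (coframe m p q (onbVec m q i)) (coframe m p q (onbVec m q j))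
      = secondForm hF q (frame m p q (coframe m p q (onbVec m q i)))
        (frame m p q (coframe m p q (onbVec m q j))) := rfl
  rw [h1, frame_coframe m hq, frame_coframe m hq]
  rfl

end Continuity

section BoundaryForm

variable {m n : ℕ} [NeZero m] [NeZero n]
  {M : Type*} [TopologicalSpace M] [ChartedSpace (EuclideanHalfSpace m) M]
  [RiemannianBundle (fun p : M => TangentSpace (𝓡∂ m) p)]
  {X : Type*} [TopologicalSpace X] [ChartedSpace (EuclideanHalfSpace n) X]
  [RiemannianBundle (fun x : X => TangentSpace (𝓡∂ n) x)]
  [IsManifold (𝓡∂ m) ∞ M] [IsManifold (𝓡∂ n) ∞ X]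
  [IsContMDiffRiemannianBundle (𝓡∂ m) ∞ (EuclideanSpace ℝ (Fin m))
      (fun p : M => TangentSpace (𝓡∂ m) p)]
  [IsContMDiffRiemannianBundle (𝓡∂ n) ∞ (EuclideanSpace ℝ (Fin n))
      (fun p : X => TangentSpace (𝓡∂ n) p)]
  {F : M → X} {ν : ∀ p, TangentSpace (𝓡∂ n) (F p)}

lemma boundaryII_eq (p : X) (v w : Euc n) : boundaryII n p v w
    = - metricAt n p (chartChristoffel n p (extChartAt (𝓡∂ n) p p) v w)
        (chartNormal n p (extChartAt (𝓡∂ n) p p)) := by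
  rw [← outwardNormal_eq, ← christoffel_eq n p (mem_extChartAt_target p)]
  rfl

lemma metricAt_chartNormal (p : X) (v : Euc n) :
    metricAt n p v (chartNormal n p (extChartAt (𝓡∂ n) p p))
      = -(Real.sqrt (chartGrad0 n p (extChartAt (𝓡∂ n) p p) 0))⁻¹ * v 0 := by
  rw [metricAt_comm, ← chartMetric_self, chartMetric_normal p (mem_extChartAt_target p)]

/-- The second fundamental form of the boundary in an arbitrary chart. -/
lemma boundaryII_frame {x p : X} (hp : p ∈ (extChartAt (𝓡∂ n) x).source)
    (hb : p ∈ (𝓡∂ n).boundary X) {v w : Euc n} (hv : v 0 = 0) (hw : w 0 = 0) :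
    boundaryII n p (frame n x p v) (frame n x p w)
      = - chartMetric n x (extChartAt (𝓡∂ n) x p)
          (chartChristoffel n x (extChartAt (𝓡∂ n) x p) v w)
          (chartNormal n x (extChartAt (𝓡∂ n) x p)) := by
  have hid : ContMDiff (𝓡∂ n) (𝓡∂ n) ∞ (id : X → X) := contMDiff_id
  have hz : extChartAt (𝓡∂ n) x p ∈ chartDomain n n id x p :=
    mem_chartDomain (F := (id : X → X)) hp (mem_extChartAt_source p)
  have h1 := localSndDeriv_transition n x p hz v w
  rw [fderivWithin_transition n hp, localSndDeriv, fderivWithin_transition n hp,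
    inCharts_apply hp] at h1
  have h2 := fderivWithin_fderivWithin_inCharts_zero hid (fun p hp => hp) hz
    ((mem_boundary_iff hp).1 hb) hv hw
  rw [boundaryII_eq, chartMetric_eq n hp, ← outwardNormal_frame hp hb, ← h1, outwardNormal_eq,
    metricAt_add_left]
  simp only [metricAt_chartNormal, h2, mul_zero, zero_add, id]

/-- The boundaries have the same second fundamental form along a free boundary hypersurface. -/
lemma boundaryII_dAt (hF : IsFBMH m n F ν) {p : M} (hb : p ∈ (𝓡∂ m).boundary M) {v w : Euc m}
    (hv : v 0 = 0) (hw : w 0 = 0) :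
    boundaryII n (F p) (dAt m n F p v) (dAt m n F p w) = boundaryII m p v w := by
  obtain ⟨u, hu, he⟩ := exists_open_chartDomain (m := m) (n := n) hF.smooth.continuous p (F p)
  have hz := mem_chartDomain (F := F) (mem_extChartAt_source (I := 𝓡∂ m) p)
    (mem_extChartAt_source (I := 𝓡∂ n) (F p))
  have h2 := fderivWithin_fderivWithin_inCharts_zero hF.smooth hF.boundary hz
    ((mem_boundary_iff (mem_extChartAt_source p)).1 hb) hv hw
  have h3 := congrArg (fun t => metricAt n (F p) t
    (chartNormal n (F p) (extChartAt (𝓡∂ n) (F p) (F p)))) (localSndDeriv_sub hF p v w)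
  have h4 : chartNormal n (F p) (extChartAt (𝓡∂ n) (F p) (F p))
      = dAt m n F p (chartNormal m p (extChartAt (𝓡∂ m) p p)) := by
    rw [← outwardNormal_eq, ← outwardNormal_eq]
    exact (hF.free_boundary p hb).symm
  beta_reduce at h3
  rw [metricAt_sub_left, localSndDeriv, fderivWithin_inCharts_self hF.smooth, metricAt_add_left,
    inCharts_apply (mem_extChartAt_source p), metricAt_smul_left, metricAt_chartNormal, h2, h4,
    metricAt_dAt hF, metricAt_comm (F p) (nrm n F ν p), metricAt_dAt_normal hF] at h3
  rw [boundaryII_eq, boundaryII_eq, h4]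
  linarith

lemma nrm_zero (hF : IsFBMH m n F ν) {p : M} (hb : p ∈ (𝓡∂ m).boundary M) : nrm n F ν p 0 = 0 := by
  have h1 := hF.normal p (outwardNormal m p)
  rw [hF.free_boundary p hb] at h1
  have h2 : metricAt n (F p) (chartNormal n (F p) (extChartAt (𝓡∂ n) (F p) (F p)))
      (nrm n F ν p) = 0 := by
    rw [← outwardNormal_eq]; exact h1
  rw [metricAt_comm, metricAt_chartNormal] at h2
  have h3 := chartGrad0_normSq_pos (F p) (mem_extChartAt_target (I := 𝓡∂ n) (F p))
  rcases mul_eq_zero.1 h2 with h | h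
  · rw [neg_eq_zero, inv_eq_zero, Real.sqrt_eq_zero h3.le] at h
    exact absurd h h3.ne'
  · exact h

lemma coframe_zero {x p : X} (hp : p ∈ (extChartAt (𝓡∂ n) x).source)
    (hb : p ∈ (𝓡∂ n).boundary X) {w : Euc n} (hw : w 0 = 0) : coframe n x p w 0 = 0 := by
  obtain ⟨c, hc, hcv⟩ := frame_normal hp hb
  have := hcv (coframe n x p w)
  rw [frame_coframe n hp, hw] at this
  exact (mul_eq_zero.1 this.symm).resolve_left hc.ne'

lemma continuousOn_boundaryII_normal (hF : IsFBMH m n F ν) :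
    ContinuousOn (fun p => boundaryII n (F p) (ν p) (ν p)) ((𝓡∂ m).boundary M) := by
  intro p hpb
  have hc := hF.smooth.continuous
  have hy := mem_extChartAt_source (I := 𝓡∂ n) (F p)
  have hLC := isLeviCivitaOn_chart n (F p)
  have hN := continuousAt_normalVec hF hy
  have hΓ := continuousAt_of_target hc hy hLC.smooth_christoffel.continuousOn
  have hg := continuousAt_of_target hc hy (contDiffOn_chartMetric n (F p)).continuousOn
  have h1 : ContDiffOn ℝ ∞ (chartGrad0 n (F p)) (extChartAt (𝓡∂ n) (F p)).target :=
    contDiffOn_chartSharp n (F p) subset_rfl contDiffOn_const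
  have h2 : ContinuousOn (chartNormal n (F p)) (extChartAt (𝓡∂ n) (F p)).target := by
    refine ContinuousOn.smul (ContinuousOn.neg (ContinuousOn.inv₀ (ContinuousOn.sqrt ?_) ?_))
      h1.continuousOn
    · exact (EuclideanSpace.proj (𝕜 := ℝ) (0 : Fin n)).continuous.comp_continuousOn h1.continuousOn
    · intro z hz
      exact (Real.sqrt_pos.2 (chartGrad0_normSq_pos (F p) hz)).ne'
  have hη := continuousAt_of_target hc hy h2
  have key := (((hg.clm_apply ((hΓ.clm_apply hN).clm_apply hN)).clm_apply hη).neg).continuousWithinAt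
    (s := (𝓡∂ m).boundary M)
  have hev : ∀ q ∈ (𝓡∂ m).boundary M, F q ∈ (extChartAt (𝓡∂ n) (F p)).source →
      boundaryII n (F q) (ν q) (ν q) = - chartMetric n (F p) (extChartAt (𝓡∂ n) (F p) (F q))
        (chartChristoffel n (F p) (extChartAt (𝓡∂ n) (F p) (F q)) (normalVec n F ν (F p) q)
          (normalVec n F ν (F p) q)) (chartNormal n (F p) (extChartAt (𝓡∂ n) (F p) (F q))) := by
    intro q hq hqs
    have hz := coframe_zero hqs (hF.boundary q hq) (nrm_zero hF hq)
    have := boundaryII_frame hqs (hF.boundary q hq) hz hz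
    rw [frame_coframe n hqs] at this
    exact this
  refine key.congr_of_eventuallyEq ?_ (hev p hpb hy)
  filter_upwards [self_mem_nhdsWithin, mem_nhdsWithin_of_mem_nhds
    (hc.continuousAt.preimage_mem_nhds (extChartAt_source_mem_nhds (I := 𝓡∂ n) (F p)))] with q hq hq'
  exact hev q hq hq'

end BoundaryForm

section Gluing

variable {X : Type*} [TopologicalSpace X] [SecondCountableTopology X] [MeasurableSpace X]
  [BorelSpace X]

/-- The supremum of a family of measures that live on the members of an open cover and agree on
the overlaps restricts to the members of the family. -/
lemma iSup_measure_apply {μ : X → Measure X} {S : X → Set X} (hS : ∀ x, IsOpen (S x))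
    (hxS : ∀ x, x ∈ S x) (h1 : ∀ x, μ x (S x)ᶜ = 0)
    (h2 : ∀ x y A, MeasurableSet A → A ⊆ S x → A ⊆ S y → μ x A = μ y A)
    {x : X} {A : Set X} (hA : MeasurableSet A) :
    ((⨆ x, μ x) (A ∩ S x) = μ x A) ∧ ((∀ y, μ y A = 0) → (⨆ x, μ x) A = 0) := by
  obtain ⟨s, hs, hsu⟩ := TopologicalSpace.countable_cover_nhds fun x => (hS x).mem_nhds (hxS x)
  have hne : s.Nonempty := by
    by_contra h
    rw [not_nonempty_iff_eq_empty] at h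
    simp only [h, mem_empty_iff_false, iUnion_of_empty, iUnion_empty] at hsu
    exact absurd (mem_univ x) (by rw [← hsu]; simp)
  obtain ⟨f, rfl⟩ := hs.exists_eq_range hne
  have hcov : ⋃ k, S (f k) = univ := by rw [← hsu]; simp
  set D : ℕ → Set X := disjointed fun k => S (f k) with hD
  have hDm : ∀ k, MeasurableSet (D k) := fun k =>
    MeasurableSet.disjointed (fun k => (hS _).measurableSet) k
  have hDd : Pairwise (Function.onFun Disjoint D) := disjoint_disjointed _
  have hDu : ⋃ k, D k = univ := by rw [hD, iUnion_disjointed, hcov]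
  have hDs : ∀ k, D k ⊆ S (f k) := fun k => disjointed_subset _ _
  set N : Measure X := Measure.sum fun k => (μ (f k)).restrict (D k) with hN
  have hNA : ∀ B, MeasurableSet B → N B = ∑' k, μ (f k) (B ∩ D k) := fun B hB => by
    rw [hN, Measure.sum_apply _ hB]
    exact tsum_congr fun k => Measure.restrict_apply hB
  have hS' : ∀ y B, MeasurableSet B → μ y B = μ y (B ∩ S y) := fun y B hB => by
    rw [← measure_inter_add_sdiff B (hS y).measurableSet]
    have : μ y (B \ S y) = 0 := measure_mono_null (fun z hz => hz.2) (h1 y)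
    rw [this, add_zero]
  have hsplit : ∀ y B, MeasurableSet B → μ y B = ∑' k, μ y (B ∩ D k) := fun y B hB => by
    rw [← measure_iUnion (fun i j hij => (hDd hij).mono inter_subset_right inter_subset_right)
      fun k => hB.inter (hDm k), ← inter_iUnion, hDu, inter_univ]
  have hcomp : ∀ y B, MeasurableSet B → μ y B = N (B ∩ S y) := fun y B hB => by
    rw [hS' y B hB, hNA _ (hB.inter (hS y).measurableSet),
      hsplit y _ (hB.inter (hS y).measurableSet)]
    refine tsum_congr fun k => h2 _ _ _ ((hB.inter (hS y).measurableSet).inter (hDm k))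
      (fun z hz => hz.1.2) fun z hz => hDs k hz.2
  have hle : (⨆ x, μ x) ≤ N := iSup_le fun y => Measure.le_iff.2 fun B hB => by
    rw [hcomp y B hB]; exact measure_mono inter_subset_left
  refine ⟨le_antisymm ?_ ?_, fun h0 => ?_⟩
  · rw [hcomp x A hA]; exact hle _
  · rw [hS' x A hA]; exact (le_iSup μ x) _
  · refine le_antisymm ((hle A).trans ?_) bot_le
    rw [hNA A hA]
    simp only [nonpos_iff_eq_zero, ENNReal.tsum_eq_zero]
    exact fun k => measure_mono_null inter_subset_left (h0 _)

variable {ι : Type*} [Fintype ι]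

lemma measurableSet_inter_preimage {V : Type*} [TopologicalSpace V] [MeasurableSpace V]
    [BorelSpace V] {D : Set V} (hD : MeasurableSet D) {ψ : V → X} (hψ : ContinuousOn ψ D)
    {A : Set X} (hA : MeasurableSet A) : MeasurableSet (ψ ⁻¹' A ∩ D) := by
  have h1 : Measurable (D.domRestrict ψ) := hψ.domRestrict.measurable
  have h2 := hD.subtype_image (h1 hA)
  convert h2 using 1
  ext z
  simp [and_comm]

lemma map_param_apply {D : Set (EuclideanSpace ℝ ι)} (hD : MeasurableSet D)
    {ψ : EuclideanSpace ℝ ι → X} (hψ : ContinuousOn ψ D) (ρ : EuclideanSpace ℝ ι → ENNReal)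
    {A : Set X} (hA : MeasurableSet A) :
    Measure.map ψ ((volume.restrict D).withDensity ρ) A = ∫⁻ z in ψ ⁻¹' A ∩ D, ρ z := by
  have h1 : AEMeasurable ψ ((volume.restrict D).withDensity ρ) :=
    (hψ.aemeasurable hD).mono_ac (withDensity_absolutelyContinuous _ _)
  rw [Measure.map_apply_of_aemeasurable h1 hA, withDensity_apply', Measure.restrict_restrict' hD]

lemma map_param_eq {D D' : Set (EuclideanSpace ℝ ι)} (hD : MeasurableSet D)
    (hD' : MeasurableSet D') {ψ ψ' : EuclideanSpace ℝ ι → X} (hψ : ContinuousOn ψ D)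
    (hψ' : ContinuousOn ψ' D') (hinj : InjOn ψ D) (hinj' : InjOn ψ' D')
    (ρ ρ' : EuclideanSpace ℝ ι → ENNReal) {A : Set X} (hA : MeasurableSet A)
    {θ : EuclideanSpace ℝ ι → EuclideanSpace ℝ ι}
    {θ' : EuclideanSpace ℝ ι → EuclideanSpace ℝ ι →L[ℝ] EuclideanSpace ℝ ι}
    (hθ : ∀ z ∈ D, ψ z ∈ A → θ z ∈ D' ∧ ψ' (θ z) = ψ z ∧
      HasFDerivWithinAt θ (θ' z) (ψ ⁻¹' A ∩ D) z ∧
      ρ z = ENNReal.ofReal |(θ' z).det| * ρ' (θ z))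
    (hsurj : ∀ z' ∈ D', ψ' z' ∈ A → ∃ z ∈ D, ψ z = ψ' z') :
    Measure.map ψ ((volume.restrict D).withDensity ρ) A
      = Measure.map ψ' ((volume.restrict D').withDensity ρ') A := by
  rw [map_param_apply hD hψ ρ hA, map_param_apply hD' hψ' ρ' hA]
  have hs := measurableSet_inter_preimage hD hψ hA
  have himg : ψ' ⁻¹' A ∩ D' = θ '' (ψ ⁻¹' A ∩ D) := by
    ext z'
    constructor
    · rintro ⟨h1, h2⟩
      obtain ⟨z, hz, hzz⟩ := hsurj z' h2 h1
      have hzA : ψ z ∈ A := by rw [hzz]; exact h1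
      obtain ⟨h3, h4, -, -⟩ := hθ z hz hzA
      exact ⟨z, ⟨hzA, hz⟩, hinj' h3 h2 (h4.trans hzz)⟩
    · rintro ⟨z, ⟨h1, h2⟩, rfl⟩
      obtain ⟨h3, h4, -, -⟩ := hθ z h2 h1
      refine ⟨?_, h3⟩
      rw [mem_preimage, h4]; exact h1
  have hinjθ : InjOn θ (ψ ⁻¹' A ∩ D) := by
    intro z hz w hw h
    apply hinj hz.2 hw.2
    rw [← (hθ z hz.2 hz.1).2.1, ← (hθ w hw.2 hw.1).2.1, h]
  rw [himg, lintegral_image_eq_lintegral_abs_det_fderiv_mul volume hs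
    (fun z hz => (hθ z hz.2 hz.1).2.2.1) hinjθ]
  exact setLIntegral_congr_fun hs fun z hz => (hθ z hz.2 hz.1).2.2.2

/-- Gram determinants under a linear change of variables. -/
lemma det_gram_comp [DecidableEq ι] (B : EuclideanSpace ℝ ι →ₗ[ℝ] EuclideanSpace ℝ ι →ₗ[ℝ] ℝ)
    (L : EuclideanSpace ℝ ι →L[ℝ] EuclideanSpace ℝ ι) :
    (Matrix.of fun i j => B (L (EuclideanSpace.single i 1)) (L (EuclideanSpace.single j 1))).det
      = L.det ^ 2 * (Matrix.of fun i j => B (EuclideanSpace.single i 1)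
        (EuclideanSpace.single j 1)).det := by
  set b := (EuclideanSpace.basisFun ι ℝ).toBasis with hb
  set G : Matrix ι ι ℝ := Matrix.of fun i j => B (EuclideanSpace.single i 1)
        (EuclideanSpace.single j 1) with hG
  have h1 : (Matrix.of fun i j => B (L (EuclideanSpace.single i 1)) (L (EuclideanSpace.single j 1)))
      = (LinearMap.toMatrix b b L.toLinearMap).transpose * G
        * LinearMap.toMatrix b b L.toLinearMap := by
    ext i j
    have h2 : ∀ v : EuclideanSpace ℝ ι, v = ∑ k, v k • EuclideanSpace.single k (1 : ℝ) := by
      intro v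
      conv_lhs => rw [← (EuclideanSpace.basisFun ι ℝ).sum_repr v]
      simp
    simp only [Matrix.of_apply, Matrix.mul_apply, Matrix.transpose_apply, LinearMap.toMatrix_apply]
    conv_lhs => rw [h2 (L (EuclideanSpace.single i 1)), h2 (L (EuclideanSpace.single j 1))]
    simp only [map_sum, map_smul, LinearMap.sum_apply, LinearMap.smul_apply, smul_eq_mul,
      Finset.mul_sum, Finset.sum_mul]
    refine Finset.sum_congr rfl fun k _ => Finset.sum_congr rfl fun l _ => ?_
    simp [hb, hG]
    ring
  rw [h1, Matrix.det_mul, Matrix.det_mul, Matrix.det_transpose, LinearMap.det_toMatrix]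
  have : L.det = LinearMap.det L.toLinearMap := rfl
  rw [this]; ring

end Gluing

section Charts

variable {n : ℕ} [NeZero n] {X : Type*} [TopologicalSpace X]
  [ChartedSpace (EuclideanHalfSpace n) X]
  [RiemannianBundle (fun x : X => TangentSpace (𝓡∂ n) x)]
  [IsManifold (𝓡∂ n) ∞ X]
  [IsContMDiffRiemannianBundle (𝓡∂ n) ∞ (EuclideanSpace ℝ (Fin n))
      (fun p : X => TangentSpace (𝓡∂ n) p)]

lemma measurableSet_target (x : X) : MeasurableSet (extChartAt (𝓡∂ n) x).target := by
  obtain ⟨O, hO, he⟩ := exists_open_target n x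
  rw [he]
  refine hO.measurableSet.inter (IsClosed.measurableSet ?_)
  exact isClosed_le continuous_const (EuclideanSpace.proj (𝕜 := ℝ) (0 : Fin n)).continuous

variable (n) in
/-- The Riemannian density in the chart at `x`. -/
def chartDensity (x : X) (z : Euc n) : ℝ := Real.sqrt (gram n x z).det

lemma transition_facts {x y : X} {z : Euc n} (hz : z ∈ (extChartAt (𝓡∂ n) x).target)
    (hzy : (extChartAt (𝓡∂ n) x).symm z ∈ (extChartAt (𝓡∂ n) y).source) :
    inCharts n n id x y z ∈ (extChartAt (𝓡∂ n) y).target ∧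
    (extChartAt (𝓡∂ n) y).symm (inCharts n n id x y z) = (extChartAt (𝓡∂ n) x).symm z ∧
    HasFDerivWithinAt (inCharts n n id x y)
      (fderivWithin ℝ (inCharts n n id x y) (extChartAt (𝓡∂ n) x).target z)
      (extChartAt (𝓡∂ n) x).target z ∧
    (∀ v w, chartMetric n x z v w = chartMetric n y (inCharts n n id x y z)
      (fderivWithin ℝ (inCharts n n id x y) (extChartAt (𝓡∂ n) x).target z v)
      (fderivWithin ℝ (inCharts n n id x y) (extChartAt (𝓡∂ n) x).target z w)) := by
  have hid : ContMDiff (𝓡∂ n) (𝓡∂ n) ∞ (id : X → X) := contMDiff_id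
  have hd : z ∈ chartDomain n n id x y := ⟨hz, hzy⟩
  obtain ⟨u, hu, he⟩ := exists_open_chartDomain (m := n) (n := n) hid.continuous x y
  have hd' := hd
  rw [he] at hd'
  refine ⟨(extChartAt (𝓡∂ n) y).map_source hzy, (extChartAt (𝓡∂ n) y).left_inv hzy, ?_, ?_⟩
  · have h1 := diffWithinAt_of_smooth (contDiffOn_inCharts hid x y) hd
    have h2 : DifferentiableWithinAt ℝ (inCharts n n id x y)
        ((extChartAt (𝓡∂ n) x).target ∩ u) z := by rw [← he]; exact h1
    exact ((differentiableWithinAt_inter (hu.mem_nhds hd'.2)).1 h2).hasFDerivWithinAt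
  · intro v w
    have h3 := isometric_inCharts hid (isIsometric_id n) x y z hd v w
    rw [he, fderivWithin_inter_open hu _ hd'.2] at h3
    exact h3.symm

lemma chartDensity_transition {x y : X} {z : Euc n} (hz : z ∈ (extChartAt (𝓡∂ n) x).target)
    (hzy : (extChartAt (𝓡∂ n) x).symm z ∈ (extChartAt (𝓡∂ n) y).source) :
    chartDensity n x z = |(fderivWithin ℝ (inCharts n n id x y)
      (extChartAt (𝓡∂ n) x).target z).det| * chartDensity n y (inCharts n n id x y z) := by
  obtain ⟨h1, -, -, h4⟩ := transition_facts hz hzy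
  have h5 := det_gram_comp (LinearMap.mk₂ ℝ
    (fun v w => chartMetric n y (inCharts n n id x y z) v w)
    (fun v v' w => by simp only [map_add, add_apply]) (fun c v w => by simp only [map_smul, smul_apply])
      (fun v w w' => by simp only [map_add]) (fun c v w => by simp only [map_smul]))
    (fderivWithin ℝ (inCharts n n id x y) (extChartAt (𝓡∂ n) x).target z)
  simp only [LinearMap.mk₂_apply, ← h4] at h5
  have h6 : gram n x z = Matrix.of fun i j => chartMetric n x z (EuclideanSpace.single i 1)
    (EuclideanSpace.single j 1) := rfl
  have h7 : gram n y (inCharts n n id x y z) = Matrix.of fun i j =>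
    chartMetric n y (inCharts n n id x y z) (EuclideanSpace.single i 1)
    (EuclideanSpace.single j 1) := rfl
  rw [chartDensity, chartDensity, h6, h5, ← h7, Real.sqrt_mul (sq_nonneg _), Real.sqrt_sq_eq_abs]

variable (n) in
/-- The inclusion of the hyperplane, as a continuous linear map. -/
def inclCLM : EuclideanSpace ℝ {i : Fin n // i ≠ 0} →L[ℝ] Euc n :=
  LinearMap.toContinuousLinearMap
    { toFun := bdryIncl n
      map_add' := fun v w => by ext i; by_cases h : i = 0 <;> simp [bdryIncl, h]
      map_smul' := fun c v => by ext i; by_cases h : i = 0 <;> simp [bdryIncl, h] }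

lemma inclCLM_apply (y : EuclideanSpace ℝ {i : Fin n // i ≠ 0}) : inclCLM n y = bdryIncl n y := rfl

variable (n) in
/-- The projection to the hyperplane. -/
def projCLM : Euc n →L[ℝ] EuclideanSpace ℝ {i : Fin n // i ≠ 0} :=
  LinearMap.toContinuousLinearMap
    { toFun := fun v => WithLp.toLp 2 fun i => v i.1
      map_add' := fun v w => by ext i; simp
      map_smul' := fun c v => by ext i; simp }

lemma projCLM_apply (v : Euc n) (i : {i : Fin n // i ≠ 0}) : projCLM n v i = v i.1 := rfl

lemma bdryIncl_zero (y : EuclideanSpace ℝ {i : Fin n // i ≠ 0}) : bdryIncl n y 0 = 0 := by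
  simp [bdryIncl]

lemma bdryIncl_coord (y : EuclideanSpace ℝ {i : Fin n // i ≠ 0}) {i : Fin n} (hi : i ≠ 0) :
    bdryIncl n y i = y ⟨i, hi⟩ := by simp [bdryIncl, hi]

lemma projCLM_incl (y : EuclideanSpace ℝ {i : Fin n // i ≠ 0}) :
    projCLM n (bdryIncl n y) = y := by
  ext i; rw [projCLM_apply, bdryIncl_coord y i.2]

lemma incl_projCLM {v : Euc n} (hv : v 0 = 0) : bdryIncl n (projCLM n v) = v := by
  ext i
  by_cases h : i = 0
  · rw [h, bdryIncl_zero, hv]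
  · rw [bdryIncl_coord _ h]; rfl

lemma continuous_bdryIncl : Continuous (bdryIncl n) := (inclCLM n).continuous

lemma bdryIncl_injective : Function.Injective (bdryIncl n) :=
  Function.LeftInverse.injective projCLM_incl

lemma bdryIncl_single (i : {i : Fin n // i ≠ 0}) :
    bdryIncl n (EuclideanSpace.single i 1) = EuclideanSpace.single i.1 1 := by
  ext j
  by_cases h : j = 0
  · subst h; rw [bdryIncl_zero]; simp [i.2.symm]
  · rw [bdryIncl_coord _ h]; simp [PiLp.single_apply, Subtype.ext_iff]

variable (n) in
/-- The density of the boundary area in the chart at `x`. -/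
def chartBdryDensity (x : X) (y : EuclideanSpace ℝ {i : Fin n // i ≠ 0}) : ℝ :=
  Real.sqrt ((gram n x (bdryIncl n y)).submatrix (Subtype.val : {i : Fin n // i ≠ 0} → Fin n)
          Subtype.val).det

variable (n) in
/-- The transition map of boundary charts. -/
def bdryTransition (x y : X) (v : EuclideanSpace ℝ {i : Fin n // i ≠ 0}) :
    EuclideanSpace ℝ {i : Fin n // i ≠ 0} := projCLM n (inCharts n n id x y (bdryIncl n v))

variable (n) in
/-- The derivative of the transition map of boundary charts. -/
def bdryTransitionDeriv (x y : X) (v : EuclideanSpace ℝ {i : Fin n // i ≠ 0}) :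
    EuclideanSpace ℝ {i : Fin n // i ≠ 0} →L[ℝ] EuclideanSpace ℝ {i : Fin n // i ≠ 0} :=
  (projCLM n).comp ((fderivWithin ℝ (inCharts n n id x y)
      (extChartAt (𝓡∂ n) x).target (bdryIncl n v)).comp (inclCLM n))

lemma inCharts_id_zero {x y : X} {z : Euc n} (hz : z ∈ (extChartAt (𝓡∂ n) x).target)
    (hzy : (extChartAt (𝓡∂ n) x).symm z ∈ (extChartAt (𝓡∂ n) y).source) (h0 : z 0 = 0) :
    inCharts n n id x y z 0 = 0 := by
  have hs := (extChartAt (𝓡∂ n) x).map_target hz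
  have h1 := (mem_boundary_iff hs).2 (by rw [(extChartAt (𝓡∂ n) x).right_inv hz]; exact h0)
  exact (mem_boundary_iff hzy).1 h1

lemma bdryTransition_facts {x y : X} {v : EuclideanSpace ℝ {i : Fin n // i ≠ 0}}
    (hz : bdryIncl n v ∈ (extChartAt (𝓡∂ n) x).target)
    (hzy : (extChartAt (𝓡∂ n) x).symm (bdryIncl n v) ∈ (extChartAt (𝓡∂ n) y).source) :
    bdryIncl n (bdryTransition n x y v) = inCharts n n id x y (bdryIncl n v) ∧
    HasFDerivWithinAt (bdryTransition n x y) (bdryTransitionDeriv n x y v)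
      (bdryIncl n ⁻¹' (extChartAt (𝓡∂ n) x).target) v ∧
    chartBdryDensity n x v = |(bdryTransitionDeriv n x y v).det|
      * chartBdryDensity n y (bdryTransition n x y v) := by
  obtain ⟨h1, h2, h3, h4⟩ := transition_facts hz hzy
  have h5 := inCharts_id_zero hz hzy (bdryIncl_zero v)
  have h6 : bdryIncl n (bdryTransition n x y v) = inCharts n n id x y (bdryIncl n v) :=
    incl_projCLM h5
  refine ⟨h6, ?_, ?_⟩
  · have h7 : HasFDerivWithinAt (bdryIncl n) (inclCLM n)
      (bdryIncl n ⁻¹' (extChartAt (𝓡∂ n) x).target) v := (inclCLM n).hasFDerivWithinAt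
    exact (projCLM n).hasFDerivAt.comp_hasFDerivWithinAt v (h3.comp v h7 fun w hw => hw)
  · have hid : ContMDiff (𝓡∂ n) (𝓡∂ n) ∞ (id : X → X) := contMDiff_id
    have h7 : ∀ w, bdryIncl n (bdryTransitionDeriv n x y v w) = fderivWithin ℝ
        (inCharts n n id x y) (extChartAt (𝓡∂ n) x).target (bdryIncl n v) (bdryIncl n w) := by
      intro w
      exact incl_projCLM (fderivWithin_inCharts_zero hid (fun p hp => hp) (x := x) (y := y)
        (z := bdryIncl n v) ⟨hz, hzy⟩ (bdryIncl_zero v) (bdryIncl_zero w))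
    have h8 := det_gram_comp (LinearMap.mk₂ ℝ
      (fun a b => chartMetric n y (inCharts n n id x y (bdryIncl n v)) (inclCLM n a) (inclCLM n b))
      (fun v v' w => by simp only [map_add, add_apply]) (fun c v w => by simp only [map_smul, smul_apply])
      (fun v w w' => by simp only [map_add]) (fun c v w => by simp only [map_smul]))
      (bdryTransitionDeriv n x y v)
    simp only [LinearMap.mk₂_apply, inclCLM_apply, h7, ← h4, bdryIncl_single] at h8
    have h9 : ∀ (a : X) (w : Euc n), (gram n a w).submatrix (Subtype.val : {i : Fin n // i ≠ 0} → Fin n)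
          Subtype.val = Matrix.of fun (i j : {i : Fin n // i ≠ 0}) => chartMetric n a w (EuclideanSpace.single i.1 1)
          (EuclideanSpace.single j.1 1) := fun a w => rfl
    rw [chartBdryDensity, chartBdryDensity, h6, h9, h8, ← h9, Real.sqrt_mul (sq_nonneg _),
      Real.sqrt_sq_eq_abs]

end Charts

section Volume

variable {n : ℕ} [NeZero n] {X : Type*} [TopologicalSpace X]
  [ChartedSpace (EuclideanHalfSpace n) X]
  [RiemannianBundle (fun x : X => TangentSpace (𝓡∂ n) x)]
  [IsManifold (𝓡∂ n) ∞ X]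
  [IsContMDiffRiemannianBundle (𝓡∂ n) ∞ (EuclideanSpace ℝ (Fin n))
      (fun p : X => TangentSpace (𝓡∂ n) p)]

variable [SecondCountableTopology X] [MeasurableSpace X] [BorelSpace X]

lemma chartVolume_apply (x : X) {A : Set X} (hA : MeasurableSet A) :
    chartVolume n x A = ∫⁻ z in (extChartAt (𝓡∂ n) x).symm ⁻¹' A ∩ (extChartAt (𝓡∂ n) x).target,
      ENNReal.ofReal (chartDensity n x z) :=
  map_param_apply (measurableSet_target x) (continuousOn_extChartAt_symm x) _ hA

variable (n) in
/-- The parametrization of the boundary. -/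
def bdryParam (x : X) (y : EuclideanSpace ℝ {i : Fin n // i ≠ 0}) : X :=
  (extChartAt (𝓡∂ n) x).symm (bdryIncl n y)

variable (n) in
/-- The domain of the parametrization of the boundary. -/
def bdryTarget (x : X) : Set (EuclideanSpace ℝ {i : Fin n // i ≠ 0}) :=
  bdryIncl n ⁻¹' (extChartAt (𝓡∂ n) x).target

lemma measurableSet_bdryTarget (x : X) : MeasurableSet (bdryTarget n x) :=
  continuous_bdryIncl.measurable (measurableSet_target x)

lemma continuousOn_bdryParam (x : X) : ContinuousOn (bdryParam n x) (bdryTarget n x) :=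
  (continuousOn_extChartAt_symm x).comp continuous_bdryIncl.continuousOn fun _ h => h

lemma injOn_bdryParam (x : X) : InjOn (bdryParam n x) (bdryTarget n x) := fun _ ha _ hb h =>
  bdryIncl_injective ((extChartAt (𝓡∂ n) x).symm.injOn ha hb h)

lemma chartBdryArea_eq (x : X) : chartBdryArea n x = Measure.map (bdryParam n x)
    ((volume.restrict (bdryTarget n x)).withDensity
      fun y => ENNReal.ofReal (chartBdryDensity n x y)) := rfl

lemma chartBdryArea_apply (x : X) {A : Set X} (hA : MeasurableSet A) :
    chartBdryArea n x A = ∫⁻ y in bdryParam n x ⁻¹' A ∩ bdryTarget n x,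
      ENNReal.ofReal (chartBdryDensity n x y) :=
  map_param_apply (measurableSet_bdryTarget x) (continuousOn_bdryParam x) _ hA

lemma chartVolume_overlap (x y : X) (A : Set X) (hA : MeasurableSet A)
    (hx : A ⊆ (extChartAt (𝓡∂ n) x).source) (hy : A ⊆ (extChartAt (𝓡∂ n) y).source) :
    chartVolume n x A = chartVolume n y A := by
  refine map_param_eq (measurableSet_target x) (measurableSet_target y)
    (continuousOn_extChartAt_symm x) (continuousOn_extChartAt_symm y)
    (extChartAt (𝓡∂ n) x).symm.injOn (extChartAt (𝓡∂ n) y).symm.injOn _ _ hA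
    (θ := inCharts n n id x y) (θ' := fderivWithin ℝ (inCharts n n id x y)
      (extChartAt (𝓡∂ n) x).target) (fun z hz hzA => ?_) fun z hz hzA => ?_
  · obtain ⟨h1, h2, h3, -⟩ := transition_facts hz (hy hzA)
    refine ⟨h1, h2, h3.mono inter_subset_right, ?_⟩
    rw [← ENNReal.ofReal_mul (abs_nonneg _)]
    exact congrArg _ (chartDensity_transition hz (hy hzA))
  · exact ⟨extChartAt (𝓡∂ n) x ((extChartAt (𝓡∂ n) y).symm z),
      (extChartAt (𝓡∂ n) x).map_source (hx hzA), (extChartAt (𝓡∂ n) x).left_inv (hx hzA)⟩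

lemma bdryParam_mem_boundary (x : X) {y : EuclideanSpace ℝ {i : Fin n // i ≠ 0}}
    (hy : y ∈ bdryTarget n x) : bdryParam n x y ∈ (𝓡∂ n).boundary X := by
  refine (mem_boundary_iff ((extChartAt (𝓡∂ n) x).map_target hy)).2 ?_
  rw [(extChartAt (𝓡∂ n) x).right_inv hy, bdryIncl_zero]

lemma exists_bdryParam {x p : X} (hp : p ∈ (extChartAt (𝓡∂ n) x).source)
    (hb : p ∈ (𝓡∂ n).boundary X) : projCLM n (extChartAt (𝓡∂ n) x p) ∈ bdryTarget n x ∧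
      bdryParam n x (projCLM n (extChartAt (𝓡∂ n) x p)) = p := by
  have h1 := incl_projCLM ((mem_boundary_iff hp).1 hb)
  refine ⟨?_, ?_⟩
  · rw [bdryTarget, mem_preimage, h1]; exact (extChartAt (𝓡∂ n) x).map_source hp
  · rw [bdryParam, h1, (extChartAt (𝓡∂ n) x).left_inv hp]

lemma chartBdryArea_overlap (x y : X) (A : Set X) (hA : MeasurableSet A)
    (hx : A ⊆ (extChartAt (𝓡∂ n) x).source) (hy : A ⊆ (extChartAt (𝓡∂ n) y).source) :
    chartBdryArea n x A = chartBdryArea n y A := by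
  refine map_param_eq (measurableSet_bdryTarget x) (measurableSet_bdryTarget y)
    (continuousOn_bdryParam x) (continuousOn_bdryParam y)
    (injOn_bdryParam x) (injOn_bdryParam y) _ _ hA
    (θ := bdryTransition n x y) (θ' := bdryTransitionDeriv n x y) (fun z hz hzA => ?_)
    fun z hz hzA => ?_
  · obtain ⟨h1, h2, -, -⟩ := transition_facts hz (hy hzA)
    obtain ⟨h3, h4, h5⟩ := bdryTransition_facts hz (hy hzA)
    refine ⟨?_, ?_, h4.mono inter_subset_right, ?_⟩
    · change bdryIncl n _ ∈ (extChartAt (𝓡∂ n) y).target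
      rw [h3]; exact h1
    · rw [bdryParam, h3]; exact h2
    · rw [← ENNReal.ofReal_mul (abs_nonneg _)]
      exact congrArg _ h5
  · obtain ⟨h1, h2⟩ := exists_bdryParam (hx hzA) (bdryParam_mem_boundary y hz)
    exact ⟨_, h1, h2⟩

lemma chartVolume_compl (x : X) : chartVolume n x (extChartAt (𝓡∂ n) x).sourceᶜ = 0 := by
  rw [chartVolume_apply x (isOpen_extChartAt_source x).measurableSet.compl]
  have : (extChartAt (𝓡∂ n) x).symm ⁻¹' (extChartAt (𝓡∂ n) x).sourceᶜ
      ∩ (extChartAt (𝓡∂ n) x).target = ∅ := by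
    ext z
    simp only [mem_inter_iff, mem_preimage, mem_compl_iff, mem_empty_iff_false, iff_false, not_and]
    intro h h2
    exact h ((extChartAt (𝓡∂ n) x).map_target h2)
  rw [this]; simp

lemma chartBdryArea_compl (x : X) : chartBdryArea n x (extChartAt (𝓡∂ n) x).sourceᶜ = 0 := by
  rw [chartBdryArea_apply x (isOpen_extChartAt_source x).measurableSet.compl]
  have : bdryParam n x ⁻¹' (extChartAt (𝓡∂ n) x).sourceᶜ ∩ bdryTarget n x = ∅ := by
    ext z
    simp only [mem_inter_iff, mem_preimage, mem_compl_iff, mem_empty_iff_false, iff_false, not_and]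
    intro h h2
    exact h ((extChartAt (𝓡∂ n) x).map_target h2)
  rw [this]; simp

/-- In a chart domain, the volume is the chart volume. -/
lemma vol_restrict (x : X) :
    (vol n X).restrict (extChartAt (𝓡∂ n) x).source = chartVolume n x := by
  ext A hA
  rw [Measure.restrict_apply hA]
  exact (iSup_measure_apply (μ := chartVolume n (X := X))
    (fun y => isOpen_extChartAt_source (I := 𝓡∂ n) y) (fun y => mem_extChartAt_source y)
    chartVolume_compl chartVolume_overlap (x := x) hA).1

lemma bdryArea_restrict (x : X) :
    (bdryArea n X).restrict (extChartAt (𝓡∂ n) x).source = chartBdryArea n x := by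
  ext A hA
  rw [Measure.restrict_apply hA]
  exact (iSup_measure_apply (μ := chartBdryArea n (X := X))
    (fun y => isOpen_extChartAt_source (I := 𝓡∂ n) y) (fun y => mem_extChartAt_source y)
    chartBdryArea_compl chartBdryArea_overlap (x := x) hA).1

lemma measurableSet_boundary : MeasurableSet ((𝓡∂ n).boundary X) :=
  ((𝓡∂ n).isClosed_boundary (n := ∞) (by simp)).measurableSet

lemma vol_boundary : vol n X ((𝓡∂ n).boundary X) = 0 := by
  rcases ((𝓡∂ n).boundary X).eq_empty_or_nonempty with h | ⟨x, -⟩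
  · rw [h, measure_empty]
  refine (iSup_measure_apply (μ := chartVolume n (X := X))
    (fun y => isOpen_extChartAt_source (I := 𝓡∂ n) y) (fun y => mem_extChartAt_source y)
    chartVolume_compl chartVolume_overlap (x := x) measurableSet_boundary).2 fun y => ?_
  rw [chartVolume_apply y measurableSet_boundary]
  refine setLIntegral_measure_zero _ _ (measure_mono_null (t := (LinearMap.ker
    (proj0 n).toLinearMap : Set (Euc n))) ?_ (Measure.addHaar_submodule _ _ ?_))
  · rintro z ⟨h1, h2⟩
    have h3 := (mem_boundary_iff ((extChartAt (𝓡∂ n) y).map_target h2)).1 h1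
    rw [(extChartAt (𝓡∂ n) y).right_inv h2] at h3
    exact h3
  · intro h
    have h1 : (EuclideanSpace.single 0 1 : Euc n) ∈ LinearMap.ker (proj0 n).toLinearMap := by
      rw [h]; trivial
    have h2 : proj0 n (EuclideanSpace.single 0 1) = 0 := h1
    simp [proj0] at h2

lemma bdryArea_interior : bdryArea n X ((𝓡∂ n).boundary X)ᶜ = 0 := by
  rcases isEmpty_or_nonempty X with h | ⟨⟨x⟩⟩
  · rw [Set.eq_empty_of_isEmpty ((𝓡∂ n).boundary X)ᶜ, measure_empty]
  refine (iSup_measure_apply (μ := chartBdryArea n (X := X))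
    (fun y => isOpen_extChartAt_source (I := 𝓡∂ n) y) (fun y => mem_extChartAt_source y)
    chartBdryArea_compl chartBdryArea_overlap (x := x) measurableSet_boundary.compl).2 fun y => ?_
  rw [chartBdryArea_apply y measurableSet_boundary.compl]
  have : bdryParam n y ⁻¹' ((𝓡∂ n).boundary X)ᶜ ∩ bdryTarget n y = ∅ := by
    ext z
    simp only [mem_inter_iff, mem_preimage, mem_compl_iff, mem_empty_iff_false, iff_false, not_and]
    intro h h2
    exact h (bdryParam_mem_boundary y h2)
  rw [this]; simp

lemma continuousOn_chartDensity (x : X) :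
    ContinuousOn (chartDensity n x) (extChartAt (𝓡∂ n) x).target :=
  (contDiffOn_det fun i j => contDiffOn_gram n x i j).continuousOn.sqrt

variable (n) in
/-- The determinant of the Gram matrix of the hyperplane directions. -/
def subGramDet (x : X) (z : Euc n) : ℝ := ((gram n x z).submatrix
      (Subtype.val : {i : Fin n // i ≠ 0} → Fin n) Subtype.val).det

lemma contDiffOn_subGramDet (x : X) :
    ContDiffOn ℝ ∞ (subGramDet n x) (extChartAt (𝓡∂ n) x).target :=
  contDiffOn_det (A := fun z => (gram n x z).submatrix
    (Subtype.val : {i : Fin n // i ≠ 0} → Fin n) Subtype.val)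
    fun i j => contDiffOn_gram n x i.1 j.1

lemma continuousOn_chartBdryDensity (x : X) :
    ContinuousOn (chartBdryDensity n x) (bdryTarget n x) := by
  exact (contDiffOn_subGramDet x).continuousOn.sqrt.comp continuous_bdryIncl.continuousOn
    fun _ h => h

lemma lintegral_finite_of_bound {ι : Type*} [Fintype ι] {A : Set (EuclideanSpace ℝ ι)}
    (hAm : MeasurableSet A)
    (hA : Bornology.IsBounded A) {ρ : EuclideanSpace ℝ ι → ℝ} {c : ℝ} (h : ∀ z ∈ A, ρ z ≤ c) :
    ∫⁻ z in A, ENNReal.ofReal (ρ z) < ⊤ := by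
  refine lt_of_le_of_lt (setLIntegral_mono' hAm fun z hz => ENNReal.ofReal_le_ofReal (h z hz)) ?_
  rw [setLIntegral_const]
  exact ENNReal.mul_lt_top ENNReal.ofReal_lt_top hA.measure_lt_top

lemma norm_le_norm_bdryIncl (y : EuclideanSpace ℝ {i : Fin n // i ≠ 0}) :
    ‖y‖ ≤ ‖(projCLM n)‖ * ‖bdryIncl n y‖ := by
  conv_lhs => rw [← projCLM_incl y]
  exact (projCLM n).le_opNorm _

lemma exists_good_nhds (x : X) {k : Euc n → ℝ}
    (hk : ContinuousOn k (extChartAt (𝓡∂ n) x).target) : ∃ u : Set (Euc n), IsOpen u ∧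
      extChartAt (𝓡∂ n) x x ∈ u ∧ Bornology.IsBounded u ∧ ∃ c, ∀ z ∈ (extChartAt (𝓡∂ n) x).target,
      z ∈ u → k z ≤ c := by
  have hz := mem_extChartAt_target (I := 𝓡∂ n) x
  have h1 := (hk _ hz).eventually_lt (continuousWithinAt_const (b := k (extChartAt (𝓡∂ n) x x) + 1))
    (by linarith)
  obtain ⟨u, hu, hzu, hsub⟩ := mem_nhdsWithin.1 h1
  refine ⟨u ∩ Metric.ball (extChartAt (𝓡∂ n) x x) 1, hu.inter Metric.isOpen_ball,
    ⟨hzu, Metric.mem_ball_self one_pos⟩, Metric.isBounded_ball.subset inter_subset_right,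
    k (extChartAt (𝓡∂ n) x x) + 1, fun z hz hzu => le_of_lt (hsub ⟨hzu.1, hz⟩)⟩

instance : IsLocallyFiniteMeasure (vol n X) := by
  refine ⟨fun x => ?_⟩
  obtain ⟨u, hu, hxu, hb, c, hc⟩ := exists_good_nhds x (continuousOn_chartDensity (n := n) x)
  have hU : IsOpen ((extChartAt (𝓡∂ n) x).source ∩ extChartAt (𝓡∂ n) x ⁻¹' u) :=
    (continuousOn_extChartAt x).isOpen_inter_preimage (isOpen_extChartAt_source x) hu
  refine ⟨_, hU.mem_nhds ⟨mem_extChartAt_source x, hxu⟩, ?_⟩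
  rw [inter_comm, ← Measure.restrict_apply' (isOpen_extChartAt_source x).measurableSet,
    vol_restrict]
  refine lt_of_le_of_lt (measure_mono (t := (extChartAt (𝓡∂ n) x ⁻¹' u ∩
    (extChartAt (𝓡∂ n) x).source) ∪ (extChartAt (𝓡∂ n) x).sourceᶜ) fun p hp => ?_) ?_
  · by_cases h : p ∈ (extChartAt (𝓡∂ n) x).source
    · exact Or.inl ⟨hp, h⟩
    · exact Or.inr h
  refine lt_of_le_of_lt (measure_union_le _ _) ?_
  rw [chartVolume_compl, add_zero, inter_comm, chartVolume_apply x hU.measurableSet]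
  refine lintegral_finite_of_bound (measurableSet_inter_preimage (measurableSet_target x)
    (continuousOn_extChartAt_symm x) hU.measurableSet) (hb.subset ?_) (c := c) ?_
  · rintro z ⟨h1, h2⟩
    have := h1.2
    rwa [mem_preimage, (extChartAt (𝓡∂ n) x).right_inv h2] at this
  · rintro z ⟨h1, h2⟩
    have := h1.2
    rw [mem_preimage, (extChartAt (𝓡∂ n) x).right_inv h2] at this
    exact hc z h2 this

instance : IsLocallyFiniteMeasure (bdryArea n X) := by
  refine ⟨fun x => ?_⟩
  obtain ⟨u, hu, hxu, hb, c, hc⟩ := exists_good_nhds x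
    (contDiffOn_subGramDet (n := n) x).continuousOn.sqrt
  have hU : IsOpen ((extChartAt (𝓡∂ n) x).source ∩ extChartAt (𝓡∂ n) x ⁻¹' u) :=
    (continuousOn_extChartAt x).isOpen_inter_preimage (isOpen_extChartAt_source x) hu
  refine ⟨_, hU.mem_nhds ⟨mem_extChartAt_source x, hxu⟩, ?_⟩
  rw [inter_comm, ← Measure.restrict_apply' (isOpen_extChartAt_source x).measurableSet,
    bdryArea_restrict]
  refine lt_of_le_of_lt (measure_mono (t := (extChartAt (𝓡∂ n) x ⁻¹' u ∩
    (extChartAt (𝓡∂ n) x).source) ∪ (extChartAt (𝓡∂ n) x).sourceᶜ) fun p hp => ?_) ?_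
  · by_cases h : p ∈ (extChartAt (𝓡∂ n) x).source
    · exact Or.inl ⟨hp, h⟩
    · exact Or.inr h
  refine lt_of_le_of_lt (measure_union_le _ _) ?_
  rw [chartBdryArea_compl, add_zero, inter_comm, chartBdryArea_apply x hU.measurableSet]
  have hmem : ∀ y ∈ bdryParam n x ⁻¹' ((extChartAt (𝓡∂ n) x).source ∩ extChartAt (𝓡∂ n) x ⁻¹' u)
      ∩ bdryTarget n x, bdryIncl n y ∈ u := by
    rintro y ⟨h1, h2⟩
    have := h1.2
    rwa [mem_preimage, bdryParam, (extChartAt (𝓡∂ n) x).right_inv h2] at this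
  refine lintegral_finite_of_bound (measurableSet_inter_preimage (measurableSet_bdryTarget x)
    (continuousOn_bdryParam x) hU.measurableSet) ?_ (c := c) ?_
  · obtain ⟨R, hR⟩ := hb.exists_norm_le
    refine (Metric.isBounded_closedBall (x := 0) (r := ‖(projCLM n)‖ * R)).subset fun y hy => ?_
    rw [mem_closedBall_zero_iff]
    exact (norm_le_norm_bdryIncl y).trans
      (mul_le_mul_of_nonneg_left (hR _ (hmem y hy)) (norm_nonneg _))
  · intro y hy
    exact hc _ hy.2 (hmem y hy)

/-- The integral of a function that vanishes outside of a chart domain. -/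
lemma integral_vol_chart (x : X) {f : X → ℝ} (hf : Continuous f)
    (h0 : ∀ p ∉ (extChartAt (𝓡∂ n) x).source, f p = 0) :
    ∫ p, f p ∂(vol n X) = ∫ z in (extChartAt (𝓡∂ n) x).target,
      chartDensity n x z * f ((extChartAt (𝓡∂ n) x).symm z) := by
  rw [← setIntegral_eq_integral_of_forall_compl_eq_zero h0, vol_restrict, chartVolume,
    integral_map ((continuousOn_extChartAt_symm x).aemeasurable (measurableSet_target x) |>.mono_ac
      (withDensity_absolutelyContinuous _ _)) hf.aestronglyMeasurable]
  have hm : AEMeasurable (fun z => ENNReal.ofReal (chartDensity n x z))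
      (volume.restrict (extChartAt (𝓡∂ n) x).target) :=
    ((continuousOn_chartDensity x).aemeasurable (measurableSet_target x)).ennreal_ofReal
  refine (integral_withDensity_eq_integral_toReal_smul₀ hm
    (Filter.Eventually.of_forall fun z => ENNReal.ofReal_lt_top) _).trans ?_
  refine integral_congr_ae (Filter.Eventually.of_forall fun z => ?_)
  simp only [smul_eq_mul]
  rw [chartDensity, ENNReal.toReal_ofReal (Real.sqrt_nonneg _)]

lemma integral_bdryArea_chart (x : X) {f : X → ℝ} (hf : ContinuousOn f ((𝓡∂ n).boundary X))
    (h0 : ∀ p ∉ (extChartAt (𝓡∂ n) x).source, f p = 0) :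
    ∫ p, f p ∂(bdryArea n X) = ∫ y in bdryTarget n x,
      chartBdryDensity n x y * f (bdryParam n x y) := by
  have hms : AEStronglyMeasurable f (bdryArea n X) := by
    have h1 := hf.aestronglyMeasurable (μ := bdryArea n X) measurableSet_boundary
    rwa [Measure.restrict_eq_self_of_ae_mem] at h1
    exact bdryArea_interior
  rw [← setIntegral_eq_integral_of_forall_compl_eq_zero h0, bdryArea_restrict]
  have hms' : AEStronglyMeasurable f (chartBdryArea n x) := by
    rw [← bdryArea_restrict]; exact hms.restrict
  rw [chartBdryArea_eq] at hms' ⊢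
  rw [integral_map ((continuousOn_bdryParam x).aemeasurable (measurableSet_bdryTarget x) |>.mono_ac
      (withDensity_absolutelyContinuous _ _)) hms']
  have hm : AEMeasurable (fun z => ENNReal.ofReal (chartBdryDensity n x z))
      (volume.restrict (bdryTarget n x)) :=
    ((continuousOn_chartBdryDensity x).aemeasurable (measurableSet_bdryTarget x)).ennreal_ofReal
  refine (integral_withDensity_eq_integral_toReal_smul₀ hm
    (Filter.Eventually.of_forall fun z => ENNReal.ofReal_lt_top) _).trans ?_
  refine integral_congr_ae (Filter.Eventually.of_forall fun z => ?_)
  simp only [smul_eq_mul]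
  rw [chartBdryDensity, ENNReal.toReal_ofReal (Real.sqrt_nonneg _)]

end Volume

section HalfSpace

/-- A function that is continuous on a relatively open subset of a set and vanishes outside of a
closed subset extends continuously by zero. -/
lemma continuousOn_indicator_of_closed {E F : Type*} [TopologicalSpace E] [TopologicalSpace F] [Zero F]
    {H O K : Set E} (hO : IsOpen O) (hK : IsClosed K) (hKT : K ⊆ O ∩ H) {k : E → F}
    (hk : ContinuousOn k (O ∩ H)) (h0 : ∀ z ∈ O ∩ H, z ∉ K → k z = 0) :
    ContinuousOn ((O ∩ H).indicator k) H := by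
  intro z hz
  by_cases hzK : z ∈ K
  · have h1 : ContinuousWithinAt k (O ∩ H) z := hk z (hKT hzK)
    have h2 : ContinuousWithinAt ((O ∩ H).indicator k) (O ∩ H) z :=
      h1.congr (fun y hy => indicator_of_mem hy k) (indicator_of_mem (hKT hzK) k)
    rw [inter_comm] at h2 ⊢
    exact (continuousWithinAt_inter (hO.mem_nhds (hKT hzK).1)).1 h2
  · have h1 : ∀ y ∉ K, (O ∩ H).indicator k y = 0 := fun y hy => by
      by_cases h : y ∈ O ∩ H
      · rw [indicator_of_mem h, h0 y h hy]
      · exact indicator_of_notMem h k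
    refine ContinuousAt.continuousWithinAt ?_
    refine (continuousAt_const (y := (0 : F))).congr ?_
    filter_upwards [hK.isOpen_compl.mem_nhds hzK] with y hy
    exact (h1 y hy).symm

lemma bdryIncl_finSucc_equiv (x : Fin 2 → ℝ) :
    bdryIncl 3 (WithLp.toLp 2 (MeasurableEquiv.piCongrLeft (fun _ : {i : Fin 3 // i ≠ 0} => ℝ)
      (finSuccAboveEquiv (0 : Fin 3)) x)) = WithLp.toLp 2 (Fin.insertNth 0 (0 : ℝ) x) := by
  ext i
  refine Fin.cases ?_ (fun j => ?_) i
  · rw [bdryIncl_zero]; simp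
  · rw [bdryIncl_coord _ (Fin.succ_ne_zero j)]
    have h1 : (⟨j.succ, Fin.succ_ne_zero j⟩ : {i : Fin 3 // i ≠ 0})
        = (finSuccAboveEquiv (0 : Fin 3)) j := by
      ext; simp [finSuccAboveEquiv]
    rw [h1]
    have h2 := Equiv.piCongrLeft_apply_apply (fun _ : {i : Fin 3 // i ≠ 0} => ℝ)
      (finSuccAboveEquiv (0 : Fin 3)) x j
    refine h2.trans ?_
    simp

/-- The divergence theorem on the half-space, for vector fields with compact support. -/
lemma integral_divergence_halfSpace {O K : Set (Euc 3)} (hO : IsOpen O) (hK : IsCompact K)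
    (hKT : K ⊆ O ∩ {z | 0 ≤ z 0}) {V : Euc 3 → Euc 3}
    (hV : ContDiffOn ℝ ∞ V (O ∩ {z | 0 ≤ z 0}))
    (hu : UniqueDiffOn ℝ (O ∩ {z : Euc 3 | 0 ≤ z 0}))
    (h0 : ∀ z ∈ O ∩ {z | 0 ≤ z 0}, z ∉ K → V z = 0) :
    ∫ z in O ∩ {z | 0 ≤ z 0}, ∑ i, fderivWithin ℝ V (O ∩ {z | 0 ≤ z 0}) z
        (EuclideanSpace.single i 1) i
      = - ∫ y in bdryIncl 3 ⁻¹' (O ∩ {z | 0 ≤ z 0}), V (bdryIncl 3 y) 0 := by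
  set T : Set (Euc 3) := O ∩ {z | 0 ≤ z 0} with hT
  have hTm : MeasurableSet T := hO.measurableSet.inter (IsClosed.measurableSet
    (isClosed_le continuous_const (EuclideanSpace.proj (𝕜 := ℝ) (0 : Fin 3)).continuous))
  obtain ⟨R, hR0, hR⟩ : ∃ R : ℝ, 0 < R ∧ ∀ z ∈ K, ∀ i, |z i| < R := by
    obtain ⟨R, hR⟩ := hK.isBounded.exists_norm_le
    refine ⟨max R 0 + 1, by positivity, fun z hz i => ?_⟩
    have h1 := (PiLp.norm_apply_le z i).trans (hR z hz)
    rw [Real.norm_eq_abs] at h1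
    exact lt_of_le_of_lt (h1.trans (le_max_left _ _)) (by linarith)
  set W : Euc 3 → Euc 3 := T.indicator V with hW
  set D : Euc 3 → Euc 3 →L[ℝ] Euc 3 := T.indicator (fderivWithin ℝ V T) with hD
  have hD0 : ∀ z ∈ T, z ∉ K → fderivWithin ℝ V T z = 0 := fun z hz hzK => by
    have h1 : fderivWithin ℝ V (T ∩ Kᶜ) z = fderivWithin ℝ V T z :=
      fderivWithin_inter_open hK.isClosed.isOpen_compl V hzK
    rw [← h1, fderivWithin_congr (f := fun _ => (0 : Euc 3)) (fun y hy => h0 y hy.1 hy.2)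
      (h0 z hz hzK), fderivWithin_fun_const]
    rfl
  have hWc : ContinuousOn W {z | 0 ≤ z 0} :=
    continuousOn_indicator_of_closed hO hK.isClosed hKT hV.continuousOn h0
  have hDc : ContinuousOn D {z | 0 ≤ z 0} :=
    continuousOn_indicator_of_closed hO hK.isClosed hKT (smooth_fderivWithin hV hu).continuousOn hD0
  have hW0 : ∀ z ∉ K, W z = 0 := fun z hz => by
    by_cases h : z ∈ T
    · rw [hW, indicator_of_mem h, h0 z h hz]
    · exact indicator_of_notMem h V
  have hD0' : ∀ z ∉ K, D z = 0 := fun z hz => by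
    by_cases h : z ∈ T
    · rw [hD, indicator_of_mem h, hD0 z h hz]
    · exact indicator_of_notMem h _
  have hWD : ∀ z : Euc 3, 0 < z 0 → HasFDerivAt W (D z) z := by
    intro z hz
    by_cases hzT : z ∈ T
    · have hnT : T ∈ 𝓝 z := by
        refine Filter.inter_mem (hO.mem_nhds hzT.1) ?_
        have := (isOpen_lt (f := fun _ : Euc 3 => (0 : ℝ)) (g := fun z : Euc 3 => z 0)
          continuous_const (EuclideanSpace.proj (𝕜 := ℝ) (0 : Fin 3)).continuous).mem_nhds hz
        filter_upwards [this] with y hy using le_of_lt hy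
      have h1 := (diffWithinAt_of_smooth hV hzT).hasFDerivWithinAt.hasFDerivAt hnT
      rw [hD, indicator_of_mem hzT]
      refine h1.congr_of_eventuallyEq ?_
      filter_upwards [hnT] with y hy
      rw [hW, indicator_of_mem hy]
    · have hzK : z ∉ K := fun h => hzT (hKT h)
      rw [hD0' z hzK]
      refine (hasFDerivAt_const (0 : Euc 3) z).congr_of_eventuallyEq ?_
      filter_upwards [hK.isClosed.isOpen_compl.mem_nhds hzK] with y hy
      exact hW0 y hy
  set a : Fin 3 → ℝ := fun i => if i = 0 then 0 else -R with ha
  set b : Fin 3 → ℝ := fun _ => R with hb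
  have hle : a ≤ b := by
    intro i; by_cases h : i = 0 <;> simp only [ha, hb, h, if_true, if_false] <;> linarith
  have ha0 : a 0 = 0 := by simp [ha]
  let eL : (Fin 3 → ℝ) →L[ℝ] Euc 3 := ((PiLp.continuousLinearEquiv 2 ℝ (fun _ : Fin 3 => ℝ)).symm :
    (Fin 3 → ℝ) →L[ℝ] Euc 3)
  have heL : ∀ z, eL z = WithLp.toLp 2 z := fun z => rfl
  have hmaps : MapsTo eL (Icc a b) {z : Euc 3 | 0 ≤ z 0} := by
    intro z hz
    have := hz.1 0
    rw [ha0] at this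
    exact this
  have hsum_cont : ContinuousOn (fun z => ∑ i, D z (EuclideanSpace.single i 1) i)
      {z : Euc 3 | 0 ≤ z 0} := by
    refine continuousOn_finsetSum _ fun i _ => ?_
    exact (EuclideanSpace.proj (𝕜 := ℝ) i).continuous.comp_continuousOn
      (hDc.clm_apply continuousOn_const)
  have key := integral_divergence_of_hasFDerivAt_off_countable' a b hle
    (fun i z => W (eL z) i)
    (fun i z => ((EuclideanSpace.proj (𝕜 := ℝ) i : Euc 3 →L[ℝ] ℝ).comp (D (eL z))).comp eL)
    ∅ countable_empty
    (fun i => (EuclideanSpace.proj (𝕜 := ℝ) i).continuous.comp_continuousOn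
      (hWc.comp eL.continuous.continuousOn hmaps))
    (fun z hz i => by
      have hz0 : 0 < (eL z) 0 := by
        have := (hz.1 0 (mem_univ _)).1
        rwa [ha0] at this
      exact (((EuclideanSpace.proj (𝕜 := ℝ) i : Euc 3 →L[ℝ] ℝ).hasFDerivAt).comp z
        ((hWD _ hz0).comp z eL.hasFDerivAt)))
    (by
      refine ContinuousOn.integrableOn_compact isCompact_Icc ?_
      exact hsum_cont.comp eL.continuous.continuousOn hmaps)
  have hsingle : ∀ i : Fin 3, eL (Pi.single i 1) = EuclideanSpace.single i 1 := fun i => rfl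
  have hlhs : ∫ z in T, ∑ i, fderivWithin ℝ V T z (EuclideanSpace.single i 1) i
      = ∫ x in Icc a b, ∑ i, D (eL x) (eL (Pi.single i 1)) i := by
    rw [setIntegral_eq_integral_of_forall_compl_eq_zero (s := Icc a b)]
    · have h1 := (PiLp.volume_preserving_toLp (Fin 3)).integral_comp
        (MeasurableEquiv.toLp 2 (Fin 3 → ℝ)).measurableEmbedding
        (fun z : Euc 3 => ∑ i, D z (EuclideanSpace.single i 1) i)
      refine Eq.trans ?_ h1.symm
      rw [← integral_indicator hTm]
      congr 1
      ext z
      by_cases h : z ∈ T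
      · rw [indicator_of_mem h, hD]; simp only [indicator_of_mem h]
      · rw [indicator_of_notMem h, hD]; simp [indicator_of_notMem h]
    · intro z hz
      have hzK : eL z ∉ K := by
        intro h
        apply hz
        refine ⟨fun i => ?_, fun i => (abs_lt.1 (hR _ h i)).2.le⟩
        by_cases hi : i = 0
        · subst hi; rw [ha0]; exact (hKT h).2
        · simp only [ha, hi, if_false]; exact (abs_lt.1 (hR _ h i)).1.le
      rw [hD0' _ hzK]; simp
  rw [hlhs]
  refine key.trans ?_
  have hface : ∀ i : Fin 3, ∀ c, |c| = R → ∀ x : Fin 2 → ℝ, W (eL (Fin.insertNth i c x)) i = 0 := by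
    intro i c hc x
    rw [hW0]
    · rfl
    · intro h
      have h1 := hR _ h i
      have h2 : (eL (Fin.insertNth i c x)) i = c := by
        rw [heL]; simp
      rw [h2, hc] at h1
      exact lt_irrefl _ h1
  have hbR : ∀ i : Fin 3, |b i| = R := fun i => abs_of_pos hR0
  have haR : ∀ i : Fin 3, i ≠ 0 → |a i| = R := fun i hi => by
    simp only [ha, hi, if_false, abs_neg]; exact abs_of_pos hR0
  rw [Finset.sum_eq_single_of_mem (0 : Fin 3) (Finset.mem_univ _)]
  · simp only [hface 0 (b 0) (hbR 0), integral_zero, zero_sub, ha0]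
    congr 1
    rw [setIntegral_eq_integral_of_forall_compl_eq_zero]
    · have h1 : MeasurePreserving (fun x : Fin 2 → ℝ => (WithLp.toLp 2
          (MeasurableEquiv.piCongrLeft (fun _ : {i : Fin 3 // i ≠ 0} => ℝ)
          (finSuccAboveEquiv (0 : Fin 3)) x) : EuclideanSpace ℝ {i : Fin 3 // i ≠ 0}))
          volume volume :=
        (PiLp.volume_preserving_toLp {i : Fin 3 // i ≠ 0}).comp
          (volume_measurePreserving_piCongrLeft (fun _ : {i : Fin 3 // i ≠ 0} => ℝ)
            (finSuccAboveEquiv (0 : Fin 3)))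
      have h2 := h1.integral_comp ((MeasurableEquiv.toLp 2
          ({i : Fin 3 // i ≠ 0} → ℝ)).measurableEmbedding.comp
          (MeasurableEquiv.piCongrLeft (fun _ : {i : Fin 3 // i ≠ 0} => ℝ)
            (finSuccAboveEquiv (0 : Fin 3))).measurableEmbedding)
          (fun y => W (bdryIncl 3 y) 0)
      simp only [bdryIncl_finSucc_equiv] at h2
      refine h2.trans ?_
      rw [← integral_indicator (continuous_bdryIncl.measurable hTm)]
      congr 1
      ext y
      by_cases h : bdryIncl 3 y ∈ T
      · rw [indicator_of_mem (show y ∈ bdryIncl 3 ⁻¹' T from h), hW, indicator_of_mem h]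
      · rw [indicator_of_notMem (show y ∉ bdryIncl 3 ⁻¹' T from h), hW, indicator_of_notMem h]
        rfl
    · intro x hx
      rw [hW0]
      · rfl
      · intro h
        apply hx
        have h3 : ∀ j : Fin 2, |x j| < R := fun j => by
          have := hR _ h (Fin.succAbove 0 j)
          rw [heL] at this
          simpa using this
        refine ⟨fun j => ?_, fun j => (abs_lt.1 (h3 j)).2.le⟩
        simp only [Function.comp, ha, Fin.succAbove_ne, if_false]
        exact (abs_lt.1 (h3 j)).1.le
  · intro i _ hi
    simp only [hface i (b i) (hbR i), hface i (a i) (haR i hi), integral_zero, sub_self]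

end HalfSpace

section Green

variable {n : ℕ} [NeZero n] {X : Type*} [TopologicalSpace X]
  [ChartedSpace (EuclideanHalfSpace n) X]
  [RiemannianBundle (fun x : X => TangentSpace (𝓡∂ n) x)]
  [IsManifold (𝓡∂ n) ∞ X]
  [IsContMDiffRiemannianBundle (𝓡∂ n) ∞ (EuclideanSpace ℝ (Fin n))
      (fun p : X => TangentSpace (𝓡∂ n) p)]

lemma trace_eq_sum_coord (L : Euc n →L[ℝ] Euc n) :
    LinearMap.trace ℝ (Euc n) L = ∑ i, L (EuclideanSpace.single i 1) i := by
  rw [LinearMap.trace_eq_matrix_trace ℝ (EuclideanSpace.basisFun (Fin n) ℝ).toBasis, Matrix.trace]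
  refine Finset.sum_congr rfl fun i _ => ?_
  simp [LinearMap.toMatrix_apply]

lemma fderivWithin_gram (x : X) {z : Euc n} (hz : z ∈ (extChartAt (𝓡∂ n) x).target) (v : Euc n)
    (i j : Fin n) : fderivWithin ℝ (fun y => gram n x y i j) (extChartAt (𝓡∂ n) x).target z v
      = ∑ k, chartChristoffel n x z v (EuclideanSpace.single i 1) k * gram n x z k j
        + ∑ k, chartChristoffel n x z v (EuclideanSpace.single j 1) k * gram n x z k i := by
  have h := isLeviCivitaOn_chart n x
  have h1 := h.compat hz v (EuclideanSpace.single i 1) (EuclideanSpace.single j 1)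
  rw [h.symm z hz (EuclideanSpace.single i 1), chartMetric_single_left,
    chartMetric_single_left] at h1
  rw [← h1, ← fderivWithin_eval₂ (h.uniq z hz) (diffWithinAt_of_smooth h.smooth_g hz)]
  rfl

lemma chartGrad0_zero (x : X) (z : Euc n) : chartGrad0 n x z 0 = (gram n x z)⁻¹ 0 0 := by
  simp [chartGrad0, chartSharp, proj0, PiLp.single_apply]

end Green

section DensityDerivative

variable {M : Type*} [TopologicalSpace M]
  [ChartedSpace (EuclideanHalfSpace 3) M]
  [RiemannianBundle (fun x : M => TangentSpace (𝓡∂ 3) x)]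
  [IsManifold (𝓡∂ 3) ∞ M]
  [IsContMDiffRiemannianBundle (𝓡∂ 3) ∞ (EuclideanSpace ℝ (Fin 3))
      (fun p : M => TangentSpace (𝓡∂ 3) p)]

lemma chartDensity_sq (x : M) {z : Euc 3} (hz : z ∈ (extChartAt (𝓡∂ 3) x).target) :
    0 < (gram 3 x z).det := (gram_posDef 3 x hz).det_pos

lemma fderivWithin_gram_det (x : M) {z : Euc 3} (hz : z ∈ (extChartAt (𝓡∂ 3) x).target)
    (v : Euc 3) : fderivWithin ℝ (fun y => (gram 3 x y).det) (extChartAt (𝓡∂ 3) x).target z v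
      = 2 * (gram 3 x z).det * ∑ i, chartChristoffel 3 x z v (EuclideanSpace.single i 1) i := by
  have hu := uniqueDiffOn_extChartAt_target (I := 𝓡∂ 3) x z hz
  have hd : ∀ i j, HasFDerivWithinAt (fun y => gram 3 x y i j)
      (fderivWithin ℝ (fun y => gram 3 x y i j) (extChartAt (𝓡∂ 3) x).target z)
      (extChartAt (𝓡∂ 3) x).target z := fun i j =>
    (diffWithinAt_of_smooth (contDiffOn_gram 3 x i j) hz).hasFDerivWithinAt
  have h1 := (((((((hd 0 0).mul (hd 1 1)).mul (hd 2 2)).sub (((hd 0 0).mul (hd 1 2)).mul (hd 2 1))).sub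
    (((hd 0 1).mul (hd 1 0)).mul (hd 2 2))).add (((hd 0 1).mul (hd 1 2)).mul (hd 2 0))).add
    (((hd 0 2).mul (hd 1 0)).mul (hd 2 1))).sub (((hd 0 2).mul (hd 1 1)).mul (hd 2 0))
  have h2 : (fun y => (gram 3 x y).det) = _ := funext fun y => Matrix.det_fin_three (gram 3 x y)
  have h3 := congrArg (fun L : Euc 3 →L[ℝ] ℝ => L v) (h1.fderivWithin hu)
  rw [h2]
  refine Eq.trans h3 ?_
  have hs : ∀ i j, gram 3 x z i j = gram 3 x z j i := fun i j =>
    (isLeviCivitaOn_chart 3 x).symm z hz _ _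
  simp only [add_apply, sub_apply, smul_apply, smul_eq_mul, fderivWithin_gram x hz,
    Fin.sum_univ_three, Pi.mul_apply, Matrix.det_fin_three]
  rw [hs 1 0, hs 2 0, hs 2 1]
  ring

lemma fderivWithin_chartDensity (x : M) {z : Euc 3} (hz : z ∈ (extChartAt (𝓡∂ 3) x).target)
    (v : Euc 3) : fderivWithin ℝ (chartDensity 3 x) (extChartAt (𝓡∂ 3) x).target z v
      = chartDensity 3 x z * ∑ i, chartChristoffel 3 x z v (EuclideanSpace.single i 1) i := by
  have hu := uniqueDiffOn_extChartAt_target (I := 𝓡∂ 3) x z hz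
  have hpos := chartDensity_sq x hz
  have h1 : HasFDerivWithinAt (fun y => (gram 3 x y).det) _ (extChartAt (𝓡∂ 3) x).target z :=
    (diffWithinAt_of_smooth (contDiffOn_det fun i j => contDiffOn_gram 3 x i j)
    hz).hasFDerivWithinAt
  have h2 := congrArg (fun L : Euc 3 →L[ℝ] ℝ => L v) ((h1.sqrt hpos.ne').fderivWithin hu)
  refine Eq.trans h2 ?_
  simp only [smul_apply, smul_eq_mul, fderivWithin_gram_det x hz, chartDensity]
  have h3 := Real.sq_sqrt hpos.le
  have h4 := Real.sqrt_pos.2 hpos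
  field_simp
  linear_combination (-1) * (∑ i, chartChristoffel 3 x z v (EuclideanSpace.single i 1) i) * h3

lemma contDiffOn_chartDensity (x : M) :
    ContDiffOn ℝ ∞ (chartDensity 3 x) (extChartAt (𝓡∂ 3) x).target :=
  (contDiffOn_det fun i j => contDiffOn_gram 3 x i j).sqrt fun _ hz => (chartDensity_sq x hz).ne'

/-- The coordinate divergence of `√g f ∇h`. -/
lemma divergence_eq {f h : M → ℝ} (hf : ContMDiff (𝓡∂ 3) 𝓘(ℝ, ℝ) ∞ f)
    (hh : ContMDiff (𝓡∂ 3) 𝓘(ℝ, ℝ) ∞ h) {x : M} {z : Euc 3}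
    (hz : z ∈ (extChartAt (𝓡∂ 3) x).target) :
    ∑ i, fderivWithin ℝ (fun y => (chartDensity 3 x y * inChart 3 f x y) • chartGrad 3 h x y)
        (extChartAt (𝓡∂ 3) x).target z (EuclideanSpace.single i 1) i
      = chartDensity 3 x z * (chartD 3 f x z (chartGrad 3 h x z) + inChart 3 f x z
        * LinearMap.trace ℝ (Euc 3) (localNabla (extChartAt (𝓡∂ 3) x).target
          (chartChristoffel 3 x) (chartGrad 3 h x) z)) := by
  have hu := uniqueDiffOn_extChartAt_target (I := 𝓡∂ 3) x z hz
  have h1 := (diffWithinAt_of_smooth (contDiffOn_chartDensity x) hz).hasFDerivWithinAt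
  have h2 := (diffWithinAt_of_smooth (contDiffOn_comp_symm hf x) hz).hasFDerivWithinAt
  have h3 := (diffWithinAt_of_smooth (contDiffOn_chartGrad hh x) hz).hasFDerivWithinAt
  have h4 := ((h1.mul h2).smul h3).fderivWithin hu
  have h5 : fderivWithin ℝ (fun y => (chartDensity 3 x y * inChart 3 f x y) • chartGrad 3 h x y)
      (extChartAt (𝓡∂ 3) x).target z = _ := h4
  have h6 := (isLeviCivitaOn_chart 3 x).christoffel_symm hz
  have h7 : ∀ L : Euc 3 →L[ℝ] ℝ, L (chartGrad 3 h x z)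
      = ∑ i, chartGrad 3 h x z i * L (EuclideanSpace.single i 1) := fun L => by
    conv_lhs => rw [euc_eq_sum 3 (chartGrad 3 h x z)]
    simp
  have h8 : ∀ i, fderivWithin ℝ (fun y => f ((extChartAt (𝓡∂ 3) x).symm y))
      (extChartAt (𝓡∂ 3) x).target z (EuclideanSpace.single i 1)
      = chartD 3 f x z (EuclideanSpace.single i 1) := fun i => rfl
  have h9 : f ((extChartAt (𝓡∂ 3) x).symm z) = inChart 3 f x z := rfl
  have h10 := fderivWithin_chartDensity x hz (chartGrad 3 h x z)
  rw [h7] at h10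
  rw [h5, trace_eq_sum_coord, h7]
  simp only [add_apply, smul_apply, ContinuousLinearMap.smulRight_apply, PiLp.add_apply,
    PiLp.smul_apply, smul_eq_mul, localNabla, ContinuousLinearMap.flip_apply, Pi.mul_apply, h8, h9,
    h6 (EuclideanSpace.single _ 1)]
  simp only [Fin.sum_univ_three] at h10 ⊢
  linear_combination inChart 3 f x z * h10

lemma det_mul_inv_zero (x : M) {z : Euc 3} (hz : z ∈ (extChartAt (𝓡∂ 3) x).target) :
    (gram 3 x z).det * chartGrad0 3 x z 0 = subGramDet 3 x z := by
  have h1 := (chartDensity_sq x hz).ne'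
  rw [chartGrad0_zero, Matrix.inv_def, Matrix.smul_apply, Ring.inverse_eq_inv', smul_eq_mul,
    mul_inv_cancel_left₀ h1, Matrix.adjugate_fin_succ_eq_det_submatrix, subGramDet]
  rw [← Matrix.det_submatrix_equiv_self (finSuccAboveEquiv (0 : Fin 3))]
  simp only [Fin.val_zero, add_zero, pow_zero, one_mul, Matrix.submatrix_submatrix]
  rfl

lemma chartDensity_mul_sqrt (x : M) {y : EuclideanSpace ℝ {i : Fin 3 // i ≠ 0}}
    (hy : y ∈ bdryTarget 3 x) : chartDensity 3 x (bdryIncl 3 y)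
      * Real.sqrt (chartGrad0 3 x (bdryIncl 3 y) 0) = chartBdryDensity 3 x y := by
  rw [chartDensity, chartBdryDensity, ← Real.sqrt_mul (chartDensity_sq x hy).le,
    det_mul_inv_zero x hy, subGramDet]

/-- The normal derivative. -/
def normalDeriv (h : M → ℝ) (p : M) : ℝ := dfun 3 h p (outwardNormal 3 p)

end DensityDerivative

section GreenFormula

variable {M : Type*} [TopologicalSpace M]
  [ChartedSpace (EuclideanHalfSpace 3) M]
  [RiemannianBundle (fun x : M => TangentSpace (𝓡∂ 3) x)]
  [IsManifold (𝓡∂ 3) ∞ M]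
  [IsContMDiffRiemannianBundle (𝓡∂ 3) ∞ (EuclideanSpace ℝ (Fin 3))
      (fun p : M => TangentSpace (𝓡∂ 3) p)]

lemma normalDeriv_chart {h : M → ℝ} (hh : ContMDiff (𝓡∂ 3) 𝓘(ℝ, ℝ) ∞ h) {x p : M}
    (hp : p ∈ (extChartAt (𝓡∂ 3) x).source) (hb : p ∈ (𝓡∂ 3).boundary M) :
    normalDeriv h p = chartD 3 h x (extChartAt (𝓡∂ 3) x p)
      (chartNormal 3 x (extChartAt (𝓡∂ 3) x p)) := by
  rw [← dfun_frame hp (hh.mdifferentiableAt (by simp)), ← outwardNormal_frame hp hb]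
  rfl

lemma continuousOn_chartNormal (x : M) :
    ContinuousOn (chartNormal 3 x) (extChartAt (𝓡∂ 3) x).target := by
  have h1 : ContDiffOn ℝ ∞ (chartGrad0 3 x) (extChartAt (𝓡∂ 3) x).target :=
    contDiffOn_chartSharp 3 x subset_rfl contDiffOn_const
  refine ContinuousOn.smul (ContinuousOn.neg (ContinuousOn.inv₀ (ContinuousOn.sqrt ?_) ?_))
    h1.continuousOn
  · exact (EuclideanSpace.proj (𝕜 := ℝ) (0 : Fin 3)).continuous.comp_continuousOn h1.continuousOn
  · intro z hz
    exact (Real.sqrt_pos.2 (chartGrad0_normSq_pos x hz)).ne'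

lemma continuousOn_normalDeriv {h : M → ℝ} (hh : ContMDiff (𝓡∂ 3) 𝓘(ℝ, ℝ) ∞ h) :
    ContinuousOn (normalDeriv h) ((𝓡∂ 3).boundary M) := by
  intro p hp
  have hs := mem_extChartAt_source (I := 𝓡∂ 3) p
  have h1 : ContinuousOn (fun z => chartD 3 h p z (chartNormal 3 p z))
      (extChartAt (𝓡∂ 3) p).target :=
    (contDiffOn_chartD hh p).continuousOn.clm_apply (continuousOn_chartNormal p)
  have h2 := (continuousAt_of_chart hs isOpen_univ (mem_univ _) (by
    rwa [inter_univ])).continuousWithinAt (s := (𝓡∂ 3).boundary M)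
  refine h2.congr_of_eventuallyEq ?_ (normalDeriv_chart hh hs hp)
  filter_upwards [self_mem_nhdsWithin, mem_nhdsWithin_of_mem_nhds
    (extChartAt_source_mem_nhds (I := 𝓡∂ 3) p)] with q hq hq'
  exact normalDeriv_chart hh hq' hq

lemma dfun_eq_zero_of_eventually {f : M → ℝ} {p : M} (h : ∀ᶠ q in 𝓝 p, f q = 0) :
    dfun 3 f p = 0 := by
  have h1 : f =ᶠ[𝓝 p] fun _ => (0 : ℝ) := h
  have h2 : mfderiv (𝓡∂ 3) 𝓘(ℝ, ℝ) f p = mfderiv (𝓡∂ 3) 𝓘(ℝ, ℝ) (fun _ => (0 : ℝ)) p :=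
    h1.mfderiv_eq
  rw [mfderiv_const] at h2
  exact h2

lemma dfun_eq_zero_of_notMem {f : M → ℝ} {p : M} (h : p ∉ tsupport f) : dfun 3 f p = 0 := by
  refine dfun_eq_zero_of_eventually ?_
  filter_upwards [(isClosed_tsupport f).isOpen_compl.mem_nhds h] with q hq
  exact image_eq_zero_of_notMem_tsupport hq

lemma continuous_dfun_grad {f h : M → ℝ} (hf : ContMDiff (𝓡∂ 3) 𝓘(ℝ, ℝ) ∞ f)
    (hh : ContMDiff (𝓡∂ 3) 𝓘(ℝ, ℝ) ∞ h) :
    Continuous fun p => dfun 3 f p (gradVec 3 h p) := by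
  simp only [← metricAt_grad]
  exact (contMDiff_inner_grad hf hh).continuous

variable [SecondCountableTopology M] [MeasurableSpace M] [BorelSpace M]

/-- Green's formula for functions supported in a chart domain. -/
lemma green_local {f h : M → ℝ} (hf : ContMDiff (𝓡∂ 3) 𝓘(ℝ, ℝ) ∞ f)
    (hh : ContMDiff (𝓡∂ 3) 𝓘(ℝ, ℝ) ∞ h) {x : M} (hc : HasCompactSupport f)
    (hs : tsupport f ⊆ (extChartAt (𝓡∂ 3) x).source) :
    ∫ p, (dfun 3 f p (gradVec 3 h p) + f p * laplacian 3 h p) ∂(vol 3 M)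
      = ∫ p, f p * normalDeriv h p ∂(bdryArea 3 M) := by
  have hcont : Continuous fun p => dfun 3 f p (gradVec 3 h p) + f p * laplacian 3 h p :=
    (continuous_dfun_grad hf hh).add (hf.continuous.mul (continuous_laplacian hh))
  have hf0 : ∀ p ∉ (extChartAt (𝓡∂ 3) x).source, f p = 0 := fun p hp =>
    image_eq_zero_of_notMem_tsupport fun h => hp (hs h)
  rw [integral_vol_chart x hcont fun p hp => by
      rw [dfun_eq_zero_of_notMem fun h => hp (hs h), hf0 p hp]; simp,
    integral_bdryArea_chart x (f := fun p => f p * normalDeriv h p) (hf.continuous.continuousOn.mul (continuousOn_normalDeriv hh))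
      fun p hp => by rw [hf0 p hp, zero_mul]]
  obtain ⟨O, hO, he⟩ := exists_open_target 3 x
  set K : Set (Euc 3) := extChartAt (𝓡∂ 3) x '' tsupport f with hK
  have hKc : IsCompact K := hc.isCompact.image_of_continuousOn ((continuousOn_extChartAt x).mono hs)
  have hKT : K ⊆ (extChartAt (𝓡∂ 3) x).target := by
    rintro _ ⟨p, hp, rfl⟩; exact (extChartAt (𝓡∂ 3) x).map_source (hs hp)
  have hV : ContDiffOn ℝ ∞ (fun y => (chartDensity 3 x y * inChart 3 f x y) • chartGrad 3 h x y)
      (extChartAt (𝓡∂ 3) x).target :=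
    ((contDiffOn_chartDensity x).mul (contDiffOn_comp_symm hf x)).smul (contDiffOn_chartGrad hh x)
  have hV0 : ∀ z ∈ (extChartAt (𝓡∂ 3) x).target, z ∉ K →
      (chartDensity 3 x z * inChart 3 f x z) • chartGrad 3 h x z = 0 := by
    intro z hz hzK
    have h1 : f ((extChartAt (𝓡∂ 3) x).symm z) = 0 := by
      refine image_eq_zero_of_notMem_tsupport fun h => hzK ⟨_, h, ?_⟩
      exact (extChartAt (𝓡∂ 3) x).right_inv hz
    rw [inChart, h1, mul_zero, zero_smul]
  have huniq := uniqueDiffOn_extChartAt_target (I := 𝓡∂ 3) x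
  rw [he] at hKT hV hV0 huniq
  have key := integral_divergence_halfSpace hO hKc hKT hV huniq hV0
  rw [← he] at key
  have hl : ∫ z in (extChartAt (𝓡∂ 3) x).target, chartDensity 3 x z *
      (dfun 3 f ((extChartAt (𝓡∂ 3) x).symm z) (gradVec 3 h ((extChartAt (𝓡∂ 3) x).symm z))
        + f ((extChartAt (𝓡∂ 3) x).symm z) * laplacian 3 h ((extChartAt (𝓡∂ 3) x).symm z))
      = ∫ z in (extChartAt (𝓡∂ 3) x).target, ∑ i, fderivWithin ℝ
        (fun y => (chartDensity 3 x y * inChart 3 f x y) • chartGrad 3 h x y)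
        (extChartAt (𝓡∂ 3) x).target z (EuclideanSpace.single i 1) i := by
    refine setIntegral_congr_fun (measurableSet_target x) fun z hz => ?_
    have hp := (extChartAt (𝓡∂ 3) x).map_target hz
    beta_reduce
    rw [divergence_eq hf hh hz, gradVec_eq_frame hp (hh.mdifferentiableAt (by simp)),
      dfun_frame hp (hf.mdifferentiableAt (by simp)), laplacian_eq_trace hh hp,
      (extChartAt (𝓡∂ 3) x).right_inv hz]
    rfl
  rw [hl, key, ← integral_neg]
  refine setIntegral_congr_fun (measurableSet_bdryTarget x) fun y hy => ?_
  have hp := (extChartAt (𝓡∂ 3) x).map_target hy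
  have hb := bdryParam_mem_boundary x hy
  beta_reduce
  rw [bdryParam] at hb ⊢
  rw [normalDeriv_chart hh hp hb, (extChartAt (𝓡∂ 3) x).right_inv hy,
    ← chartMetric_grad h x hy, (isLeviCivitaOn_chart 3 x).symm _ hy, chartMetric_normal x hy,
    ← chartDensity_mul_sqrt x hy, PiLp.smul_apply, smul_eq_mul]
  have h1 := (Real.sqrt_pos.2 (chartGrad0_normSq_pos x hy)).ne'
  have h2 : inChart 3 f x (bdryIncl 3 y) = f ((extChartAt (𝓡∂ 3) x).symm (bdryIncl 3 y)) := rfl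
  rw [h2]
  field_simp

lemma dfun_mul {f g : M → ℝ} {p : M} (hf : MDifferentiableAt (𝓡∂ 3) 𝓘(ℝ, ℝ) f p)
    (hg : MDifferentiableAt (𝓡∂ 3) 𝓘(ℝ, ℝ) g p) :
    dfun 3 (fun q => f q * g q) p = f p • dfun 3 g p + g p • dfun 3 f p := by
  have h1 := hf.hasMFDerivAt
  have h2 := hg.hasMFDerivAt
  exact (h1.mul h2).mfderiv

lemma dfun_sum {ι : Type*} {s : Finset ι} {f : ι → M → ℝ} {p : M}
    (hf : ∀ i ∈ s, MDifferentiableAt (𝓡∂ 3) 𝓘(ℝ, ℝ) (f i) p) :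
    dfun 3 (fun q => ∑ i ∈ s, f i q) p = ∑ i ∈ s, dfun 3 (f i) p := by
  classical
  suffices h : HasMFDerivAt (𝓡∂ 3) 𝓘(ℝ, ℝ) (fun q => ∑ i ∈ s, f i q) p
      (∑ i ∈ s, dfun 3 (f i) p : Euc 3 →L[ℝ] ℝ) from h.mfderiv
  induction s using Finset.induction_on with
  | empty =>
    simp only [Finset.sum_empty]
    exact hasMFDerivAt_const (0 : ℝ) p
  | insert a s ha ih =>
    have e : (fun q => ∑ i ∈ insert a s, f i q) = f a + fun q => ∑ i ∈ s, f i q := by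
      ext q; simp [Finset.sum_insert ha]
    rw [e, Finset.sum_insert ha]
    exact (hf a (Finset.mem_insert_self a s)).hasMFDerivAt.add
      (ih fun i hi => hf i (Finset.mem_insert_of_mem hi))

variable [T2Space M]

/-- A smooth partition of unity on a compact set by functions supported in charts. -/
lemma exists_finite_partition (K : Set M) (hK : IsCompact K) :
    ∃ (J : Finset M) (χ : M → M → ℝ), (∀ x, ContMDiff (𝓡∂ 3) 𝓘(ℝ, ℝ) ∞ (χ x)) ∧
      (∀ x, tsupport (χ x) ⊆ (extChartAt (𝓡∂ 3) x).source) ∧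
      (∀ p ∈ K, ∑ x ∈ J, χ x p = 1) ∧ ∀ x, HasCompactSupport (χ x) := by
  have : LocallyCompactSpace (EuclideanHalfSpace 3) := (𝓡∂ 3).locallyCompactSpace
  have : LocallyCompactSpace M := ChartedSpace.locallyCompactSpace (EuclideanHalfSpace 3) M
  have : SigmaCompactSpace M := inferInstance
  choose L hL hxL hLs using fun x : M => exists_compact_subset
    (isOpen_extChartAt_source (I := 𝓡∂ 3) x) (mem_extChartAt_source x)
  obtain ⟨χ, hχ⟩ := SmoothPartitionOfUnity.exists_isSubordinate (𝓡∂ 3) (isClosed_univ (X := M))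
    (fun x => interior (L x)) (fun x => isOpen_interior) (fun x _ => mem_iUnion.2 ⟨x, hxL x⟩)
  have hfin := χ.locallyFinite.finite_nonempty_inter_compact hK
  refine ⟨hfin.toFinset, fun x => χ x, fun x => (χ x).contMDiff, fun x =>
    ((hχ x).trans interior_subset).trans (hLs x), fun p hp => ?_,
    fun x => (hL x).of_isClosed_subset (isClosed_tsupport _) ((hχ x).trans interior_subset)⟩
  have h1 := χ.sum_eq_one (mem_univ p)
  rw [← h1]
  refine (finsum_eq_sum_of_support_subset _ fun x hx => ?_).symm
  rw [Finite.coe_toFinset]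
  exact ⟨p, hx, hp⟩

lemma integrable_of_continuous {f : M → ℝ} (hf : Continuous f) (hc : HasCompactSupport f) :
    Integrable f (vol 3 M) := hf.integrable_of_hasCompactSupport hc

lemma integrable_bdry_of_continuousOn {f : M → ℝ} (hf : ContinuousOn f ((𝓡∂ 3).boundary M))
    (hc : HasCompactSupport f) : Integrable f (bdryArea 3 M) := by
  have h1 : IntegrableOn f (tsupport f ∩ (𝓡∂ 3).boundary M) (bdryArea 3 M) :=
    (hf.mono inter_subset_right).integrableOn_compact (hc.isCompact.inter_right
      ((𝓡∂ 3).isClosed_boundary (n := ∞) (by simp)))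
  refine (integrableOn_iff_integrable_of_support_subset (s := tsupport f)
    (subset_tsupport f)).1 ?_
  refine h1.congr_set_ae ?_
  have h2 : ∀ᵐ p ∂(bdryArea 3 M), p ∈ (𝓡∂ 3).boundary M := by
    rw [ae_iff]; exact bdryArea_interior
  filter_upwards [h2] with p hp
  exact propext ⟨fun h => ⟨h, hp⟩, fun h => h.1⟩

/-- Green's formula. -/
lemma green {f h : M → ℝ} (hf : ContMDiff (𝓡∂ 3) 𝓘(ℝ, ℝ) ∞ f)
    (hh : ContMDiff (𝓡∂ 3) 𝓘(ℝ, ℝ) ∞ h) (hc : HasCompactSupport f) :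
    ∫ p, (dfun 3 f p (gradVec 3 h p) + f p * laplacian 3 h p) ∂(vol 3 M)
      = ∫ p, f p * normalDeriv h p ∂(bdryArea 3 M) := by
  obtain ⟨J, χ, hχ, hχs, hχ1, -⟩ := exists_finite_partition (tsupport f) hc.isCompact
  set g : M → M → ℝ := fun x p => χ x p * f p with hg
  have hgs : ∀ x, ContMDiff (𝓡∂ 3) 𝓘(ℝ, ℝ) ∞ (g x) := fun x => (hχ x).mul hf
  have hgc : ∀ x, HasCompactSupport (g x) := fun x => hc.mul_left
  have hgt : ∀ x, tsupport (g x) ⊆ (extChartAt (𝓡∂ 3) x).source := fun x =>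
    (closure_mono (fun p hp => left_ne_zero_of_mul hp)).trans (hχs x)
  have hfg : f = fun p => ∑ x ∈ J, g x p := by
    ext p
    rw [hg]
    simp only [← Finset.sum_mul]
    by_cases hp : p ∈ tsupport f
    · rw [hχ1 p hp, one_mul]
    · rw [image_eq_zero_of_notMem_tsupport hp, mul_zero]
  have hd : ∀ p, dfun 3 f p = ∑ x ∈ J, dfun 3 (g x) p := fun p => by
    conv_lhs => rw [hfg]
    exact dfun_sum fun x _ => (hgs x).mdifferentiableAt (by simp)
  have hi : ∀ x, Integrable (fun p => dfun 3 (g x) p (gradVec 3 h p) + g x p * laplacian 3 h p)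
      (vol 3 M) := fun x => by
    refine integrable_of_continuous ((continuous_dfun_grad (hgs x) hh).add
      ((hgs x).continuous.mul (continuous_laplacian hh))) ?_
    refine HasCompactSupport.intro (hgc x).isCompact fun p hp => ?_
    rw [dfun_eq_zero_of_notMem hp, image_eq_zero_of_notMem_tsupport hp]
    simp
  have hib : ∀ x, Integrable (fun p => g x p * normalDeriv h p) (bdryArea 3 M) := fun x =>
    integrable_bdry_of_continuousOn ((hgs x).continuous.continuousOn.mul
      (continuousOn_normalDeriv hh)) (hgc x).mul_right
  have e1 : ∀ p, dfun 3 f p (gradVec 3 h p) + f p * laplacian 3 h p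
      = ∑ x ∈ J, (dfun 3 (g x) p (gradVec 3 h p) + g x p * laplacian 3 h p) := fun p => by
    rw [hd, Finset.sum_add_distrib, sum_apply, ← Finset.sum_mul]
    rw [← congrFun hfg p]
  have e2 : ∀ p, f p * normalDeriv h p = ∑ x ∈ J, g x p * normalDeriv h p := fun p => by
    rw [← Finset.sum_mul, ← congrFun hfg p]
  simp only [e1, e2]
  rw [integral_finsetSum _ fun x _ => hi x, integral_finsetSum _ fun x _ => hib x]
  exact Finset.sum_congr rfl fun x _ => green_local (hgs x) hh (hgc x) (hgt x)

end GreenFormula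

section Algebra

/-- The refined Cauchy-Schwarz inequality for trace-free symmetric `3 × 3` matrices. -/
lemma tracefree_mulVec_sq_le (A : Fin 3 → Fin 3 → ℝ) (hA : ∀ i j, A i j = A j i)
    (ht : ∑ i, A i i = 0) (v : Fin 3 → ℝ) :
    ∑ i, (∑ j, A i j * v j) ^ 2 ≤ 2 / 3 * (∑ i, ∑ j, A i j ^ 2) * ∑ i, v i ^ 2 := by
  set w : Fin 3 → ℝ := fun i => ∑ j, A i j * v j with hw
  set s : ℝ := ∑ i, v i ^ 2 with hs
  set c : ℝ := ∑ i, v i * w i with hc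
  have hs0 : 0 ≤ s := Finset.sum_nonneg fun i _ => sq_nonneg _
  have h1 : 0 ≤ ∑ i, ∑ j, (s * A i j - 3 / 4 * (v i * w j + w i * v j)
      + 1 / 2 * c * (if i = j then 1 else 0)) ^ 2 :=
    Finset.sum_nonneg fun i _ => Finset.sum_nonneg fun j _ => sq_nonneg _
  have h2 : ∑ i, ∑ j, (s * A i j - 3 / 4 * (v i * w j + w i * v j)
      + 1 / 2 * c * (if i = j then 1 else 0)) ^ 2
      = s ^ 2 * (∑ i, ∑ j, A i j ^ 2) - 15 / 8 * s * (∑ i, w i ^ 2) + 3 / 8 * c ^ 2 := by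
    have e0 : w 0 = A 0 0 * v 0 + A 0 1 * v 1 + A 0 2 * v 2 := by simp [hw, Fin.sum_univ_three]
    have e1 : w 1 = A 0 1 * v 0 + A 1 1 * v 1 + A 1 2 * v 2 := by
      simp [hw, Fin.sum_univ_three, hA 1 0]
    have e2 : w 2 = A 0 2 * v 0 + A 1 2 * v 1 + A 2 2 * v 2 := by
      simp [hw, Fin.sum_univ_three, hA 2 0, hA 2 1]
    have et : A 2 2 = - A 0 0 - A 1 1 := by
      rw [Fin.sum_univ_three] at ht; linarith
    simp only [hs, hc, Fin.sum_univ_three, hA 1 0, hA 2 0, hA 2 1, e0, e1, e2, et]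
    simp
    ring
  have h3 : c ^ 2 ≤ s * ∑ i, w i ^ 2 := Finset.sum_mul_sq_le_sq_mul_sq _ _ _
  rw [h2] at h1
  rcases hs0.eq_or_lt with h0 | hpos
  · have hv : ∀ i, v i = 0 := fun i => by
      have := (Finset.sum_eq_zero_iff_of_nonneg (fun i _ => sq_nonneg (v i))).1 h0.symm i
        (Finset.mem_univ i)
      exact pow_eq_zero_iff (two_ne_zero) |>.1 this
    rw [← h0, mul_zero]
    exact (Finset.sum_eq_zero fun i _ => by simp [hv]).le
  · have h4 : 0 ≤ s * (s * (∑ i, ∑ j, A i j ^ 2) - 3 / 2 * ∑ i, w i ^ 2) := by nlinarith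
    have h5 := nonneg_of_mul_nonneg_right h4 hpos
    linarith

end Algebra

section Pointwise

lemma localHess_congr {E : Type*} [NormedAddCommGroup E] [NormedSpace ℝ E] {s : Set E}
    {Γ : E → E →L[ℝ] E →L[ℝ] E} {f g : E → ℝ} (h : ∀ y ∈ s, f y = g y) {z : E} (hz : z ∈ s)
    (v w : E) : localHess s Γ f z v w = localHess s Γ g z v w := by
  have h1 : ∀ y ∈ s, fderivWithin ℝ f s y = fderivWithin ℝ g s y := fun y hy =>
    fderivWithin_congr h (h y hy)
  rw [localHess, localHess, h1 z hz, fderivWithin_congr h1 (h1 z hz)]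

variable {n : ℕ} [NeZero n] {X : Type*} [TopologicalSpace X]
  [ChartedSpace (EuclideanHalfSpace n) X]
  [RiemannianBundle (fun x : X => TangentSpace (𝓡∂ n) x)]
  [IsManifold (𝓡∂ n) ∞ X]
  [IsContMDiffRiemannianBundle (𝓡∂ n) ∞ (EuclideanSpace ℝ (Fin n))
      (fun p : X => TangentSpace (𝓡∂ n) p)]

variable (n) in
/-- The squared norm of the gradient. -/
def gradSq (u : X → ℝ) (p : X) : ℝ := gradNorm n u p ^ 2

lemma contMDiff_gradSq {u : X → ℝ} (hu : ContMDiff (𝓡∂ n) 𝓘(ℝ, ℝ) ∞ u) :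
    ContMDiff (𝓡∂ n) 𝓘(ℝ, ℝ) ∞ (gradSq n u) := contMDiff_gradNorm_sq hu

lemma inChart_gradSq {u : X → ℝ} (hu : ContMDiff (𝓡∂ n) 𝓘(ℝ, ℝ) ∞ u) (x : X) {z : Euc n}
    (hz : z ∈ (extChartAt (𝓡∂ n) x).target) : inChart n (gradSq n u) x z
      = chartMetric n x z (chartGrad n u x z) (chartGrad n u x z) := by
  have hp := (extChartAt (𝓡∂ n) x).map_target hz
  have hd : MDifferentiableAt (𝓡∂ n) 𝓘(ℝ, ℝ) u ((extChartAt (𝓡∂ n) x).symm z) :=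
    hu.mdifferentiableAt (by simp)
  rw [inChart, gradSq, gradNorm_sq, metricAt_gradVec hp hd hd, (extChartAt (𝓡∂ n) x).right_inv hz]

lemma dfun_self {f : X → ℝ} (hf : ContMDiff (𝓡∂ n) 𝓘(ℝ, ℝ) ∞ f) (p : X) :
    dfun n f p = chartD n f p (extChartAt (𝓡∂ n) p p) := by
  rw [← dfun_comp_frame (mem_extChartAt_source p) (hf.mdifferentiableAt (by simp)), frame_self]
  rfl

lemma gradVec_self {f : X → ℝ} (hf : ContMDiff (𝓡∂ n) 𝓘(ℝ, ℝ) ∞ f) (p : X) :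
    gradVec n f p = chartGrad n f p (extChartAt (𝓡∂ n) p p) := by
  rw [gradVec_eq_frame (mem_extChartAt_source p) (hf.mdifferentiableAt (by simp)), frame_self]
  rfl

variable (n) in
/-- The Hessian in coordinates. -/
def hess (u : X → ℝ) (p : X) (v w : Euc n) : ℝ := localHess (extChartAt (𝓡∂ n) p).target
  (chartChristoffel n p) (inChart n u p) (extChartAt (𝓡∂ n) p p) v w

lemma dfun_gradSq {u : X → ℝ} (hu : ContMDiff (𝓡∂ n) 𝓘(ℝ, ℝ) ∞ u) (p : X) (v : Euc n) :
    dfun n (gradSq n u) p v = 2 * hess n u p v (gradVec n u p) := by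
  have hz := mem_extChartAt_target (I := 𝓡∂ n) p
  rw [dfun_self (contMDiff_gradSq hu), chartD, fderivWithin_congr
    (fun y hy => inChart_gradSq hu p hy) (inChart_gradSq hu p hz),
    (isLeviCivitaOn_chart n p).fderivWithin_normSq_grad (contDiffOn_comp_symm hu p)
      (contDiffOn_chartGrad hu p) (fun z hz v => chartMetric_grad u p hz v) hz, gradVec_self hu]
  rfl

lemma hess_symm {u : X → ℝ} (hu : ContMDiff (𝓡∂ n) 𝓘(ℝ, ℝ) ∞ u) (p : X) (v w : Euc n) :
    hess n u p v w = hess n u p w v :=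
  (isLeviCivitaOn_chart n p).localHess_symm (contDiffOn_comp_symm hu p)
    (mem_extChartAt_target p) v w

lemma hess_sum_right (u : X → ℝ) (p : X) (v : Euc n) {ι : Type*} [Fintype ι] (c : ι → ℝ)
    (e : ι → Euc n) : hess n u p v (∑ j, c j • e j) = ∑ j, c j * hess n u p v (e j) := by
  have h := map_sum (localHessForm (extChartAt (𝓡∂ n) p).target
    (chartChristoffel n p) (inChart n u p) (extChartAt (𝓡∂ n) p p) v) (fun j => c j • e j)
    Finset.univ
  simp only [map_smul, smul_eq_mul] at h
  exact h

lemma laplacian_gradSq {u : X → ℝ} (hu : IsHarmonic n u) {p : X} {ι : Type*} [Fintype ι]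
    [DecidableEq ι] {e : ι → Euc n}
    (he : IsOrthoBasis (chartMetric n p (extChartAt (𝓡∂ n) p p)) e) :
    laplacian n (gradSq n u) p = 2 * (∑ i, ∑ j, hess n u p (e i) (e j) ^ 2
      + ∑ i, riem n p (e i) (gradVec n u p) (gradVec n u p) (e i)) := by
  have hz := mem_extChartAt_target (I := 𝓡∂ n) p
  have hb := (isLeviCivitaOn_chart n p).bochner (contDiffOn_comp_symm hu.1 p)
    (contDiffOn_chartGrad hu.1 p) (fun z hz v => chartMetric_grad u p hz v)
    (fun z hz => by
      have := laplacian_eq_trace hu.1 ((extChartAt (𝓡∂ n) p).map_target hz)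
      rw [hu.2, (extChartAt (𝓡∂ n) p).right_inv hz] at this
      exact this.symm) hz he
  rw [laplacian_eq_sum (contMDiff_gradSq hu.1) (mem_extChartAt_source p) he]
  refine Eq.trans (Finset.sum_congr rfl fun i _ => localHess_congr
    (fun y hy => inChart_gradSq hu.1 p hy) hz _ _) (hb.trans ?_)
  congr 2
  refine Finset.sum_congr rfl fun i _ => ?_
  rw [riem_eq, ← chartMetric_self, gradVec_self hu.1]

lemma gradNorm_sq_eq_sum (f : X → ℝ) {p : X} {ι : Type*} [Fintype ι] [DecidableEq ι]
    {e : ι → Euc n} (he : IsOrthoBasis (chartMetric n p (extChartAt (𝓡∂ n) p p)) e) :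
    gradNorm n f p ^ 2 = ∑ i, dfun n f p (e i) ^ 2 := by
  rw [gradNorm_sq, ← chartMetric_self, he.inner_eq]
  refine Finset.sum_congr rfl fun i _ => ?_
  rw [(isLeviCivitaOn_chart n p).symm _ (mem_extChartAt_target p) (e i), chartMetric_self,
    metricAt_grad, sq]

lemma riem_antisymm_left (p : X) (a b c d : Euc n) : riem n p a b c d = - riem n p b a c d := by
  rw [riem_eq, riem_eq, ← chartMetric_self, ← chartMetric_self, IsLeviCivitaOn.localCurv_antisymm, map_neg]
  rfl

lemma riem_antisymm_right (p : X) (a b c d : Euc n) : riem n p a b c d = - riem n p a b d c := by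
  rw [riem_eq, riem_eq, ← chartMetric_self, ← chartMetric_self]
  exact (isLeviCivitaOn_chart n p).inner_localCurv_antisymm (mem_extChartAt_target p) a b c d

lemma riem_swap (p : X) (a b : Euc n) : riem n p a b b a = riem n p b a a b := by
  rw [riem_antisymm_left, riem_antisymm_right, neg_neg]

lemma riem_self_left (p : X) (a c d : Euc n) : riem n p a a c d = 0 := by
  have := riem_antisymm_left p a a c d
  linarith

lemma ricci_eq_sum_onb {p : X} {ι : Type*} [Fintype ι] [DecidableEq ι] {e : ι → Euc n}
    (he : IsOrthoBasis (chartMetric n p (extChartAt (𝓡∂ n) p p)) e) (v : Euc n) :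
    ricci n p v v = ∑ i, riem n p (e i) v v (e i) := by
  let b : Euc n →ₗ[ℝ] Euc n →ₗ[ℝ] ℝ := LinearMap.mk₂ ℝ
    (fun s t => riem n p s v v t)
    (fun s s' t => by
      simp only [riem_eq, ← chartMetric_self]
      rw [← add_apply, ← map_add]; congr 2; simp only [localCurv, map_add, add_apply]; abel)
    (fun c s t => by
      simp only [riem_eq, ← chartMetric_self]
      rw [← smul_apply, ← map_smul]; congr 2
      simp only [localCurv, map_smul, smul_apply, smul_add, smul_sub])
    (fun s t t' => by simp only [riem_eq, ← chartMetric_self]; exact map_add _ _ _)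
    (fun c s t => by simp only [riem_eq, ← chartMetric_self]; exact map_smul _ _ _)
  exact (isOrthoBasis_onb p).sum_bilin_eq he b

/-- An orthonormal basis whose first vector has the direction of a given vector. -/
lemma exists_onb_first [Nontrivial (Fin n)] (p : X) (v : Euc n) : ∃ e : Fin n → Euc n,
    IsOrthoBasis (chartMetric n p (extChartAt (𝓡∂ n) p p)) e ∧
    v = Real.sqrt (metricAt n p v v) • e 0 := by
  let v' : TangentSpace (𝓡∂ n) p := v
  have hfin : Module.finrank ℝ (TangentSpace (𝓡∂ n) p) = Fintype.card (Fin n) := by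
    simpa using finrank_tangent p
  have hn : ‖v'‖ = Real.sqrt (metricAt n p v v) := by
    rw [← Real.sqrt_sq (norm_nonneg v'), norm_sq_eq]
  have hbasis : ∀ b : OrthonormalBasis (Fin n) ℝ (TangentSpace (𝓡∂ n) p),
      IsOrthoBasis (chartMetric n p (extChartAt (𝓡∂ n) p p)) (fun i => (b i : Euc n)) := fun b =>
    isOrthoBasis_of_metricAt (fun i j => (orthonormal_iff_ite.1 b.orthonormal) i j) (by simp)
  by_cases h0 : v' = 0
  · let b := (stdOrthonormalBasis ℝ (TangentSpace (𝓡∂ n) p)).reindex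
      (finCongr (finrank_tangent p))
    refine ⟨_, hbasis b, ?_⟩
    have h1 : v = 0 := h0
    rw [← hn, h0, norm_zero, h1]
    exact (zero_smul ℝ _).symm
  · have hne : ‖v'‖ ≠ 0 := norm_ne_zero_iff.2 h0
    have horth : Orthonormal ℝ (({0} : Set (Fin n)).domRestrict fun _ => ‖v'‖⁻¹ • v') := by
      constructor
      · intro i
        simp [Set.domRestrict, norm_smul, hne]
      · intro i j hij
        exact absurd (Subsingleton.elim i j) hij
    obtain ⟨b, hb⟩ := horth.exists_orthonormalBasis_extension_of_card_eq hfin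
    refine ⟨_, hbasis b, ?_⟩
    have h1 : b 0 = ‖v'‖⁻¹ • v' := hb 0 rfl
    have h2 : v' = ‖v'‖ • b 0 := by rw [h1, smul_smul, mul_inv_cancel₀ hne, one_smul]
    rw [← hn]
    exact h2

end Pointwise

section Interior

variable {M : Type*} [TopologicalSpace M] [ChartedSpace (EuclideanHalfSpace 3) M]
  [RiemannianBundle (fun p : M => TangentSpace (𝓡∂ 3) p)]
  {X : Type*} [TopologicalSpace X] [ChartedSpace (EuclideanHalfSpace 4) X]
  [RiemannianBundle (fun x : X => TangentSpace (𝓡∂ 4) x)]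
  [IsManifold (𝓡∂ 3) ∞ M] [IsManifold (𝓡∂ 4) ∞ X]
  [IsContMDiffRiemannianBundle (𝓡∂ 3) ∞ (EuclideanSpace ℝ (Fin 3))
      (fun p : M => TangentSpace (𝓡∂ 3) p)]
  [IsContMDiffRiemannianBundle (𝓡∂ 4) ∞ (EuclideanSpace ℝ (Fin 4))
      (fun p : X => TangentSpace (𝓡∂ 4) p)]
  {F : M → X} {ν : ∀ p, TangentSpace (𝓡∂ 4) (F p)}

/-- The adapted basis, as a family of tangent vectors. -/
def adaptedTangent (F : M → X) (ν : ∀ p, TangentSpace (𝓡∂ 4) (F p)) (p : M) (e : Fin 3 → Euc 3)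
    (o : Option (Fin 3)) : TangentSpace (𝓡∂ 4) (F p) := adapted F ν p e o

lemma orthonormal_adapted (hF : IsFBMH 3 4 F ν) {p : M} {e : Fin 3 → Euc 3}
    (he : IsOrthoBasis (chartMetric 3 p (extChartAt (𝓡∂ 3) p p)) e) :
    Orthonormal ℝ (adaptedTangent F ν p e) := by
  rw [orthonormal_iff_ite]
  intro i j
  have h := (isOrthoBasis_adapted hF he (by simp)).orth i j
  rw [chartMetric_self] at h
  exact h

/-- The sectional curvatures of the ambient space in an adapted basis. -/
def adaptedCurv (F : M → X) (ν : ∀ p, TangentSpace (𝓡∂ 4) (F p)) (p : M) (e : Fin 3 → Euc 3)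
    (o o' : Option (Fin 3)) : ℝ :=
  riem 4 (F p) (adapted F ν p e o) (adapted F ν p e o') (adapted F ν p e o') (adapted F ν p e o)

lemma adaptedCurv_add_nonneg (hRic : Ric2Nonneg 4 X) (hF : IsFBMH 3 4 F ν) {p : M}
    {e : Fin 3 → Euc 3}
    (he : IsOrthoBasis (chartMetric 3 p (extChartAt (𝓡∂ 3) p p)) e) {a b c : Option (Fin 3)}
    (hab : a ≠ b) (hac : a ≠ c) (hbc : b ≠ c) :
    0 ≤ adaptedCurv F ν p e b a + adaptedCurv F ν p e c a := by
  refine hRic (F p) (adapted F ν p e a) (adapted F ν p e b) (adapted F ν p e c) ?_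
  have hinj : Function.Injective ![a, b, c] := by
    intro i j hij
    fin_cases i <;> fin_cases j <;> simp_all
  have h := (orthonormal_adapted hF he).comp _ hinj
  have h1 : (![adaptedTangent F ν p e a, adaptedTangent F ν p e b, adaptedTangent F ν p e c] :
      Fin 3 → TangentSpace (𝓡∂ 4) (F p)) = adaptedTangent F ν p e ∘ ![a, b, c] := by
    funext i
    fin_cases i <;> rfl
  rw [← h1] at h
  exact h

lemma riem_smul_mid (p : M) (a b d : Euc 3) (c : ℝ) :
    riem 3 p a (c • b) (c • b) d = c ^ 2 * riem 3 p a b b d := by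
  simp only [riem_eq, ← chartMetric_self]
  rw [← smul_eq_mul, ← smul_apply, ← map_smul]
  congr 2
  simp only [localCurv, map_smul, smul_apply, smul_add, smul_sub, sq, smul_smul]

/-- The pointwise inequality of the stability argument. -/
lemma pointwise_interior (hRic : Ric2Nonneg 4 X) (hF : IsFBMH 3 4 F ν) {u : M → ℝ}
    (hu : IsHarmonic 3 u) (p : M) :
    3 / 2 * (gradNorm 3 (gradSq 3 u) p ^ 2 / (4 * gradSq 3 u p))
      + 1 / 3 * normSqII 3 4 F ν p * gradSq 3 u p
    ≤ 1 / 2 * laplacian 3 (gradSq 3 u) p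
      + (ricci 4 (F p) (ν p) (ν p) + normSqII 3 4 F ν p) * gradSq 3 u p := by
  obtain ⟨e, he, hN⟩ := exists_onb_first (n := 3) p (gradVec 3 u p)
  rw [← gradNorm_sq] at hN
  change _ = Real.sqrt (gradSq 3 u p) • e 0 at hN
  set W := gradSq 3 u p with hW
  have hW0 : 0 ≤ W := sq_nonneg _
  set c := Real.sqrt W with hc
  have hcW : c ^ 2 = W := Real.sq_sqrt hW0
  set H : Fin 3 → Fin 3 → ℝ := fun i j => hess 3 u p (e i) (e j) with hH
  set b : Fin 3 → Fin 3 → ℝ := fun i j => secondForm hF p (e i) (e j) with hb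
  have hHt : ∑ i, H i i = 0 := by
    have := laplacian_eq_sum hu.1 (mem_extChartAt_source p) he
    rw [hu.2] at this
    exact this.symm
  have hbt : ∑ i, b i i = 0 := by
    have h1 := (isOrthoBasis_onb p).sum_bilin_eq he (secondForm hF p)
    rw [← h1]
    exact hF.minimal p
  have hsel : ∀ A : Fin 3 → Fin 3 → ℝ, (∀ i j, A i j = A j i) → ∑ i, A i i = 0 →
      ∑ i, A i 0 ^ 2 ≤ 2 / 3 * ∑ i, ∑ j, A i j ^ 2 := fun A hA ht => by
    have := tracefree_mulVec_sq_le A hA ht (fun i => if i = 0 then 1 else 0)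
    simpa using this
  have hH1 := hsel H (fun i j => hess_symm hu.1 p _ _) hHt
  have hb1 := hsel b (fun i j => secondForm_symm hF p _ _) hbt
  have hgW : gradNorm 3 (gradSq 3 u) p ^ 2 = 4 * W * ∑ i, H i 0 ^ 2 := by
    rw [gradNorm_sq_eq_sum _ he, Finset.mul_sum]
    refine Finset.sum_congr rfl fun i _ => ?_
    have h1 : hess 3 u p (e i) (c • e 0) = c * H i 0 := by
      have := hess_sum_right u p (e i) (fun _ : Fin 1 => c) (fun _ => e 0)
      simpa using this
    rw [dfun_gradSq hu.1, hN, h1, ← hcW]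
    ring
  have hkato : gradNorm 3 (gradSq 3 u) p ^ 2 / (4 * W) ≤ ∑ i, H i 0 ^ 2 := by
    rw [hgW]
    rcases hW0.eq_or_lt with h | h
    · rw [← h]; simp only [mul_zero, zero_mul, div_zero]
      exact Finset.sum_nonneg fun i _ => sq_nonneg _
    · rw [mul_div_cancel_left₀ _ (by positivity)]
  have hII : normSqII 3 4 F ν p = ∑ i, ∑ j, b i j ^ 2 := normSqII_eq_sum hF he
  have hlap := laplacian_gradSq hu he
  have hricX : ricci 4 (F p) (ν p) (ν p) = ∑ i, adaptedCurv F ν p e (some i) none := by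
    have h1 := ricci_eq_sum_onb (isOrthoBasis_adapted hF he (by simp)) (nrm 4 F ν p)
    rw [Fintype.sum_option] at h1
    have h2 : riem 4 (F p) (adapted F ν p e none) (nrm 4 F ν p) (nrm 4 F ν p)
        (adapted F ν p e none) = 0 := riem_self_left _ _ _ _
    rw [h2, zero_add] at h1
    exact h1
  have hricM : ∀ i, riem 3 p (e i) (gradVec 3 u p) (gradVec 3 u p) (e i)
      = W * (adaptedCurv F ν p e (some i) (some 0) + b 0 0 * b i i - b i 0 ^ 2) := fun i => by
    rw [hN, riem_smul_mid, hcW]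
    have h1 := gauss_eq hF p (e i) (e 0) (e 0) (e i)
    have h2 : adaptedCurv F ν p e (some i) (some 0) = riem 4 (F p) (dAt 3 4 F p (e i))
      (dAt 3 4 F p (e 0)) (dAt 3 4 F p (e 0)) (dAt 3 4 F p (e i)) := rfl
    have h3 : b 0 i = b i 0 := secondForm_symm hF p _ _
    rw [h2, h1]
    change _ = W * (_ - b 0 0 * b i i + b i 0 * b 0 i + _ - _)
    rw [h3]
    ring
  simp only [hricM] at hlap
  rw [hlap, hricX, hII]
  have hself : adaptedCurv F ν p e (some 0) (some 0) = 0 := riem_self_left _ _ _ _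
  have hsw : ∀ o o', adaptedCurv F ν p e o o' = adaptedCurv F ν p e o' o := fun o o' =>
    riem_swap _ _ _
  have K : ∀ {a b c : Option (Fin 3)}, a ≠ b → a ≠ c → b ≠ c →
    0 ≤ adaptedCurv F ν p e b a + adaptedCurv F ν p e c a := fun h1 h2 h3 =>
      adaptedCurv_add_nonneg hRic hF he h1 h2 h3
  have k1 := K (a := some 0) (b := some 1) (c := some 2) (by simp) (by simp) (by simp)
  have k2 := K (a := some 2) (b := some 0) (c := none) (by simp) (by simp) (by simp)
  have k3 := K (a := none) (b := some 2) (c := some 0) (by simp) (by simp) (by simp)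
  have k4 := K (a := none) (b := some 0) (c := some 1) (by simp) (by simp) (by simp)
  have k5 := K (a := some 1) (b := none) (c := some 0) (by simp) (by simp) (by simp)
  rw [hsw (some 0) (some 2), hsw none (some 2)] at k2
  rw [hsw none (some 1), hsw (some 0) (some 1)] at k5
  have hsum : ∑ i, W * (adaptedCurv F ν p e (some i) (some 0) + b 0 0 * b i i - b i 0 ^ 2)
      = W * (adaptedCurv F ν p e (some 1) (some 0) + adaptedCurv F ν p e (some 2) (some 0))
        - W * ∑ i, b i 0 ^ 2 := by
    rw [← Finset.mul_sum, Finset.sum_sub_distrib, Finset.sum_add_distrib, ← Finset.mul_sum, hbt]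
    simp only [Fin.sum_univ_three, hself]
    ring
  rw [hsum, Fin.sum_univ_three (fun i => adaptedCurv F ν p e (some i) none)]
  have hB := mul_le_mul_of_nonneg_left hb1 hW0
  have hKW : 0 ≤ W * (adaptedCurv F ν p e (some 1) (some 0) + adaptedCurv F ν p e (some 2) (some 0)
    + (adaptedCurv F ν p e (some 0) none + adaptedCurv F ν p e (some 1) none
      + adaptedCurv F ν p e (some 2) none)) := mul_nonneg hW0 (by linarith)
  change _ ≤ 1 / 2 * (2 * (∑ i, ∑ j, H i j ^ 2 + _)) + _
  nlinarith [hkato, hH1, hB, hKW]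

end Interior

section BoundaryIntrinsic

variable {n : ℕ} [NeZero n] {X : Type*} [TopologicalSpace X]
  [ChartedSpace (EuclideanHalfSpace n) X]
  [RiemannianBundle (fun x : X => TangentSpace (𝓡∂ n) x)]
  [IsManifold (𝓡∂ n) ∞ X]
  [IsContMDiffRiemannianBundle (𝓡∂ n) ∞ (EuclideanSpace ℝ (Fin n))
      (fun p : X => TangentSpace (𝓡∂ n) p)]

variable (n) in
/-- The outward unit normal as a coordinate vector. -/
def outNormal (p : X) : Euc n := chartNormal n p (extChartAt (𝓡∂ n) p p)

lemma metricAt_outNormal_self (p : X) : metricAt n p (outNormal n p) (outNormal n p) = 1 := by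
  have h3 := chartGrad0_normSq_pos p (mem_extChartAt_target (I := 𝓡∂ n) p)
  have h4 := Real.sqrt_pos.2 h3
  rw [outNormal, metricAt_chartNormal]
  have h5 : chartNormal n p (extChartAt (𝓡∂ n) p p) 0
    = -(Real.sqrt (chartGrad0 n p (extChartAt (𝓡∂ n) p p) 0))⁻¹
      * chartGrad0 n p (extChartAt (𝓡∂ n) p p) 0 := rfl
  rw [h5]
  set c := chartGrad0 n p (extChartAt (𝓡∂ n) p p) 0
  have h6 := Real.mul_self_sqrt h3.le
  field_simp
  linarith

lemma outNormal_coeff_ne_zero (p : X) :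
    -(Real.sqrt (chartGrad0 n p (extChartAt (𝓡∂ n) p p) 0))⁻¹ ≠ 0 :=
  neg_ne_zero.2 (inv_ne_zero
    (Real.sqrt_pos.2 (chartGrad0_normSq_pos p (mem_extChartAt_target (I := 𝓡∂ n) p))).ne')

lemma metricAt_outNormal_eq_zero_iff (p : X) (v : Euc n) :
    metricAt n p v (outNormal n p) = 0 ↔ v 0 = 0 := by
  rw [outNormal, metricAt_chartNormal, mul_eq_zero, or_iff_right (outNormal_coeff_ne_zero p)]

/-- An orthonormal basis whose first vector is the outward unit normal. -/
lemma exists_onb_outNormal [Nontrivial (Fin n)] (p : X) : ∃ e : Fin n → Euc n,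
    IsOrthoBasis (chartMetric n p (extChartAt (𝓡∂ n) p p)) e ∧ e 0 = outNormal n p ∧
    ∀ i, i ≠ 0 → e i 0 = 0 := by
  obtain ⟨e, he, h0⟩ := exists_onb_first p (outNormal n p)
  rw [metricAt_outNormal_self, Real.sqrt_one, one_smul] at h0
  refine ⟨e, he, h0.symm, fun i hi => ?_⟩
  have := he.orth i 0
  rw [if_neg hi, chartMetric_self, ← h0] at this
  exact (metricAt_outNormal_eq_zero_iff p _).1 this

lemma boundaryII_smul_smul (p : X) (c : ℝ) (v w : Euc n) :
    boundaryII n p (c • v) (c • w) = c ^ 2 * boundaryII n p v w := by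
  simp only [boundaryII_eq, ← chartMetric_self, map_smul, smul_apply, smul_eq_mul]
  ring

variable (n) in
/-- The second fundamental form of the boundary precomposed with the orthogonal projection onto
its tangent space. -/
def boundaryForm (p : X) : Euc n →ₗ[ℝ] Euc n →ₗ[ℝ] ℝ :=
  LinearMap.mk₂ ℝ (fun v w => boundaryII n p (v - metricAt n p v (outNormal n p) • outNormal n p)
      (w - metricAt n p w (outNormal n p) • outNormal n p))
    (fun v v' w => by
      simp only [boundaryII_eq, ← chartMetric_self, map_add, map_sub, map_smul, add_apply,
        sub_apply, smul_apply, smul_eq_mul]; ring)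
    (fun c v w => by
      simp only [boundaryII_eq, ← chartMetric_self, map_sub, map_smul,
        sub_apply, smul_apply, smul_eq_mul]; ring)
    (fun v w w' => by
      simp only [boundaryII_eq, ← chartMetric_self, map_add, map_sub, map_smul, add_apply,
        sub_apply, smul_apply, smul_eq_mul]; ring)
    (fun c v w => by
      simp only [boundaryII_eq, ← chartMetric_self, map_sub, map_smul,
        sub_apply, smul_apply, smul_eq_mul]; ring)

lemma boundaryForm_tangent (p : X) {v : Euc n} (hv : v 0 = 0) :
    boundaryForm n p v v = boundaryII n p v v := by
  change boundaryII n p (v - metricAt n p v (outNormal n p) • outNormal n p)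
      (v - metricAt n p v (outNormal n p) • outNormal n p) = _
  rw [(metricAt_outNormal_eq_zero_iff p v).2 hv, zero_smul, sub_zero]

lemma boundaryForm_outNormal (p : X) :
    boundaryForm n p (outNormal n p) (outNormal n p) = 0 := by
  change boundaryII n p (outNormal n p - metricAt n p _ (outNormal n p) • outNormal n p)
      (outNormal n p - metricAt n p _ (outNormal n p) • outNormal n p) = 0
  rw [metricAt_outNormal_self, one_smul, sub_self]
  have := boundaryII_smul_smul (n := n) p 0 0 0
  simpa using this

lemma boundaryMeanCurvature_eq_sum (p : X) {ι : Type*} [Fintype ι] [DecidableEq ι] {e : ι → Euc n}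
    (he : IsOrthoBasis (chartMetric n p (extChartAt (𝓡∂ n) p p)) e) :
    boundaryMeanCurvature n p = ∑ i, boundaryForm n p (e i) (e i) := by
  rw [← (isOrthoBasis_onb p).sum_bilin_eq he (boundaryForm n p)]
  refine Finset.sum_congr rfl fun i _ => ?_
  have h : ∀ v : Euc n, (boundaryProj n p v : Euc n)
      = v - metricAt n p v (outNormal n p) • outNormal n p := fun v => by
    have h1 : (outwardNormal n p : Euc n) = outNormal n p := outwardNormal_eq p
    rw [← h1]
    rfl
  exact congrArg₂ (boundaryII n p) (h (onbVec n p i)) (h (onbVec n p i))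

end BoundaryIntrinsic

section BoundaryIdentities

variable {M : Type*} [TopologicalSpace M] [ChartedSpace (EuclideanHalfSpace 3) M]
  [RiemannianBundle (fun p : M => TangentSpace (𝓡∂ 3) p)]
  [IsManifold (𝓡∂ 3) ∞ M]
  [IsContMDiffRiemannianBundle (𝓡∂ 3) ∞ (EuclideanSpace ℝ (Fin 3))
      (fun p : M => TangentSpace (𝓡∂ 3) p)]

lemma normalDeriv_gradSq {u : M → ℝ} (hu : ContMDiff (𝓡∂ 3) 𝓘(ℝ, ℝ) ∞ u) (p : M) :
    normalDeriv (gradSq 3 u) p = 2 * hess 3 u p (outNormal 3 p) (gradVec 3 u p) := by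
  rw [← dfun_gradSq hu]
  have h1 : (outwardNormal 3 p : Euc 3) = outNormal 3 p := outwardNormal_eq p
  rw [← h1]
  rfl

lemma gradVec_normal {u : M → ℝ} (hu : ContMDiff (𝓡∂ 3) 𝓘(ℝ, ℝ) ∞ u)
    (hN : IsNeumann 3 u) (x : M) {z : Euc 3} (hz : z ∈ (extChartAt (𝓡∂ 3) x).target)
    (hz0 : z 0 = 0) : chartGrad 3 u x z 0 = 0 := by
  have hp := (extChartAt (𝓡∂ 3) x).map_target hz
  have hb : (extChartAt (𝓡∂ 3) x).symm z ∈ (𝓡∂ 3).boundary M := by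
    rw [mem_boundary_iff hp, (extChartAt (𝓡∂ 3) x).right_inv hz, hz0]
  have h1 : normalDeriv u ((extChartAt (𝓡∂ 3) x).symm z) = 0 := hN _ hb
  rw [normalDeriv_chart hu hp hb, (extChartAt (𝓡∂ 3) x).right_inv hz] at h1
  have h2 := chartMetric_grad u x hz (chartNormal 3 x z)
  have h3 : chartMetric 3 x z (chartGrad 3 u x z) (chartNormal 3 x z) = 0 := h2.trans h1
  rw [(isLeviCivitaOn_chart 3 x).symm z hz, chartMetric_normal x hz] at h3
  refine (mul_eq_zero.1 h3).resolve_left ?_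
  exact neg_ne_zero.2 (inv_ne_zero (Real.sqrt_pos.2 (chartGrad0_normSq_pos x hz)).ne')

lemma hess_neumann {u : M → ℝ} (hu : ContMDiff (𝓡∂ 3) 𝓘(ℝ, ℝ) ∞ u)
    (hN : IsNeumann 3 u) {p : M} (hb : p ∈ (𝓡∂ 3).boundary M) :
    gradVec 3 u p 0 = 0 ∧ hess 3 u p (outNormal 3 p) (gradVec 3 u p)
      = - boundaryII 3 p (gradVec 3 u p) (gradVec 3 u p) := by
  have hz := mem_extChartAt_target (I := 𝓡∂ 3) p
  have hz0 := (mem_boundary_iff (mem_extChartAt_source p)).1 hb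
  have h0 : gradVec 3 u p 0 = 0 := by rw [gradVec_self hu]; exact gradVec_normal hu hN p hz hz0
  refine ⟨h0, ?_⟩
  have h1 := (isLeviCivitaOn_chart 3 p).inner_localNabla (contDiffOn_comp_symm hu p)
    (contDiffOn_chartGrad hu p) (fun z hz v => chartMetric_grad u p hz v) hz
    (gradVec 3 u p) (outNormal 3 p)
  have h2 : fderivWithin ℝ (chartGrad 3 u p) (extChartAt (𝓡∂ 3) p).target
      (extChartAt (𝓡∂ 3) p p) (gradVec 3 u p) 0 = 0 := by
    have hd : DifferentiableWithinAt ℝ (chartGrad 3 u p) (extChartAt (𝓡∂ 3) p).target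
      (extChartAt (𝓡∂ 3) p p) := (contDiffOn_chartGrad hu p _ hz).differentiableWithinAt (by simp)
    have h3 := fderivWithin_eq_zero_of_boundary (n := 3) p isOpen_univ
      (k := fun y => EuclideanSpace.proj (𝕜 := ℝ) (0 : Fin 3) (chartGrad 3 u p y))
      (z := extChartAt (𝓡∂ 3) p p) (w := gradVec 3 u p) ⟨hz, mem_univ _⟩ hz0 h0
      (by
        rw [inter_univ]
        exact (EuclideanSpace.proj (𝕜 := ℝ) (0 : Fin 3)).differentiableAt.comp_differentiableWithinAt
          _ hd)
      (fun y hy hy0 => gradVec_normal hu hN p hy.1 hy0)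
    rw [inter_univ] at h3
    have h4 := ((EuclideanSpace.proj (𝕜 := ℝ) (0 : Fin 3)).hasFDerivAt.comp_hasFDerivWithinAt _
      hd.hasFDerivWithinAt).fderivWithin ((isLeviCivitaOn_chart 3 p).uniq _ hz)
    change fderivWithin ℝ (EuclideanSpace.proj (𝕜 := ℝ) (0 : Fin 3) ∘ chartGrad 3 u p) _ _ _ = 0 at h3
    rw [h4] at h3
    exact h3
  rw [hess_symm hu]
  change localHess _ _ _ _ _ _ = _
  refine h1.symm.trans ?_
  rw [boundaryII_eq, neg_neg, localNabla, add_apply, map_add, add_apply, chartMetric_self,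
    chartMetric_self, (metricAt_outNormal_eq_zero_iff p _).2 h2, zero_add,
    ContinuousLinearMap.flip_apply, ← gradVec_self hu]
  rfl

lemma chartD_dirichlet {u : M → ℝ} (hu : ContMDiff (𝓡∂ 3) 𝓘(ℝ, ℝ) ∞ u)
    (hD : IsDirichlet 3 u) {p : M} (hb : p ∈ (𝓡∂ 3).boundary M) :
    ∃ U : Set (Euc 3), IsOpen U ∧ extChartAt (𝓡∂ 3) p p ∈ U ∧
      ∀ z ∈ (extChartAt (𝓡∂ 3) p).target ∩ U, z 0 = 0 → ∀ v : Euc 3, v 0 = 0 →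
        chartD 3 u p z v = 0 := by
  have h1 := (IsLocallyConstant.iff_eventually_eq _).1 hD ⟨p, hb⟩
  rw [nhds_subtype_eq_comap, Filter.eventually_comap] at h1
  obtain ⟨V, hV, hVo, hpV⟩ := eventually_nhds_iff.1 h1
  obtain ⟨U, hU, hUV⟩ := continuousOn_iff'.1 (continuousOn_extChartAt_symm (I := 𝓡∂ 3) p) V hVo
  have hz := mem_extChartAt_target (I := 𝓡∂ 3) p
  have hzU : extChartAt (𝓡∂ 3) p p ∈ U := by
    have : extChartAt (𝓡∂ 3) p p ∈ (extChartAt (𝓡∂ 3) p).symm ⁻¹' V ∩ (extChartAt (𝓡∂ 3) p).target :=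
      ⟨by rw [mem_preimage, extChartAt_to_inv]; exact hpV, hz⟩
    rw [hUV] at this
    exact this.1
  refine ⟨U, hU, hzU, fun z hzz hz0 v hv => ?_⟩
  have hconst : ∀ y ∈ (extChartAt (𝓡∂ 3) p).target ∩ U, y 0 = 0 → inChart 3 u p y - u p = 0 := by
    intro y hy hy0
    have hyV : y ∈ (extChartAt (𝓡∂ 3) p).symm ⁻¹' V ∩ (extChartAt (𝓡∂ 3) p).target := by
      rw [hUV]; exact ⟨hy.2, hy.1⟩
    have hp := (extChartAt (𝓡∂ 3) p).map_target hy.1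
    have hbq : (extChartAt (𝓡∂ 3) p).symm y ∈ (𝓡∂ 3).boundary M := by
      rw [mem_boundary_iff hp, (extChartAt (𝓡∂ 3) p).right_inv hy.1, hy0]
    exact sub_eq_zero.2 (hV _ hyV.1 ⟨_, hbq⟩ rfl)
  have hd : DifferentiableWithinAt ℝ (inChart 3 u p) (extChartAt (𝓡∂ 3) p).target z :=
    (contDiffOn_comp_symm hu p _ hzz.1).differentiableWithinAt (by simp)
  have h3 := fderivWithin_eq_zero_of_boundary (n := 3) p hU hzz hz0 hv
    ((hd.mono inter_subset_left).sub_const (u p)) hconst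
  rw [fderivWithin_sub_const, fderivWithin_inter (hU.mem_nhds hzz.2)] at h3
  exact h3

lemma hess_dirichlet {u : M → ℝ} (hu : ContMDiff (𝓡∂ 3) 𝓘(ℝ, ℝ) ∞ u)
    (hD : IsDirichlet 3 u) {p : M} (hb : p ∈ (𝓡∂ 3).boundary M) {v w : Euc 3} (hv : v 0 = 0)
    (hw : w 0 = 0) : dfun 3 u p v = 0 ∧ hess 3 u p v w
      = - metricAt 3 p (gradVec 3 u p)
          (chartChristoffel 3 p (extChartAt (𝓡∂ 3) p p) v w) := by
  have hz := mem_extChartAt_target (I := 𝓡∂ 3) p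
  have hz0 := (mem_boundary_iff (mem_extChartAt_source p)).1 hb
  obtain ⟨U, hU, hzU, hUD⟩ := chartD_dirichlet hu hD hb
  refine ⟨by rw [dfun_self hu]; exact hUD _ ⟨hz, hzU⟩ hz0 v hv, ?_⟩
  have hd : DifferentiableWithinAt ℝ (chartD 3 u p) (extChartAt (𝓡∂ 3) p).target
      (extChartAt (𝓡∂ 3) p p) := (contDiffOn_chartD hu p _ hz).differentiableWithinAt (by simp)
  have hu1 := (isLeviCivitaOn_chart 3 p).uniq _ hz
  have h3 := fderivWithin_eq_zero_of_boundary (n := 3) p hU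
    (k := fun y => chartD 3 u p y w) ⟨hz, hzU⟩ hz0 hv
    ((hd.mono inter_subset_left).clm_apply (differentiableWithinAt_const w))
    (fun y hy hy0 => hUD y hy hy0 w hw)
  rw [fderivWithin_inter (hU.mem_nhds hzU), fderivWithin_eval hu1 hd] at h3
  rw [metricAt_grad, dfun_self hu, hess, localHess]
  change fderivWithin ℝ (chartD 3 u p) _ _ v w - _ = _
  rw [h3, zero_sub]
  rfl

end BoundaryIdentities

section BoundaryPointwise

variable {M : Type*} [TopologicalSpace M] [ChartedSpace (EuclideanHalfSpace 3) M]
  [RiemannianBundle (fun p : M => TangentSpace (𝓡∂ 3) p)]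
  {X : Type*} [TopologicalSpace X] [ChartedSpace (EuclideanHalfSpace 4) X]
  [RiemannianBundle (fun x : X => TangentSpace (𝓡∂ 4) x)]
  [IsManifold (𝓡∂ 3) ∞ M] [IsManifold (𝓡∂ 4) ∞ X]
  [IsContMDiffRiemannianBundle (𝓡∂ 3) ∞ (EuclideanSpace ℝ (Fin 3))
      (fun p : M => TangentSpace (𝓡∂ 3) p)]
  [IsContMDiffRiemannianBundle (𝓡∂ 4) ∞ (EuclideanSpace ℝ (Fin 4))
      (fun p : X => TangentSpace (𝓡∂ 4) p)]
  {F : M → X} {ν : ∀ p, TangentSpace (𝓡∂ 4) (F p)}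


lemma orthonormal_normal_pair (hF : IsFBMH 3 4 F ν) {p : M} {e : Fin 3 → Euc 3}
    (he : IsOrthoBasis (chartMetric 3 p (extChartAt (𝓡∂ 3) p p)) e) (i : Fin 3) :
    Orthonormal ℝ ![adaptedTangent F ν p e none, adaptedTangent F ν p e (some i)] := by
  have hinj : Function.Injective ![none, some i] := by
    intro i j hij
    fin_cases i <;> fin_cases j <;> simp_all
  have h := (orthonormal_adapted hF he).comp _ hinj
  have h1 : (![adaptedTangent F ν p e none, adaptedTangent F ν p e (some i)] :
      Fin 2 → TangentSpace (𝓡∂ 4) (F p)) = adaptedTangent F ν p e ∘ ![none, some i] := by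
    funext i
    fin_cases i <;> rfl
  rwa [h1]

lemma dAt_zero (hF : IsFBMH 3 4 F ν) {p : M} (hb : p ∈ (𝓡∂ 3).boundary M) {v : Euc 3}
    (hv : v 0 = 0) : dAt 3 4 F p v 0 = 0 := by
  have h := fderivWithin_inCharts_zero hF.smooth hF.boundary
    (mem_chartDomain (F := F) (mem_extChartAt_source (I := 𝓡∂ 3) p)
      (mem_extChartAt_source (I := 𝓡∂ 4) (F p)))
    ((mem_boundary_iff (mem_extChartAt_source p)).1 hb) hv
  rwa [fderivWithin_inCharts_self hF.smooth p] at h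

lemma dAt_outNormal (hF : IsFBMH 3 4 F ν) {p : M} (hb : p ∈ (𝓡∂ 3).boundary M) :
    dAt 3 4 F p (outNormal 3 p) = outNormal 4 (F p) := by
  have h1 : (outwardNormal 3 p : Euc 3) = outNormal 3 p := outwardNormal_eq p
  have h2 : (outwardNormal 4 (F p) : Euc 4) = outNormal 4 (F p) := outwardNormal_eq (F p)
  rw [← h1, ← h2]
  exact hF.free_boundary p hb

/-- The boundary terms in the stability argument have a favourable sign. -/
lemma pointwise_boundary (hF : IsFBMH 3 4 F ν) {u : M → ℝ} (hu : IsHarmonic 3 u)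
    (hbdry : (IsNeumann 3 u ∧ Bdry2Convex 4 X) ∨ (IsDirichlet 3 u ∧ BdryMeanConvex 4 X))
    {p : M} (hp : p ∈ (𝓡∂ 3).boundary M) :
    0 ≤ boundaryII 4 (F p) (ν p) (ν p) * gradSq 3 u p
      - 1 / 2 * normalDeriv (gradSq 3 u) p := by
  rw [normalDeriv_gradSq hu.1]
  rcases hbdry with ⟨hN, hconv⟩ | ⟨hD, hconv⟩
  · obtain ⟨h0, hH⟩ := hess_neumann hu.1 hN hp
    rw [hH]
    obtain ⟨e, he, hNe⟩ := exists_onb_first (n := 3) p (gradVec 3 u p)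
    rw [← gradNorm_sq] at hNe
    change _ = Real.sqrt (gradSq 3 u p) • e 0 at hNe
    have hW0 : 0 ≤ gradSq 3 u p := sq_nonneg _
    have hcW := Real.sq_sqrt hW0
    rw [hNe, boundaryII_smul_smul, hcW]
    rcases hW0.eq_or_lt with h | h
    · rw [← h]; simp
    · have he0 : e 0 0 = 0 := by
        rw [hNe] at h0
        exact (mul_eq_zero.1 (show Real.sqrt (gradSq 3 u p) * e 0 0 = 0 from h0)).resolve_left
          (Real.sqrt_pos.2 h).ne'
      have h1 := hconv (F p) (hF.boundary p hp) _ (show nrm 4 F ν p 0 = 0 from nrm_zero hF hp) _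
        (show dAt 3 4 F p (e 0) 0 = 0 from dAt_zero hF hp he0) (orthonormal_normal_pair hF he 0)
      have h2 : boundaryII 4 (F p) (dAt 3 4 F p (e 0)) (dAt 3 4 F p (e 0))
        = boundaryII 3 p (e 0) (e 0) := boundaryII_dAt hF hp he0 he0
      have h3 : 0 ≤ boundaryII 4 (F p) (ν p) (ν p) + boundaryII 3 p (e 0) (e 0) := by
        rw [← h2]; exact h1
      nlinarith
  · obtain ⟨e, he, he0, het⟩ := exists_onb_outNormal (n := 3) p
    set N := gradVec 3 u p with hNdef
    set a := metricAt 3 p N (e 0) with ha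
    have hi : ∀ i, i ≠ 0 → metricAt 3 p N (e i) = 0 := fun i hi => by
      rw [metricAt_grad]; exact (hess_dirichlet hu.1 hD hp (het i hi) (het i hi)).1
    have hN : N = a • e 0 := by
      have := he.span N
      rw [Fin.sum_univ_three] at this
      simp only [chartMetric_self, hi 1 (by simp), hi 2 (by simp), zero_smul, add_zero] at this
      exact this
    have hHi : ∀ i, i ≠ 0 → hess 3 u p (e i) (e i) = a * boundaryII 3 p (e i) (e i) := fun i hi => by
      rw [(hess_dirichlet hu.1 hD hp (het i hi) (het i hi)).2, boundaryII_eq, ← hNdef, hN]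
      change _ = a * -metricAt 3 p _ (outNormal 3 p)
      rw [← he0, metricAt_comm, ← chartMetric_self, ← chartMetric_self, map_smul, smul_eq_mul]
      ring
    have hW : gradSq 3 u p = a ^ 2 := by
      have h1 : gradSq 3 u p = metricAt 3 p N N := gradNorm_sq u p
      rw [h1, hN, ← chartMetric_self, map_smul, map_smul, smul_apply, he.orth, if_pos rfl]
      simp [sq]
    have hlap := laplacian_eq_sum hu.1 (mem_extChartAt_source p) he
    rw [hu.2, Fin.sum_univ_three] at hlap
    change 0 = hess 3 u p (e 0) (e 0) + hess 3 u p (e 1) (e 1) + hess 3 u p (e 2) (e 2) at hlap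
    rw [hHi 1 (by simp), hHi 2 (by simp)] at hlap
    have h1 : hess 3 u p (outNormal 3 p) N = a * hess 3 u p (e 0) (e 0) := by
      have := hess_sum_right u p (e 0) (fun _ : Fin 1 => a) (fun _ => e 0)
      rw [hN, ← he0]
      simpa using this
    have hH := boundaryMeanCurvature_eq_sum (F p) (isOrthoBasis_adapted hF he (by simp))
    rw [Fintype.sum_option, Fin.sum_univ_three] at hH
    have t0 : adapted F ν p e none = nrm 4 F ν p := rfl
    have ti : ∀ i, adapted F ν p e (some i) = dAt 3 4 F p (e i) := fun i => rfl
    rw [t0, ti, ti, ti, he0, dAt_outNormal hF hp, boundaryForm_outNormal,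
      boundaryForm_tangent _ (nrm_zero hF hp), boundaryForm_tangent _ (dAt_zero hF hp (het 1 (by simp))),
      boundaryForm_tangent _ (dAt_zero hF hp (het 2 (by simp))),
      boundaryII_dAt hF hp (het 1 (by simp)) (het 1 (by simp)),
      boundaryII_dAt hF hp (het 2 (by simp)) (het 2 (by simp))] at hH
    have h2 := hconv (F p) (hF.boundary p hp)
    rw [hH] at h2
    have h3 : boundaryII 4 (F p) (nrm 4 F ν p) (nrm 4 F ν p) = boundaryII 4 (F p) (ν p) (ν p) := rfl
    rw [h3] at h2
    rw [h1, hW]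
    have h4 : hess 3 u p (e 0) (e 0) = -(a * boundaryII 3 p (e 1) (e 1) + a * boundaryII 3 p (e 2) (e 2)) := by
      linarith
    rw [h4]
    nlinarith [mul_nonneg (sq_nonneg a) h2]

end BoundaryPointwise

section GradientAlgebra

lemma integral_linear_combination {α : Type*} [MeasurableSpace α] {μ : Measure α}
    {f g h k : α → ℝ} (hf : Integrable f μ) (hg : Integrable g μ) (hh : Integrable h μ)
    (hk : Integrable k μ) (a b : ℝ) :
    ∫ p, (a * f p + g p + b * h p - k p) ∂μ
      = a * ∫ p, f p ∂μ + ∫ p, g p ∂μ + b * ∫ p, h p ∂μ - ∫ p, k p ∂μ := by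
  have h1 := hf.const_mul a
  have h2 := hh.const_mul b
  have h3 : Integrable (fun p => a * f p + g p) μ := h1.add hg
  have h4 : Integrable (fun p => a * f p + g p + b * h p) μ := h3.add h2
  rw [integral_sub h4 hk, integral_add h3 h2, integral_add h1 hg, integral_const_mul,
    integral_const_mul]

variable {M : Type*} [TopologicalSpace M] [ChartedSpace (EuclideanHalfSpace 3) M]
  [RiemannianBundle (fun p : M => TangentSpace (𝓡∂ 3) p)]
  [IsManifold (𝓡∂ 3) ∞ M]
  [IsContMDiffRiemannianBundle (𝓡∂ 3) ∞ (EuclideanSpace ℝ (Fin 3))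
      (fun p : M => TangentSpace (𝓡∂ 3) p)]
  [SecondCountableTopology M] [MeasurableSpace M] [BorelSpace M]

lemma dfun_grad_eq_sum (f h : M → ℝ) {p : M} {ι : Type*} [Fintype ι] [DecidableEq ι]
    {e : ι → Euc 3} (he : IsOrthoBasis (chartMetric 3 p (extChartAt (𝓡∂ 3) p p)) e) :
    dfun 3 f p (gradVec 3 h p) = ∑ i, dfun 3 f p (e i) * dfun 3 h p (e i) := by
  rw [← metricAt_grad f, ← chartMetric_self, he.inner_eq]
  refine Finset.sum_congr rfl fun i _ => ?_
  rw [(isLeviCivitaOn_chart 3 p).symm _ (mem_extChartAt_target p) (e i), chartMetric_self,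
    chartMetric_self, metricAt_grad, metricAt_grad]

lemma contMDiff_sqrt_add {W : M → ℝ} (hW : ContMDiff (𝓡∂ 3) 𝓘(ℝ, ℝ) ∞ W) (h0 : ∀ p, 0 ≤ W p)
    {ε : ℝ} (hε : 0 < ε) :
    ContMDiff (𝓡∂ 3) 𝓘(ℝ, ℝ) ∞ (fun p => Real.sqrt (W p + ε)) := by
  intro p
  have h1 : ContMDiffAt (𝓡∂ 3) 𝓘(ℝ, ℝ) ∞ (fun p => W p + ε) p := (hW p).add contMDiffAt_const
  have h2 : ContMDiffAt 𝓘(ℝ, ℝ) 𝓘(ℝ, ℝ) ∞ Real.sqrt (W p + ε) :=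
    (Real.contDiffAt_sqrt (by have := h0 p; positivity)).contMDiffAt
  exact h2.comp p h1

lemma dfun_sqrt_add {W : M → ℝ} (hW : ContMDiff (𝓡∂ 3) 𝓘(ℝ, ℝ) ∞ W) (h0 : ∀ p, 0 ≤ W p)
    {ε : ℝ} (hε : 0 < ε) (p : M) (v : Euc 3) :
    2 * Real.sqrt (W p + ε) * dfun 3 (fun q => Real.sqrt (W q + ε)) p v = dfun 3 W p v := by
  have hs := (contMDiff_sqrt_add hW h0 hε).mdifferentiableAt (x := p) (by simp)
  have h1 := dfun_mul hs hs
  have h2 : (fun q => Real.sqrt (W q + ε) * Real.sqrt (W q + ε)) = W + fun _ => ε := by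
    ext q
    exact Real.mul_self_sqrt (by have := h0 q; positivity)
  have h3 : dfun 3 (W + fun _ => ε) p = dfun 3 W p := by
    have := ((hW.mdifferentiableAt (x := p) (by simp)).hasMFDerivAt.add
      (hasMFDerivAt_const (I := 𝓡∂ 3) ε p)).mfderiv
    exact this.trans (add_zero _)
  rw [h2, h3] at h1
  rw [h1, add_apply, smul_apply, smul_eq_mul]
  ring

/-- The gradient of `φ √(W + ε)`. -/
lemma gradNorm_sq_mul_sqrt {φ W : M → ℝ} (hφ : ContMDiff (𝓡∂ 3) 𝓘(ℝ, ℝ) ∞ φ)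
    (hW : ContMDiff (𝓡∂ 3) 𝓘(ℝ, ℝ) ∞ W) (h0 : ∀ p, 0 ≤ W p) {ε : ℝ} (hε : 0 < ε) (p : M) :
    gradNorm 3 (fun q => φ q * Real.sqrt (W q + ε)) p ^ 2
      = φ p ^ 2 * (gradNorm 3 W p ^ 2 / (4 * (W p + ε)))
        + 1 / 2 * dfun 3 (fun q => φ q * φ q) p (gradVec 3 W p)
        + (W p + ε) * gradNorm 3 φ p ^ 2 := by
  have he := isOrthoBasis_onb (n := 3) p
  have hφd := hφ.mdifferentiableAt (x := p) (by simp)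
  have hs := (contMDiff_sqrt_add hW h0 hε).mdifferentiableAt (x := p) (by simp)
  have hpos : 0 < W p + ε := by have := h0 p; positivity
  set c := Real.sqrt (W p + ε) with hc
  have hc2 : c ^ 2 = W p + ε := Real.sq_sqrt hpos.le
  have hcpos : 0 < c := Real.sqrt_pos.2 hpos
  rw [gradNorm_sq_eq_sum _ he, gradNorm_sq_eq_sum W he, gradNorm_sq_eq_sum φ he,
    dfun_grad_eq_sum _ _ he, dfun_mul hφd hs, dfun_mul hφd hφd, Finset.sum_div, Finset.mul_sum,
    Finset.mul_sum, Finset.mul_sum, ← Finset.sum_add_distrib, ← Finset.sum_add_distrib]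
  refine Finset.sum_congr rfl fun i _ => ?_
  rw [← dfun_sqrt_add hW h0 hε p (onbVec 3 p i), ← hc, ← hc2]
  simp only [add_apply, smul_apply, smul_eq_mul]
  field_simp
  ring

end GradientAlgebra

section Smooth

variable {M : Type*} [TopologicalSpace M] [ChartedSpace (EuclideanHalfSpace 3) M]
  [RiemannianBundle (fun p : M => TangentSpace (𝓡∂ 3) p)]
  {X : Type*} [TopologicalSpace X] [ChartedSpace (EuclideanHalfSpace 4) X]
  [RiemannianBundle (fun x : X => TangentSpace (𝓡∂ 4) x)]
  [IsManifold (𝓡∂ 3) ∞ M] [IsManifold (𝓡∂ 4) ∞ X]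
  [IsContMDiffRiemannianBundle (𝓡∂ 3) ∞ (EuclideanSpace ℝ (Fin 3))
      (fun p : M => TangentSpace (𝓡∂ 3) p)]
  [IsContMDiffRiemannianBundle (𝓡∂ 4) ∞ (EuclideanSpace ℝ (Fin 4))
      (fun p : X => TangentSpace (𝓡∂ 4) p)]
  [SecondCountableTopology M] [MeasurableSpace M] [BorelSpace M] [T2Space M]
  {F : M → X} {ν : ∀ p, TangentSpace (𝓡∂ 4) (F p)}


/-- The Kato quotient `|∇|∇u|²|² / (4 |∇u|²)`, which is `|∇|∇u||²` almost everywhere. -/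
def kato (u : M → ℝ) (p : M) : ℝ := gradNorm 3 (gradSq 3 u) p ^ 2 / (4 * gradSq 3 u p)

lemma gradSq_nonneg (u : M → ℝ) (p : M) : 0 ≤ gradSq 3 u p := sq_nonneg _

lemma kato_nonneg (u : M → ℝ) (p : M) : 0 ≤ kato u p :=
  div_nonneg (sq_nonneg _) (mul_nonneg (by norm_num) (gradSq_nonneg u p))

variable (F ν) in
/-- The integrand on the left hand side. -/
def katoII (u : M → ℝ) (p : M) : ℝ :=
  1 / 3 * normSqII 3 4 F ν p * gradSq 3 u p + 1 / 2 * kato u p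

lemma normSqII_nonneg (p : M) : 0 ≤ normSqII 3 4 F ν p :=
  Finset.sum_nonneg fun _ _ => Finset.sum_nonneg fun _ _ => sq_nonneg _

lemma katoII_nonneg (u : M → ℝ) (p : M) : 0 ≤ katoII F ν u p := by
  have h1 := normSqII_nonneg (F := F) (ν := ν) p
  have h2 := gradSq_nonneg u p
  have h3 := kato_nonneg u p
  unfold katoII
  positivity

lemma measurable_kato {u : M → ℝ} (hu : ContMDiff (𝓡∂ 3) 𝓘(ℝ, ℝ) ∞ u) : Measurable (kato u) := by
  have h1 := contMDiff_gradSq hu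
  exact (contMDiff_gradSq h1).continuous.measurable.div (h1.continuous.measurable.const_mul 4)

lemma measurable_katoII (hF : IsFBMH 3 4 F ν) {u : M → ℝ}
    (hu : ContMDiff (𝓡∂ 3) 𝓘(ℝ, ℝ) ∞ u) : Measurable (katoII F ν u) :=
  (((continuous_normSqII hF).measurable.const_mul _).mul
    (contMDiff_gradSq hu).continuous.measurable).add ((measurable_kato hu).const_mul _)

variable (F ν) in
/-- The quantity that controls the Kato term. -/
def bochnerBound (u : M → ℝ) (p : M) : ℝ :=
  1 / 2 * laplacian 3 (gradSq 3 u) p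
    + (ricci 4 (F p) (ν p) (ν p) + normSqII 3 4 F ν p) * gradSq 3 u p

lemma continuous_bochnerBound (hF : IsFBMH 3 4 F ν) {u : M → ℝ}
    (hu : ContMDiff (𝓡∂ 3) 𝓘(ℝ, ℝ) ∞ u) : Continuous (bochnerBound F ν u) :=
  (continuous_const.mul (continuous_laplacian (contMDiff_gradSq hu))).add
    (((continuous_ricci_normal hF).add (continuous_normSqII hF)).mul
      (contMDiff_gradSq hu).continuous)

lemma kato_add_katoII_le (hRic : Ric2Nonneg 4 X) (hF : IsFBMH 3 4 F ν) {u : M → ℝ}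
    (hu : IsHarmonic 3 u) (p : M) : kato u p + katoII F ν u p ≤ bochnerBound F ν u p := by
  have := pointwise_interior hRic hF hu p
  unfold katoII bochnerBound kato
  linarith

lemma katoII_le (hRic : Ric2Nonneg 4 X) (hF : IsFBMH 3 4 F ν) {u : M → ℝ}
    (hu : IsHarmonic 3 u) (p : M) : katoII F ν u p ≤ bochnerBound F ν u p := by
  have := kato_add_katoII_le hRic hF hu p
  have := kato_nonneg u p
  linarith

lemma integrable_sq_mul_katoII (hRic : Ric2Nonneg 4 X) (hF : IsFBMH 3 4 F ν) {u : M → ℝ}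
    (hu : IsHarmonic 3 u) {φ : M → ℝ} (hφ : Continuous φ) (hc : HasCompactSupport φ) :
    Integrable (fun p => φ p ^ 2 * katoII F ν u p) (vol 3 M) := by
  have hc2 : HasCompactSupport (fun p => φ p ^ 2) := hc.comp_left (g := fun t : ℝ => t ^ 2) (by simp)
  have h1 : Integrable (fun p => φ p ^ 2 * bochnerBound F ν u p) (vol 3 M) :=
    integrable_of_continuous ((hφ.pow 2).mul (continuous_bochnerBound hF hu.1)) hc2.mul_right
  refine h1.mono' ((hφ.pow 2).measurable.mul (measurable_katoII hF hu.1)).aestronglyMeasurable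
    (Filter.Eventually.of_forall fun p => ?_)
  rw [Real.norm_of_nonneg (mul_nonneg (sq_nonneg _) (katoII_nonneg u p))]
  exact mul_le_mul_of_nonneg_left (katoII_le hRic hF hu p) (sq_nonneg _)

lemma hasCompactSupport_gradNorm {φ : M → ℝ} (hc : HasCompactSupport φ) :
    HasCompactSupport (fun p => gradNorm 3 φ p ^ 2) := by
  refine HasCompactSupport.intro hc.isCompact fun p hp => ?_
  rw [gradNorm_sq_eq_sum φ (isOrthoBasis_onb p), dfun_eq_zero_of_notMem hp]
  simp

/-- The stability inequality tested with `φ |∇u|`, for smooth `φ`. -/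
lemma stability_smooth (hRic : Ric2Nonneg 4 X) (hF : IsFBMH 3 4 F ν) (hst : IsStable 3 4 F ν)
    {u : M → ℝ} (hu : IsHarmonic 3 u)
    (hbdry : (IsNeumann 3 u ∧ Bdry2Convex 4 X) ∨ (IsDirichlet 3 u ∧ BdryMeanConvex 4 X))
    {φ : M → ℝ} (hφ : ContMDiff (𝓡∂ 3) 𝓘(ℝ, ℝ) ∞ φ) (hc : HasCompactSupport φ) :
    ∫ p, φ p ^ 2 * katoII F ν u p ∂(vol 3 M)
      ≤ ∫ p, gradNorm 3 φ p ^ 2 * gradSq 3 u p ∂(vol 3 M) := by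
  set W := gradSq 3 u with hWdef
  have hW : ContMDiff (𝓡∂ 3) 𝓘(ℝ, ℝ) ∞ W := contMDiff_gradSq hu.1
  have hW0 : ∀ p, 0 ≤ W p := gradSq_nonneg u
  set Q : M → ℝ := fun p => ricci 4 (F p) (ν p) (ν p) + normSqII 3 4 F ν p with hQ
  have hQc : Continuous Q := (continuous_ricci_normal hF).add (continuous_normSqII hF)
  set B : M → ℝ := fun p => boundaryII 4 (F p) (ν p) (ν p) with hB
  have hBc : ContinuousOn B ((𝓡∂ 3).boundary M) := continuousOn_boundaryII_normal hF
  have hφc := hφ.continuous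
  have hc2 : HasCompactSupport (fun p => φ p ^ 2) := hc.comp_left (g := fun t : ℝ => t ^ 2) (by simp)
  have hgc : Continuous (fun p => gradNorm 3 φ p ^ 2) := (contMDiff_gradSq hφ).continuous
  have hgs := hasCompactSupport_gradNorm hc
  have hφφ : ContMDiff (𝓡∂ 3) 𝓘(ℝ, ℝ) ∞ (fun q => φ q * φ q) := hφ.mul hφ
  have hφφc : HasCompactSupport (fun q => φ q * φ q) := hc.mul_right
  have hgreen := green hφφ hW hφφc
  have i1 := integrable_sq_mul_katoII hRic hF hu hφc hc
  have i2 : Integrable (fun p => gradNorm 3 φ p ^ 2 * W p) (vol 3 M) :=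
    integrable_of_continuous (hgc.mul hW.continuous) hgs.mul_right
  have i3 : Integrable (fun p => gradNorm 3 φ p ^ 2 - Q p * φ p ^ 2) (vol 3 M) :=
    integrable_of_continuous (hgc.sub (hQc.mul (hφc.pow 2))) (hgs.sub hc2.mul_left)
  have i4 : Integrable (fun p => dfun 3 (fun q => φ q * φ q) p (gradVec 3 W p)
      + φ p * φ p * laplacian 3 W p) (vol 3 M) := by
    refine integrable_of_continuous ((continuous_dfun_grad hφφ hW).add
      (hφφ.continuous.mul (continuous_laplacian hW))) ?_
    refine HasCompactSupport.intro hφφc.isCompact fun p hp => ?_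
    have h0 : φ p * φ p = 0 := image_eq_zero_of_notMem_tsupport (f := fun q => φ q * φ q) hp
    rw [dfun_eq_zero_of_notMem hp, h0]
    simp
  have j1 : Integrable (fun p => B p * φ p ^ 2) (bdryArea 3 M) :=
    integrable_bdry_of_continuousOn (hBc.mul (hφc.pow 2).continuousOn) hc2.mul_left
  have j2 : Integrable (fun p => φ p * φ p * normalDeriv W p) (bdryArea 3 M) :=
    integrable_bdry_of_continuousOn (hφφ.continuous.continuousOn.mul (continuousOn_normalDeriv hW))
      hφφc.mul_right
  have j3 : Integrable (fun p => B p * φ p ^ 2 * W p) (bdryArea 3 M) :=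
    integrable_bdry_of_continuousOn ((hBc.mul (hφc.pow 2).continuousOn).mul
      hW.continuous.continuousOn) hc2.mul_left.mul_right
  set C : ℝ := ∫ p, (gradNorm 3 φ p ^ 2 - Q p * φ p ^ 2) ∂(vol 3 M)
    - ∫ p, B p * φ p ^ 2 ∂(bdryArea 3 M) with hC
  have hbd : 0 ≤ ∫ p, (B p * φ p ^ 2 * W p - 1 / 2 * (φ p * φ p * normalDeriv W p))
      ∂(bdryArea 3 M) := by
    have h2 : ∀ᵐ p ∂(bdryArea 3 M), p ∈ (𝓡∂ 3).boundary M := by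
      rw [ae_iff]; exact bdryArea_interior
    refine integral_nonneg_of_ae ?_
    filter_upwards [h2] with p hp
    have := mul_nonneg (sq_nonneg (φ p)) (pointwise_boundary hF hu hbdry hp)
    change 0 ≤ B p * φ p ^ 2 * W p - 1 / 2 * (φ p * φ p * normalDeriv W p)
    change 0 ≤ φ p ^ 2 * (B p * W p - 1 / 2 * normalDeriv W p) at this
    linarith
  rw [integral_sub j3 (j2.const_mul _), integral_const_mul] at hbd
  have key : ∀ ε : ℝ, 0 < ε → ∫ p, φ p ^ 2 * katoII F ν u p ∂(vol 3 M)
      ≤ ∫ p, gradNorm 3 φ p ^ 2 * W p ∂(vol 3 M) + ε * C := by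
    intro ε hε
    have hs := contMDiff_sqrt_add hW hW0 hε
    have h1 := hst (fun q => φ q * Real.sqrt (W q + ε)) (hφ.mul hs) hc.mul_right
    have hsq : ∀ p, (φ p * Real.sqrt (W p + ε)) ^ 2 = φ p ^ 2 * (W p + ε) := fun p => by
      rw [mul_pow, Real.sq_sqrt (by have := hW0 p; positivity)]
    have hle : ∫ p, (gradNorm 3 (fun q => φ q * Real.sqrt (W q + ε)) p ^ 2
          - Q p * (φ p * Real.sqrt (W p + ε)) ^ 2) ∂(vol 3 M)
        ≤ ∫ p, (1 / 2 * (dfun 3 (fun q => φ q * φ q) p (gradVec 3 W p)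
            + φ p * φ p * laplacian 3 W p) + gradNorm 3 φ p ^ 2 * W p
            + ε * (gradNorm 3 φ p ^ 2 - Q p * φ p ^ 2) - φ p ^ 2 * katoII F ν u p) ∂(vol 3 M) := by
      refine integral_mono ?_ (((i4.const_mul _).add i2).add (i3.const_mul ε) |>.sub i1) fun p => ?_
      · refine integrable_of_continuous ((contMDiff_gradSq (hφ.mul hs)).continuous.sub
          (hQc.mul ((hφc.mul hs.continuous).pow 2))) ?_
        refine (hasCompactSupport_gradNorm hc.mul_right).sub (HasCompactSupport.mul_left ?_)
        simp only [hsq]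
        exact hc2.mul_right
      · change gradNorm 3 (fun q => φ q * Real.sqrt (W q + ε)) p ^ 2
          - Q p * (φ p * Real.sqrt (W p + ε)) ^ 2 ≤ 1 / 2 * (dfun 3 (fun q => φ q * φ q) p
            (gradVec 3 W p) + φ p * φ p * laplacian 3 W p) + gradNorm 3 φ p ^ 2 * W p
            + ε * (gradNorm 3 φ p ^ 2 - Q p * φ p ^ 2) - φ p ^ 2 * katoII F ν u p
        rw [gradNorm_sq_mul_sqrt hφ hW hW0 hε, hsq]
        have hk := kato_add_katoII_le hRic hF hu p
        have hk2 : gradNorm 3 W p ^ 2 / (4 * (W p + ε)) ≤ kato u p := by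
          rcases (hW0 p).eq_or_lt with h | h
          · have h3 : gradNorm 3 W p ^ 2 = 0 := by
              rw [gradNorm_sq_eq_sum _ (isOrthoBasis_onb p)]
              refine Finset.sum_eq_zero fun i _ => ?_
              rw [dfun_gradSq hu.1]
              have h4 : gradVec 3 u p = 0 := by
                have h5 : gradNorm 3 u p ^ 2 = 0 := h.symm
                have h6 : ‖grad 3 u p‖ = 0 := (pow_eq_zero_iff two_ne_zero).1 h5
                have h7 : grad 3 u p = 0 := norm_eq_zero.1 h6
                exact h7
              rw [h4]
              have := hess_sum_right u p (onbVec 3 p i) (fun _ : Fin 0 => 0) (fun _ => 0)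
              simp only [Finset.univ_eq_empty, Finset.sum_empty] at this
              rw [this]; simp
            rw [h3, zero_div]
            exact kato_nonneg u p
          · exact div_le_div_of_nonneg_left (sq_nonneg _) (by positivity) (by linarith)
        have hk3 := mul_le_mul_of_nonneg_left (add_le_add_left hk2 (katoII F ν u p))
          (sq_nonneg (φ p))
        have hk4 := mul_le_mul_of_nonneg_left hk (sq_nonneg (φ p))
        change _ ≤ φ p ^ 2 * (1 / 2 * laplacian 3 W p + Q p * W p) at hk4
        linarith
    have hb : ∫ p, boundaryII 4 (F p) (ν p) (ν p) * (φ p * Real.sqrt (W p + ε)) ^ 2 ∂(bdryArea 3 M)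
        = ∫ p, B p * φ p ^ 2 * W p ∂(bdryArea 3 M) + ε * ∫ p, B p * φ p ^ 2 ∂(bdryArea 3 M) := by
      rw [← integral_const_mul, ← integral_add j3 (j1.const_mul ε)]
      refine integral_congr_ae (Filter.Eventually.of_forall fun p => ?_)
      change B p * (φ p * Real.sqrt (W p + ε)) ^ 2 = B p * φ p ^ 2 * W p + ε * (B p * φ p ^ 2)
      rw [hsq]; ring
    rw [hb] at h1
    have h2 := h1.trans (sub_le_sub_right hle _)
    have hsplit := integral_linear_combination i4 i2 i3 i1 (1 / 2) ε
    beta_reduce at hsplit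
    rw [hsplit, hgreen] at h2
    rw [hC]
    linarith
  have hlim : Filter.Tendsto (fun ε : ℝ => ∫ p, gradNorm 3 φ p ^ 2 * W p ∂(vol 3 M) + ε * C)
      (𝓝[>] 0) (𝓝 (∫ p, gradNorm 3 φ p ^ 2 * W p ∂(vol 3 M))) := by
    have : Continuous (fun ε : ℝ => ∫ p, gradNorm 3 φ p ^ 2 * W p ∂(vol 3 M) + ε * C) := by
      fun_prop
    have h := (this.tendsto 0).mono_left (nhdsWithin_le_nhds (s := Ioi 0))
    simpa using h
  exact ge_of_tendsto hlim (eventually_nhdsWithin_of_forall fun ε hε => key ε hε)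

end Smooth

section Mollification

open scoped Convolution

/-- Mollification of a Lipschitz function. -/
lemma exists_mollification {f : Euc 3 → ℝ} {K : NNReal} (hf : LipschitzWith K f) :
    ∃ g : ℕ → Euc 3 → ℝ, (∀ k, ContDiff ℝ ∞ (g k)) ∧ (∀ k z, |g k z - f z| ≤ K) ∧
      (∀ z, Filter.Tendsto (fun k => g k z) Filter.atTop (𝓝 (f z))) ∧
      (∀ k z v, |fderiv ℝ (g k) z v| ≤ K * ‖v‖) ∧
      ∀ᵐ z ∂(volume : Measure (Euc 3)), DifferentiableAt ℝ f z ∧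
        ∀ v, Filter.Tendsto (fun k => fderiv ℝ (g k) z v) Filter.atTop
          (𝓝 (fderiv ℝ f z v)) := by
  let b : ℕ → ContDiffBump (0 : Euc 3) := fun k =>
    ⟨1 / (2 * ((k : ℝ) + 1)), 1 / ((k : ℝ) + 1), by positivity, by
      apply one_div_lt_one_div_of_lt <;> [positivity; linarith [k.cast_nonneg (α := ℝ)]]⟩
  have hbout : ∀ k, (b k).rOut = 1 / ((k : ℝ) + 1) := fun k => rfl
  have hbin : ∀ k, (b k).rIn = 1 / (2 * ((k : ℝ) + 1)) := fun k => rfl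
  have hlim : Filter.Tendsto (fun k => (b k).rOut) Filter.atTop (𝓝 0) :=
    tendsto_one_div_add_atTop_nhds_zero_nat
  let ρ : ℕ → Euc 3 → ℝ := fun k => (b k).normed volume
  have hρs : ∀ k, ContDiff ℝ ∞ (ρ k) := fun k => (b k).contDiff_normed
  have hρc : ∀ k, HasCompactSupport (ρ k) := fun k => (b k).hasCompactSupport_normed
  have hfl : LocallyIntegrable f (volume : Measure (Euc 3)) := hf.continuous.locallyIntegrable
  let g : ℕ → Euc 3 → ℝ := fun k => ρ k ⋆[ContinuousLinearMap.lsmul ℝ ℝ, volume] f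
  have hdist : ∀ k z, |g k z - f z| ≤ K * (b k).rOut := fun k z => by
    rw [← Real.dist_eq]
    refine ContDiffBump.dist_normed_convolution_le hf.continuous.aestronglyMeasurable
      fun x hx => (hf.dist_le_mul x z).trans ?_
    exact mul_le_mul_of_nonneg_left (Metric.mem_ball.1 hx).le K.2
  have hder : ∀ k z v, fderiv ℝ (g k) z v
      = (ρ k ⋆[ContinuousLinearMap.lsmul ℝ ℝ, volume] fun x => lineDeriv ℝ f x v) z := by
    intro k z v
    have h1 := (hρc k).hasFDerivAt_convolution_left (ContinuousLinearMap.lsmul ℝ ℝ)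
      ((hρs k).of_le (by simp)) hfl z
    have h2 : fderiv ℝ (g k) z = _ := h1.fderiv
    have h3 := ((((hρc k).fderiv ℝ).convolutionExists_left
      ((ContinuousLinearMap.lsmul ℝ ℝ).precompL (Euc 3)) ((hρs k).continuous_fderiv (by simp))
      hfl) z).integrable_swap
    rw [h2, convolution_eq_swap, convolution_eq_swap, ContinuousLinearMap.integral_apply h3]
    simp only [ContinuousLinearMap.precompL_apply]
    let h : Euc 3 → ℝ := fun x => ρ k (z - x)
    have hd : ∀ x, HasFDerivAt h (-(fderiv ℝ (ρ k) (z - x))) x := fun x => by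
      have e1 : HasFDerivAt (ρ k) (fderiv ℝ (ρ k) (z - x)) (z - x) :=
        ((hρs k).differentiable (by simp) _).hasFDerivAt
      have e2 : HasFDerivAt (fun y : Euc 3 => z - y) (-ContinuousLinearMap.id ℝ (Euc 3)) x :=
        (hasFDerivAt_id x).const_sub z
      have e3 := e1.comp x e2
      rwa [ContinuousLinearMap.comp_neg, ContinuousLinearMap.comp_id] at e3
    have hhc : HasCompactSupport h := (hρc k).comp_homeomorph (Homeomorph.subLeft z)
    have hhs : ContDiff ℝ ∞ h := (hρs k).comp (contDiff_const.sub contDiff_id)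
    obtain ⟨D, hD⟩ := (hhs.of_le (m := 1) (by simp)).lipschitzWith_of_hasCompactSupport hhc one_ne_zero
    have key := hf.integral_lineDeriv_mul_eq (μ := volume) hD hhc v
    have e4 : ∀ x, lineDeriv ℝ h x (-v) = fderiv ℝ (ρ k) (z - x) v := fun x => by
      rw [(hd x).differentiableAt.lineDeriv_eq_fderiv, (hd x).fderiv]
      simp
    simp only [e4] at key
    simp only [ContinuousLinearMap.lsmul_apply, smul_eq_mul]
    rw [← key]
    exact integral_congr_ae (Filter.Eventually.of_forall fun x => mul_comm _ _)
  refine ⟨g, fun k => (hρc k).contDiff_convolution_left (n := ⊤) _ (hρs k) hfl, fun k z => ?_,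
    fun z => ?_, fun k z v => ?_, ?_⟩
  · refine (hdist k z).trans (mul_le_of_le_one_right K.2 ?_)
    rw [hbout, div_le_one (by positivity)]
    linarith [k.cast_nonneg (α := ℝ)]
  · rw [tendsto_iff_dist_tendsto_zero]
    refine squeeze_zero (fun _ => dist_nonneg) (fun k => ?_) (by simpa using hlim.const_mul (K : ℝ))
    rw [Real.dist_eq]
    exact hdist k z
  · rw [hder, convolution_eq_swap, ← Real.norm_eq_abs]
    have h1 : Integrable (fun t => ρ k (z - t) * (K * ‖v‖)) (volume : Measure (Euc 3)) :=
      (((b k).integrable_normed (μ := volume)).comp_sub_left z).mul_const _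
    refine (norm_integral_le_of_norm_le h1 (Filter.Eventually.of_forall fun t => ?_)).trans ?_
    · simp only [ContinuousLinearMap.lsmul_apply, smul_eq_mul, norm_mul]
      rw [Real.norm_of_nonneg (show 0 ≤ ρ k (z - t) from (b k).nonneg_normed _)]
      exact mul_le_mul_of_nonneg_left (norm_lineDeriv_le_of_lipschitz ℝ hf)
        ((b k).nonneg_normed _)
    · rw [integral_mul_const, integral_sub_left_eq_self (fun t => ρ k t) volume z,
        (b k).integral_normed, one_mul]
  · have hae : ∀ j : Fin 3, ∀ᵐ z ∂(volume : Measure (Euc 3)), Filter.Tendsto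
        (fun k => fderiv ℝ (g k) z (EuclideanSpace.single j 1)) Filter.atTop
          (𝓝 (lineDeriv ℝ f z (EuclideanSpace.single j 1))) := fun j => by
      have h1 := ContDiffBump.ae_convolution_tendsto_right_of_locallyIntegrable
        (μ := (volume : Measure (Euc 3))) (φ := b) (K := 2) hlim
        (Filter.Eventually.of_forall fun k => by
          rw [hbout, hbin]; apply le_of_eq; field_simp)
        ((hf.memLp_lineDeriv (μ := volume) (EuclideanSpace.single j 1)).locallyIntegrable le_top)
      filter_upwards [h1] with z hz
      simp only [hder]
      exact hz
    filter_upwards [hf.ae_differentiableAt, ae_all_iff.2 hae] with z hz hz2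
    refine ⟨hz, fun v => ?_⟩
    have hv : v = ∑ j, v j • EuclideanSpace.single j (1 : ℝ) := by
      ext i
      simp [Finset.sum_apply, Pi.single_apply]
    have hexp : ∀ L : Euc 3 →L[ℝ] ℝ, L v = ∑ j, v j * L (EuclideanSpace.single j 1) := fun L => by
      conv_lhs => rw [hv, map_sum]
      simp
    simp only [hexp]
    refine tendsto_finsetSum _ fun j _ => (Filter.Tendsto.const_mul _ ?_)
    rw [← hz.lineDeriv_eq_fderiv]
    exact hz2 j

end Mollification

section Kato

variable {M : Type*} [TopologicalSpace M] [ChartedSpace (EuclideanHalfSpace 3) M]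
  [RiemannianBundle (fun p : M => TangentSpace (𝓡∂ 3) p)]
  {X : Type*} [TopologicalSpace X] [ChartedSpace (EuclideanHalfSpace 4) X]
  [RiemannianBundle (fun x : X => TangentSpace (𝓡∂ 4) x)]
  [IsManifold (𝓡∂ 3) ∞ M] [IsManifold (𝓡∂ 4) ∞ X]
  [IsContMDiffRiemannianBundle (𝓡∂ 3) ∞ (EuclideanSpace ℝ (Fin 3))
      (fun p : M => TangentSpace (𝓡∂ 3) p)]
  [IsContMDiffRiemannianBundle (𝓡∂ 4) ∞ (EuclideanSpace ℝ (Fin 4))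
      (fun p : X => TangentSpace (𝓡∂ 4) p)]
  [SecondCountableTopology M] [MeasurableSpace M] [BorelSpace M] [T2Space M]
  {F : M → X} {ν : ∀ p, TangentSpace (𝓡∂ 4) (F p)}


/-- Almost everywhere `|∇|∇u||²` is the Kato quotient. -/
lemma gradNorm_gradNorm_sq {u : M → ℝ} (hu : ContMDiff (𝓡∂ 3) 𝓘(ℝ, ℝ) ∞ u) {p : M}
    (hp : p ∉ (𝓡∂ 3).boundary M) : gradNorm 3 (gradNorm 3 u) p ^ 2 = kato u p := by
  have he := isOrthoBasis_onb (n := 3) p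
  have hW := contMDiff_gradSq hu
  have hw0 : ∀ q, 0 ≤ gradNorm 3 u q := fun q => norm_nonneg _
  rcases (hw0 p).eq_or_lt with h | h
  · have hk : kato u p = 0 := by
      rw [kato, gradSq, ← h]; simp
    rw [hk, gradNorm_sq_eq_sum _ he]
    have hd : dfun 3 (gradNorm 3 u) p = 0 := by
      have hint : (𝓡∂ 3).IsInteriorPoint p :=
        (ModelWithCorners.isInteriorPoint_iff_not_isBoundaryPoint p).2 hp
      by_cases hm : MDifferentiableAt (𝓡∂ 3) 𝓘(ℝ, ℝ) (gradNorm 3 u) p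
      · have h1 : mfderiv (𝓡∂ 3) 𝓘(ℝ, ℝ) (gradNorm 3 u) p = _ := hm.mfderiv
        rw [fderivWithin_of_mem_nhds (range_mem_nhds_isInteriorPoint hint),
          IsLocalMin.fderiv_eq_zero (Filter.Eventually.of_forall fun z => ?_)] at h1
        · exact h1
        · simp only [writtenInExtChartAt, extChartAt_model_space_eq_id, Function.comp_apply,
            PartialEquiv.refl_coe, id, extChartAt_to_inv]
          rw [← h]
          exact hw0 _
      · exact mfderiv_zero_of_not_mdifferentiableAt hm
    rw [hd]; simp
  · have hWp : gradSq 3 u p ≠ 0 := (pow_pos h 2).ne'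
    have hwe : gradNorm 3 u = fun q => Real.sqrt (gradSq 3 u q) := by
      ext q; exact (Real.sqrt_sq (hw0 q)).symm
    have hm : MDifferentiableAt (𝓡∂ 3) 𝓘(ℝ, ℝ) (gradNorm 3 u) p := by
      rw [hwe]
      have h2 : ContMDiffAt 𝓘(ℝ, ℝ) 𝓘(ℝ, ℝ) ∞ Real.sqrt (gradSq 3 u p) :=
        (Real.contDiffAt_sqrt hWp).contMDiffAt
      exact (h2.comp p (hW p)).mdifferentiableAt (by simp)
    have h1 := dfun_mul hm hm
    have h2 : (fun q => gradNorm 3 u q * gradNorm 3 u q) = gradSq 3 u := by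
      ext q; exact (sq _).symm
    rw [h2] at h1
    rw [kato, gradNorm_sq_eq_sum _ he, gradNorm_sq_eq_sum _ he, h1, Finset.sum_div]
    refine Finset.sum_congr rfl fun i _ => ?_
    rw [gradSq, add_apply, smul_apply, smul_eq_mul]
    field_simp
    ring

end Kato

section LipschitzCharts

lemma exists_lower_bound_of_compact {L : Set (Euc 3)} (hL : IsCompact L)
    {g : Euc 3 → Euc 3 →L[ℝ] Euc 3 →L[ℝ] ℝ} (hg : ContinuousOn g L)
    (hpos : ∀ z ∈ L, ∀ v, v ≠ 0 → 0 < g z v v) :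
    ∃ μ : ℝ, 0 < μ ∧ ∀ z ∈ L, ∀ v, μ * ‖v‖ ^ 2 ≤ g z v v := by
  rcases L.eq_empty_or_nonempty with h | ⟨z₀, hz₀⟩
  · exact ⟨1, one_pos, fun z hz => by rw [h] at hz; exact hz.elim⟩
  obtain ⟨w, hw⟩ : (Metric.sphere (0 : Euc 3) 1).Nonempty :=
    NormedSpace.sphere_nonempty.2 zero_le_one
  have hc : ContinuousOn (fun y : Euc 3 × Euc 3 => g y.1 y.2 y.2)
      (L ×ˢ Metric.sphere (0 : Euc 3) 1) :=
    ((hg.comp continuousOn_fst fun y hy => hy.1).clm_apply continuousOn_snd).clm_apply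
      continuousOn_snd
  obtain ⟨⟨z₁, v₁⟩, hm, hmin⟩ := (hL.prod (isCompact_sphere (0 : Euc 3) 1)).exists_isMinOn
    ⟨(z₀, w), hz₀, hw⟩ hc
  refine ⟨g z₁ v₁ v₁, hpos z₁ hm.1 v₁ (ne_zero_of_mem_unit_sphere ⟨v₁, hm.2⟩), fun z hz v => ?_⟩
  rcases eq_or_ne v 0 with h0 | h0
  · simp [h0]
  have hn : 0 < ‖v‖ := norm_pos_iff.2 h0
  have h1 : g z₁ v₁ v₁ ≤ g z (‖v‖⁻¹ • v) (‖v‖⁻¹ • v) :=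
    hmin (show (z, ‖v‖⁻¹ • v) ∈ L ×ˢ Metric.sphere (0 : Euc 3) 1 from ⟨hz, by
      rw [mem_sphere_zero_iff_norm, norm_smul, norm_inv, norm_norm, inv_mul_cancel₀ hn.ne']⟩)
  rw [map_smul, map_smul, smul_apply, smul_eq_mul, smul_eq_mul] at h1
  calc g z₁ v₁ v₁ * ‖v‖ ^ 2 ≤ ‖v‖⁻¹ * (‖v‖⁻¹ * g z v v) * ‖v‖ ^ 2 :=
        mul_le_mul_of_nonneg_right h1 (by positivity)
    _ = g z v v := by field_simp

variable {M : Type*} [TopologicalSpace M] [ChartedSpace (EuclideanHalfSpace 3) M]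
  [RiemannianBundle (fun p : M => TangentSpace (𝓡∂ 3) p)]
  [IsManifold (𝓡∂ 3) ∞ M]
  [IsContMDiffRiemannianBundle (𝓡∂ 3) ∞ (EuclideanSpace ℝ (Fin 3))
      (fun p : M => TangentSpace (𝓡∂ 3) p)]

lemma exists_lipschitzOnWith_chart {φ : M → ℝ} (hφ : IsLocallyLipschitz 3 φ) (x : M)
    {L : Set (Euc 3)} (hL : IsCompact L) (hLt : L ⊆ (extChartAt (𝓡∂ 3) x).target) :
    ∃ K, LipschitzOnWith K (inChart 3 φ x) L := by
  refine LocallyLipschitzOn.exists_lipschitzOnWith_of_compact hL fun z hzL => ?_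
  have hz := hLt hzL
  set q := (extChartAt (𝓡∂ 3) x).symm z with hq
  obtain ⟨K₁, s, hs, hK₁⟩ := hφ q
  have hid : ContMDiff (𝓡∂ 3) (𝓡∂ 3) ∞ (id : M → M) := contMDiff_id
  obtain ⟨U, hU, hUe⟩ := exists_open_chartDomain (m := 3) (n := 3) hid.continuous x q
  have hzD : z ∈ chartDomain 3 3 (id : M → M) x q := ⟨hz, mem_extChartAt_source (I := 𝓡∂ 3) q⟩
  have hzU : z ∈ U := by
    have := hzD
    rw [hUe] at this
    exact this.2
  have hsm : ContDiffOn ℝ ∞ (inCharts 3 3 (id : M → M) x q) (chartDomain 3 3 (id : M → M) x q) :=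
    contDiffOn_inCharts hid x q
  have hnh : 𝓝[chartDomain 3 3 (id : M → M) x q] z = 𝓝[(extChartAt (𝓡∂ 3) x).target] z := by
    rw [hUe, nhdsWithin_inter_of_mem' (mem_nhdsWithin_of_mem_nhds (hU.mem_nhds hzU))]
  have hnr : 𝓝[(extChartAt (𝓡∂ 3) x).target] z = 𝓝[range (𝓡∂ 3)] z :=
    nhdsWithin_extChartAt_target_eq_of_mem hz
  have hT : inCharts 3 3 (id : M → M) x q z = extChartAt (𝓡∂ 3) q q := rfl
  have h1 : ContDiffWithinAt ℝ 1 (inCharts 3 3 (id : M → M) x q) (range (𝓡∂ 3)) z := by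
    refine ((hsm z hzD).of_le (by simp)).mono_of_mem_nhdsWithin ?_
    rw [← hnr, ← hnh]
    exact self_mem_nhdsWithin
  obtain ⟨K₂, t, ht, hK₂⟩ := h1.exists_lipschitzOnWith (𝓡∂ 3).convex_range
  have hcont : Filter.Tendsto (inCharts 3 3 (id : M → M) x q)
      (𝓝[chartDomain 3 3 (id : M → M) x q] z) (𝓝[range (𝓡∂ 3)] (extChartAt (𝓡∂ 3) q q)) := by
    rw [← hT]
    refine (hsm z hzD).continuousWithinAt.tendsto_nhdsWithin fun y hy => ?_
    exact extChartAt_target_subset_range q ((extChartAt (𝓡∂ 3) q).map_source hy.2)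
  refine ⟨K₁ * K₂, t ∩ (chartDomain 3 3 (id : M → M) x q ∩ inCharts 3 3 (id : M → M) x q ⁻¹' s),
    ?_, ?_⟩
  · refine nhdsWithin_mono z hLt ?_
    refine Filter.inter_mem (by rw [hnr]; exact ht) ?_
    rw [← hnh]
    exact Filter.inter_mem self_mem_nhdsWithin (hcont hs)
  · have hmaps : MapsTo (inCharts 3 3 (id : M → M) x q) (t ∩ (chartDomain 3 3 (id : M → M) x q ∩
      inCharts 3 3 (id : M → M) x q ⁻¹' s)) s := fun y hy => hy.2.2
    have h2 := hK₁.comp (hK₂.mono inter_subset_left) hmaps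
    intro y hy y' hy'
    have e : ∀ y ∈ chartDomain 3 3 (id : M → M) x q, inChart 3 φ x y
        = φ ((extChartAt (𝓡∂ 3) q).symm (inCharts 3 3 (id : M → M) x q y)) := fun y hy =>
      congrArg φ ((extChartAt (𝓡∂ 3) q).left_inv hy.2).symm
    rw [e y hy.2.1, e y' hy'.2.1]
    exact h2 hy hy'

lemma exists_coframe_bound (x : M) {K : Set M} (hK : IsCompact K)
    (hKs : K ⊆ (extChartAt (𝓡∂ 3) x).source) :
    ∃ C : ℝ, 0 ≤ C ∧ ∀ p ∈ K, ∀ v : Euc 3, metricAt 3 p v v = 1 → ‖coframe 3 x p v‖ ≤ C := by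
  obtain ⟨μ, hμ0, hμ⟩ := exists_lower_bound_of_compact
    (hK.image_of_continuousOn ((continuousOn_extChartAt x).mono hKs))
    (g := chartMetric 3 x) ((contDiffOn_chartMetric 3 x).continuousOn.mono (by
      rintro _ ⟨p, hp, rfl⟩; exact (extChartAt (𝓡∂ 3) x).map_source (hKs hp))) (by
      rintro _ ⟨p, hp, rfl⟩
      exact (isLeviCivitaOn_chart 3 x).pos _ ((extChartAt (𝓡∂ 3) x).map_source (hKs hp)))
  refine ⟨(Real.sqrt μ)⁻¹, by positivity, fun p hp v hv => ?_⟩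
  have h1 := hμ _ (mem_image_of_mem _ hp) (coframe 3 x p v)
  rw [chartMetric_eq 3 (hKs hp), frame_coframe 3 (hKs hp), hv] at h1
  rw [← Real.sqrt_inv]
  refine Real.le_sqrt_of_sq_le ?_
  rwa [← one_div, le_div_iff₀' hμ0]

lemma abs_dfun_le_gradNorm (f : M → ℝ) (p : M) {v : Euc 3} (hv : metricAt 3 p v v = 1) :
    |dfun 3 f p v| ≤ gradNorm 3 f p := by
  rw [← metricAt_grad]
  have h1 := abs_real_inner_le_norm (grad 3 f p) (show TangentSpace (𝓡∂ 3) p from v)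
  have h2 : ‖(show TangentSpace (𝓡∂ 3) p from v)‖ = 1 := by
    have := norm_sq_eq p v
    rw [hv] at this
    have h0 := norm_nonneg (show TangentSpace (𝓡∂ 3) p from v)
    nlinarith
  rw [h2, mul_one] at h1
  exact h1

variable [SecondCountableTopology M] [MeasurableSpace M] [BorelSpace M]

lemma dfun_mul_chart {χ : M → ℝ} (hχ : ContMDiff (𝓡∂ 3) 𝓘(ℝ, ℝ) ∞ χ) {x : M}
    (hχs : tsupport χ ⊆ (extChartAt (𝓡∂ 3) x).source) {h : Euc 3 → ℝ} {p : M}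
    (hd : p ∈ tsupport χ → DifferentiableAt ℝ h (extChartAt (𝓡∂ 3) x p)) :
    MDifferentiableAt (𝓡∂ 3) 𝓘(ℝ, ℝ) (fun q => χ q * h (extChartAt (𝓡∂ 3) x q)) p ∧
    ∀ v, dfun 3 (fun q => χ q * h (extChartAt (𝓡∂ 3) x q)) p v
      = χ p * fderiv ℝ h (extChartAt (𝓡∂ 3) x p) (coframe 3 x p v)
        + h (extChartAt (𝓡∂ 3) x p) * dfun 3 χ p v := by
  by_cases hp : p ∈ tsupport χ
  · have hd' := hd hp
    have h1 : MDifferentiableAt (𝓡∂ 3) 𝓘(ℝ, Euc 3) (extChartAt (𝓡∂ 3) x) p :=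
      mdifferentiableAt_extChartAt (by rw [← extChartAt_source (𝓡∂ 3)]; exact hχs hp)
    have h2 : HasMFDerivAt (𝓡∂ 3) 𝓘(ℝ, ℝ) (h ∘ extChartAt (𝓡∂ 3) x) p
        ((fderiv ℝ h (extChartAt (𝓡∂ 3) x p)).comp (coframe 3 x p)) :=
      hd'.hasFDerivAt.hasMFDerivAt.comp p h1.hasMFDerivAt
    have hχd := hχ.mdifferentiableAt (x := p) (by simp)
    refine ⟨(hχd.hasMFDerivAt.mul h2.mdifferentiableAt.hasMFDerivAt).mdifferentiableAt,
      fun v => ?_⟩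
    have h3 := dfun_mul hχd h2.mdifferentiableAt
    have h4 : dfun 3 (h ∘ extChartAt (𝓡∂ 3) x) p
      = (fderiv ℝ h (extChartAt (𝓡∂ 3) x p)).comp (coframe 3 x p) := h2.mfderiv
    rw [h4] at h3
    exact congrArg (fun T : Euc 3 →L[ℝ] ℝ => T v) h3
  · have hev : (fun q => χ q * h (extChartAt (𝓡∂ 3) x q)) =ᶠ[𝓝 p] fun _ => (0 : ℝ) := by
      filter_upwards [(isClosed_tsupport χ).isOpen_compl.mem_nhds hp] with q hq
      rw [image_eq_zero_of_notMem_tsupport hq, zero_mul]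
    refine ⟨((hasMFDerivAt_const (0 : ℝ) p).congr_of_eventuallyEq hev).mdifferentiableAt,
      fun v => ?_⟩
    rw [dfun_eq_zero_of_eventually hev, dfun_eq_zero_of_notMem hp,
      image_eq_zero_of_notMem_tsupport hp]
    simp

lemma contMDiff_mul_chart {χ : M → ℝ} (hχ : ContMDiff (𝓡∂ 3) 𝓘(ℝ, ℝ) ∞ χ) {x : M}
    (hχs : tsupport χ ⊆ (extChartAt (𝓡∂ 3) x).source) {h : Euc 3 → ℝ} (hh : ContDiff ℝ ∞ h) :
    ContMDiff (𝓡∂ 3) 𝓘(ℝ, ℝ) ∞ (fun q => χ q * h (extChartAt (𝓡∂ 3) x q)) := by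
  refine contMDiff_of_tsupport fun p hp => ?_
  have hps : p ∈ (extChartAt (𝓡∂ 3) x).source :=
    hχs (closure_mono (fun q hq => left_ne_zero_of_mul hq) hp)
  refine (hχ p).mul ?_
  exact ((contMDiffOn_of_chart (n := 3) (x := x) hh.contDiffOn) p hps).contMDiffAt
    ((isOpen_extChartAt_source x).mem_nhds hps)

lemma ae_chart (x : M) {P : Euc 3 → Prop} (hP : ∀ᵐ z ∂(volume : Measure (Euc 3)), P z) :
    ∀ᵐ p ∂(vol 3 M), p ∈ (extChartAt (𝓡∂ 3) x).source → P (extChartAt (𝓡∂ 3) x p) := by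
  set N := toMeasurable volume {z : Euc 3 | ¬ P z} with hN
  have hN0 : volume N = 0 := by rw [hN, measure_toMeasurable]; exact hP
  set A := (extChartAt (𝓡∂ 3) x).source ∩ extChartAt (𝓡∂ 3) x ⁻¹' N with hA
  have hAm : MeasurableSet A := by
    have h1 := (continuousOn_extChartAt (I := 𝓡∂ 3) x).domRestrict.measurable
      (measurableSet_toMeasurable volume {z : Euc 3 | ¬ P z})
    have h2 := (isOpen_extChartAt_source (I := 𝓡∂ 3) x).measurableSet.subtype_image h1
    convert h2 using 1
    ext q
    simp [hA, hN, and_comm]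
  have hA0 : vol 3 M A = 0 := by
    have h1 : vol 3 M A = (vol 3 M).restrict (extChartAt (𝓡∂ 3) x).source A := by
      rw [Measure.restrict_apply hAm, inter_eq_left.2 inter_subset_left]
    rw [h1, vol_restrict, chartVolume_apply x hAm]
    refine setLIntegral_measure_zero _ _ (measure_mono_null ?_ hN0)
    rintro z ⟨h2, h3⟩
    have h4 := h2.2
    rwa [mem_preimage, (extChartAt (𝓡∂ 3) x).right_inv h3] at h4
  rw [ae_iff]
  refine measure_mono_null (fun p hp => ?_) hA0
  rw [mem_ofPred_eq, Classical.not_imp] at hp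
  exact ⟨hp.1, subset_toMeasurable _ _ hp.2⟩

end LipschitzCharts

section LipschitzApproximation

variable {M : Type*} [TopologicalSpace M] [ChartedSpace (EuclideanHalfSpace 3) M]
  [RiemannianBundle (fun p : M => TangentSpace (𝓡∂ 3) p)]
  [IsManifold (𝓡∂ 3) ∞ M]
  [IsContMDiffRiemannianBundle (𝓡∂ 3) ∞ (EuclideanSpace ℝ (Fin 3))
      (fun p : M => TangentSpace (𝓡∂ 3) p)]
  [SecondCountableTopology M] [MeasurableSpace M] [BorelSpace M] [T2Space M]

/-- `ψ k` are smooth functions with uniformly bounded differentials supported in the compact set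
`K`, which converge to `φ` together with their differentials. -/
structure IsSmoothApprox (φ : M → ℝ) (ψ : ℕ → M → ℝ) (K : Set M) (B : ℝ) : Prop where
  compact : IsCompact K
  smooth : ∀ k, ContMDiff (𝓡∂ 3) 𝓘(ℝ, ℝ) ∞ (ψ k)
  support : ∀ k, tsupport (ψ k) ⊆ K
  bound : ∀ k p, |ψ k p| ≤ B
  bound_dfun : ∀ k p (v : Euc 3), metricAt 3 p v v = 1 → |dfun 3 (ψ k) p v| ≤ B
  tendsto : ∀ p, Filter.Tendsto (fun k => ψ k p) Filter.atTop (𝓝 (φ p))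
  tendsto_dfun : ∀ᵐ p ∂(vol 3 M), ∀ v : Euc 3, Filter.Tendsto (fun k => dfun 3 (ψ k) p v) Filter.atTop (𝓝 (dfun 3 φ p v))

lemma exists_smoothApprox_chart {φ : M → ℝ} (hφ : IsLocallyLipschitz 3 φ) {χ : M → ℝ}
    (hχ : ContMDiff (𝓡∂ 3) 𝓘(ℝ, ℝ) ∞ χ) {x : M}
    (hχs : tsupport χ ⊆ (extChartAt (𝓡∂ 3) x).source) (hχc : HasCompactSupport χ) :
    (∀ᵐ p ∂(vol 3 M), MDifferentiableAt (𝓡∂ 3) 𝓘(ℝ, ℝ) (fun p => χ p * φ p) p) ∧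
      ∃ ψ B, IsSmoothApprox (fun p => χ p * φ p) ψ (tsupport χ) B := by
  have hK : IsCompact (tsupport χ) := hχc.isCompact
  have hL := hK.image_of_continuousOn ((continuousOn_extChartAt x).mono hχs)
  obtain ⟨Λ, hΛ⟩ := exists_lipschitzOnWith_chart hφ x hL (by
    rintro _ ⟨p, hp, rfl⟩; exact (extChartAt (𝓡∂ 3) x).map_source (hχs hp))
  obtain ⟨f, hf, hfe⟩ := hΛ.extend_real
  obtain ⟨g, hg, hgb, hgt, hgd, hgae⟩ := exists_mollification hf
  obtain ⟨C, hC0, hC⟩ := exists_coframe_bound x hK hχs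
  obtain ⟨Cf, hCf⟩ := hL.exists_bound_of_continuousOn hf.continuous.continuousOn
  obtain ⟨Cχ, hCχ⟩ := hχc.exists_bound_of_continuous hχ.continuous
  obtain ⟨D, hD⟩ := (hasCompactSupport_gradNorm hχc).exists_bound_of_continuous
    (contMDiff_gradSq hχ).continuous
  have hCχ' : ∀ p, |χ p| ≤ |Cχ| := fun p => (hCχ p).trans (le_abs_self _)
  have hgrad : ∀ p, gradNorm 3 χ p ≤ Real.sqrt D := fun p =>
    Real.le_sqrt_of_sq_le ((le_abs_self _).trans (hD p))
  have hgB : ∀ k, ∀ p ∈ tsupport χ, |g k (extChartAt (𝓡∂ 3) x p)| ≤ |Cf| + Λ := fun k p hp => by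
    have h1 := hCf _ (mem_image_of_mem (extChartAt (𝓡∂ 3) x) hp)
    rw [Real.norm_eq_abs] at h1
    have h2 := hgb k (extChartAt (𝓡∂ 3) x p)
    have h3 := abs_sub_abs_le_abs_sub (g k (extChartAt (𝓡∂ 3) x p)) (f (extChartAt (𝓡∂ 3) x p))
    linarith [le_abs_self Cf]
  have hΛ0 : (0 : ℝ) ≤ Λ := Λ.2
  have hφf : (fun p => χ p * φ p) = fun p => χ p * f (extChartAt (𝓡∂ 3) x p) := by
    ext p
    by_cases hp : p ∈ tsupport χ
    · have h1 := hfe (mem_image_of_mem (extChartAt (𝓡∂ 3) x) hp)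
      rw [inChart, (extChartAt (𝓡∂ 3) x).left_inv (hχs hp)] at h1
      rw [h1]
    · rw [image_eq_zero_of_notMem_tsupport hp, zero_mul, zero_mul]
  rw [hφf]
  have hdiff : ∀ᵐ p ∂(vol 3 M), p ∈ tsupport χ → DifferentiableAt ℝ f (extChartAt (𝓡∂ 3) x p) := by
    filter_upwards [ae_chart x hgae] with p hp hpt using (hp (hχs hpt)).1
  refine ⟨hdiff.mono fun p hp => (dfun_mul_chart hχ hχs hp).1,
    fun k p => χ p * g k (extChartAt (𝓡∂ 3) x p),
    |Cχ| * (|Cf| + Λ) + (|Cχ| * (Λ * C) + (|Cf| + Λ) * Real.sqrt D), hK,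
    fun k => contMDiff_mul_chart hχ hχs (hg k),
    fun k => closure_mono fun p hp => left_ne_zero_of_mul hp, fun k p => ?_, fun k p v hv => ?_,
    fun p => (hgt _).const_mul _, ?_⟩
  · refine le_add_of_le_of_nonneg ?_ (by positivity)
    by_cases hp : p ∈ tsupport χ
    · rw [abs_mul]
      exact mul_le_mul (hCχ' p) (hgB k p hp) (abs_nonneg _) (abs_nonneg _)
    · rw [image_eq_zero_of_notMem_tsupport hp, zero_mul, abs_zero]
      positivity
  · refine le_add_of_nonneg_of_le (by positivity) ?_
    rw [(dfun_mul_chart hχ hχs fun _ => ((hg k).differentiable (by simp)) _).2]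
    by_cases hp : p ∈ tsupport χ
    · refine (abs_add_le _ _).trans (add_le_add ?_ ?_)
      · rw [abs_mul]
        refine mul_le_mul (hCχ' p) ((hgd k _ _).trans ?_) (abs_nonneg _) (abs_nonneg _)
        exact mul_le_mul_of_nonneg_left (hC p hp v hv) hΛ0
      · rw [abs_mul]
        exact mul_le_mul (hgB k p hp) ((abs_dfun_le_gradNorm χ p hv).trans (hgrad p))
          (abs_nonneg _) (by positivity)
    · rw [image_eq_zero_of_notMem_tsupport hp, dfun_eq_zero_of_notMem hp, zero_apply, zero_mul,
        mul_zero, add_zero, abs_zero]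
      positivity
  · filter_upwards [ae_chart x hgae, hdiff] with p hp hpd
    intro v
    rw [(dfun_mul_chart hχ hχs hpd).2]
    simp only [fun k => (dfun_mul_chart hχ hχs (p := p) fun _ =>
      ((hg k).differentiable (by simp)) (extChartAt (𝓡∂ 3) x p)).2 v]
    refine Filter.Tendsto.add ?_ ((hgt _).mul_const _)
    by_cases hpt : p ∈ tsupport χ
    · exact ((hp (hχs hpt)).2 _).const_mul _
    · rw [image_eq_zero_of_notMem_tsupport hpt]
      simp only [zero_mul]
      exact tendsto_const_nhds

/-- Compactly supported locally Lipschitz functions are limits of smooth functions. -/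
lemma exists_smoothApprox {φ : M → ℝ} (hφ : IsLocallyLipschitz 3 φ)
    (hc : HasCompactSupport φ) : ∃ ψ K B, IsSmoothApprox φ ψ K B := by
  obtain ⟨J, χ, hχ, hχs, hχ1, hχc⟩ := exists_finite_partition (tsupport φ) hc.isCompact
  choose hdiff ψ B hψ using fun x => exists_smoothApprox_chart hφ (hχ x) (hχs x) (hχc x)
  have hφe : φ = fun p => ∑ x ∈ J, χ x p * φ p := by
    ext p
    rw [← Finset.sum_mul]
    by_cases hp : p ∈ tsupport φ
    · rw [hχ1 p hp, one_mul]
    · rw [image_eq_zero_of_notMem_tsupport hp, mul_zero]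
  have hd : ∀ k p, dfun 3 (fun q => ∑ x ∈ J, ψ x k q) p = ∑ x ∈ J, dfun 3 (ψ x k) p := fun k p =>
    dfun_sum fun x _ => ((hψ x).smooth k).mdifferentiableAt (by simp)
  have hcl : ∀ x, IsClosed (tsupport (χ x)) := fun x => isClosed_tsupport _
  refine ⟨fun k p => ∑ x ∈ J, ψ x k p, ⋃ x ∈ J, tsupport (χ x), ∑ x ∈ J, B x,
    J.isCompact_biUnion fun x _ => (hψ x).compact,
    fun k => contMDiff_finsetSum fun x _ => (hψ x).smooth k, fun k => ?_, fun k p => ?_,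
    fun k p v hv => ?_, fun p => ?_, ?_⟩
  · refine closure_minimal (fun p hp => ?_) (isClosed_biUnion_finset fun x _ => hcl x)
    obtain ⟨x, hx, hxp⟩ := Finset.exists_ne_zero_of_sum_ne_zero hp
    exact mem_biUnion hx ((hψ x).support k (subset_tsupport _ hxp))
  · exact (Finset.abs_sum_le_sum_abs _ _).trans (Finset.sum_le_sum fun x _ => (hψ x).bound k p)
  · rw [hd, sum_apply]
    exact (Finset.abs_sum_le_sum_abs _ _).trans
      (Finset.sum_le_sum fun x _ => (hψ x).bound_dfun k p v hv)
  · rw [congrFun hφe p]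
    exact tendsto_finsetSum _ fun x _ => (hψ x).tendsto p
  · filter_upwards [(Finset.eventually_all J).2 fun x _ => hdiff x,
      (Finset.eventually_all J).2 fun x _ => (hψ x).tendsto_dfun] with p hp hp'
    intro v
    have h1 := dfun_sum (s := J) (f := fun x p => χ x p * φ p) hp
    rw [← hφe] at h1
    rw [h1, sum_apply]
    simp only [hd, sum_apply]
    exact tendsto_finsetSum _ fun x hx => hp' x hx v

end LipschitzApproximation

section Conclusion

variable {M : Type*} [TopologicalSpace M] [ChartedSpace (EuclideanHalfSpace 3) M]
  [RiemannianBundle (fun p : M => TangentSpace (𝓡∂ 3) p)]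
  {X : Type*} [TopologicalSpace X] [ChartedSpace (EuclideanHalfSpace 4) X]
  [RiemannianBundle (fun x : X => TangentSpace (𝓡∂ 4) x)]
  [IsManifold (𝓡∂ 3) ∞ M] [IsManifold (𝓡∂ 4) ∞ X]
  [IsContMDiffRiemannianBundle (𝓡∂ 3) ∞ (EuclideanSpace ℝ (Fin 3))
      (fun p : M => TangentSpace (𝓡∂ 3) p)]
  [IsContMDiffRiemannianBundle (𝓡∂ 4) ∞ (EuclideanSpace ℝ (Fin 4))
      (fun p : X => TangentSpace (𝓡∂ 4) p)]
  [SecondCountableTopology M] [MeasurableSpace M] [BorelSpace M] [T2Space M]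
  {F : M → X} {ν : ∀ p, TangentSpace (𝓡∂ 4) (F p)}


/-- The stability inequality tested with `φ |∇u|`, for locally Lipschitz `φ`. -/
lemma stability_lipschitz (hRic : Ric2Nonneg 4 X) (hF : IsFBMH 3 4 F ν) (hst : IsStable 3 4 F ν)
    {u : M → ℝ} (hu : IsHarmonic 3 u)
    (hbdry : (IsNeumann 3 u ∧ Bdry2Convex 4 X) ∨ (IsDirichlet 3 u ∧ BdryMeanConvex 4 X))
    {φ : M → ℝ} (hφ : IsLocallyLipschitz 3 φ) (hc : HasCompactSupport φ) :
    Integrable (fun p => φ p ^ 2 * katoII F ν u p) (vol 3 M) ∧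
    Integrable (fun p => gradNorm 3 φ p ^ 2 * gradSq 3 u p) (vol 3 M) ∧
    ∫ p, φ p ^ 2 * katoII F ν u p ∂(vol 3 M)
      ≤ ∫ p, gradNorm 3 φ p ^ 2 * gradSq 3 u p ∂(vol 3 M) := by
  obtain ⟨ψ, K, B, h⟩ := exists_smoothApprox hφ hc
  have hKm : MeasurableSet K := h.compact.measurableSet
  have hψc : ∀ k, HasCompactSupport (ψ k) := fun k =>
    h.compact.of_isClosed_subset (isClosed_tsupport _) (h.support k)
  have hW := contMDiff_gradSq hu.1
  have hind : ∀ {f : M → ℝ}, Continuous f → ∀ c : ℝ,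
      Integrable (K.indicator fun p => c * f p) (vol 3 M) := fun {f} hf c =>
    (integrable_indicator_iff hKm).2
      ((continuous_const.mul hf).continuousOn.integrableOn_compact h.compact)
  have l1 : ∀ k, AEStronglyMeasurable (fun p => ψ k p ^ 2 * katoII F ν u p) (vol 3 M) := fun k =>
    (integrable_sq_mul_katoII hRic hF hu (h.smooth k).continuous (hψc k)).aestronglyMeasurable
  have l2 : ∀ k, ∀ᵐ p ∂(vol 3 M), ‖ψ k p ^ 2 * katoII F ν u p‖
      ≤ K.indicator (fun p => B ^ 2 * bochnerBound F ν u p) p := fun k => by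
    refine Filter.Eventually.of_forall fun p => ?_
    rw [Real.norm_of_nonneg (mul_nonneg (sq_nonneg _) (katoII_nonneg u p))]
    by_cases hp : p ∈ K
    · rw [indicator_of_mem hp]
      exact mul_le_mul (sq_le_sq' (abs_le.1 (h.bound k p)).1 (abs_le.1 (h.bound k p)).2)
        (katoII_le hRic hF hu p) (katoII_nonneg u p) (sq_nonneg _)
    · rw [indicator_of_notMem hp,
        image_eq_zero_of_notMem_tsupport (f := ψ k) fun hp' => hp (h.support k hp')]
      simp
  have l3 : ∀ᵐ p ∂(vol 3 M), Filter.Tendsto (fun k => ψ k p ^ 2 * katoII F ν u p) Filter.atTop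
      (𝓝 (φ p ^ 2 * katoII F ν u p)) :=
    Filter.Eventually.of_forall fun p => ((h.tendsto p).pow 2).mul_const _
  have lint := hind (continuous_bochnerBound hF hu.1) (B ^ 2)
  have r1 : ∀ k, AEStronglyMeasurable (fun p => gradNorm 3 (ψ k) p ^ 2 * gradSq 3 u p)
      (vol 3 M) := fun k =>
    ((contMDiff_gradSq (h.smooth k)).continuous.mul hW.continuous).aestronglyMeasurable
  have r2 : ∀ k, ∀ᵐ p ∂(vol 3 M), ‖gradNorm 3 (ψ k) p ^ 2 * gradSq 3 u p‖
      ≤ K.indicator (fun p => (3 * B ^ 2) * gradSq 3 u p) p := fun k => by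
    refine Filter.Eventually.of_forall fun p => ?_
    rw [Real.norm_of_nonneg (mul_nonneg (sq_nonneg _) (gradSq_nonneg u p))]
    obtain ⟨e, he, -⟩ := exists_onb_first (n := 3) p 0
    by_cases hp : p ∈ K
    · rw [indicator_of_mem hp]
      refine mul_le_mul_of_nonneg_right ?_ (gradSq_nonneg u p)
      rw [gradNorm_sq_eq_sum _ he]
      have hi : ∀ i ∈ Finset.univ, dfun 3 (ψ k) p (e i) ^ 2 ≤ B ^ 2 := fun i _ => by
        have h1 := he.orth i i
        rw [if_pos rfl, chartMetric_self] at h1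
        have h2 := abs_le.1 (h.bound_dfun k p (e i) h1)
        exact sq_le_sq' h2.1 h2.2
      refine (Finset.sum_le_sum hi).trans (le_of_eq ?_)
      simp
    · rw [indicator_of_notMem hp, gradNorm_sq_eq_sum _ he,
        dfun_eq_zero_of_notMem fun hp' => hp (h.support k hp')]
      simp
  have r3 : ∀ᵐ p ∂(vol 3 M), Filter.Tendsto (fun k => gradNorm 3 (ψ k) p ^ 2 * gradSq 3 u p)
      Filter.atTop (𝓝 (gradNorm 3 φ p ^ 2 * gradSq 3 u p)) := by
    filter_upwards [h.tendsto_dfun] with p hp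
    have e1 : ∀ f : M → ℝ, gradNorm 3 f p ^ 2 = _ := fun f =>
      gradNorm_sq_eq_sum f (isOrthoBasis_onb p)
    simp only [e1]
    exact (tendsto_finsetSum _ fun i _ => (hp _).pow 2).mul_const _
  have rint := hind hW.continuous (3 * B ^ 2)
  have limit_integrable : ∀ {a : ℕ → M → ℝ} {b c : M → ℝ},
      (∀ k, AEStronglyMeasurable (a k) (vol 3 M)) → Integrable c (vol 3 M) →
      (∀ k, ∀ᵐ p ∂(vol 3 M), ‖a k p‖ ≤ c p) →
      (∀ᵐ p ∂(vol 3 M), Filter.Tendsto (fun k => a k p) Filter.atTop (𝓝 (b p))) →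
      Integrable b (vol 3 M) := fun {a b c} h1 h2 h3 h4 => by
    refine h2.mono' (aestronglyMeasurable_of_tendsto_ae Filter.atTop h1 h4) ?_
    filter_upwards [h4, ae_all_iff.2 h3] with p hp hp'
    exact le_of_tendsto hp.norm (Filter.Eventually.of_forall hp')
  refine ⟨limit_integrable l1 lint l2 l3, limit_integrable r1 rint r2 r3, ?_⟩
  refine le_of_tendsto_of_tendsto' (tendsto_integral_of_dominated_convergence _ l1 lint l2 l3)
    (tendsto_integral_of_dominated_convergence _ r1 rint r2 r3) fun k => ?_
  exact stability_smooth hRic hF hst hu hbdry (h.smooth k) (hψc k)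

lemma ae_integrand_eq {u : M → ℝ} (hu : ContMDiff (𝓡∂ 3) 𝓘(ℝ, ℝ) ∞ u) (φ : M → ℝ) :
    ∀ᵐ p ∂(vol 3 M), φ p ^ 2 * katoII F ν u p
      = φ p ^ 2 * (1 / 3 * normSqII 3 4 F ν p * gradNorm 3 u p ^ 2
          + 1 / 2 * gradNorm 3 (gradNorm 3 u) p ^ 2) := by
  have h1 : ∀ᵐ p ∂(vol 3 M), p ∉ (𝓡∂ 3).boundary M := by
    rw [ae_iff]; simpa using vol_boundary (n := 3) (X := M)
  filter_upwards [h1] with p hp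
  rw [gradNorm_gradNorm_sq hu hp]
  rfl

end Conclusion

end RiemBdry

end

theorem lemma5
    {X : Type*} [EMetricSpace X] [SecondCountableTopology X]
    [ChartedSpace (EuclideanHalfSpace 4) X] [IsManifold (𝓡∂ 4) ∞ X]
    [RiemannianBundle (fun x : X => TangentSpace (𝓡∂ 4) x)]
    [IsContMDiffRiemannianBundle (𝓡∂ 4) ∞ (EuclideanSpace ℝ (Fin 4))
      (fun x : X => TangentSpace (𝓡∂ 4) x)]
    [IsRiemannianManifold (𝓡∂ 4) X] [CompleteSpace X]
    {M : Type*} [TopologicalSpace M] [T2Space M] [SecondCountableTopology M]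
    [MeasurableSpace M] [BorelSpace M]
    [ChartedSpace (EuclideanHalfSpace 3) M] [IsManifold (𝓡∂ 3) ∞ M]
    [RiemannianBundle (fun p : M => TangentSpace (𝓡∂ 3) p)]
    [IsContMDiffRiemannianBundle (𝓡∂ 3) ∞ (EuclideanSpace ℝ (Fin 3))
      (fun p : M => TangentSpace (𝓡∂ 3) p)]
    (hRic : RiemBdry.Ric2Nonneg 4 X)
    (F : M → X) (ν : ∀ p, TangentSpace (𝓡∂ 4) (F p))
    (hF : RiemBdry.IsFBMH 3 4 F ν) (hstable : RiemBdry.IsStable 3 4 F ν)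
    (u : M → ℝ) (hu : RiemBdry.IsHarmonic 3 u)
    (hbdry : (RiemBdry.IsNeumann 3 u ∧ RiemBdry.Bdry2Convex 4 X) ∨
      (RiemBdry.IsDirichlet 3 u ∧ RiemBdry.BdryMeanConvex 4 X))
    (φ : M → ℝ) (hφ : RiemBdry.IsLocallyLipschitz 3 φ) (hφc : HasCompactSupport φ) :
    MeasureTheory.Integrable
        (fun p => φ p ^ 2 * (1 / 3 * RiemBdry.normSqII 3 4 F ν p * RiemBdry.gradNorm 3 u p ^ 2
          + 1 / 2 * RiemBdry.gradNorm 3 (RiemBdry.gradNorm 3 u) p ^ 2))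
        (RiemBdry.vol 3 M) ∧
    MeasureTheory.Integrable
        (fun p => RiemBdry.gradNorm 3 φ p ^ 2 * RiemBdry.gradNorm 3 u p ^ 2)
        (RiemBdry.vol 3 M) ∧
    ∫ p, φ p ^ 2 * (1 / 3 * RiemBdry.normSqII 3 4 F ν p * RiemBdry.gradNorm 3 u p ^ 2
          + 1 / 2 * RiemBdry.gradNorm 3 (RiemBdry.gradNorm 3 u) p ^ 2)
        ∂(RiemBdry.vol 3 M)
      ≤ ∫ p, RiemBdry.gradNorm 3 φ p ^ 2 * RiemBdry.gradNorm 3 u p ^ 2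
        ∂(RiemBdry.vol 3 M) := by
  have hae := RiemBdry.ae_integrand_eq (F := F) (ν := ν) hu.1 φ
  obtain ⟨h1, h2, h3⟩ := RiemBdry.stability_lipschitz hRic hF hstable hu hbdry hφ hφc
  refine ⟨h1.congr hae, h2, ?_⟩
  rw [← integral_congr_ae hae]
  exact h3
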